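/- Let $R$ be an integral domain of characteristic $0$ with field of fractions $K=k(\eta)$, let $n\in\mathbf Z$, and let $\mathcal C$ be a small dg category over $R$ (a category enriched over cochain complexes of $R$-modules). Write $\mathrm H\mathcal C$ for its cohomology category, a graded $R$-linear category with composition induced by that of $\mathcal C$. Assume: (i) $\mathcal C$ is flat: all the $R$-modules $\mathrm H^i(\mathcal C(X,Y))$ are projective; (ii) $\mathcal C$ is weakly proper $n$-Calabi–Yau: every complex $\mathcal C(X,Y)$ is perfect over $R$, and there is a class in $\mathrm{HH}^\vee_{-n}(\mathcal C)=\mathrm H^{-n}\big(\mathrm{RHom}_R(\mathcal C\otimes^{\mathrm L}_{\mathcal C\otimes^{\mathrm L}\mathcal C^{\mathrm{op}}}\mathcal C,\,R)\big)$ whose associated morphism of bimodules $\mathcal C\to\mathcal C^{\mathrm{op},\vee}[-n]$, where $\mathcal C^{\mathrm{op},\vee}(X,Y)=\mathrm{RHom}_R(\mathcal C(Y,X),R)$, is an isomorphism in the derived category; (iii) the Hochschild homology $\mathrm{HH}_\bullet(\mathrm H\mathcal C)$ of the graded category $\mathrm H\mathcal C$ (with no higher operations) is a projective $R$-module. Call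 a dg category formal if it is connected to its cohomology category, regarded as a dg category with zero differential, by a finite zigzag of quasi-isomorphisms of dg categories, that is, of dg functors that are bijective on objects and quasi-isomorphisms on all morphism complexes. Then $\mathcal C$ is formal over $R$ if and only if its generic fibre $\mathcal C_\eta$, with the same objects and morphism complexes $\mathcal C(X,Y)\otimes_R K$, is formal over $K$. -/

import Mathlib

open CategoryTheory DirectSum TensorProduct

universe u

noncomputable section

section Complexes

variable {R : Type u} [CommRing R]

/-- The cohomology `Hⁱ(A) = ker(dⁱ) / im(dⁱ⁻¹)` of a complex of `R`-modules. -/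
abbrev Coh (A : CochainComplex (ModuleCat.{u} R) ℤ) (i : ℤ) : Type u :=
  LinearMap.ker (A.d i (i + 1)).hom ⧸
    (LinearMap.range (A.d (i - 1) i).hom).comap (LinearMap.ker (A.d i (i + 1)).hom).subtype

/-- A perfect complex: quasi-isomorphic to a bounded complex of finitely generated projective
modules. (Bounded complexes of projectives being K-projective, one arrow is enough.) -/
def IsPerfectComplex (A : CochainComplex (ModuleCat.{u} R) ℤ) : Prop :=
  ∃ (P : CochainComplex (ModuleCat.{u} R) ℤ) (f : P ⟶ A), QuasiIso f ∧
    (∀ i, Module.Finite R (P.X i)) ∧ (∀ i, Module.Projective R (P.X i)) ∧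
    ∃ a b : ℤ, ∀ i, (i < a ∨ b < i) → Subsingleton (P.X i)

/-- The shifted dual `A^∨[-n]`; its term in degree `i` is `Hom_R(A^{n-i}, R)` and its
differential is `ψ ↦ -(-1)^i ψ ∘ d`. -/
def shiftedDual (n : ℤ) (A : CochainComplex (ModuleCat.{u} R) ℤ) :
    CochainComplex (ModuleCat.{u} R) ℤ where
  X i := ModuleCat.of R (Module.Dual R (A.X (n - i)))
  d i j := ModuleCat.ofHom (-(i.negOnePow • Module.Dual.transpose (A.d (n - j) (n - i)).hom))
  shape i j h := by
    have : ¬ (ComplexShape.up ℤ).Rel (n - j) (n - i) := by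
      simp only [ComplexShape.up_Rel] at h ⊢; omega
    rw [A.shape _ _ this]; ext; simp
  d_comp_d' i j k _ _ := by
    ext f x
    have : (A.d (n - j) (n - i)).hom ((A.d (n - k) (n - j)).hom x) = 0 := by
      rw [← ModuleCat.comp_apply, A.d_comp_d]; rfl
    simp [Module.Dual.transpose, Units.smul_def, this]

end Complexes

/-- A (small, unital) differential graded category over `R`: a category enriched over complexes
of `R`-modules. `comp i j k h g f` is `g ∘ f` for `g` of degree `i` and `f` of degree `j`. -/
structure DGCat (R : Type u) [CommRing R] where
  Obj : Type u
  Hom : Obj → Obj → CochainComplex (ModuleCat.{u} R) ℤ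
  comp : ∀ {X Y Z : Obj} (i j k : ℤ), i + j = k →
    ((Hom Y Z).X i →ₗ[R] (Hom X Y).X j →ₗ[R] (Hom X Z).X k)
  id : ∀ X : Obj, (Hom X X).X 0
  id_comp : ∀ {X Y : Obj} (i : ℤ) (f : (Hom X Y).X i), comp 0 i i (zero_add i) (id Y) f = f
  comp_id : ∀ {X Y : Obj} (i : ℤ) (f : (Hom X Y).X i), comp i 0 i (add_zero i) f (id X) = f
  assoc : ∀ {W X Y Z : Obj} (i j k ij jk ijk : ℤ) (hij : i + j = ij) (hjk : j + k = jk)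
    (h₁ : ij + k = ijk) (h₂ : i + jk = ijk)
    (h : (Hom Y Z).X i) (g : (Hom X Y).X j) (f : (Hom W X).X k),
    comp ij k ijk h₁ (comp i j ij hij h g) f = comp i jk ijk h₂ h (comp j k jk hjk g f)
  d_id : ∀ X : Obj, (Hom X X).d 0 1 (id X) = 0
  leibniz : ∀ {X Y Z : Obj} (i j i' j' k k' : ℤ) (hk : i + j = k) (hi : i' + j = k')
    (hj : i + j' = k') (_ : i + 1 = i') (_ : j + 1 = j')
    (g : (Hom Y Z).X i) (f : (Hom X Y).X j),
    (Hom X Z).d k k' (comp i j k hk g f) =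
      comp i' j k' hi ((Hom Y Z).d i i' g) f +
        i.negOnePow • comp i j' k' hj g ((Hom X Y).d j j' f)

namespace DGCat

variable {R : Type u} [CommRing R]

/-- A dg functor. -/
structure Functor (C D : DGCat.{u} R) where
  obj : C.Obj → D.Obj
  map : ∀ X Y : C.Obj, C.Hom X Y ⟶ D.Hom (obj X) (obj Y)
  map_id : ∀ X : C.Obj, (map X X).f 0 (C.id X) = D.id (obj X)
  map_comp : ∀ {X Y Z : C.Obj} (i j k : ℤ) (h : i + j = k)
    (g : (C.Hom Y Z).X i) (f : (C.Hom X Y).X j),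
    (map X Z).f k (C.comp i j k h g f) = D.comp i j k h ((map Y Z).f i g) ((map X Y).f j f)

/-- A quasi-isomorphism of dg categories: bijective on objects and a quasi-isomorphism on all
morphism complexes. -/
structure Functor.IsQuasiIso {C D : DGCat.{u} R} (F : Functor C D) : Prop where
  bijective_obj : Function.Bijective F.obj
  quasiIso_map : ∀ X Y : C.Obj, QuasiIso (F.map X Y)

/-- Two dg categories are quasi-isomorphic when they are connected by a finite zigzag of
quasi-isomorphisms of dg categories. -/
def QuasiIsomorphic (C D : DGCat.{u} R) : Prop :=
  Relation.EqvGen (fun A B : DGCat.{u} R => ∃ F : Functor A B, F.IsQuasiIso) C D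

section Cohomology

variable (C : DGCat.{u} R)

lemma comp_cocycle {X Y Z : C.Obj} {i j k : ℤ} (h : i + j = k)
    (g : (C.Hom Y Z).X i) (f : (C.Hom X Y).X j)
    (hg : (C.Hom Y Z).d i (i + 1) g = 0) (hf : (C.Hom X Y).d j (j + 1) f = 0) :
    (C.Hom X Z).d k (k + 1) (C.comp i j k h g f) = 0 := by
  rw [C.leibniz i j (i + 1) (j + 1) k (k + 1) h (by omega) (by omega) rfl rfl, hg, hf]
  simp

/-- Composition of cocycles, as a bilinear map with values in cohomology. -/
def cocycleComp {X Y Z : C.Obj} (i j k : ℤ) (h : i + j = k) :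
    LinearMap.ker ((C.Hom Y Z).d i (i + 1)).hom →ₗ[R]
      LinearMap.ker ((C.Hom X Y).d j (j + 1)).hom →ₗ[R] Coh (C.Hom X Z) k :=
  LinearMap.mk₂ R (fun g f => Submodule.Quotient.mk
      ⟨C.comp i j k h g.1 f.1, C.comp_cocycle h g.1 f.1 g.2 f.2⟩)
    (fun _ _ _ => by
      rw [← Submodule.Quotient.mk_add]; congr 1; ext; simp)
    (fun _ _ _ => by
      rw [← Submodule.Quotient.mk_smul]; congr 1; ext; simp)
    (fun _ _ _ => by
      rw [← Submodule.Quotient.mk_add]; congr 1; ext; simp)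
    (fun _ _ _ => by
      rw [← Submodule.Quotient.mk_smul]; congr 1; ext; simp)

/-- Composition on cohomology, `[g] ∘ [f] = [g ∘ f]`. -/
def cohComp {X Y Z : C.Obj} (i j k : ℤ) (h : i + j = k) :
    Coh (C.Hom Y Z) i →ₗ[R] Coh (C.Hom X Y) j →ₗ[R] Coh (C.Hom X Z) k :=
  Submodule.liftQ _
    (LinearMap.flip (Submodule.liftQ _ (C.cocycleComp i j k h).flip (by
      rintro ⟨f, hf⟩ ⟨e, he⟩
      ext ⟨g, hg⟩
      refine (Submodule.Quotient.mk_eq_zero _).2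
        ⟨i.negOnePow • C.comp i (j - 1) (k - 1) (by omega) g e, ?_⟩
      have := C.leibniz i (j - 1) (i + 1) j (k - 1) k (by omega) (by omega) h rfl (by omega) g e
      simp only [LinearMap.mem_ker] at hg
      simp only [Submodule.coe_subtype] at he ⊢
      rw [Units.smul_def, map_zsmul, ← Units.smul_def]
      refine (congrArg (fun x => i.negOnePow • x) (this.trans (?_ : _ =
        i.negOnePow • C.comp i j k h g f))).trans ?_
      · rw [← he]
        simpa using congrArg (fun x => C.comp (i + 1) (j - 1) k (by omega) x e) hg
      · simp [smul_smul]))) (by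
    rintro ⟨g, hg⟩ ⟨e, he⟩
    apply LinearMap.ext
    intro f
    obtain ⟨⟨f, hf⟩, rfl⟩ := Submodule.Quotient.mk_surjective _ f
    refine (Submodule.Quotient.mk_eq_zero _).2 ⟨C.comp (i - 1) j (k - 1) (by omega) e f, ?_⟩
    have := C.leibniz (i - 1) j i (j + 1) (k - 1) k (by omega) h (by omega) (by omega) rfl e f
    simp only [LinearMap.mem_ker] at hf
    simp only [Submodule.coe_subtype] at he ⊢
    rw [this, hf, he]
    simp)

lemma cohComp_mk {X Y Z : C.Obj} (i j k : ℤ) (h : i + j = k)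
    (g : LinearMap.ker ((C.Hom Y Z).d i (i + 1)).hom)
    (f : LinearMap.ker ((C.Hom X Y).d j (j + 1)).hom) :
    C.cohComp i j k h (Submodule.Quotient.mk g) (Submodule.Quotient.mk f) =
      Submodule.Quotient.mk ⟨C.comp i j k h g.1 f.1, C.comp_cocycle h g.1 f.1 g.2 f.2⟩ :=
  rfl

/-- The cohomology of a complex, viewed as a complex with zero differential. -/
def _root_.cohComplex (A : CochainComplex (ModuleCat.{u} R) ℤ) :
    CochainComplex (ModuleCat.{u} R) ℤ where
  X i := ModuleCat.of R (Coh A i)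
  d _ _ := 0

/-- The cohomology category `HC`, viewed as a dg category with zero differential. -/
def cohomology : DGCat.{u} R where
  Obj := C.Obj
  Hom X Y := cohComplex (C.Hom X Y)
  comp {X Y Z} i j k h := C.cohComp (X := X) (Y := Y) (Z := Z) i j k h
  id X := Submodule.Quotient.mk (p := (LinearMap.range ((C.Hom X X).d (0 - 1) 0).hom).comap
    (LinearMap.ker ((C.Hom X X).d 0 (0 + 1)).hom).subtype) ⟨C.id X, C.d_id X⟩
  id_comp {X Y} i f := by
    obtain ⟨f, rfl⟩ := Submodule.Quotient.mk_surjective _ f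
    refine (C.cohComp_mk _ _ _ _ _ _).trans ?_
    congr 1
    exact Subtype.ext (C.id_comp i f.1)
  comp_id {X Y} i f := by
    obtain ⟨f, rfl⟩ := Submodule.Quotient.mk_surjective _ f
    refine (C.cohComp_mk _ _ _ _ _ _).trans ?_
    congr 1
    exact Subtype.ext (C.comp_id i f.1)
  assoc {W X Y Z} i j k ij jk ijk hij hjk h₁ h₂ h g f := by
    obtain ⟨f, rfl⟩ := Submodule.Quotient.mk_surjective _ f
    obtain ⟨g, rfl⟩ := Submodule.Quotient.mk_surjective _ g
    obtain ⟨h, rfl⟩ := Submodule.Quotient.mk_surjective _ h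
    refine Eq.trans (b := Submodule.Quotient.mk ⟨C.comp ij k ijk h₁ (C.comp i j ij hij h.1 g.1) f.1,
      C.comp_cocycle h₁ _ _ (C.comp_cocycle hij _ _ h.2 g.2) f.2⟩) rfl ?_
    congr 1
    exact Subtype.ext (C.assoc i j k ij jk ijk hij hjk h₁ h₂ h.1 g.1 f.1)
  d_id X := rfl
  leibniz {X Y Z} i j i' j' k k' hk hi hj _ _ g f :=
    (show (0 : Coh (C.Hom X Z) k') = C.cohComp i' j k' hi (0 : Coh (C.Hom Y Z) i') f +
      i.negOnePow • C.cohComp i j' k' hj g (0 : Coh (C.Hom X Y) j') by simp; rfl)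

end Cohomology

/-- `C` is formal when it is quasi-isomorphic to its cohomology category. -/
def IsFormal (C : DGCat.{u} R) : Prop :=
  QuasiIsomorphic C C.cohomology

/-- `C` is flat when the morphism modules of its cohomology category are projective. -/
def IsFlat (C : DGCat.{u} R) : Prop :=
  ∀ (X Y : C.Obj) (i : ℤ), Module.Projective R (Coh (C.Hom X Y) i)

/-- `C` is proper when all its morphism complexes are perfect. -/
def IsProper (C : DGCat.{u} R) : Prop :=
  ∀ X Y : C.Obj, IsPerfectComplex (C.Hom X Y)

section BaseChange

/-- The `S`-bilinear extension of an `R`-bilinear map, `(a ⊗ m, b ⊗ n) ↦ ab ⊗ μ(m, n)`. -/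
def _root_.bilinBaseChange (S : Type u) [CommRing S] [Algebra R S] {M N P : Type u}
    [AddCommGroup M] [AddCommGroup N] [AddCommGroup P] [Module R M] [Module R N] [Module R P]
    (μ : M →ₗ[R] N →ₗ[R] P) : S ⊗[R] M →ₗ[S] S ⊗[R] N →ₗ[S] S ⊗[R] P :=
  (TensorProduct.mk S _ _).compr₂
    (((TensorProduct.lift μ).baseChange S).comp
      (AlgebraTensorModule.distribBaseChange R S M N).symm.toLinearMap)

lemma _root_.bilinBaseChange_tmul (S : Type u) [CommRing S] [Algebra R S] {M N P : Type u}
    [AddCommGroup M] [AddCommGroup N] [AddCommGroup P] [Module R M] [Module R N] [Module R P]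
    (μ : M →ₗ[R] N →ₗ[R] P) (a b : S) (m : M) (n : N) :
    bilinBaseChange S μ (a ⊗ₜ m) (b ⊗ₜ n) = (a * b) ⊗ₜ μ m n := by
  have : (AlgebraTensorModule.distribBaseChange R S M N).symm ((a ⊗ₜ[R] m) ⊗ₜ[S] (b ⊗ₜ[R] n)) =
      (a * b) ⊗ₜ[R] (m ⊗ₜ[R] n) := by
    rw [LinearEquiv.symm_apply_eq, AlgebraTensorModule.distribBaseChange_tmul]
    rw [mul_comm, ← smul_eq_mul, ← TensorProduct.smul_tmul', TensorProduct.smul_tmul,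
      TensorProduct.smul_tmul', smul_eq_mul, mul_one]
  simp [bilinBaseChange, this]

/-- The base change `S ⊗_R A` of a complex. -/
def _root_.complexBaseChange (S : Type u) [CommRing S] [Algebra R S]
    (A : CochainComplex (ModuleCat.{u} R) ℤ) : CochainComplex (ModuleCat.{u} S) ℤ where
  X i := ModuleCat.of S (S ⊗[R] A.X i)
  d i j := ModuleCat.ofHom ((A.d i j).hom.baseChange S)
  shape i j h := by
    rw [A.shape _ _ h]; ext; simp
  d_comp_d' i j k _ _ := by
    rw [← ModuleCat.ofHom_comp, ← LinearMap.baseChange_comp, ← ModuleCat.hom_comp, A.d_comp_d]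
    ext; simp

variable (S : Type u) [CommRing S] [Algebra R S] (C : DGCat.{u} R)

/-- The base change `Ind_{S/R}(C)`: same objects, morphism complexes `S ⊗_R C(X, Y)`, and
`(a ⊗ g) ∘ (b ⊗ f) = ab ⊗ (g ∘ f)`. -/
def baseChange : DGCat.{u} S where
  Obj := C.Obj
  Hom X Y := complexBaseChange S (C.Hom X Y)
  comp i j k h := bilinBaseChange S (C.comp i j k h)
  id X := (1 : S) ⊗ₜ[R] C.id X
  id_comp {X Y} i f := by
    change S ⊗[R] (C.Hom X Y).X i at f
    change bilinBaseChange S (C.comp 0 i i (zero_add i)) ((1 : S) ⊗ₜ[R] C.id Y) f = f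
    induction f with
    | zero => simp
    | tmul b f => rw [bilinBaseChange_tmul, C.id_comp, one_mul]
    | add x y hx hy => rw [map_add, hx, hy]
  comp_id {X Y} i f := by
    change S ⊗[R] (C.Hom X Y).X i at f
    change bilinBaseChange S (C.comp i 0 i (add_zero i)) f ((1 : S) ⊗ₜ[R] C.id X) = f
    induction f with
    | zero => simp
    | tmul b f => rw [bilinBaseChange_tmul, C.comp_id, mul_one]
    | add x y hx hy => rw [map_add, LinearMap.add_apply, hx, hy]
  assoc {W X Y Z} i j k ij jk ijk hij hjk h₁ h₂ h g f := by
    change S ⊗[R] (C.Hom W X).X k at f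
    change S ⊗[R] (C.Hom X Y).X j at g
    change S ⊗[R] (C.Hom Y Z).X i at h
    change bilinBaseChange S (C.comp ij k ijk h₁) (bilinBaseChange S (C.comp i j ij hij) h g) f =
      bilinBaseChange S (C.comp i jk ijk h₂) h (bilinBaseChange S (C.comp j k jk hjk) g f)
    induction h with
    | zero => simp
    | add x y hx hy => simp only [map_add, LinearMap.add_apply, hx, hy]
    | tmul a h =>
      induction g with
      | zero => simp
      | add x y hx hy => simp only [map_add, LinearMap.add_apply, hx, hy]
      | tmul b g =>
        induction f with
        | zero => simp
        | add x y hx hy => simp only [map_add, hx, hy]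
        | tmul c f =>
          simp only [bilinBaseChange_tmul, C.assoc i j k ij jk ijk hij hjk h₁ h₂, mul_assoc]
  d_id X := by
    change ((C.Hom X X).d 0 1).hom.baseChange S ((1 : S) ⊗ₜ[R] C.id X) = 0
    rw [LinearMap.baseChange_tmul, C.d_id, tmul_zero]
  leibniz {X Y Z} i j i' j' k k' hk hi hj h₁ h₂ g f := by
    change S ⊗[R] (C.Hom X Y).X j at f
    change S ⊗[R] (C.Hom Y Z).X i at g
    change ((C.Hom X Z).d k k').hom.baseChange S (bilinBaseChange S (C.comp i j k hk) g f) =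
      bilinBaseChange S (C.comp i' j k' hi) (((C.Hom Y Z).d i i').hom.baseChange S g) f +
      i.negOnePow • bilinBaseChange S (C.comp i j' k' hj) g
        (((C.Hom X Y).d j j').hom.baseChange S f)
    induction g with
    | zero => simp
    | add x y hx hy =>
      simp only [map_add, LinearMap.add_apply, hx, hy, smul_add]; abel
    | tmul a g =>
      induction f with
      | zero => simp
      | add x y hx hy => simp only [map_add, hx, hy, smul_add]; abel
      | tmul b f =>
        simp only [bilinBaseChange_tmul, LinearMap.baseChange_tmul]
        rw [C.leibniz i j i' j' k k' hk hi hj h₁ h₂, tmul_add]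
        simp only [Units.smul_def, tmul_smul]

end BaseChange

section Hochschild

/-- The total module `⨁ᵢ Aⁱ` of a complex. -/
abbrev _root_.Tot (A : CochainComplex (ModuleCat.{u} R) ℤ) : Type u := ⨁ i, A.X i

/-- The bilinear map on total modules with prescribed homogeneous components. -/
def _root_.totLift {A B : CochainComplex (ModuleCat.{u} R) ℤ} {M : Type u} [AddCommMonoid M]
    [Module R M] (μ : ∀ i j : ℤ, A.X i →ₗ[R] B.X j →ₗ[R] M) : Tot A →ₗ[R] Tot B →ₗ[R] M :=
  DirectSum.toModule R ℤ _ fun i =>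
    (DirectSum.toModule R ℤ _ fun j => (μ i j).flip).flip

/-- The differential on the total module. -/
def _root_.totD (A : CochainComplex (ModuleCat.{u} R) ℤ) : Tot A →ₗ[R] Tot A :=
  DirectSum.toModule R ℤ _ fun i =>
    (DirectSum.lof R ℤ (fun i => A.X i) (i + 1)).comp (A.d i (i + 1)).hom

/-- The sign involution `a ↦ (-1)^|a| a`. -/
def _root_.totSign (A : CochainComplex (ModuleCat.{u} R) ℤ) : Tot A →ₗ[R] Tot A :=
  DirectSum.toModule R ℤ _ fun i => i.negOnePow • DirectSum.lof R ℤ (fun i => A.X i) i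

/-- The Koszul twist `(a, b) ↦ (-1)^(|a||b|) q(a, b)` of a bilinear map `q`. -/
def _root_.totTwist {A B : CochainComplex (ModuleCat.{u} R) ℤ} {M : Type u} [AddCommMonoid M]
    [Module R M] (q : Tot A →ₗ[R] Tot B →ₗ[R] M) : Tot A →ₗ[R] Tot B →ₗ[R] M :=
  totLift fun i j => (((i * j).negOnePow : ℤ) : R) •
    q.compl₁₂ (DirectSum.lof R ℤ (fun i => A.X i) i) (DirectSum.lof R ℤ (fun j => B.X j) j)

variable (C : DGCat.{u} R)

/-- Composition on total modules. -/
def compTot (X Y Z : C.Obj) :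
    Tot (C.Hom Y Z) →ₗ[R] Tot (C.Hom X Y) →ₗ[R] Tot (C.Hom X Z) :=
  totLift fun i j => (C.comp i j (i + j) rfl).compr₂
    (DirectSum.lof R ℤ (fun k => (C.Hom X Z).X k) (i + j))

/-- The module of composable words `a₀ ⊗ a₁ ⊗ ⋯ ⊗ aₙ` with `n + 1` letters going from `X` to `Y`:
the sum over `X₁, …, Xₙ` of `C(X₁, Y) ⊗ C(X₂, X₁) ⊗ ⋯ ⊗ C(X, Xₙ)`. -/
def Word : ℕ → C.Obj → C.Obj → ModuleCat.{u} R
  | 0, X, Y => ModuleCat.of R (Tot (C.Hom X Y))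
  | n + 1, X, Y => ModuleCat.of R (⨁ Z : C.Obj, Tot (C.Hom Z Y) ⊗[R] Word n X Z)

open scoped Classical in
/-- Put the letter `a` in front of the word `w`. -/
def cons (n : ℕ) (X Z Y : C.Obj) :
    Tot (C.Hom Z Y) →ₗ[R] C.Word n X Z →ₗ[R] C.Word (n + 1) X Y :=
  (TensorProduct.mk R _ _).compr₂
    (DirectSum.lof R C.Obj (fun Z => Tot (C.Hom Z Y) ⊗[R] C.Word n X Z) Z)

open scoped Classical in
/-- A linear map out of words of length at least two is determined by its values on `a ⊗ w`. -/
def wordLift (n : ℕ) (X Y : C.Obj) {M : Type u} [AddCommMonoid M] [Module R M]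
    (f : ∀ Z : C.Obj, Tot (C.Hom Z Y) →ₗ[R] C.Word n X Z →ₗ[R] M) :
    C.Word (n + 1) X Y →ₗ[R] M :=
  DirectSum.toModule R C.Obj M fun Z => TensorProduct.lift (f Z)

/-- Multiply the first letter of a word: `a, a₀ ⊗ a₁ ⊗ ⋯ ↦ (a ∘ a₀) ⊗ a₁ ⊗ ⋯`. -/
def mulFirst : ∀ (n : ℕ) (X Z Y : C.Obj),
    Tot (C.Hom Z Y) →ₗ[R] C.Word n X Z →ₗ[R] C.Word n X Y
  | 0, X, Z, Y => C.compTot X Z Y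
  | n + 1, X, Z, Y => LinearMap.flip (C.wordLift n X Z fun V =>
      LinearMap.lflip.comp ((C.compTot V Z Y).compr₂ (C.cons n X V Y)).flip)

/-- The part `∑ᵢ (-1)ⁱ a₀ ⊗ ⋯ ⊗ (aᵢ ∘ aᵢ₊₁) ⊗ ⋯ ⊗ aₙ`, `0 ≤ i < n`, of the Hochschild differential. -/
def bar : ∀ (n : ℕ) (X Y : C.Obj), C.Word (n + 1) X Y →ₗ[R] C.Word n X Y
  | 0, X, Y => C.wordLift 0 X Y fun Z => C.compTot X Z Y
  | n + 1, X, Y => C.wordLift (n + 1) X Y fun Z =>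
      C.mulFirst (n + 1) X Z Y - (C.cons n X Z Y).compl₂ (bar n X Z)

/-- The internal differential `∑ᵢ (-1)^(|a₀| + ⋯ + |aᵢ₋₁|) a₀ ⊗ ⋯ ⊗ daᵢ ⊗ ⋯ ⊗ aₙ`. -/
def wordD : ∀ (n : ℕ) (X Y : C.Obj), C.Word n X Y →ₗ[R] C.Word n X Y
  | 0, X, Y => totD (C.Hom X Y)
  | n + 1, X, Y => C.wordLift n X Y fun Z =>
      (C.cons n X Z Y).comp (totD (C.Hom Z Y)) +
        (C.cons n X Z Y).compl₁₂ (totSign (C.Hom Z Y)) (wordD n X Z)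

/-- `⨁ C(X, V) ⊗ (words from V to Y)`: a word from `X` to `Y` whose last letter was put in front. -/
abbrev Rotated (n : ℕ) (X Y : C.Obj) : Type u :=
  ⨁ V : C.Obj, Tot (C.Hom X V) ⊗[R] C.Word n V Y

open scoped Classical in
/-- `f, w ↦ f ⊗ w`. -/
def rotatedMk (n : ℕ) (X V Y : C.Obj) :
    Tot (C.Hom X V) →ₗ[R] C.Word n V Y →ₗ[R] C.Rotated n X Y :=
  (TensorProduct.mk R _ _).compr₂
    (DirectSum.lof R C.Obj (fun V => Tot (C.Hom X V) ⊗[R] C.Word n V Y) V)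

open scoped Classical in
/-- A linear map out of rotated words is determined by its values on `f ⊗ w`. -/
def rotatedLift (n : ℕ) (X Y : C.Obj) {M : Type u} [AddCommMonoid M] [Module R M]
    (q : ∀ V : C.Obj, Tot (C.Hom X V) →ₗ[R] C.Word n V Y →ₗ[R] M) :
    C.Rotated n X Y →ₗ[R] M :=
  DirectSum.toModule R C.Obj M fun V => TensorProduct.lift (q V)

/-- `a, f ⊗ w ↦ (-1)^(|f||a|) f ⊗ (a ⊗ w)`. -/
def rotatedCons (n : ℕ) (X Z Y : C.Obj) :
    Tot (C.Hom Z Y) →ₗ[R] C.Rotated n X Z →ₗ[R] C.Rotated (n + 1) X Y :=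
  LinearMap.flip (C.rotatedLift n X Z fun V => LinearMap.lflip.comp (totTwist
    ((LinearMap.llcomp R (C.Word n V Z) (C.Word (n + 1) V Y) (C.Rotated (n + 1) X Y)).compl₁₂
      (C.rotatedMk (n + 1) X V Y) (C.cons n V Z Y))))

/-- Move the last letter to the front, with its Koszul sign:
`a₀ ⊗ ⋯ ⊗ aₙ ↦ (-1)^(|aₙ|(|a₀| + ⋯ + |aₙ₋₁|)) aₙ ⊗ (a₀ ⊗ ⋯ ⊗ aₙ₋₁)`. -/
def lastToFront : ∀ (n : ℕ) (X Y : C.Obj), C.Word (n + 1) X Y →ₗ[R] C.Rotated n X Y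
  | 0, X, Y => C.wordLift 0 X Y fun Z => totTwist (C.rotatedMk 0 X Z Y).flip
  | n + 1, X, Y => C.wordLift (n + 1) X Y fun Z =>
      (C.rotatedCons n X Z Y).compl₂ (lastToFront n X Z)

/-- The Hochschild chains with `n + 1` letters: the sum of
`C(X₁, X) ⊗ C(X₂, X₁) ⊗ ⋯ ⊗ C(X, Xₙ)` over all `X, X₁, …, Xₙ`. -/
def Chains (n : ℕ) : ModuleCat.{u} R := ModuleCat.of R (⨁ X : C.Obj, C.Word n X X)

open scoped Classical in
/-- The inclusion of the closed words based at `X`. -/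
def chainsOf (n : ℕ) (X : C.Obj) : C.Word n X X →ₗ[R] C.Chains n :=
  DirectSum.lof R C.Obj (fun X => C.Word n X X) X

open scoped Classical in
/-- The Hochschild differential
`b(a₀ ⊗ ⋯ ⊗ aₙ₊₁) = ∑_{i ≤ n} (-1)ⁱ a₀ ⊗ ⋯ ⊗ aᵢ aᵢ₊₁ ⊗ ⋯ ⊗ aₙ₊₁
  + (-1)^(n + 1 + |aₙ₊₁|(|a₀| + ⋯ + |aₙ|)) aₙ₊₁ a₀ ⊗ a₁ ⊗ ⋯ ⊗ aₙ`. -/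
def hochB (n : ℕ) : C.Chains (n + 1) →ₗ[R] C.Chains n :=
  DirectSum.toModule R C.Obj (C.Chains n) fun X =>
    (C.chainsOf n X).comp (C.bar n X X) +
      (-1 : R) ^ (n + 1) • (C.rotatedLift n X X fun V =>
        (C.mulFirst n V X V).compr₂ (C.chainsOf n V)).comp (C.lastToFront n X X)

open scoped Classical in
/-- The internal differential on Hochschild chains. -/
def chainsD (n : ℕ) : C.Chains n →ₗ[R] C.Chains n :=
  DirectSum.toModule R C.Obj (C.Chains n) fun X => (C.chainsOf n X).comp (C.wordD n X X)

/-- The total Hochschild chain module `CC_•(C)`. -/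
def HochschildChains : ModuleCat.{u} R := ModuleCat.of R (⨁ n : ℕ, C.Chains n)

/-- The inclusion of the chains with `n + 1` letters. -/
def hochOf (n : ℕ) : C.Chains n →ₗ[R] C.HochschildChains :=
  DirectSum.lof R ℕ (fun n => C.Chains n) n

/-- The total differential `b + (-1)ⁿ d` of the Hochschild chain complex. -/
def hochD : C.HochschildChains →ₗ[R] C.HochschildChains :=
  DirectSum.toModule R ℕ C.HochschildChains fun n => match n with
    | 0 => (C.hochOf 0).comp (C.chainsD 0)
    | n + 1 => (C.hochOf n).comp (C.hochB n) +
        (-1 : R) ^ (n + 1) • (C.hochOf (n + 1)).comp (C.chainsD (n + 1))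

/-- Hochschild homology `HH_•(C)`, the sum of the homology modules over all degrees. -/
abbrev HochschildHomology : Type u :=
  LinearMap.ker C.hochD ⧸ (LinearMap.range C.hochD).comap (LinearMap.ker C.hochD).subtype

/-- The words of internal degree `k`, i.e. `|a₀| + ⋯ + |aₙ| = k`. -/
def wordDeg : ∀ (n : ℕ) (X Y : C.Obj), ℤ → Submodule R (C.Word n X Y)
  | 0, X, Y, k => LinearMap.range (DirectSum.lof R ℤ (fun k => (C.Hom X Y).X k) k)
  | n + 1, X, Y, k => Submodule.span R
      {x | ∃ (Z : C.Obj) (i j : ℤ) (a : (C.Hom Z Y).X i) (w : C.Word n X Z),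
        i + j = k ∧ w ∈ wordDeg n X Z j ∧
          x = C.cons n X Z Y (DirectSum.lof R ℤ (fun i => (C.Hom Z Y).X i) i a) w}

end Hochschild

section CalabiYau

variable (C : DGCat.{u} R)

/-- A cocycle of degree `-n` in `Hom_R(CC_•(C), R)`: a functional `φ` on Hochschild chains that
kills boundaries and is supported on chains of total cohomological degree
`(|a₀| + ⋯ + |aₚ|) - p = n`. -/
structure HochschildCocycle (n : ℤ) where
  φ : C.HochschildChains →ₗ[R] R
  closed : φ.comp C.hochD = 0
  degree : ∀ (p : ℕ) (X : C.Obj) (k : ℤ), ∀ w ∈ C.wordDeg p X X k, k - p ≠ n →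
    φ (C.hochOf p (C.chainsOf p X w)) = 0

variable {C} {n : ℤ}

/-- The restriction of a Hochschild cocycle to endomorphisms of `X`, in degree `k`. -/
def HochschildCocycle.trace (c : C.HochschildCocycle n) (X : C.Obj) (k : ℤ) :
    (C.Hom X X).X k →ₗ[R] R :=
  c.φ.comp ((C.hochOf 0).comp ((C.chainsOf 0 X).comp
    (DirectSum.lof R ℤ (fun k => (C.Hom X X).X k) k)))

lemma HochschildCocycle.trace_d (c : C.HochschildCocycle n) (X : C.Obj) (k k' : ℤ)
    (h : k + 1 = k') (x : (C.Hom X X).X k) :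
    c.trace X k' ((C.Hom X X).d k k' x) = 0 := by
  subst h
  have := LinearMap.congr_fun c.closed
    (C.hochOf 0 (C.chainsOf 0 X (DirectSum.lof R ℤ (fun k => (C.Hom X X).X k) k x)))
  have e₁ : C.hochD (C.hochOf 0 (C.chainsOf 0 X
      (DirectSum.lof R ℤ (fun k => (C.Hom X X).X k) k x))) =
      C.hochOf 0 (C.chainsD 0 (C.chainsOf 0 X
        (DirectSum.lof R ℤ (fun k => (C.Hom X X).X k) k x))) :=
    DirectSum.toModule_lof (M := fun n => C.Chains n) R 0 _
  have e₂ (w : Tot (C.Hom X X)) : C.chainsD 0 (C.chainsOf 0 X w) =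
      C.chainsOf 0 X (totD (C.Hom X X) w) := by
    classical
    exact DirectSum.toModule_lof (M := fun X => C.Word 0 X X) R X w
  have e₃ : totD (C.Hom X X) (DirectSum.lof R ℤ (fun k => (C.Hom X X).X k) k x) =
      DirectSum.lof R ℤ (fun k => (C.Hom X X).X k) (k + 1) ((C.Hom X X).d k (k + 1) x) :=
    DirectSum.toModule_lof (M := fun k => (C.Hom X X).X k) R k x
  rw [LinearMap.comp_apply, e₁, e₂, e₃] at this
  exact this

/-- The morphism `C(X, Y) → C(Y, X)^∨[-n]`, `f ↦ (g ↦ φ(f ∘ g))`, induced by a Hochschild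
cocycle. -/
def HochschildCocycle.pairing (c : C.HochschildCocycle n) (X Y : C.Obj) :
    C.Hom X Y ⟶ shiftedDual n (C.Hom Y X) where
  f i := ModuleCat.ofHom ((C.comp i (n - i) n (by omega)).compr₂ (c.trace Y n))
  comm' i j h := by
    have h' : i + 1 = j := h
    ext f
    refine LinearMap.ext fun (g : (C.Hom Y X).X (n - j)) => ?_
    have e := c.trace_d Y (n - 1) n (by omega) (C.comp i (n - j) (n - 1) (by omega) f g)
    rw [C.leibniz i (n - j) j (n - i) (n - 1) n (by omega) (by omega) (by omega) h' (by omega),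
      map_add, Units.smul_def, map_zsmul, ← Units.smul_def] at e
    change -(i.negOnePow • c.trace Y n (C.comp i (n - i) n (by omega) f
      ((C.Hom Y X).d (n - j) (n - i) g))) = c.trace Y n (C.comp j (n - j) n (by omega)
        ((C.Hom X Y).d i j f) g)
    exact (eq_neg_of_add_eq_zero_left e).symm

end CalabiYau

/-- `C` is a weakly proper `n`-Calabi–Yau dg category: it is proper and carries a class in
`HH^∨_{-n}(C) = H^{-n}(RHom_R(C ⊗^L_{C ⊗^L C^op} C, R))` whose associated morphism
`C → C^{op,∨}[-n]` is an isomorphism in the derived category of bimodules.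
The derived functors are computed, as usual, on a quasi-isomorphic dg category `D` with
K-projective morphism complexes: there `C ⊗^L C` over bimodules is the Hochschild chain complex
`CC_•(D)`, which is again K-projective over `R`. A morphism of bimodules is an isomorphism in the
derived category when it is a quasi-isomorphism on each pair of objects. -/
def IsWeaklyProperCalabiYau (n : ℤ) (C : DGCat.{u} R) : Prop :=
  C.IsProper ∧
    ∃ (D : DGCat.{u} R) (F : Functor D C), F.IsQuasiIso ∧
      (∀ X Y : D.Obj, (D.Hom X Y).IsKProjective) ∧
      ∃ c : D.HochschildCocycle n, ∀ X Y : D.Obj, QuasiIso (c.pairing X Y)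

end DGCat
end

/-!
A dg category `C` is formal exactly if there is an `A∞`-quasi-isomorphism to it from its
cohomology category `H`. Here such a functor is a *twisting cochain*: a family `f` of maps from
words of composable morphisms of `H` to the morphisms of a dg category `D`, subject to one equation,
the vanishing of the curvature `LC.curv f`. It is built by adding letters to the words. The
obstruction to adding one letter is the part of the curvature in the top word length; it only
matters up to boundaries in `D` and up to the Hochschild coboundaries that arise from changing the
last component of `f`. To descend formality from the generic fibre is to show that this
obstruction vanishes over `R` as soon as it vanishes over `K`.

This is where the hypotheses enter. As `D` one takes the K-projective model of `C` in the
Calabi–Yau datum, where the class of the Hochschild homology becomes a trace, and by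
nondegeneracy of the trace pairing (`DGCat.isPerfectPairing`) the obstruction is the same thing as
a functional `LC.traceForm` on the Hochschild chains of `H`. The obstruction vanishes if
this functional factors through the Hochschild differential (`LC.IsPerfectPairing.extends`), and
the functional of a vanishing obstruction is zero on Hochschild cycles (`LC.Extends.traceForm_eq`). Since the Hochschild homology of `H` is
projective, so are the boundaries and the cycles, and they are direct summands; hence it is enough
that the functional is zero on cycles (`DGCat.exists_factor_hochB`). As a functional with values in
`R ⊆ K`, it is zero if it is zero over `K` (`LC.IsPerfectPairing.extends_of_push`). The induction
starts with a choice of representatives of the cohomology classes, which exists because `H` is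
projective (`DGCat.exists_qi_curv`), and `LC.exists_curv_eq_zero` passes to the limit.

Vanishing over `K` needs an argument, since formality of the generic fibre provides some twisting
cochain, and not an extension of the given truncated one. The property
`LC.HasExtensions` says that *every* truncated twisting cochain which becomes a quasi-isomorphism
over the fraction field extends, after a change in the top word length only. It is invariant under
quasi-isomorphisms of the target (`DGCat.QuasiIsomorphic.hasExtensions_iff`), by lifting cochains
along the quasi-isomorphism and correcting by gauge transformations. So the target may be taken to
be `H ⊗ K` with zero differential, and there the Euler field of the word length decides
(`LC.HasExtensions.of_isLocal`): the cochain whose component on words with `n + 1` letters is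
`n fₙ` is the derivative of `f` along a vector field on `H`, and this equation in the top word
length can be solved for the top component, because its weight is invertible in characteristic
zero. With the top component chosen in this way, the curvature vanishes in the next word length.

Conversely, a twisting cochain `f` that induces an isomorphism on cohomology yields a zigzag
`D ← LC.glue f → H` of quasi-isomorphisms (`LC.QI.quasiIsomorphic`). The middle term consists of a
morphism of `H`, a morphism of `D` and a homotopy between the two inside the bimodule of cochains
on words with values in `D`; the bar complex makes both projections quasi-isomorphisms.

That formality passes to the generic fibre is base change along the flat map `R → K`
(`DGCat.IsFormal.baseChange`).
-/


noncomputable section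

/-! ### Signed categories -/

/-- A differential graded category with the grading forgotten down to the sign involution `sgn`
(`x ↦ (-1)^|x| x`), so that all sign rules are written with `sgn` instead of with degrees. The
submodules `deg k` remember the homogeneous elements; the morphism modules need not be the sum
of these. -/
structure SCat (R : Type u) [CommRing R] where
  Obj : Type u
  Hom : Obj → Obj → ModuleCat.{u} R
  mul : ∀ {X Y Z : Obj}, Hom Y Z →ₗ[R] Hom X Y →ₗ[R] Hom X Z
  one : ∀ X : Obj, Hom X X
  sgn : ∀ {X Y : Obj}, Hom X Y →ₗ[R] Hom X Y
  d : ∀ {X Y : Obj}, Hom X Y →ₗ[R] Hom X Y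
  deg : ∀ {X Y : Obj}, ℤ → Submodule R (Hom X Y)
  mul_assoc : ∀ {W X Y Z : Obj} (h : Hom Y Z) (g : Hom X Y) (f : Hom W X),
    mul (mul h g) f = mul h (mul g f)
  one_mul : ∀ {X Y : Obj} (f : Hom X Y), mul (one Y) f = f
  mul_one : ∀ {X Y : Obj} (f : Hom X Y), mul f (one X) = f
  sgn_mul : ∀ {X Y Z : Obj} (g : Hom Y Z) (f : Hom X Y), sgn (mul g f) = mul (sgn g) (sgn f)
  sgn_sgn : ∀ {X Y : Obj} (f : Hom X Y), sgn (sgn f) = f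
  sgn_d : ∀ {X Y : Obj} (f : Hom X Y), sgn (d f) = -d (sgn f)
  d_d : ∀ {X Y : Obj} (f : Hom X Y), d (d f) = 0
  d_mul : ∀ {X Y Z : Obj} (g : Hom Y Z) (f : Hom X Y),
    d (mul g f) = mul (d g) f + mul (sgn g) (d f)
  d_one : ∀ X : Obj, d (one X) = 0
  deg_mul : ∀ {X Y Z : Obj} (i j : ℤ) (g : Hom Y Z) (f : Hom X Y), g ∈ deg (X := Y) i →
    f ∈ deg (X := X) j → mul g f ∈ deg (X := X) (i + j)
  deg_one : ∀ X : Obj, one X ∈ deg (X := X) 0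
  deg_d : ∀ {X Y : Obj} (i : ℤ) (f : Hom X Y), f ∈ deg (X := X) i → d f ∈ deg (X := X) (i + 1)
  sgn_deg : ∀ {X Y : Obj} (i : ℤ) (f : Hom X Y), f ∈ deg (X := X) i → sgn f = i.negOnePow • f

namespace SCat

variable {R : Type u} [CommRing R] (B : SCat.{u} R)

lemma sgn_one (X : B.Obj) : B.sgn (B.one X) = B.one X := by
  simpa using B.sgn_deg 0 _ (B.deg_one X)

end SCat

section Tot

variable {R : Type u} [CommRing R] {A B : CochainComplex (ModuleCat.{u} R) ℤ}

/-- The inclusion of the degree `i` part in the total module. -/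
abbrev tof (A : CochainComplex (ModuleCat.{u} R) ℤ) (i : ℤ) : A.X i →ₗ[R] Tot A :=
  DirectSum.lof R ℤ (fun i => A.X i) i

/-- The projection of the total module to its degree `i` part. -/
abbrev tcomp (A : CochainComplex (ModuleCat.{u} R) ℤ) (i : ℤ) : Tot A →ₗ[R] A.X i :=
  DirectSum.component R ℤ (fun i => A.X i) i

lemma tcomp_tof (i : ℤ) (x : A.X i) : tcomp A i (tof A i x) = x :=
  DirectSum.component.lof_self (M := fun i => A.X i) R i x

lemma tcomp_tof_ne {i j : ℤ} (h : i ≠ j) (x : A.X i) : tcomp A j (tof A i x) = 0 := by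
  rw [DirectSum.component.of]; simp [h]

lemma tot_hom_ext {M : Type*} [AddCommMonoid M] [Module R M] {f g : Tot A →ₗ[R] M}
    (h : ∀ i x, f (tof A i x) = g (tof A i x)) : f = g :=
  DirectSum.linearMap_ext R fun i => LinearMap.ext (h i)

lemma tot_induction {p : Tot A → Prop} (x : Tot A) (h0 : p 0) (h1 : ∀ i a, p (tof A i a))
    (h2 : ∀ x y, p x → p y → p (x + y)) : p x :=
  DirectSum.induction_on x h0 h1 h2

lemma totD_tof (i : ℤ) (x : A.X i) : totD A (tof A i x) = tof A (i + 1) (A.d i (i + 1) x) :=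
  DirectSum.toModule_lof (M := fun i => A.X i) R i x

lemma totSign_tof (i : ℤ) (x : A.X i) : totSign A (tof A i x) = i.negOnePow • tof A i x :=
  DirectSum.toModule_lof (M := fun i => A.X i) R i x

lemma totLift_tof {M : Type u} [AddCommMonoid M] [Module R M]
    (μ : ∀ i j : ℤ, A.X i →ₗ[R] B.X j →ₗ[R] M) (i j : ℤ) (x : A.X i) (y : B.X j) :
    totLift μ (tof A i x) (tof B j y) = μ i j x y := by
  simp [totLift, DirectSum.toModule_lof]

lemma totTwist_tof {M : Type u} [AddCommMonoid M] [Module R M]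
    (q : Tot A →ₗ[R] Tot B →ₗ[R] M) (i j : ℤ) (x : A.X i) (y : B.X j) :
    totTwist q (tof A i x) (tof B j y) =
      (((i * j).negOnePow : ℤ) : R) • q (tof A i x) (tof B j y) := by
  rw [totTwist, totLift_tof]; rfl

/-- The homogeneous elements of degree `k` in the total module. -/
def totDeg (A : CochainComplex (ModuleCat.{u} R) ℤ) (k : ℤ) : Submodule R (Tot A) :=
  LinearMap.range (tof A k)

lemma tof_mem (k : ℤ) (x : A.X k) : tof A k x ∈ totDeg A k := ⟨x, rfl⟩

/-- The projection of the total module to the homogeneous elements of degree `k`. -/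
def totProj (A : CochainComplex (ModuleCat.{u} R) ℤ) (k : ℤ) : Tot A →ₗ[R] Tot A :=
  (tof A k).comp (tcomp A k)

lemma totProj_mem (k : ℤ) (x : Tot A) : totProj A k x ∈ totDeg A k := ⟨_, rfl⟩

lemma totProj_of_mem {k : ℤ} {x : Tot A} (h : x ∈ totDeg A k) : totProj A k x = x := by
  obtain ⟨x, rfl⟩ := h
  simp only [totProj, LinearMap.comp_apply, tcomp_tof]

lemma totProj_of_mem_ne {k l : ℤ} {x : Tot A} (h : x ∈ totDeg A k) (hkl : k ≠ l) :
    totProj A l x = 0 := by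
  obtain ⟨x, rfl⟩ := h
  simp only [totProj, LinearMap.comp_apply, tcomp_tof_ne hkl, map_zero]

lemma totSign_of_mem {k : ℤ} {x : Tot A} (h : x ∈ totDeg A k) :
    totSign A x = k.negOnePow • x := by
  obtain ⟨x, rfl⟩ := h; exact totSign_tof k x

lemma tcomp_totD (k : ℤ) (x : Tot A) :
    tcomp A (k + 1) (totD A x) = A.d k (k + 1) (tcomp A k x) := by
  induction x using tot_induction with
  | h0 => simp
  | h1 i a =>
    rw [totD_tof]
    by_cases h : i = k
    · subst h; simp only [tcomp_tof]
    · rw [tcomp_tof_ne h, tcomp_tof_ne (by omega), map_zero]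
  | h2 x y hx hy => simp only [map_add, hx, hy]

lemma totD_totProj (k : ℤ) (x : Tot A) : totD A (totProj A k x) = totProj A (k + 1) (totD A x) := by
  simp only [totProj, LinearMap.comp_apply, totD_tof, tcomp_totD]

lemma units_smul_map {M N : Type*} [AddCommGroup M] [AddCommGroup N] [Module R M] [Module R N]
    (f : M →ₗ[R] N) (c : ℤˣ) (x : M) : f (c • x) = c • f x := by
  rw [Units.smul_def, map_zsmul, ← Units.smul_def]

lemma units_smul_map₂ {M N P : Type*} [AddCommGroup M] [AddCommGroup N] [AddCommGroup P]
    [Module R M] [Module R N] [Module R P]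
    (f : M →ₗ[R] N →ₗ[R] P) (c : ℤˣ) (x : M) (y : N) : f (c • x) y = c • f x y :=
  units_smul_map (f.flip y) c x

lemma totSign_totSign (x : Tot A) : totSign A (totSign A x) = x := by
  induction x using tot_induction with
  | h0 => simp
  | h1 i a => rw [totSign_tof, units_smul_map, totSign_tof, smul_smul]; simp
  | h2 x y hx hy => simp only [map_add, hx, hy]

lemma totSign_totD (x : Tot A) : totSign A (totD A x) = -totD A (totSign A x) := by
  induction x using tot_induction with
  | h0 => simp
  | h1 i a =>
    rw [totD_tof, totSign_tof, totSign_tof, units_smul_map, totD_tof, Int.negOnePow_succ, Units.smul_def,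
      Units.smul_def, Units.val_neg, neg_smul]
  | h2 x y hx hy => simp only [map_add, hx, hy, neg_add]

lemma totD_totD (x : Tot A) : totD A (totD A x) = 0 := by
  induction x using tot_induction with
  | h0 => simp
  | h1 i a =>
    rw [totD_tof, totD_tof, ← ModuleCat.comp_apply, A.d_comp_d]; simp
  | h2 x y hx hy => simp only [map_add, hx, hy, add_zero]

end Tot

namespace DGCat

variable {R : Type u} [CommRing R] (C : DGCat.{u} R)

lemma compTot_tof {X Y Z : C.Obj} (i j k : ℤ) (h : i + j = k) (g : (C.Hom Y Z).X i)
    (f : (C.Hom X Y).X j) :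
    C.compTot X Y Z (tof _ i g) (tof _ j f) = tof _ k (C.comp i j k h g f) := by
  subst h
  rw [compTot, totLift_tof]; rfl

/-- The identity of `X` in the total module. -/
def idTot (X : C.Obj) : Tot (C.Hom X X) := tof _ 0 (C.id X)

lemma compTot_assoc {W X Y Z : C.Obj} (h : Tot (C.Hom Y Z)) (g : Tot (C.Hom X Y))
    (f : Tot (C.Hom W X)) :
    C.compTot W X Z (C.compTot X Y Z h g) f = C.compTot W Y Z h (C.compTot W X Y g f) := by
  induction h using tot_induction with
  | h0 => simp
  | h2 x y hx hy => simp only [map_add, LinearMap.add_apply, hx, hy]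
  | h1 i h =>
  induction g using tot_induction with
  | h0 => simp
  | h2 x y hx hy => simp only [map_add, LinearMap.add_apply, hx, hy]
  | h1 j g =>
  induction f using tot_induction with
  | h0 => simp
  | h2 x y hx hy => simp only [map_add, hx, hy]
  | h1 k f =>
    rw [C.compTot_tof i j _ rfl, C.compTot_tof j k _ rfl, C.compTot_tof (i + j) k _ rfl,
      C.compTot_tof i (j + k) (i + j + k) (by omega),
      C.assoc i j k (i + j) (j + k) (i + j + k) rfl rfl rfl (by omega)]

lemma idTot_comp {X Y : C.Obj} (f : Tot (C.Hom X Y)) : C.compTot X Y Y (C.idTot Y) f = f := by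
  induction f using tot_induction with
  | h0 => simp
  | h2 x y hx hy => simp only [map_add, hx, hy]
  | h1 k f => rw [idTot, C.compTot_tof 0 k k (by omega), C.id_comp]

lemma comp_idTot {X Y : C.Obj} (f : Tot (C.Hom X Y)) : C.compTot X X Y f (C.idTot X) = f := by
  induction f using tot_induction with
  | h0 => simp
  | h2 x y hx hy => simp only [map_add, LinearMap.add_apply, hx, hy]
  | h1 k f => rw [idTot, C.compTot_tof k 0 k (by omega), C.comp_id]

lemma totSign_compTot {X Y Z : C.Obj} (g : Tot (C.Hom Y Z)) (f : Tot (C.Hom X Y)) :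
    totSign _ (C.compTot X Y Z g f) = C.compTot X Y Z (totSign _ g) (totSign _ f) := by
  induction g using tot_induction with
  | h0 => simp
  | h2 x y hx hy => simp only [map_add, LinearMap.add_apply, hx, hy]
  | h1 i g =>
  induction f using tot_induction with
  | h0 => simp
  | h2 x y hx hy => simp only [map_add, hx, hy]
  | h1 j f =>
    rw [C.compTot_tof i j _ rfl, totSign_tof, totSign_tof, totSign_tof, units_smul_map,
      units_smul_map₂, C.compTot_tof i j _ rfl, smul_smul, Int.negOnePow_add, mul_comm]

lemma totD_compTot {X Y Z : C.Obj} (g : Tot (C.Hom Y Z)) (f : Tot (C.Hom X Y)) :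
    totD _ (C.compTot X Y Z g f) =
      C.compTot X Y Z (totD _ g) f + C.compTot X Y Z (totSign _ g) (totD _ f) := by
  induction g using tot_induction with
  | h0 => simp
  | h2 x y hx hy => simp only [map_add, LinearMap.add_apply, hx, hy]; abel
  | h1 i g =>
  induction f using tot_induction with
  | h0 => simp
  | h2 x y hx hy => simp only [map_add, hx, hy]; abel
  | h1 j f =>
    rw [C.compTot_tof i j _ rfl, totD_tof, totD_tof, totD_tof, totSign_tof, units_smul_map₂,
      C.compTot_tof (i + 1) j (i + j + 1) (by omega),
      C.compTot_tof i (j + 1) (i + j + 1) (by omega),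
      C.leibniz i j (i + 1) (j + 1) (i + j) (i + j + 1) rfl (by omega) (by omega) rfl rfl,
      map_add, units_smul_map]

/-- The signed category of total modules of a dg category. -/
def toS : SCat.{u} R where
  Obj := C.Obj
  Hom X Y := ModuleCat.of R (Tot (C.Hom X Y))
  mul {X Y Z} := C.compTot X Y Z
  one X := C.idTot X
  sgn {X Y} := totSign (C.Hom X Y)
  d {X Y} := totD (C.Hom X Y)
  deg {X Y} k := totDeg (C.Hom X Y) k
  mul_assoc h g f := C.compTot_assoc h g f
  one_mul f := C.idTot_comp f
  mul_one f := C.comp_idTot f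
  sgn_mul g f := C.totSign_compTot g f
  sgn_sgn f := totSign_totSign f
  sgn_d f := totSign_totD f
  d_d f := totD_totD f
  d_mul g f := C.totD_compTot g f
  d_one X := by
    change totD _ (C.idTot X) = 0
    rw [idTot, totD_tof]
    exact (congrArg _ (C.d_id X)).trans (map_zero _)
  deg_mul i j g f := by
    rintro ⟨g, rfl⟩ ⟨f, rfl⟩
    exact ⟨_, (C.compTot_tof i j _ rfl g f).symm⟩
  deg_one X := ⟨_, rfl⟩
  deg_d i f := by
    rintro ⟨f, rfl⟩
    exact ⟨_, (totD_tof i f).symm⟩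
  sgn_deg i f h := totSign_of_mem h

end DGCat

namespace SCat

variable {R : Type u} [CommRing R]

/-- Restriction of scalars along `R → K`. -/
def restr (R : Type u) [CommRing R] {K : Type u} [CommRing K] [Algebra R K] (B : SCat.{u} K) :
    SCat.{u} R where
  Obj := B.Obj
  Hom X Y := (ModuleCat.restrictScalars (algebraMap R K)).obj (B.Hom X Y)
  mul {X _ _} :=
    { toFun := fun g => ((ModuleCat.restrictScalars (algebraMap R K)).map
        (ModuleCat.ofHom (B.mul (X := X) g))).hom
      map_add' := fun g g' => LinearMap.ext fun f => LinearMap.congr_fun (B.mul.map_add g g') f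
      map_smul' := fun r g => LinearMap.ext fun f =>
        LinearMap.congr_fun (B.mul.map_smul (algebraMap R K r) g) f }
  one := B.one
  sgn := ((ModuleCat.restrictScalars (algebraMap R K)).map (ModuleCat.ofHom B.sgn)).hom
  d := ((ModuleCat.restrictScalars (algebraMap R K)).map (ModuleCat.ofHom B.d)).hom
  deg {X Y} k :=
    { carrier := {x | (show B.Hom X Y from x) ∈ B.deg k}
      add_mem' := fun ha hb => (B.deg k).add_mem ha hb
      zero_mem' := (B.deg k).zero_mem
      smul_mem' := fun r _ h => (B.deg k).smul_mem (algebraMap R K r) h }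
  mul_assoc := B.mul_assoc
  one_mul := B.one_mul
  mul_one := B.mul_one
  sgn_mul := B.sgn_mul
  sgn_sgn := B.sgn_sgn
  sgn_d := B.sgn_d
  d_d := B.d_d
  d_mul := B.d_mul
  d_one := B.d_one
  deg_mul := B.deg_mul
  deg_one := B.deg_one
  deg_d := B.deg_d
  sgn_deg := B.sgn_deg

end SCat

/-! ### Words and the signed bar differential -/

namespace DGCat

variable {R : Type u} [CommRing R] (H : DGCat.{u} R)

section Words

variable {M : Type u} [AddCommGroup M] [Module R M] {n : ℕ} {X Y Z : H.Obj}

/-- A letter as a word of length one. -/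
def single (X Y : H.Obj) : Tot (H.Hom X Y) →ₗ[R] H.Word 0 X Y := LinearMap.id

lemma single_surjective (w : H.Word 0 X Y) : ∃ a, H.single X Y a = w := ⟨w, rfl⟩

lemma word_zero_ext {f g : H.Word 0 X Y →ₗ[R] M}
    (h : ∀ a, f (H.single X Y a) = g (H.single X Y a)) : f = g :=
  LinearMap.ext h

lemma word_zero_tof_ext {f g : H.Word 0 X Y →ₗ[R] M}
    (h : ∀ i a, f (H.single X Y (tof _ i a)) = g (H.single X Y (tof _ i a))) : f = g :=
  tot_hom_ext h

lemma wordLift_cons (f : ∀ Z : H.Obj, Tot (H.Hom Z Y) →ₗ[R] H.Word n X Z →ₗ[R] M)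
    (a : Tot (H.Hom Z Y)) (w : H.Word n X Z) :
    H.wordLift n X Y f (H.cons n X Z Y a w) = f Z a w := by
  classical
  exact (DirectSum.toModule_lof (M := fun Z => Tot (H.Hom Z Y) ⊗[R] H.Word n X Z) R Z
    (a ⊗ₜ[R] w)).trans (TensorProduct.lift.tmul a w)

lemma word_induction {p : H.Word (n + 1) X Y → Prop} (w : H.Word (n + 1) X Y) (h0 : p 0)
    (h1 : ∀ Z a w, p (H.cons n X Z Y a w)) (h2 : ∀ x y, p x → p y → p (x + y)) : p w := by
  classical
  refine DirectSum.induction_on (motive := p) w h0 (fun Z t => ?_) h2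
  induction t using TensorProduct.induction_on with
  | zero => exact (map_zero (DirectSum.lof R H.Obj (fun Z => Tot (H.Hom Z Y) ⊗[R] H.Word n X Z) Z)) ▸ h0
  | tmul a w => exact h1 Z a w
  | add x y hx hy => rw [map_add]; exact h2 _ _ hx hy

lemma word_ext {f g : H.Word (n + 1) X Y →ₗ[R] M}
    (h : ∀ Z a w, f (H.cons n X Z Y a w) = g (H.cons n X Z Y a w)) : f = g := by
  ext w
  induction w using word_induction with
  | h0 => simp
  | h1 Z a w => exact h Z a w
  | h2 x y hx hy => simp only [map_add, hx, hy]

lemma word_tof_ext {f g : H.Word (n + 1) X Y →ₗ[R] M}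
    (h : ∀ Z i a w, f (H.cons n X Z Y (tof _ i a) w) = g (H.cons n X Z Y (tof _ i a) w)) :
    f = g := by
  refine H.word_ext fun Z a w => ?_
  induction a using tot_induction with
  | h0 => simp
  | h1 i a => exact h Z i a w
  | h2 x y hx hy => simp only [map_add, LinearMap.add_apply, hx, hy]

lemma mulFirst_single (h : Tot (H.Hom Z Y)) (a : Tot (H.Hom X Z)) :
    H.mulFirst 0 X Z Y h (H.single X Z a) = H.single X Y (H.compTot X Z Y h a) := rfl

lemma mulFirst_cons {V : H.Obj} (h : Tot (H.Hom Z Y)) (a : Tot (H.Hom V Z)) (w : H.Word n X V) :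
    H.mulFirst (n + 1) X Z Y h (H.cons n X V Z a w) =
      H.cons n X V Y (H.compTot V Z Y h a) w := by
  change H.wordLift n X Z (fun V => LinearMap.lflip.comp
    ((H.compTot V Z Y).compr₂ (H.cons n X V Y)).flip) (H.cons n X V Z a w) h = _
  rw [wordLift_cons]; rfl

lemma mulFirst_mulFirst {V : H.Obj} (h : Tot (H.Hom Z Y)) (a : Tot (H.Hom V Z))
    (w : H.Word n X V) :
    H.mulFirst n X Z Y h (H.mulFirst n X V Z a w) =
      H.mulFirst n X V Y (H.compTot V Z Y h a) w := by
  cases n with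
  | zero =>
    obtain ⟨b, rfl⟩ := H.single_surjective w
    simp only [mulFirst_single, compTot_assoc]
  | succ n =>
    induction w using word_induction with
    | h0 => simp
    | h1 U b w => simp only [mulFirst_cons, compTot_assoc]
    | h2 x y hx hy => simp only [map_add, hx, hy]

lemma mulFirst_idTot (w : H.Word n X Y) : H.mulFirst n X Y Y (H.idTot Y) w = w := by
  cases n with
  | zero =>
    obtain ⟨b, rfl⟩ := H.single_surjective w
    simp only [mulFirst_single, idTot_comp]
  | succ n =>
    induction w using word_induction with
    | h0 => simp
    | h1 U b w => simp only [mulFirst_cons, idTot_comp]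
    | h2 x y hx hy => simp only [map_add, hx, hy]

/-- The bar differential on suspended words, `b'(a ⊗ a' ⊗ w) = (σa ∘ a') ⊗ w - σa ⊗ b'(a' ⊗ w)`
with `σa = (-1)^|a| a`. -/
def bS : ∀ (n : ℕ) (X Y : H.Obj), H.Word (n + 1) X Y →ₗ[R] H.Word n X Y
  | 0, X, Y => H.wordLift 0 X Y fun Z => (H.mulFirst 0 X Z Y).comp (totSign _)
  | n + 1, X, Y => H.wordLift (n + 1) X Y fun Z =>
      (H.mulFirst (n + 1) X Z Y).comp (totSign _) -
        (H.cons n X Z Y).compl₁₂ (totSign _) (bS n X Z)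

lemma bS_zero (a : Tot (H.Hom Z Y)) (w : H.Word 0 X Z) :
    H.bS 0 X Y (H.cons 0 X Z Y a w) = H.mulFirst 0 X Z Y (totSign _ a) w := by
  rw [bS, wordLift_cons]; rfl

lemma bS_succ (a : Tot (H.Hom Z Y)) (w : H.Word (n + 1) X Z) :
    H.bS (n + 1) X Y (H.cons (n + 1) X Z Y a w) = H.mulFirst (n + 1) X Z Y (totSign _ a) w -
      H.cons n X Z Y (totSign _ a) (H.bS n X Z w) := by
  rw [bS, wordLift_cons]; rfl

lemma bar_zero (a : Tot (H.Hom Z Y)) (w : H.Word 0 X Z) :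
    H.bar 0 X Y (H.cons 0 X Z Y a w) = H.mulFirst 0 X Z Y a w := by
  have e : H.bar 0 X Y = H.wordLift 0 X Y (fun Z => H.mulFirst 0 X Z Y) := by
    rw [bar]; rfl
  exact (LinearMap.congr_fun e _).trans (H.wordLift_cons (fun Z => H.mulFirst 0 X Z Y) a w)

lemma bar_succ (a : Tot (H.Hom Z Y)) (w : H.Word (n + 1) X Z) :
    H.bar (n + 1) X Y (H.cons (n + 1) X Z Y a w) = H.mulFirst (n + 1) X Z Y a w -
      H.cons n X Z Y a (H.bar n X Z w) := by
  rw [bar, wordLift_cons]; rfl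

/-- Apply a family of linear maps to every letter of a word. -/
def wMap (s : ∀ X Y : H.Obj, Tot (H.Hom X Y) →ₗ[R] Tot (H.Hom X Y)) :
    ∀ (n : ℕ) (X Y : H.Obj), H.Word n X Y →ₗ[R] H.Word n X Y
  | 0, X, Y => (H.single X Y).comp (s X Y)
  | n + 1, X, Y => H.wordLift n X Y fun Z => (H.cons n X Z Y).compl₁₂ (s Z Y) (wMap s n X Z)

lemma wMap_single (s) (a : Tot (H.Hom X Y)) :
    H.wMap s 0 X Y (H.single X Y a) = H.single X Y (s X Y a) := rfl

lemma wMap_cons (s) (a : Tot (H.Hom Z Y)) (w : H.Word n X Z) :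
    H.wMap s (n + 1) X Y (H.cons n X Z Y a w) = H.cons n X Z Y (s Z Y a) (H.wMap s n X Z w) := by
  rw [wMap, wordLift_cons]; rfl

/-- The sign `(-1)^(|w| - n)` of a suspended word with `n` letters. -/
def wSgn (n : ℕ) (X Y : H.Obj) : H.Word n X Y →ₗ[R] H.Word n X Y :=
  H.wMap (fun _ _ => -totSign _) n X Y

lemma wSgn_single (a : Tot (H.Hom X Y)) :
    H.wSgn 0 X Y (H.single X Y a) = -H.single X Y (totSign _ a) := by
  rw [wSgn, wMap_single, LinearMap.neg_apply, map_neg]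

lemma wSgn_cons (a : Tot (H.Hom Z Y)) (w : H.Word n X Z) :
    H.wSgn (n + 1) X Y (H.cons n X Z Y a w) = -H.cons n X Z Y (totSign _ a) (H.wSgn n X Z w) := by
  rw [wSgn, wMap_cons]; simp only [LinearMap.neg_apply, map_neg]; rfl

lemma wSgn_wSgn (w : H.Word n X Y) : H.wSgn n X Y (H.wSgn n X Y w) = w := by
  induction n generalizing Y with
  | zero =>
    obtain ⟨b, rfl⟩ := H.single_surjective w
    simp only [wSgn_single, map_neg, totSign_totSign, neg_neg]
  | succ n ih =>
    induction w using word_induction with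
    | h0 => simp
    | h1 U b w => simp only [wSgn_cons, map_neg, totSign_totSign, neg_neg, ih]
    | h2 x y hx hy => simp only [map_add, hx, hy]

instance word_projective [h : ∀ X Y i, Module.Projective R ((H.Hom X Y).X i)] (n : ℕ)
    (X Y : H.Obj) : Module.Projective R (H.Word n X Y) := by
  classical
  induction n generalizing Y with
  | zero =>
    change Module.Projective R (⨁ i, (H.Hom X Y).X i)
    infer_instance
  | succ n ih =>
    change Module.Projective R (⨁ Z : H.Obj, Tot (H.Hom Z Y) ⊗[R] H.Word n X Z)
    have : ∀ Z, Module.Projective R (Tot (H.Hom Z Y)) := fun Z => by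
      change Module.Projective R (⨁ i, (H.Hom Z Y).X i)
      infer_instance
    infer_instance

end Words

end DGCat

/-! ### Cochains on words -/

section Cochains

variable {R : Type u} [CommRing R] (H : DGCat.{u} R) (B : SCat.{u} R) (e : H.Obj → B.Obj)

/-- Cochains on the words that end in `Z`, with values in the morphisms of `B` to `Y`. The value
`φ n` is the component on words with `n + 1` letters. -/
abbrev LC (Z : H.Obj) (Y : B.Obj) : Type u :=
  ∀ (n : ℕ) (V : H.Obj), H.Word n V Z →ₗ[R] B.Hom (e V) Y

/-- Cochains on words in `H` with values in `B`. -/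
abbrev AA : Type u := ∀ Y : H.Obj, LC H B e Y (e Y)

variable {H B e} {U V Z : H.Obj} {Y Y' : B.Obj} {n : ℕ}

namespace LC

@[ext]
lemma ext' {φ ψ : LC H B e Z Y} (h0 : ∀ V a, φ 0 V (H.single V Z a) = ψ 0 V (H.single V Z a))
    (h1 : ∀ n V U a w, φ (n + 1) V (H.cons n V U Z a w) = ψ (n + 1) V (H.cons n V U Z a w)) :
    φ = ψ := by
  funext n V
  cases n with
  | zero => exact H.word_zero_ext (h0 V)
  | succ n => exact H.word_ext (h1 n V)

/-- Prepend a letter to the argument of a cochain. -/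
def sh : Tot (H.Hom U Z) →ₗ[R] LC H B e Z Y →ₗ[R] LC H B e U Y :=
  LinearMap.mk₂ R (fun a φ n V => (φ (n + 1) V).comp (H.cons n V U Z a))
    (fun a a' φ => by funext n V; ext w; simp)
    (fun r a φ => by funext n V; ext w; simp)
    (fun a φ φ' => by funext n V; ext w; simp)
    (fun r a φ => by funext n V; ext w; simp)

lemma sh_apply (a : Tot (H.Hom U Z)) (φ : LC H B e Z Y) (w : H.Word n V U) :
    sh a φ n V w = φ (n + 1) V (H.cons n V U Z a w) := rfl

/-- Multiply the first letter of the argument of a cochain. -/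
def ract : Tot (H.Hom U Z) →ₗ[R] LC H B e Z Y →ₗ[R] LC H B e U Y :=
  LinearMap.mk₂ R (fun a φ n V => (φ n V).comp (H.mulFirst n V U Z a))
    (fun a a' φ => by funext n V; ext w; simp)
    (fun r a φ => by funext n V; ext w; simp)
    (fun a φ φ' => by funext n V; ext w; simp)
    (fun r a φ => by funext n V; ext w; simp)

lemma ract_apply (a : Tot (H.Hom U Z)) (φ : LC H B e Z Y) (w : H.Word n V U) :
    ract a φ n V w = φ n V (H.mulFirst n V U Z a w) := rfl

/-- Multiply the value of a cochain from the left. -/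
def lact : B.Hom Y Y' →ₗ[R] LC H B e Z Y →ₗ[R] LC H B e Z Y' :=
  LinearMap.mk₂ R (fun c φ n V => (B.mul c).comp (φ n V))
    (fun a a' φ => by funext n V; ext w; simp)
    (fun r a φ => by funext n V; ext w; simp)
    (fun a φ φ' => by funext n V; ext w; simp)
    (fun r a φ => by funext n V; ext w; simp)

lemma lact_apply (c : B.Hom Y Y') (φ : LC H B e Z Y) (w : H.Word n V Z) :
    lact c φ n V w = B.mul c (φ n V w) := rfl

/-- Postcomposition with the sign involution. -/
def sg : LC H B e Z Y →ₗ[R] LC H B e Z Y where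
  toFun φ n V := B.sgn.comp (φ n V)
  map_add' φ ψ := by funext n V; ext w; simp
  map_smul' r φ := by funext n V; ext w; simp

lemma sg_apply (φ : LC H B e Z Y) (w : H.Word n V Z) : sg φ n V w = B.sgn (φ n V w) := rfl

/-- Postcomposition with the differential. -/
def dd : LC H B e Z Y →ₗ[R] LC H B e Z Y where
  toFun φ n V := B.d.comp (φ n V)
  map_add' φ ψ := by funext n V; ext w; simp
  map_smul' r φ := by funext n V; ext w; simp

lemma dd_apply (φ : LC H B e Z Y) (w : H.Word n V Z) : dd φ n V w = B.d (φ n V w) := rfl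

/-- Precomposition with the sign involution of suspended words. -/
def tw : LC H B e Z Y →ₗ[R] LC H B e Z Y where
  toFun φ n V := (φ n V).comp (H.wSgn n V Z)
  map_add' φ ψ := by funext n V; ext w; simp
  map_smul' r φ := by funext n V; ext w; simp

lemma tw_apply (φ : LC H B e Z Y) (w : H.Word n V Z) : tw φ n V w = φ n V (H.wSgn n V Z w) := rfl

/-- Precomposition with the bar differential. -/
def pb : LC H B e Z Y →ₗ[R] LC H B e Z Y where
  toFun φ n V := match n with
    | 0 => 0
    | n + 1 => (φ n V).comp (H.bS n V Z)
  map_add' φ ψ := by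
    funext n V
    cases n with
    | zero => exact (add_zero (0 : H.Word 0 V Z →ₗ[R] B.Hom (e V) Y)).symm
    | succ n => exact LinearMap.add_comp _ _ _
  map_smul' r φ := by
    funext n V
    cases n with
    | zero => exact (smul_zero (A := H.Word 0 V Z →ₗ[R] B.Hom (e V) Y) r).symm
    | succ n => exact LinearMap.smul_comp _ _ _

lemma pb_zero (φ : LC H B e Z Y) (w : H.Word 0 V Z) : pb φ 0 V w = 0 := rfl

lemma pb_succ (φ : LC H B e Z Y) (w : H.Word (n + 1) V Z) :
    pb φ (n + 1) V w = φ n V (H.bS n V Z w) := rfl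

lemma sh_pb (a : Tot (H.Hom U Z)) (φ : LC H B e Z Y) :
    sh a (pb φ) = ract (totSign _ a) φ - pb (sh (totSign _ a) φ) := by
  funext n V
  ext w
  simp only [Pi.sub_apply, LinearMap.sub_apply, sh_apply, pb_succ, ract_apply]
  cases n with
  | zero => rw [H.bS_zero, pb_zero, sub_zero]
  | succ n => rw [H.bS_succ, map_sub, pb_succ, sh_apply]

lemma sh_ract {W : H.Obj} (a : Tot (H.Hom U Z)) (b : Tot (H.Hom W U)) (φ : LC H B e Z Y) :
    sh b (ract a φ) = sh (H.compTot W U Z a b) φ := by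
  funext n V
  ext w
  simp only [sh_apply, ract_apply, H.mulFirst_cons]

lemma sh_lact (a : Tot (H.Hom U Z)) (c : B.Hom Y Y') (φ : LC H B e Z Y) :
    sh a (lact c φ) = lact c (sh a φ) := rfl

lemma sh_sg (a : Tot (H.Hom U Z)) (φ : LC H B e Z Y) : sh a (sg φ) = sg (sh a φ) := rfl

lemma sh_dd (a : Tot (H.Hom U Z)) (φ : LC H B e Z Y) : sh a (dd φ) = dd (sh a φ) := rfl

lemma sh_tw (a : Tot (H.Hom U Z)) (φ : LC H B e Z Y) :
    sh a (tw φ) = -tw (sh (totSign _ a) φ) := by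
  funext n V
  ext w
  simp only [sh_apply, tw_apply, H.wSgn_cons, map_neg, Pi.neg_apply, LinearMap.neg_apply]

lemma sg_sg (φ : LC H B e Z Y) : sg (sg φ) = φ := by
  funext n V; ext w; simp only [sg_apply, B.sgn_sgn]

lemma tw_tw (φ : LC H B e Z Y) : tw (tw φ) = φ := by
  funext n V; ext w; simp only [tw_apply, H.wSgn_wSgn]

lemma sg_dd (φ : LC H B e Z Y) : sg (dd φ) = -dd (sg φ) := by
  funext n V; ext w
  simp only [sg_apply, dd_apply, B.sgn_d, Pi.neg_apply, LinearMap.neg_apply]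

lemma dd_dd (φ : LC H B e Z Y) : dd (dd φ) = 0 := by
  funext n V; ext w; simp only [dd_apply, B.d_d]; rfl

lemma dd_pb (φ : LC H B e Z Y) : dd (pb φ) = pb (dd φ) := by
  funext n V; ext w
  cases n with
  | zero => simp only [dd_apply, pb_zero, map_zero]
  | succ n => rfl

lemma sg_pb (φ : LC H B e Z Y) : sg (pb φ) = pb (sg φ) := by
  funext n V; ext w
  cases n with
  | zero => simp only [sg_apply, pb_zero, map_zero]
  | succ n => rfl

lemma dd_lact (c : B.Hom Y Y') (φ : LC H B e Z Y) :
    dd (lact c φ) = lact (B.d c) φ + lact (B.sgn c) (dd φ) := by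
  funext n V; ext w
  simp only [dd_apply, lact_apply, B.d_mul, Pi.add_apply, LinearMap.add_apply]

lemma sg_lact (c : B.Hom Y Y') (φ : LC H B e Z Y) :
    sg (lact c φ) = lact (B.sgn c) (sg φ) := by
  funext n V; ext w
  simp only [sg_apply, lact_apply, B.sgn_mul]

lemma pb_lact (c : B.Hom Y Y') (φ : LC H B e Z Y) : pb (lact c φ) = lact c (pb φ) := by
  funext n V; ext w
  cases n with
  | zero => simp only [lact_apply, pb_zero, map_zero]
  | succ n => rfl

lemma tw_lact (c : B.Hom Y Y') (φ : LC H B e Z Y) : tw (lact c φ) = lact c (tw φ) := rfl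

lemma sg_tw (φ : LC H B e Z Y) : sg (tw φ) = tw (sg φ) := rfl

lemma dd_tw (φ : LC H B e Z Y) : dd (tw φ) = tw (dd φ) := rfl

lemma lact_lact {Y'' : B.Obj} (c : B.Hom Y' Y'') (c' : B.Hom Y Y') (φ : LC H B e Z Y) :
    lact c (lact c' φ) = lact (B.mul c c') φ := by
  funext n V; ext w; simp only [lact_apply, B.mul_assoc]

lemma lact_one (φ : LC H B e Z Y) : lact (B.one Y) φ = φ := by
  funext n V; ext w; simp only [lact_apply, B.one_mul]

lemma ract_ract {W : H.Obj} (a : Tot (H.Hom U Z)) (b : Tot (H.Hom W U)) (φ : LC H B e Z Y) :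
    ract b (ract a φ) = ract (H.compTot W U Z a b) φ := by
  funext n V; ext w; simp only [ract_apply, H.mulFirst_mulFirst]

lemma ract_one (φ : LC H B e Z Y) : ract (H.idTot Z) φ = φ := by
  funext n V; ext w; simp only [ract_apply, H.mulFirst_idTot]

lemma ract_lact (a : Tot (H.Hom U Z)) (c : B.Hom Y Y') (φ : LC H B e Z Y) :
    ract a (lact c φ) = lact c (ract a φ) := rfl

lemma ract_sg (a : Tot (H.Hom U Z)) (φ : LC H B e Z Y) : ract a (sg φ) = sg (ract a φ) := rfl

lemma ract_dd (a : Tot (H.Hom U Z)) (φ : LC H B e Z Y) : ract a (dd φ) = dd (ract a φ) := rfl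

lemma tw_ract (a : Tot (H.Hom U Z)) (φ : LC H B e Z Y) :
    tw (ract a φ) = ract (totSign _ a) (tw φ) := by
  ext V b
  · simp only [tw_apply, ract_apply, H.wSgn_single, map_neg, H.mulFirst_single,
      H.totSign_compTot, totSign_totSign]
  · simp only [tw_apply, ract_apply, H.wSgn_cons, map_neg, H.mulFirst_cons,
      H.totSign_compTot, totSign_totSign]

/-- The recursion step for the components of the cup product. -/
def cupStep (n : ℕ) (Z : H.Obj) (Y : B.Obj) (V : H.Obj)
    (I : ∀ U : H.Obj, LC H B e U Y →ₗ[R] AA H B e →ₗ[R] H.Word n V U →ₗ[R] B.Hom (e V) Y) :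
    LC H B e Z Y →ₗ[R] AA H B e →ₗ[R] H.Word (n + 1) V Z →ₗ[R] B.Hom (e V) Y :=
  LinearMap.mk₂ R (fun φ g => H.wordLift n V Z fun U =>
        (B.mul.comp ((φ 0 U).comp (H.single U Z))).compl₂ (g U n V) +
          ((I U).flip g).comp (sh.flip φ))
      (fun φ φ' g => H.word_ext fun U a w => by
        simp only [H.wordLift_cons, LinearMap.add_apply, LinearMap.compl₂_apply,
          LinearMap.comp_apply, map_add, LinearMap.flip_apply, Pi.add_apply]
        abel)
      (fun r φ g => H.word_ext fun U a w => by
        simp only [H.wordLift_cons, LinearMap.add_apply, LinearMap.compl₂_apply,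
          LinearMap.comp_apply, map_smul, LinearMap.flip_apply, Pi.smul_apply,
          LinearMap.smul_apply, smul_add])
      (fun φ g g' => H.word_ext fun U a w => by
        simp only [H.wordLift_cons, LinearMap.add_apply, LinearMap.compl₂_apply,
          LinearMap.comp_apply, map_add, LinearMap.flip_apply, Pi.add_apply]
        abel)
      (fun r φ g => H.word_ext fun U a w => by
        simp only [H.wordLift_cons, LinearMap.add_apply, LinearMap.compl₂_apply,
          LinearMap.comp_apply, map_smul, LinearMap.flip_apply, Pi.smul_apply,
          LinearMap.smul_apply, smul_add])

lemma cupStep_cons (n : ℕ) (Z : H.Obj) (Y : B.Obj) (V : H.Obj)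
    (I : ∀ U : H.Obj, LC H B e U Y →ₗ[R] AA H B e →ₗ[R] H.Word n V U →ₗ[R] B.Hom (e V) Y)
    (φ : LC H B e Z Y) (g : AA H B e) (a : Tot (H.Hom U Z)) (w : H.Word n V U) :
    cupStep n Z Y V I φ g (H.cons n V U Z a w) =
      B.mul (φ 0 U (H.single U Z a)) (g U n V w) + I U (sh a φ) g w := by
  rw [cupStep, LinearMap.mk₂_apply, H.wordLift_cons]
  rfl

/-- The components of the cup product of a cochain `φ` on words ending in `Z` with a cochain `g`:
the sum of `φ(w₁) ∘ g(w₂)` over the splittings of a word into two nonempty words `w₁`, `w₂`. No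
signs are inserted. -/
def cupN : ∀ (n : ℕ) (Z : H.Obj) (Y : B.Obj) (V : H.Obj),
    LC H B e Z Y →ₗ[R] AA H B e →ₗ[R] H.Word n V Z →ₗ[R] B.Hom (e V) Y
  | 0, _, _, _ => 0
  | n + 1, Z, Y, V => cupStep n Z Y V fun U => cupN n U Y V

/-- The cup product, without signs. -/
def cup : LC H B e Z Y →ₗ[R] AA H B e →ₗ[R] LC H B e Z Y :=
  LinearMap.mk₂ R (fun φ g n V => cupN n Z Y V φ g)
    (fun φ φ' g => by funext n V; simp)
    (fun r φ g => by funext n V; simp)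
    (fun φ g g' => by funext n V; simp)
    (fun r φ g => by funext n V; simp)

lemma cup_zero (φ : LC H B e Z Y) (g : AA H B e) : cup φ g 0 V = 0 := rfl

lemma sh_cup (a : Tot (H.Hom U Z)) (φ : LC H B e Z Y) (g : AA H B e) :
    sh a (cup φ g) = lact (φ 0 U (H.single U Z a)) (g U) + cup (sh a φ) g := by
  funext n V
  ext w
  rw [sh_apply]
  exact cupStep_cons n Z Y V (fun U => cupN n U Y V) φ g a w

lemma cup_cons (φ : LC H B e Z Y) (g : AA H B e) (a : Tot (H.Hom U Z)) (w : H.Word n V U) :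
    cup φ g (n + 1) V (H.cons n V U Z a w) =
      B.mul (φ 0 U (H.single U Z a)) (g U n V w) + cup (sh a φ) g n V w := by
  rw [← sh_apply, sh_cup]; rfl

lemma lact_cup (c : B.Hom Y Y') (φ : LC H B e Z Y) (g : AA H B e) :
    lact c (cup φ g) = cup (lact c φ) g := by
  funext n V
  induction n generalizing Z with
  | zero => ext w; simp only [lact_apply, cup_zero, LinearMap.zero_apply, map_zero]
  | succ n ih =>
    refine H.word_ext fun U a w => ?_
    rw [lact_apply, cup_cons, cup_cons, map_add, lact_apply, B.mul_assoc, ← lact_apply, sh_lact]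
    exact congrArg _ (LinearMap.congr_fun (ih _) w)

lemma ract_cup (a : Tot (H.Hom U Z)) (φ : LC H B e Z Y) (g : AA H B e) :
    ract a (cup φ g) = cup (ract a φ) g := by
  ext V b
  · simp only [ract_apply, H.mulFirst_single, cup_zero, LinearMap.zero_apply]
  · rw [ract_apply, H.mulFirst_cons, cup_cons, cup_cons, sh_ract, ract_apply, H.mulFirst_single]

lemma cup_assoc (φ : LC H B e Z Y) (g k : AA H B e) :
    cup (cup φ g) k = cup φ (fun X => cup (g X) k) := by
  funext n V
  induction n generalizing Z with
  | zero => rfl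
  | succ n ih =>
    refine H.word_ext fun U a w => ?_
    rw [cup_cons, cup_cons, cup_zero, LinearMap.zero_apply, map_zero, LinearMap.zero_apply,
      zero_add, sh_cup, map_add, LinearMap.add_apply, ← lact_cup]
    exact congrArg (_ + ·) (LinearMap.congr_fun (ih _) w)

lemma dd_cup (φ : LC H B e Z Y) (g : AA H B e) :
    dd (cup φ g) = cup (dd φ) g + cup (sg φ) (fun X => dd (g X)) := by
  funext n V
  induction n generalizing Z with
  | zero => ext w; simp [dd_apply, cup_zero]
  | succ n ih =>
    refine H.word_ext fun U a w => ?_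
    have := LinearMap.congr_fun (ih (sh a φ)) w
    simp only [Pi.add_apply, LinearMap.add_apply, dd_apply] at this ⊢
    simp only [cup_cons, map_add, this, B.d_mul, sh_dd, sh_sg, dd_apply, sg_apply]
    abel

lemma sg_cup (φ : LC H B e Z Y) (g : AA H B e) :
    sg (cup φ g) = cup (sg φ) (fun X => sg (g X)) := by
  funext n V
  induction n generalizing Z with
  | zero => ext w; simp [sg_apply, cup_zero]
  | succ n ih =>
    refine H.word_ext fun U a w => ?_
    have := LinearMap.congr_fun (ih (sh a φ)) w
    simp only [sg_apply] at this ⊢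
    simp only [cup_cons, map_add, this, B.sgn_mul, sh_sg, sg_apply]

/-- The bar differential is a coderivation for splitting words. -/
lemma pb_cup (φ : LC H B e Z Y) (g : AA H B e) :
    pb (cup φ g) = cup (pb φ) g + cup (tw φ) (fun X => pb (g X)) := by
  funext n V
  induction n generalizing Z with
  | zero => exact (add_zero (0 : H.Word 0 V Z →ₗ[R] B.Hom (e V) Y)).symm
  | succ n ih =>
    refine H.word_ext fun U a w => ?_
    have := LinearMap.congr_fun (ih (sh (totSign _ a) φ)) w
    rw [← sh_apply, ← sh_apply, sh_pb, map_add, sh_cup, sh_cup, sh_cup, ract_cup, sh_pb, sh_tw,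
      tw_apply, H.wSgn_single, pb_zero, map_add, pb_lact]
    simp only [Pi.add_apply, Pi.sub_apply, LinearMap.add_apply, LinearMap.sub_apply, map_neg,
      map_sub, Pi.neg_apply, LinearMap.neg_apply, map_zero, Pi.zero_apply, LinearMap.zero_apply]
      at this ⊢
    rw [this]
    abel

/-! ### Locality of the operations in the word length -/

/-- A cochain that vanishes on words with fewer than `q + 1` letters. -/
def Van (q : ℕ) (φ : LC H B e Z Y) : Prop := ∀ n < q, ∀ V, φ n V = 0

lemma Van.sh {q : ℕ} {φ : LC H B e Z Y} (h : Van (q + 1) φ) (a : Tot (H.Hom U Z)) :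
    Van q (sh a φ) := fun n hn V => by
  ext w; rw [sh_apply, h (n + 1) (by omega)]; rfl

lemma Van.cup_left {q : ℕ} {φ : LC H B e Z Y} (h : Van q φ) (g : AA H B e) :
    Van (q + 1) (cup φ g) := by
  intro n hn V
  induction n generalizing Z q with
  | zero => rfl
  | succ n ih =>
    refine H.word_ext fun U a w => ?_
    obtain ⟨q, rfl⟩ : ∃ q', q = q' + 1 := ⟨q - 1, by omega⟩
    rw [cup_cons, h 0 (by omega), ih (h.sh a) (by omega)]
    simp

lemma Van.cup_right {q : ℕ} (φ : LC H B e Z Y) {g : AA H B e} (h : ∀ X, Van q (g X)) :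
    Van (q + 1) (cup φ g) := by
  intro n hn V
  induction n generalizing Z with
  | zero => rfl
  | succ n ih =>
    refine H.word_ext fun U a w => ?_
    rw [cup_cons, h U n (by omega), ih _ (by omega)]
    simp

lemma Van.pb {q : ℕ} {φ : LC H B e Z Y} (h : Van q φ) : Van (q + 1) (pb φ) := by
  intro n hn V
  cases n with
  | zero => rfl
  | succ n => ext w; rw [pb_succ, h n (by omega)]; rfl

lemma Van.sg {q : ℕ} {φ : LC H B e Z Y} (h : Van q φ) : Van q (sg φ) := fun n hn V => by
  ext w; rw [sg_apply, h n hn, LinearMap.zero_apply, map_zero]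

lemma Van.dd {q : ℕ} {φ : LC H B e Z Y} (h : Van q φ) : Van q (dd φ) := fun n hn V => by
  ext w; rw [dd_apply, h n hn, LinearMap.zero_apply, map_zero]

end LC

end Cochains

section Homogeneous

variable {R : Type u} [CommRing R] {H : DGCat.{u} R} {B : SCat.{u} R} {e : H.Obj → B.Obj}
  {M : Type u} [AddCommGroup M] [Module R M] {n : ℕ}

/-! ### Homogeneous cochains -/

/-- A linear map on words is homogeneous of degree `k` when it raises the sum of the degrees of
the letters by `k`. -/
def Homog (D : ℤ → Submodule R M) : ∀ (n : ℕ) {X Y : H.Obj} (_ : ℤ)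
    (_ : H.Word n X Y →ₗ[R] M), Prop
  | 0, X, Y, k, φ => ∀ i a, φ (H.single X Y (tof _ i a)) ∈ D (k + i)
  | n + 1, X, Y, k, φ => ∀ Z i a, Homog D n (k + i) (φ.comp (H.cons n X Z Y (tof _ i a)))

namespace Homog

variable {D : ℤ → Submodule R M} {X Y : H.Obj} {k : ℤ} {φ ψ : H.Word n X Y →ₗ[R] M}

lemma of_eq {k' : ℤ} (h : Homog D n k φ) (e : k = k') : Homog D n k' φ := e ▸ h

lemma zero (k : ℤ) : Homog D n k (0 : H.Word n X Y →ₗ[R] M) := by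
  induction n generalizing Y k with
  | zero => exact fun i a => (D _).zero_mem
  | succ n ih => exact fun Z i a => ih _

lemma add (hφ : Homog D n k φ) (hψ : Homog D n k ψ) : Homog D n k (φ + ψ) := by
  induction n generalizing Y k with
  | zero => exact fun i a => (D _).add_mem (hφ i a) (hψ i a)
  | succ n ih => exact fun Z i a => ih (hφ Z i a) (hψ Z i a)

lemma map {N : Type u} [AddCommGroup N] [Module R N] {D' : ℤ → Submodule R N} (c : M →ₗ[R] N)
    {j : ℤ} (hc : ∀ i, ∀ x ∈ D i, c x ∈ D' (j + i)) (h : Homog D n k φ) :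
    Homog D' n (j + k) (c.comp φ) := by
  induction n generalizing Y k with
  | zero => exact fun i a => by simpa [add_assoc] using hc _ _ (h i a)
  | succ n ih => exact fun Z i a => (ih (h Z i a)).of_eq (by omega)

lemma map₀ {N : Type u} [AddCommGroup N] [Module R N] {D' : ℤ → Submodule R N} (c : M →ₗ[R] N)
    (hc : ∀ i, ∀ x ∈ D i, c x ∈ D' i) (h : Homog D n k φ) : Homog D' n k (c.comp φ) :=
  (h.map (j := 0) c (by simpa using hc)).of_eq (zero_add _)

lemma smul (r : R) (h : Homog D n k φ) : Homog D n k (r • φ) :=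
  h.map₀ (LinearMap.lsmul R M r) fun _ _ hx => (D _).smul_mem r hx

lemma neg (h : Homog D n k φ) : Homog D n k (-φ) := by simpa using h.smul (-1)

lemma sub (hφ : Homog D n k φ) (hψ : Homog D n k ψ) : Homog D n k (φ - ψ) := by
  rw [sub_eq_add_neg]; exact hφ.add hψ.neg

end Homog

namespace LC

variable {U V Z : H.Obj} {Y Y' : B.Obj} {k : ℤ} {φ ψ : LC H B e Z Y}

/-- A cochain is homogeneous of degree `k` when its component on words with `n + 1` letters is
homogeneous of degree `k - n`. -/
def IsHomog (k : ℤ) (φ : LC H B e Z Y) : Prop :=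
  ∀ n V, Homog (B.deg (X := e V) (Y := Y)) n (k - n) (φ n V)

lemma IsHomog.of_eq {k' : ℤ} (h : IsHomog k φ) (e : k = k') : IsHomog k' φ := e ▸ h

lemma isHomog_iff : IsHomog k φ ↔
    (∀ V i a, φ 0 V (H.single V Z (tof _ i a)) ∈ B.deg (X := e V) (Y := Y) (k + i)) ∧
      ∀ U i a, IsHomog (k + i - 1) (sh (tof (H.Hom U Z) i a) φ) := by
  constructor
  · intro h
    exact ⟨fun V i a => by simpa using h 0 V i a, fun U i a n V =>
      Homog.of_eq (h (n + 1) V U i a) (by push_cast; omega)⟩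
  · rintro ⟨h0, h1⟩ n V
    cases n with
    | zero => exact fun i a => by simpa using h0 V i a
    | succ n => exact fun U i a => Homog.of_eq (h1 U i a n V) (by push_cast; omega)

namespace IsHomog

lemma zero (k : ℤ) : IsHomog k (0 : LC H B e Z Y) := fun _ _ => Homog.zero _

lemma add (hφ : IsHomog k φ) (hψ : IsHomog k ψ) : IsHomog k (φ + ψ) := fun n V =>
  (hφ n V).add (hψ n V)

lemma sub (hφ : IsHomog k φ) (hψ : IsHomog k ψ) : IsHomog k (φ - ψ) := fun n V =>
  (hφ n V).sub (hψ n V)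

lemma smul (r : R) (hφ : IsHomog k φ) : IsHomog k (r • φ) := fun n V => (hφ n V).smul r

lemma neg (hφ : IsHomog k φ) : IsHomog k (-φ) := fun n V => (hφ n V).neg

lemma units_smul (r : ℤˣ) (hφ : IsHomog k φ) : IsHomog k (r • φ) := by
  rcases Int.units_eq_one_or r with rfl | rfl
  · simpa using hφ
  · rw [Units.smul_def, Units.val_neg, neg_smul, Units.val_one, one_smul]; exact hφ.neg

lemma sh (hφ : IsHomog k φ) (i : ℤ) (a : (H.Hom U Z).X i) :
    IsHomog (k + i - 1) (LC.sh (tof _ i a) φ) := (isHomog_iff.1 hφ).2 U i a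

lemma sh_sign (hφ : IsHomog k φ) (i : ℤ) (a : (H.Hom U Z).X i) :
    IsHomog (k + i - 1) (LC.sh (totSign _ (tof _ i a)) φ) := by
  rw [totSign_tof, units_smul_map₂]; exact (hφ.sh i a).units_smul _

lemma apply (hφ : IsHomog k φ) (i : ℤ) (a : (H.Hom V Z).X i) :
    φ 0 V (H.single V Z (tof _ i a)) ∈ B.deg (X := e V) (Y := Y) (k + i) :=
  (isHomog_iff.1 hφ).1 V i a

lemma lact (hφ : IsHomog k φ) {j : ℤ} {c : B.Hom Y Y'} (hc : c ∈ B.deg (X := Y) j) :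
    IsHomog (j + k) (LC.lact c φ) := fun n V =>
  ((hφ n V).map (D' := B.deg (X := e V)) (B.mul c) fun i x hx => B.deg_mul j i c x hc hx).of_eq
    (by omega)

lemma dd (hφ : IsHomog k φ) : IsHomog (k + 1) (LC.dd φ) := fun n V =>
  ((hφ n V).map (D' := B.deg (X := e V)) (j := 1) B.d
    fun i x hx => by rw [add_comm]; exact B.deg_d i x hx).of_eq (by omega)

lemma sg (hφ : IsHomog k φ) : IsHomog k (LC.sg φ) := fun n V =>
  (hφ n V).map₀ (D' := B.deg (X := e V)) B.sgn fun i x hx => by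
    rw [B.sgn_deg i x hx]
    exact ((B.deg (X := e V) i).toAddSubgroup.zsmul_mem hx _)

lemma ract (hφ : IsHomog k φ) (i : ℤ) (a : (H.Hom U Z).X i) :
    IsHomog (k + i) (LC.ract (tof _ i a) φ) := by
  refine isHomog_iff.2 ⟨fun V j b => ?_, fun V j b => ?_⟩
  · rw [ract_apply, H.mulFirst_single, H.compTot_tof i j _ rfl, add_assoc]
    exact hφ.apply _ _
  · rw [sh_ract, H.compTot_tof i j _ rfl]
    exact (hφ.sh _ _).of_eq (by omega)

lemma ract_sign (hφ : IsHomog k φ) (i : ℤ) (a : (H.Hom U Z).X i) :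
    IsHomog (k + i) (LC.ract (totSign _ (tof _ i a)) φ) := by
  rw [totSign_tof, units_smul_map₂]; exact (hφ.ract i a).units_smul _

lemma cup {l : ℤ} (hφ : IsHomog k φ) {g : AA H B e} (hg : ∀ X, IsHomog l (g X)) :
    IsHomog (k + l + 1) (LC.cup φ g) := by
  intro n V
  induction n generalizing Z k with
  | zero => exact Homog.zero _
  | succ n ih =>
    intro U i a
    have h1 := ((hg U).lact (hφ.apply i a) n V).add
      ((ih (hφ.sh i a)).of_eq (show _ = k + i + l - n by omega))
    refine Homog.of_eq (?_ : Homog _ n _ (LC.sh (tof _ i a) (LC.cup φ g) n V))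
      (show (k + i + l - n : ℤ) = _ by push_cast; omega)
    rw [sh_cup]; exact h1

lemma pb (hφ : IsHomog k φ) : IsHomog (k + 1) (LC.pb φ) := by
  intro n V
  induction n generalizing Z k with
  | zero => exact Homog.zero _
  | succ n ih =>
    intro U i a
    have h1 := (hφ.ract_sign i a n V).sub
      ((ih (hφ.sh_sign i a)).of_eq (show _ = k + i - n by omega))
    refine Homog.of_eq (?_ : Homog _ n _ (LC.sh (tof _ i a) (LC.pb φ) n V))
      (show (k + i - n : ℤ) = _ by push_cast; omega)
    rw [sh_pb]; exact h1

lemma sg_eq (hφ : IsHomog k φ) : LC.sg φ = (k + 1).negOnePow • tw φ := by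
  funext n V
  induction n generalizing Z k with
  | zero =>
    refine H.word_zero_tof_ext fun i a => ?_
    change B.sgn _ = (k + 1).negOnePow • φ 0 V (H.wSgn 0 V Z _)
    rw [B.sgn_deg _ _ (hφ.apply i a), H.wSgn_single, totSign_tof, units_smul_map, map_neg,
      units_smul_map, ← Units.neg_smul, smul_smul, Int.negOnePow_add, Int.negOnePow_add]
    simp
  | succ n ih =>
    refine H.word_tof_ext fun U i a w => ?_
    rw [← sh_apply, sh_sg, ih (hφ.sh i a)]
    change _ = (k + 1).negOnePow • LC.sh (tof _ i a) (tw φ) n V w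
    rw [sh_tw, totSign_tof, units_smul_map₂, units_smul_map]
    change _ = (k + 1).negOnePow • -(i.negOnePow • tw (LC.sh (tof _ i a) φ) n V w)
    rw [← Units.neg_smul, smul_smul, sub_add_cancel, Int.negOnePow_add, Int.negOnePow_add]
    simp only [Int.negOnePow_one, mul_neg, mul_one, neg_mul, neg_neg]
    rfl

lemma odd (hφ : IsHomog 0 φ) : LC.sg φ = -tw φ := by
  rw [hφ.sg_eq, zero_add, Int.negOnePow_one, Units.neg_smul, one_smul]

lemma even (hφ : IsHomog (-1) φ) : LC.sg φ = tw φ := by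
  rw [hφ.sg_eq, neg_add_cancel, Int.negOnePow_zero, one_smul]

end IsHomog

/-- The component of a cochain on words with `N + 1` letters. -/
def only (N : ℕ) (φ : LC H B e Z Y) : LC H B e Z Y := fun n V => if n = N then φ n V else 0

lemma only_self (N : ℕ) (φ : LC H B e Z Y) : only N φ N V = φ N V := if_pos rfl

lemma only_ne {N : ℕ} (φ : LC H B e Z Y) (h : n ≠ N) : only N φ n V = 0 := if_neg h

lemma van_only (N : ℕ) (φ : LC H B e Z Y) : Van N (only N φ) := fun _ hn _ => only_ne φ hn.ne

lemma IsHomog.only (hφ : IsHomog k φ) (N : ℕ) : IsHomog k (only N φ) := fun n V => by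
  unfold LC.only; split_ifs
  · exact hφ n V
  · exact Homog.zero _

namespace Van

variable {q p : ℕ}

lemma mono (h : Van q φ) (hp : p ≤ q) : Van p φ := fun n hn => h n (hn.trans_le hp)

lemma add (hφ : Van q φ) (hψ : Van q ψ) : Van q (φ + ψ) := fun n hn V => by
  rw [Pi.add_apply, Pi.add_apply, hφ n hn, hψ n hn, add_zero]

lemma neg (hφ : Van q φ) : Van q (-φ) := fun n hn V => by
  rw [Pi.neg_apply, Pi.neg_apply, hφ n hn, neg_zero]

lemma sub (hφ : Van q φ) (hψ : Van q ψ) : Van q (φ - ψ) := by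
  rw [sub_eq_add_neg]; exact hφ.add hψ.neg

lemma succ (h : Van q φ) (h' : ∀ V, φ q V = 0) : Van (q + 1) φ := fun n hn V => by
  rcases Nat.lt_succ_iff_lt_or_eq.1 hn with h1 | rfl
  · exact h n h1 V
  · exact h' V

end Van

/-! ### Twisting cochains and gauge transformations -/

lemma pb_ract (a : Tot (H.Hom U Z)) (φ : LC H B e Z Y) :
    pb (ract a φ) = ract (totSign _ a) (pb φ) := by
  ext V b
  · rfl
  · rw [← sh_apply, ← sh_apply, sh_pb, sh_ract, sh_ract, sh_pb, ract_ract, H.totSign_compTot,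
      totSign_totSign]

lemma pb_pb (φ : LC H B e Z Y) : pb (pb φ) = 0 := by
  funext n V
  induction n generalizing Z with
  | zero => rfl
  | succ n ih =>
    refine H.word_ext fun U a w => ?_
    rw [← sh_apply, sh_pb, sh_pb, totSign_totSign, map_sub, pb_ract, sub_sub_cancel, ih]
    rfl

/-- The curvature of a cochain `f`. Its vanishing says that `f` is a twisting cochain, that is,
an `A∞`-functor from `H` to `B`. -/
def curv (f : AA H B e) : AA H B e := fun X => dd (f X) + pb (f X) - cup (sg (f X)) f

lemma curv_homog {f : AA H B e} (hf : ∀ X, IsHomog 0 (f X)) (X : H.Obj) : IsHomog 1 (curv f X) :=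
  ((hf X).dd.add (hf X).pb).sub ((hf X).sg.cup hf)

/-- The Bianchi identity. -/
lemma dd_curv {f : AA H B e} (hf : ∀ X, IsHomog 0 (f X)) (X : H.Obj) :
    dd (curv f X) = pb (curv f X) + cup (sg (curv f X)) f - cup (f X) (curv f) := by
  have h1 : (curv f : AA H B e) = (fun X => dd (f X)) + (fun X => pb (f X)) -
    (fun X => cup (sg (f X)) f) := rfl
  have h2 : tw (sg (f X)) = -f X := by rw [(hf X).odd, map_neg, tw_tw]
  rw [h1]
  simp only [Pi.sub_apply, Pi.add_apply, map_sub, map_add, dd_dd, dd_cup, pb_cup, pb_pb, sg_cup,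
    sg_sg, LinearMap.sub_apply, LinearMap.add_apply, cup_assoc, sg_dd, sg_pb, dd_pb, h2, map_neg,
    LinearMap.neg_apply]
  abel

/-- If `f` is a twisting cochain on words with at most `p` letters, its curvature on words with
`p + 1` letters is closed. -/
lemma dd_curv_eq_zero {f : AA H B e} (hf : ∀ X, IsHomog 0 (f X)) {p : ℕ}
    (h : ∀ X, Van p (curv f X)) (X : H.Obj) : Van (p + 1) (dd (curv f X)) := by
  rw [dd_curv hf]
  exact ((h X).pb.add ((h X).sg.cup_left f)).sub (Van.cup_right _ h)

/-- The defect of `1 + h` being a gauge transformation from `f` to `f'`. -/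
def gaugeErr (f f' h : AA H B e) : AA H B e := fun X =>
  f' X + cup (f' X) h - f X - cup (sg (h X)) f + dd (h X) - pb (h X)

lemma gauge_curv {f f' h : AA H B e} (hf' : ∀ X, IsHomog 0 (f' X))
    (hh : ∀ X, IsHomog (-1) (h X)) (X : H.Obj) :
    curv f' X + cup (curv f' X) h - curv f X - cup (h X) (curv f) =
      dd (gaugeErr f f' h X) + pb (gaugeErr f f' h X) - cup (sg (f' X)) (gaugeErr f f' h) -
        cup (sg (gaugeErr f f' h X)) f := by
  have h1 : (curv f : AA H B e) = (fun X => dd (f X)) + (fun X => pb (f X)) -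
    (fun X => cup (sg (f X)) f) := rfl
  have h1' : (curv f' : AA H B e) = (fun X => dd (f' X)) + (fun X => pb (f' X)) -
    (fun X => cup (sg (f' X)) f') := rfl
  have h3 : gaugeErr f f' h = f' + (fun X => cup (f' X) h) - f - (fun X => cup (sg (h X)) f) +
    (fun X => dd (h X)) - (fun X => pb (h X)) := rfl
  rw [h1, h1', h3]
  simp only [Pi.sub_apply, Pi.add_apply, map_sub, map_add, dd_dd, dd_cup, pb_cup, pb_pb, sg_cup,
    sg_sg, LinearMap.sub_apply, LinearMap.add_apply, cup_assoc, sg_dd, sg_pb, dd_pb, map_neg,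
    LinearMap.neg_apply, ← sg_tw]
  have h4 : tw (f' X) = -sg (f' X) := by rw [(hf' X).odd, neg_neg]
  have h5 : tw (h X) = sg (h X) := (hh X).even.symm
  simp only [h4, h5, map_neg, sg_sg, LinearMap.neg_apply]
  abel

end LC

end Homogeneous

section Gauge

variable {R : Type u} [CommRing R] {H : DGCat.{u} R} {B : SCat.{u} R} {e : H.Obj → B.Obj}

namespace LC

lemma van_sub_only {Z : H.Obj} {Y : B.Obj} {N : ℕ} {φ : LC H B e Z Y} (h : Van N φ) :
    Van (N + 1) (φ - only N φ) :=
  (h.sub (van_only N φ)).succ fun V => by rw [Pi.sub_apply, Pi.sub_apply, only_self, sub_self]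

/-- The equation `f' + f' ∪ h = r` can be solved up to any word length. -/
lemma exists_add_cup_eq {r h : AA H B e} (hr : ∀ X, IsHomog 0 (r X))
    (hh : ∀ X, IsHomog (-1) (h X)) (N : ℕ) :
    ∃ f' : AA H B e, (∀ X, IsHomog 0 (f' X)) ∧ ∀ X, Van N (f' X + cup (f' X) h - r X) := by
  induction N with
  | zero => exact ⟨r, hr, fun X n hn => absurd hn n.not_lt_zero⟩
  | succ N ih =>
    obtain ⟨f, hf, hE⟩ := ih
    refine ⟨fun X => f X - only N (f X + cup (f X) h - r X), fun X =>
      (hf X).sub ((((hf X).add ((hf X).cup hh)).sub (hr X)).only N), fun X => ?_⟩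
    have h1 := (van_sub_only (hE X)).sub ((van_only N (f X + cup (f X) h - r X)).cup_left h)
    convert h1 using 1
    simp only [map_sub, LinearMap.sub_apply]
    abel

/-- The equation `f + σh ∪ f = r` can be solved up to any word length. -/
lemma exists_add_cup_eq' {r h : AA H B e} (hr : ∀ X, IsHomog 0 (r X))
    (hh : ∀ X, IsHomog (-1) (h X)) (N : ℕ) :
    ∃ f : AA H B e, (∀ X, IsHomog 0 (f X)) ∧ ∀ X, Van N (f X + cup (sg (h X)) f - r X) := by
  induction N with
  | zero => exact ⟨r, hr, fun X n hn => absurd hn n.not_lt_zero⟩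
  | succ N ih =>
    obtain ⟨f, hf, hE⟩ := ih
    refine ⟨f - fun X => only N (f X + cup (sg (h X)) f - r X), fun X =>
      (hf X).sub ((((hf X).add ((hh X).sg.cup hf)).sub (hr X)).only N), fun X => ?_⟩
    have h1 := (van_sub_only (hE X)).sub
      (Van.cup_right (sg (h X)) fun Y => van_only N (f Y + cup (sg (h Y)) f - r Y))
    convert h1 using 1
    simp only [map_sub, Pi.sub_apply]
    abel

/-- Transport of a twisting cochain along a gauge transformation, up to a given word length. -/
lemma exists_gauge {f h : AA H B e} (hf : ∀ X, IsHomog 0 (f X)) (hh : ∀ X, IsHomog (-1) (h X))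
    (N : ℕ) : ∃ f' : AA H B e, (∀ X, IsHomog 0 (f' X)) ∧ ∀ X, Van N (gaugeErr f f' h X) := by
  obtain ⟨f', hf', hE⟩ := exists_add_cup_eq
    (r := fun X => f X + cup (sg (h X)) f - dd (h X) + pb (h X)) (h := h)
    (fun X => (((hf X).add ((hh X).sg.cup hf)).sub (hh X).dd).add (hh X).pb) hh N
  refine ⟨f', hf', fun X => ?_⟩
  convert hE X using 1
  simp only [gaugeErr]
  abel

lemma exists_gauge' {f' h : AA H B e} (hf' : ∀ X, IsHomog 0 (f' X))
    (hh : ∀ X, IsHomog (-1) (h X)) (N : ℕ) :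
    ∃ f : AA H B e, (∀ X, IsHomog 0 (f X)) ∧ ∀ X, Van N (gaugeErr f f' h X) := by
  obtain ⟨f, hf, hE⟩ := exists_add_cup_eq'
    (r := fun X => f' X + cup (f' X) h + dd (h X) - pb (h X)) (h := h)
    (fun X => (((hf' X).add ((hf' X).cup hh)).add (hh X).dd).sub (hh X).pb) hh N
  refine ⟨f, hf, fun X => ?_⟩
  convert (hE X).neg using 1
  simp only [gaugeErr]
  abel

section

variable {f f' h : AA H B e} {N p q : ℕ}

lemma van_gauge_curv (hf' : ∀ X, IsHomog 0 (f' X)) (hh : ∀ X, IsHomog (-1) (h X))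
    (hE : ∀ X, Van N (gaugeErr f f' h X)) (X : H.Obj) :
    Van N (curv f' X + cup (curv f' X) h - curv f X - cup (h X) (curv f)) := by
  rw [gauge_curv hf' hh]
  exact (((hE X).dd.add ((hE X).pb.mono (by omega))).sub
    ((Van.cup_right _ hE).mono (by omega))).sub (((hE X).sg.cup_left f).mono (by omega))

lemma curv_of_gauge (hf' : ∀ X, IsHomog 0 (f' X)) (hh : ∀ X, IsHomog (-1) (h X))
    (hE : ∀ X, Van N (gaugeErr f f' h X)) (hp : p ≤ N) (hκ : ∀ X, Van p (curv f X)) (X : H.Obj) :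
    Van p (curv f' X) := by
  suffices ∀ m ≤ p, Van m (curv f' X) from this p le_rfl
  intro m hm
  induction m with
  | zero => exact fun n hn => absurd hn n.not_lt_zero
  | succ m ih =>
    have h1 := ((((van_gauge_curv hf' hh hE X).mono (hm.trans hp)).sub
      ((ih (by omega)).cup_left h)).add ((hκ X).mono hm)).add
      ((Van.cup_right (h X) hκ).mono (by omega : m + 1 ≤ p + 1))
    convert h1 using 1
    abel

lemma curv_of_gauge' (hf' : ∀ X, IsHomog 0 (f' X)) (hh : ∀ X, IsHomog (-1) (h X))
    (hE : ∀ X, Van N (gaugeErr f f' h X)) (hp : p ≤ N) (hκ : ∀ X, Van p (curv f' X))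
    (X : H.Obj) : Van p (curv f X) := by
  suffices ∀ m ≤ p, ∀ X, Van m (curv f X) from this p le_rfl X
  intro m hm
  induction m with
  | zero => exact fun X n hn => absurd hn n.not_lt_zero
  | succ m ih =>
    intro X
    have h1 := (((((van_gauge_curv hf' hh hE X).mono (hm.trans hp)).neg.sub
      (Van.cup_right (h X) (ih (by omega))))).add ((hκ X).mono hm)).add
      (((hκ X).cup_left h).mono (by omega : m + 1 ≤ p + 1))
    convert h1 using 1
    abel

/-- A gauge transformation by `1 + h`, where `h` starts in word length `q + 1`, does not change
a cochain before that length, and changes it by `-dh` there. -/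
lemma van_of_gauge (hE : ∀ X, Van N (gaugeErr f f' h X)) (hh : ∀ X, Van q (h X)) (hq : p ≤ N)
    (hq' : p ≤ q + 1) (X : H.Obj) : Van p (f' X - f X + dd (h X)) := by
  have h1 := ((((hE X).mono hq).sub ((Van.cup_right (f' X) hh).mono hq')).add
    (((hh X).sg.cup_left f).mono hq')).add ((hh X).pb.mono hq')
  convert h1 using 1
  simp only [gaugeErr]
  abel

end

end LC

end Gauge

/-! ### Homogeneous lifting -/

section Lifting

variable {R : Type u} [CommRing R] {H : DGCat.{u} R}
  {M N : Type u} [AddCommGroup M] [Module R M] [AddCommGroup N] [Module R N]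

/-- A linear map out of the total module with prescribed homogeneous components. -/
def totToModule {A : CochainComplex (ModuleCat.{u} R) ℤ} (f : ∀ i, A.X i →ₗ[R] M) :
    Tot A →ₗ[R] M := DirectSum.toModule R ℤ M f

lemma totToModule_tof {A : CochainComplex (ModuleCat.{u} R) ℤ} (f : ∀ i, A.X i →ₗ[R] M) (i : ℤ)
    (a : A.X i) : totToModule f (tof A i a) = f i a :=
  DirectSum.toModule_lof (M := fun i => A.X i) R i a

/-- A linear map on words with one letter with prescribed homogeneous components. -/
def wordZeroLift {X Y : H.Obj} (f : ∀ i, (H.Hom X Y).X i →ₗ[R] M) : H.Word 0 X Y →ₗ[R] M :=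
  totToModule f

lemma wordZeroLift_single {X Y : H.Obj} (f : ∀ i, (H.Hom X Y).X i →ₗ[R] M) (i : ℤ)
    (a : (H.Hom X Y).X i) : wordZeroLift f (H.single X Y (tof _ i a)) = f i a :=
  totToModule_tof f i a

/-- The homogeneous part of degree `k` of a linear map on words, with respect to a family `ρ` of
projections of the target. -/
def hpart (ρ : ℤ → M →ₗ[R] M) : ∀ (n : ℕ) {X Y : H.Obj} (_ : ℤ),
    (H.Word n X Y →ₗ[R] M) →ₗ[R] (H.Word n X Y →ₗ[R] M)
  | 0, X, Y, k =>
    { toFun := fun φ => wordZeroLift fun i =>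
        (ρ (k + i)).comp (φ.comp ((H.single X Y).comp (tof (H.Hom X Y) i)))
      map_add' := fun φ ψ => H.word_zero_tof_ext fun i a => by
        simp only [LinearMap.add_apply, wordZeroLift_single, LinearMap.comp_apply, map_add]
      map_smul' := fun r φ => H.word_zero_tof_ext fun i a => by
        simp only [LinearMap.smul_apply, wordZeroLift_single, LinearMap.comp_apply, map_smul,
          RingHom.id_apply] }
  | n + 1, X, Y, k =>
    { toFun := fun φ => H.wordLift n X Y fun Z => totToModule fun i =>
        (hpart ρ n (k + i)).comp
          (((LinearMap.llcomp R _ _ _ φ).comp (H.cons n X Z Y)).comp (tof (H.Hom Z Y) i))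
      map_add' := fun φ ψ => H.word_tof_ext fun Z i a w => by
        simp only [LinearMap.add_apply, H.wordLift_cons, totToModule_tof, LinearMap.comp_apply,
          map_add]
      map_smul' := fun r φ => H.word_tof_ext fun Z i a w => by
        simp only [LinearMap.smul_apply, H.wordLift_cons, totToModule_tof, LinearMap.comp_apply,
          map_smul, RingHom.id_apply] }

variable (ρ : ℤ → M →ₗ[R] M) {n : ℕ} {X Y Z : H.Obj} {k : ℤ} (φ : H.Word n X Y →ₗ[R] M)

lemma hpart_single (φ : H.Word 0 X Y →ₗ[R] M) (i : ℤ) (a : (H.Hom X Y).X i) :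
    hpart ρ 0 k φ (H.single X Y (tof _ i a)) = ρ (k + i) (φ (H.single X Y (tof _ i a))) :=
  wordZeroLift_single _ i a

lemma hpart_cons (φ : H.Word (n + 1) X Y →ₗ[R] M) (i : ℤ) (a : (H.Hom Z Y).X i) :
    (hpart ρ (n + 1) k φ).comp (H.cons n X Z Y (tof _ i a)) =
      hpart ρ n (k + i) (φ.comp (H.cons n X Z Y (tof _ i a))) := by
  ext w
  rw [LinearMap.comp_apply, hpart]
  simp only [LinearMap.coe_mk, AddHom.coe_mk]
  rw [H.wordLift_cons, totToModule_tof]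
  rfl

lemma homog_hpart {D : ℤ → Submodule R M} (hρ : ∀ i x, ρ i x ∈ D i) :
    Homog D n k (hpart ρ n k φ) := by
  induction n generalizing Y k with
  | zero => intro i a; rw [hpart_single]; exact hρ _ _
  | succ n ih => intro Z i a; rw [hpart_cons]; exact ih _

lemma hpart_eq_self {D : ℤ → Submodule R M} (hρ : ∀ i, ∀ x ∈ D i, ρ i x = x)
    (h : Homog D n k φ) : hpart ρ n k φ = φ := by
  induction n generalizing Y k with
  | zero => exact H.word_zero_tof_ext fun i a => by rw [hpart_single, hρ _ _ (h i a)]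
  | succ n ih =>
    refine H.word_tof_ext fun Z i a w => ?_
    change ((hpart ρ (n + 1) k φ).comp (H.cons n X Z Y (tof _ i a))) w = _
    rw [hpart_cons, ih _ (h Z i a)]; rfl

lemma comp_hpart {ρ' : ℤ → N →ₗ[R] N} (c : M →ₗ[R] N) {j : ℤ}
    (hc : ∀ i x, c (ρ i x) = ρ' (i + j) (c x)) :
    c.comp (hpart ρ n k φ) = hpart ρ' n (k + j) (c.comp φ) := by
  induction n generalizing Y k with
  | zero =>
    refine H.word_zero_tof_ext fun i a => ?_
    rw [LinearMap.comp_apply, hpart_single, hpart_single, hc, LinearMap.comp_apply,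
      add_right_comm]
  | succ n ih =>
    refine H.word_tof_ext fun Z i a w => ?_
    change (c.comp ((hpart ρ (n + 1) k φ).comp (H.cons n X Z Y (tof _ i a)))) w =
      ((hpart ρ' (n + 1) (k + j) (c.comp φ)).comp (H.cons n X Z Y (tof _ i a))) w
    rw [hpart_cons, hpart_cons, ih, add_right_comm]; rfl

lemma exists_lift {W : Type u} [AddCommGroup W] [Module R W] [Module.Projective R W]
    (c : M →ₗ[R] N) (φ : W →ₗ[R] N) (h : ∀ w, ∃ y, φ w = c y) : ∃ ψ : W →ₗ[R] M, c.comp ψ = φ := by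
  obtain ⟨ψ, hψ⟩ := Module.projective_lifting_property c.rangeRestrict
    (φ.codRestrict (LinearMap.range c) fun w => (h w).imp fun _ => Eq.symm)
    c.surjective_rangeRestrict
  exact ⟨ψ, LinearMap.ext fun w => congrArg Subtype.val (LinearMap.congr_fun hψ w)⟩

end Lifting

namespace SCat

variable {R : Type u} [CommRing R]

/-- Projections of the morphism modules to the homogeneous elements. -/
structure Proj (B : SCat.{u} R) where
  ρ : ∀ {X Y : B.Obj}, ℤ → B.Hom X Y →ₗ[R] B.Hom X Y
  mem : ∀ {X Y : B.Obj} (k : ℤ) (x : B.Hom X Y), ρ k x ∈ B.deg (X := X) k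
  eq_self : ∀ {X Y : B.Obj} (k : ℤ) (x : B.Hom X Y), x ∈ B.deg (X := X) k → ρ k x = x
  eq_zero : ∀ {X Y : B.Obj} (k l : ℤ) (x : B.Hom X Y), x ∈ B.deg (X := X) k → k ≠ l → ρ l x = 0
  comm_d : ∀ {X Y : B.Obj} (k : ℤ) (x : B.Hom X Y), B.d (ρ k x) = ρ (k + 1) (B.d x)

/-- Functors of signed categories. -/
structure Fun (B B' : SCat.{u} R) where
  obj : B.Obj → B'.Obj
  map : ∀ {X Y : B.Obj}, B.Hom X Y →ₗ[R] B'.Hom (obj X) (obj Y)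
  map_mul : ∀ {X Y Z : B.Obj} (g : B.Hom Y Z) (f : B.Hom X Y),
    map (B.mul g f) = B'.mul (map g) (map f)
  map_sgn : ∀ {X Y : B.Obj} (f : B.Hom X Y), map (B.sgn f) = B'.sgn (map f)
  map_d : ∀ {X Y : B.Obj} (f : B.Hom X Y), map (B.d f) = B'.d (map f)
  map_deg : ∀ {X Y : B.Obj} (k : ℤ) (f : B.Hom X Y), f ∈ B.deg (X := X) k →
    map f ∈ B'.deg (X := obj X) k

/-- Functors that induce isomorphisms on the cohomology of the morphism modules. -/
structure Fun.IsQI {B B' : SCat.{u} R} (G : Fun B B') : Prop where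
  inj : ∀ {X Y : B.Obj} (x : B.Hom X Y), B.d x = 0 → (∃ y, G.map x = B'.d y) → ∃ z, x = B.d z
  surj : ∀ {X Y : B.Obj} (y : B'.Hom (G.obj X) (G.obj Y)), B'.d y = 0 →
    ∃ x, B.d x = 0 ∧ ∃ z, y = G.map x + B'.d z

end SCat

namespace LC

variable {R : Type u} [CommRing R] {H : DGCat.{u} R} {B B' : SCat.{u} R} {e : H.Obj → B.Obj}
  {Z U V : H.Obj} {Y : B.Obj} {n : ℕ}

/-- Postcomposition of cochains with a functor. -/
def push (G : SCat.Fun B B') : LC H B e Z Y →ₗ[R] LC H B' (fun X => G.obj (e X)) Z (G.obj Y) where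
  toFun φ n V := G.map.comp (φ n V)
  map_add' φ ψ := by funext n V; ext w; simp
  map_smul' r φ := by funext n V; ext w; simp

variable (G : SCat.Fun B B') (φ : LC H B e Z Y)

lemma push_apply (w : H.Word n V Z) : push G φ n V w = G.map (φ n V w) := rfl

lemma push_dd : push G (dd φ) = dd (push G φ) := by
  funext n V; ext w; exact G.map_d _

lemma push_sg : push G (sg φ) = sg (push G φ) := by
  funext n V; ext w; exact G.map_sgn _

lemma push_pb : push G (pb φ) = pb (push G φ) := by
  funext n V; ext w
  cases n with
  | zero => exact map_zero (G.map (X := e V))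
  | succ n => rfl

lemma push_cup (g : AA H B e) : push G (cup φ g) =
    cup (push G φ) (fun X => push G (g X)) := by
  funext n V
  induction n generalizing Z with
  | zero => ext w; exact map_zero (G.map (X := e V))
  | succ n ih =>
    refine H.word_ext fun U a w => ?_
    have := LinearMap.congr_fun (ih (sh a φ)) w
    rw [push_apply] at this
    rw [push_apply, cup_cons, cup_cons, map_add, this, G.map_mul]; rfl

lemma push_curv (f : AA H B e) (X : H.Obj) :
    push G (curv f X) = curv (e := fun X => G.obj (e X)) (fun X => push G (f X)) X := by
  simp only [curv, map_sub, map_add, push_dd, push_sg, push_pb, push_cup]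

lemma IsHomog.push {k : ℤ} {φ : LC H B e Z Y} (h : IsHomog k φ) : IsHomog k (push G φ) :=
  fun n V => (h n V).map₀ (D' := B'.deg (X := G.obj (e V))) G.map G.map_deg

lemma Van.push {q : ℕ} {φ : LC H B e Z Y} (h : Van q φ) : Van q (push G φ) := fun n hn V => by
  ext w; rw [push_apply, h n hn, LinearMap.zero_apply, map_zero, LinearMap.zero_apply]

variable {G φ}

/-- The cochain with a prescribed component on words with `N + 1` letters and no others. -/
def supp (N : ℕ) (ψ : ∀ V, H.Word N V Z →ₗ[R] B.Hom (e V) Y) : LC H B e Z Y := fun n V =>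
  if h : n = N then h ▸ ψ V else 0

variable {N : ℕ} {ψ : ∀ V, H.Word N V Z →ₗ[R] B.Hom (e V) Y}

lemma supp_self : supp N ψ N V = ψ V := dif_pos rfl

lemma supp_ne (h : n ≠ N) : supp N ψ n V = 0 := dif_neg h

lemma van_supp : Van N (supp N ψ) := fun _ hn _ => supp_ne hn.ne

lemma isHomog_supp {k : ℤ} (h : ∀ V, Homog (B.deg (X := e V)) N (k - N) (ψ V)) :
    IsHomog k (supp N ψ) := fun n V => by
  by_cases hn : n = N
  · subst hn; rw [supp_self]; exact h V
  · rw [supp_ne hn]; exact Homog.zero _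

section

variable [∀ X Y i, Module.Projective R ((H.Hom X Y).X i)]

/-- A homogeneous cochain with exact values in one word length is the differential of a
homogeneous cochain there. -/
lemma exists_dd_eq (P : B.Proj) {k : ℤ} (hφ : IsHomog k φ) (N : ℕ)
    (hex : ∀ V w, ∃ y, φ N V w = B.d y) :
    ∃ ψ : LC H B e Z Y, IsHomog (k - 1) ψ ∧ (∀ n ≠ N, ∀ V, ψ n V = 0) ∧
      ∀ V, dd ψ N V = φ N V := by
  choose ψ₀ h₀ using fun V => exists_lift (W := H.Word N V Z) (B.d (X := e V) (Y := Y)) (φ N V)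
    (hex V)
  refine ⟨supp N fun V => hpart P.ρ N (k - 1 - N) (ψ₀ V),
    isHomog_supp fun V => homog_hpart _ _ P.mem, fun n hn V => supp_ne hn, fun V => ?_⟩
  change B.d.comp (supp N _ N V) = _
  rw [supp_self, comp_hpart P.ρ (ρ' := P.ρ) _ _ P.comm_d, h₀,
    hpart_eq_self _ _ P.eq_self ((hφ N V).of_eq (by omega))]

/-- A closed homogeneous cochain in one word length is, up to a differential, the image of a
closed homogeneous cochain under a quasi-isomorphism. -/
lemma exists_push_add_dd_eq (P : B.Proj) (P' : B'.Proj) (hG : G.IsQI)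
    (hPG : ∀ {X Y : B.Obj} (k) (x : B.Hom X Y), G.map (P.ρ k x) = P'.ρ k (G.map x))
    {k : ℤ} {z : LC H B' (fun X => G.obj (e X)) Z (G.obj Y)} (hz : IsHomog k z) (N : ℕ)
    (hdz : ∀ V, dd z N V = 0) :
    ∃ (g : LC H B e Z Y) (h : LC H B' (fun X => G.obj (e X)) Z (G.obj Y)), IsHomog k g ∧
      IsHomog (k - 1) h ∧ (∀ n ≠ N, ∀ V, g n V = 0) ∧ (∀ n ≠ N, ∀ V, h n V = 0) ∧
      dd g = 0 ∧ ∀ V, z N V = push G g N V + dd h N V := by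
  have key := fun V => exists_lift (W := H.Word N V Z)
    (M := LinearMap.ker (B.d (X := e V) (Y := Y)) × B'.Hom (G.obj (e V)) (G.obj Y))
    (LinearMap.coprod (G.map.comp (LinearMap.ker (B.d (X := e V) (Y := Y))).subtype) B'.d)
    (z N V) (fun w => by
      obtain ⟨x, hx, y, hy⟩ := hG.surj (z N V w) (LinearMap.congr_fun (hdz V) w)
      exact ⟨(⟨x, hx⟩, y), hy⟩)
  choose ψ₀ h₀ using key
  set g₀ : ∀ V, H.Word N V Z →ₗ[R] B.Hom (e V) Y := fun V =>
    (LinearMap.ker (B.d (X := e V) (Y := Y))).subtype.comp ((LinearMap.fst R _ _).comp (ψ₀ V))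
    with hg₀
  set k₀ : ∀ V, H.Word N V Z →ₗ[R] B'.Hom (G.obj (e V)) (G.obj Y) := fun V =>
    (LinearMap.snd R _ _).comp (ψ₀ V) with hk₀
  have e₁ : ∀ V, G.map.comp (g₀ V) + B'.d.comp (k₀ V) = z N V := fun V => by
    rw [← h₀ V]; rfl
  have e₂ : ∀ V, B.d.comp (g₀ V) = 0 := fun V => LinearMap.ext fun w => (ψ₀ V w).1.2
  refine ⟨supp N fun V => hpart P.ρ N (k - N) (g₀ V), supp N fun V => hpart P'.ρ N (k - 1 - N) (k₀ V),
    isHomog_supp fun V => homog_hpart _ _ P.mem, isHomog_supp fun V => homog_hpart _ _ P'.mem,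
    fun n hn V => supp_ne hn, fun n hn V => supp_ne hn, ?_, fun V => ?_⟩
  · funext n V
    change B.d.comp (supp N _ n V) = 0
    by_cases hn : n = N
    · subst hn
      rw [supp_self, comp_hpart P.ρ (ρ' := P.ρ) _ _ P.comm_d, e₂, map_zero]
    · rw [supp_ne hn, LinearMap.comp_zero]
  · ext w
    change z N V w = G.map (supp (e := e) N (fun V => hpart P.ρ N (k - N) (g₀ V)) N V w) +
      B'.d (supp (e := fun X => G.obj (e X)) N (fun V => hpart P'.ρ N (k - 1 - N) (k₀ V)) N V w)
    rw [supp_self, supp_self]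
    have e₃ : z N V = G.map.comp (hpart P.ρ N (k - N) (g₀ V)) +
        B'.d.comp (hpart P'.ρ N (k - 1 - N) (k₀ V)) := by
      rw [comp_hpart P.ρ (ρ' := P'.ρ) (j := 0) _ _ (fun i x => by rw [hPG, add_zero]),
        comp_hpart P'.ρ (ρ' := P'.ρ) _ _ P'.comm_d, add_zero,
        show k - 1 - (N : ℤ) + 1 = k - N by omega, ← map_add, e₁,
        hpart_eq_self _ _ P'.eq_self (hz N V)]
    exact LinearMap.congr_fun e₃ w

end

end LC

/-! ### Extension of truncated twisting cochains -/

section Extension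

variable {R : Type u} [CommRing R] {H : DGCat.{u} R} {B B' : SCat.{u} R} {e : H.Obj → B.Obj}

namespace LC

lemma curv_zero_apply {f : AA H B e} {p : ℕ} (hp : 0 < p) {X V : H.Obj} (h : Van p (curv f X))
    (a : H.Word 0 V X) : B.d (f X 0 V a) = 0 := by
  have := LinearMap.congr_fun (h 0 hp V) a
  simpa [curv, dd_apply, pb_zero, cup_zero] using this

lemma van_curv_sub {f g : AA H B e} {q : ℕ} (h : ∀ X, Van q (g X - f X)) (X : H.Obj) :
    Van (q + 1) (curv g X - curv f X - dd (g X - f X)) := by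
  have h1 := ((h X).pb.sub ((h X).sg.cup_left g)).sub
    (Van.cup_right (g := g - f) (sg (f X)) h)
  convert h1 using 1
  simp only [curv, map_sub, LinearMap.sub_apply]
  abel

lemma van_dd_sub {f g : AA H B e} {q : ℕ} (h : ∀ X, Van q (g X - f X))
    (hf : ∀ X, Van (q + 1) (curv f X)) (hg : ∀ X, Van (q + 1) (curv g X)) (X : H.Obj) :
    Van (q + 1) (dd (g X - f X)) := by
  convert ((hg X).sub (hf X)).sub (van_curv_sub h X) using 1
  abel

lemma curv_add_closed {f g : AA H B e} {q : ℕ} (hf : ∀ X, Van (q + 1) (curv f X))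
    (hg : ∀ X, Van q (g X)) (hdg : ∀ X, dd (g X) = 0) (X : H.Obj) :
    Van (q + 1) (curv (f + g) X) := by
  have h1 := van_curv_sub (f := f) (g := f + g) (q := q) (fun X => by
    rw [Pi.add_apply, add_sub_cancel_left]; exact hg X) X
  rw [Pi.add_apply, add_sub_cancel_left, hdg, sub_zero] at h1
  convert h1.add (hf X) using 1
  abel

/-- A cochain that induces on cohomology a localization of `H` at the nonzero divisors of `R`. -/
structure LocQI (f : AA H B e) : Prop where
  inj : ∀ (X Y : H.Obj) (a : Tot (H.Hom X Y)),
    (∃ y, f Y 0 X (H.single X Y a) = B.d y) → a = 0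
  surj : ∀ (X Y : H.Obj) (b : B.Hom (e X) (e Y)), B.d b = 0 →
    ∃ r ∈ nonZeroDivisors R, ∃ a y, r • b = f Y 0 X (H.single X Y a) + B.d y

lemma LocQI.of_sub {f f' h : AA H B e} (hf : LocQI f) {q : ℕ} (hq : 0 < q)
    (hv : ∀ X, Van q (f' X - f X + dd (h X))) : LocQI f' := by
  have key : ∀ X Y a, f' Y 0 X (H.single X Y a) =
      f Y 0 X (H.single X Y a) - B.d (h Y 0 X (H.single X Y a)) := fun X Y a => by
    have : f' Y 0 X (H.single X Y a) - f Y 0 X (H.single X Y a) +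
        B.d (h Y 0 X (H.single X Y a)) = 0 :=
      LinearMap.congr_fun (hv Y 0 hq X) (H.single X Y a)
    rw [← sub_eq_zero, ← this]; abel
  refine ⟨fun X Y a => ?_, fun X Y b hb => ?_⟩
  · rintro ⟨y, hy⟩
    refine hf.inj X Y a ⟨y + h Y 0 X (H.single X Y a), ?_⟩
    rw [key, sub_eq_iff_eq_add] at hy
    rw [hy, map_add]
  · obtain ⟨r, hr, a, y, hy⟩ := hf.surj X Y b hb
    exact ⟨r, hr, a, y + h Y 0 X (H.single X Y a), by rw [hy, key, map_add]; abel⟩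

variable (f : AA H B e) in
/-- The conclusion of the extension property: a twisting cochain on words with at most `p`
letters extends by one letter, after a change on words with `p` letters. -/
def Extends (p : ℕ) : Prop :=
  ∃ f' : AA H B e, (∀ X, IsHomog 0 (f' X)) ∧ (∀ X, Van (p - 1) (f' X - f X)) ∧
    ∀ X, Van (p + 1) (curv f' X)

variable [∀ X Y i, Module.Projective R ((H.Hom X Y).X i)]

/-- A twisting cochain on words with at most `p` letters extends to words with `p + 1` letters
when the curvature there is exact. -/
lemma exists_extend (P : B.Proj) {f : AA H B e} (hf : ∀ X, IsHomog 0 (f X)) {p : ℕ}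
    (hκ : ∀ X, Van p (curv f X)) (hex : ∀ X V w, ∃ y, curv f X p V w = B.d y) :
    ∃ f' : AA H B e, (∀ X, IsHomog 0 (f' X)) ∧ (∀ X, Van p (f' X - f X)) ∧
      ∀ X, Van (p + 1) (curv f' X) := by
  choose ψ h1 h2 h3 using fun X => exists_dd_eq P (curv_homog hf X) p (hex X)
  have hv : ∀ X, Van p ((f - ψ) X - f X) := fun X n hn V => by
    rw [Pi.sub_apply f ψ X, sub_sub_cancel_left, Pi.neg_apply, Pi.neg_apply, h2 X n hn.ne,
      neg_zero]
  refine ⟨f - ψ, fun X => (hf X).sub ((h1 X).of_eq (by norm_num)), hv, fun X => ?_⟩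
  have h4 := van_curv_sub hv X
  have h5 : Van (p + 1) (curv f X - dd (ψ X)) := by
    refine Van.succ ((hκ X).sub (Van.dd fun n hn V => h2 X n hn.ne V)) fun V => ?_
    rw [Pi.sub_apply, Pi.sub_apply, h3, sub_self]
  convert h4.add h5 using 1
  simp only [Pi.sub_apply, map_sub]
  abel

section

variable {G : SCat.Fun B B'} (hG : G.IsQI) (P : B.Proj) (P' : B'.Proj)
  (hPG : ∀ {X Y : B.Obj} (k) (x : B.Hom X Y), G.map (P.ρ k x) = P'.ρ k (G.map x))
  {f : AA H B e} {f' : AA H B' (fun X => G.obj (e X))}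

include hG P in
/-- If the image of a truncated twisting cochain under a quasi-isomorphism extends, then so does
the twisting cochain. -/
lemma exists_extend_of_push (hf : ∀ X, IsHomog 0 (f X)) {p : ℕ} (hκ : ∀ X, Van p (curv f X))
    (hκ' : ∀ X, Van (p + 1) (curv f' X)) (hff' : ∀ X, Van p (f' X - push G (f X))) :
    ∃ f₁ : AA H B e, (∀ X, IsHomog 0 (f₁ X)) ∧ (∀ X, Van p (f₁ X - f X)) ∧
      ∀ X, Van (p + 1) (curv f₁ X) := by
  refine exists_extend P hf hκ fun X V w => hG.inj _ ?_ ⟨-(f' X p V w - G.map (f X p V w)), ?_⟩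
  · exact LinearMap.congr_fun (dd_curv_eq_zero hf hκ X p (by omega) V) w
  · have h1 := LinearMap.congr_fun (van_curv_sub hff' X p (by omega) V) w
    have h2 := LinearMap.congr_fun (hκ' X p (by omega) V) w
    have h3 : curv (fun X => push G (f X)) X p V w = G.map (curv f X p V w) := by
      rw [← push_curv]; rfl
    simp only [Pi.sub_apply, LinearMap.sub_apply, LinearMap.zero_apply] at h1 h2
    rw [h2, h3, zero_sub, sub_eq_zero] at h1
    rw [map_neg, ← neg_eq_iff_eq_neg, h1]
    rfl

include hG P P' hPG in
lemma exists_adjust (hf : ∀ X, IsHomog 0 (f X)) (hf' : ∀ X, IsHomog 0 (f' X)) {N : ℕ}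
    (hff' : ∀ X, Van N (f' X - push G (f X)))
    (hd : ∀ X, Van (N + 1) (dd (f' X - push G (f X)))) :
    ∃ (g : AA H B e) (h : AA H B' (fun X => G.obj (e X))), (∀ X, IsHomog 0 (g X)) ∧
      (∀ X, IsHomog (-1) (h X)) ∧ (∀ X, Van N (g X)) ∧ (∀ X, Van N (h X)) ∧
      (∀ X, dd (g X) = 0) ∧ ∀ X, Van (N + 1) (f' X - push G (f X) - push G (g X) - dd (h X)) := by
  choose g h h1 h2 h3 h4 h5 h6 using fun X => exists_push_add_dd_eq P P' hG hPG
    ((hf' X).sub ((hf X).push G)) N (hd X N (by omega))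
  refine ⟨g, h, h1, fun X => (h2 X).of_eq (by norm_num), fun X n hn => h3 X n hn.ne,
    fun X n hn => h4 X n hn.ne, h5, fun X => ?_⟩
  refine Van.succ (((hff' X).sub (Van.push (G := G) fun n hn => h3 X n hn.ne)).sub
    (Van.dd fun n hn => h4 X n hn.ne)) fun V => ?_
  change (f' X - push G (f X)) N V - push G (g X) N V - dd (h X) N V = 0
  rw [h6]
  abel

end

/-- The extension property: every truncated twisting cochain that is a localization of the
cohomology extends by one letter, after a change in the top word length. -/
def HasExtensions (H : DGCat.{u} R) (B : SCat.{u} R) : Prop :=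
  ∀ (e : H.Obj → B.Obj) (p : ℕ) (f : AA H B e), 2 ≤ p → (∀ X, IsHomog 0 (f X)) →
    (∀ X, Van p (curv f X)) → LocQI f → Extends f p

section

variable {G : SCat.Fun B B'} (hG : G.IsQI) (P : B.Proj) (P' : B'.Proj)
  (hPG : ∀ {X Y : B.Obj} (k) (x : B.Hom X Y), G.map (P.ρ k x) = P'.ρ k (G.map x))

omit [∀ X Y i, Module.Projective R ((H.Hom X Y).X i)] in
include hG in
lemma LocQI.push {f : AA H B e} (hf : LocQI f)
    (hd : ∀ X Y a, B.d (f Y 0 X (H.single X Y a)) = 0) :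
    LocQI (e := fun X => G.obj (e X)) fun X => push G (f X) := by
  refine ⟨fun X Y a h => hf.inj X Y a (hG.inj _ (hd X Y a) h), fun X Y b hb => ?_⟩
  obtain ⟨x, hx, z, rfl⟩ := hG.surj b hb
  obtain ⟨r, hr, a, y, hy⟩ := hf.surj X Y x hx
  refine ⟨r, hr, a, G.map y + r • z, ?_⟩
  rw [smul_add, ← map_smul, hy, map_add, map_add, map_smul, G.map_d, push_apply, add_assoc]

omit [∀ X Y i, Module.Projective R ((H.Hom X Y).X i)] in
include hG in
lemma LocQI.of_push {f : AA H B e} {f' : AA H B' (fun X => G.obj (e X))} (hf' : LocQI f')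
    (hff' : ∀ X Y a, f' Y 0 X (H.single X Y a) = G.map (f Y 0 X (H.single X Y a)))
    (hd : ∀ X Y a, B.d (f Y 0 X (H.single X Y a)) = 0) : LocQI f := by
  refine ⟨fun X Y a ⟨y, hy⟩ => hf'.inj X Y a ⟨G.map y, ?_⟩, fun X Y b hb => ?_⟩
  · rw [hff', hy, G.map_d]
  · obtain ⟨r, hr, a, z, hz⟩ := hf'.surj X Y (G.map b) (by rw [← G.map_d, hb, map_zero])
    obtain ⟨y, hy⟩ := hG.inj (r • b - f Y 0 X (H.single X Y a))
      (by rw [map_sub, map_smul, hb, hd, smul_zero, sub_zero])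
      ⟨z, by rw [map_sub, map_smul, hz, hff', add_sub_cancel_left]⟩
    exact ⟨r, hr, a, y, by rw [← hy]; abel⟩

include hG P P' hPG in
/-- The extension property is inherited by the source of a quasi-isomorphism: extend the image in
the target, gauge it so that it comes from the source one letter further, and lift it. -/
theorem HasExtensions.of_target (hT : HasExtensions H B') : HasExtensions H B := by
  intro e p f hp hf hκ hL
  obtain ⟨p, rfl⟩ : ∃ q, p = q + 1 := ⟨p - 1, by omega⟩
  have hκG : ∀ X, Van (p + 1) (curv (e := fun X => G.obj (e X)) (fun X => push G (f X)) X) :=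
    fun X => by rw [← push_curv]; exact (hκ X).push G
  obtain ⟨f', hf', hv, hκ'⟩ := hT (fun X => G.obj (e X)) (p + 1) (fun X => push G (f X)) hp
    (fun X => (hf X).push G) hκG
    (hL.push hG fun X Y a => curv_zero_apply (by omega) (hκ Y) _)
  rw [Nat.add_sub_cancel] at hv
  obtain ⟨g, h, hg, hh, hgv, hhv, hdg, hgh⟩ := exists_adjust hG P P' hPG hf hf' hv
    (van_dd_sub hv hκG fun X => (hκ' X).mono (by omega))
  obtain ⟨f'', hf'', hE⟩ := exists_gauge hf' hh (p + 2)
  have h1 := van_of_gauge hE hhv (show p + 1 ≤ p + 2 by omega) le_rfl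
  obtain ⟨f₁, hf₁, hv₁, hκ₁⟩ := exists_extend_of_push hG P (f := f + g) (f' := f'')
    (p := p + 1) (fun X => (hf X).add (hg X)) (curv_add_closed hκ hgv hdg)
    (curv_of_gauge hf'' hh hE le_rfl hκ') (fun X => by
      convert (h1 X).add (hgh X) using 1
      simp only [Pi.add_apply, map_add]
      abel)
  refine ⟨f₁, hf₁, fun X => ?_, hκ₁⟩
  change Van p _
  convert ((hv₁ X).mono (Nat.le_succ p)).add (hgv X) using 1
  rw [Pi.add_apply]; abel

include hG P P' hPG in
/-- A truncated twisting cochain with values in the target of a quasi-isomorphism that comes from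
the source up to some word length extends: move one more letter at a time to the source, at the
price of gauge transformations. -/
lemma HasExtensions.extends_of_push (hT : HasExtensions H B) {p : ℕ} (hp : 2 ≤ p) (k : ℕ) :
    ∀ (q : ℕ), q + k = p → ∀ (f : AA H B e) (f' : AA H B' (fun X => G.obj (e X))),
      (∀ X, IsHomog 0 (f X)) → (∀ X, IsHomog 0 (f' X)) → (∀ X, Van q (curv f X)) →
      (∀ X, Van p (curv f' X)) → (∀ X, Van q (f' X - push G (f X))) → LocQI f' →
      Extends f' p := by
  induction k with
  | zero =>
    rintro p rfl f f' hf hf' hκ hκ' hv hL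
    have hd : ∀ X Y a, B.d (f Y 0 X (H.single X Y a)) = 0 := fun X Y a =>
      curv_zero_apply (by omega) (hκ Y) _
    have h0 : ∀ X Y a, f' Y 0 X (H.single X Y a) = G.map (f Y 0 X (H.single X Y a)) :=
      fun X Y a => sub_eq_zero.1 (LinearMap.congr_fun (hv Y 0 (by omega) X) _)
    obtain ⟨f₁, hf₁, hv₁, hκ₁⟩ := hT e p f hp hf hκ (hL.of_push hG h0 hd)
    refine ⟨fun X => push G (f₁ X), fun X => (hf₁ X).push G, fun X => ?_, fun X => ?_⟩
    · change Van (p - 1) _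
      convert ((hv₁ X).push G).sub ((hv X).mono (Nat.sub_le p 1)) using 1
      rw [map_sub]; abel
    · rw [← push_curv]; exact (hκ₁ X).push G
  | succ k ih =>
    intro q hq f f' hf hf' hκ hκ' hv hL
    obtain ⟨f₁, hf₁, hv₁, hκ₁⟩ := exists_extend_of_push hG P hf hκ
      (fun X => (hκ' X).mono (by omega)) hv
    have hv' : ∀ X, Van q (f' X - push G (f₁ X)) := fun X => by
      convert (hv X).sub ((hv₁ X).push G) using 1
      rw [map_sub]; abel
    obtain ⟨g, h, hg, hh, hgv, hhv, hdg, hgh⟩ := exists_adjust hG P P' hPG hf₁ hf' hv'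
      (van_dd_sub hv' (fun X => by rw [← push_curv]; exact (hκ₁ X).push G)
        fun X => (hκ' X).mono (by omega))
    obtain ⟨f'', hf'', hE⟩ := exists_gauge hf' hh (p + 1)
    have h1 := van_of_gauge hE hhv (show q + 1 ≤ p + 1 by omega) le_rfl
    obtain ⟨k₁, hk₁, hkv, hkκ⟩ := ih (q + 1) (by omega) (f₁ + g) f''
      (fun X => (hf₁ X).add (hg X)) hf'' (curv_add_closed hκ₁ hgv hdg)
      (curv_of_gauge hf'' hh hE (by omega) hκ')
      (fun X => by
        convert (h1 X).add (hgh X) using 1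
        simp only [Pi.add_apply, map_add]
        abel) (hL.of_sub (Nat.succ_pos q) h1)
    obtain ⟨f₂, hf₂, hE₂⟩ := exists_gauge' hk₁ hh (p + 1)
    refine ⟨f₂, hf₂, ?_, curv_of_gauge' hk₁ hh hE₂ le_rfl hkκ⟩
    suffices ∀ m ≤ p - 1, ∀ X, Van m (f₂ X - f' X) from this _ le_rfl
    intro m hm
    induction m with
    | zero => exact fun X n hn => absurd hn n.not_lt_zero
    | succ m ih' =>
      intro X
      have h2 := (((((hE X).mono (show m + 1 ≤ p + 1 by omega)).sub
        ((hE₂ X).mono (show m + 1 ≤ p + 1 by omega))).add ((hkv X).mono hm)).add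
        (((hkv X).mono hm).cup_left h |>.mono (Nat.le_succ _))).sub
        (Van.cup_right (g := f₂ - f') (sg (h X)) (ih' (by omega)))
      convert h2 using 1
      simp only [gaugeErr, map_sub, LinearMap.sub_apply]
      abel

include hG P P' hPG in
/-- The extension property is inherited by the target of a quasi-isomorphism that is surjective on
objects. -/
theorem HasExtensions.of_source (hT : HasExtensions H B) (hobj : Function.Surjective G.obj) :
    HasExtensions H B' := by
  intro e' p f' hp hf' hκ' hL
  choose e he using fun X => hobj (e' X)
  obtain rfl : (fun X => G.obj (e X)) = e' := funext he
  exact hT.extends_of_push hG P P' hPG hp p 0 (zero_add p) (0 : AA H B e) f'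
    (fun X => IsHomog.zero 0) hf' (fun X n hn => absurd hn n.not_lt_zero) hκ'
    (fun X n hn => absurd hn n.not_lt_zero) hL

end

end LC

end Extension

/-! ### Extension over the localization, by the Euler vector field -/

section Local

variable (R : Type u) [CommRing R]

/-- Modules on which the nonzero divisors of `R` act bijectively. -/
def IsLocal (N : Type*) [AddCommGroup N] [Module R N] : Prop :=
  ∀ r ∈ nonZeroDivisors R, Function.Bijective fun x : N => r • x

variable {R} {N : Type*} [AddCommGroup N] [Module R N]

lemma IsLocal.isUnit (h : IsLocal R N) (s : nonZeroDivisors R) :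
    IsUnit (algebraMap R (Module.End R N) s) :=
  (Module.End.isUnit_iff _).2 (h s s.2)

lemma IsLocal.eq_of_smul (h : IsLocal R N) {r : R} (hr : r ∈ nonZeroDivisors R) {x y : N}
    (hxy : r • x = r • y) : x = y := (h r hr).1 hxy

lemma IsLocal.hom (h : IsLocal R N) (M : Type*) [AddCommGroup M] [Module R M] :
    IsLocal R (M →ₗ[R] N) := fun r hr => by
  refine ⟨fun f g hfg => LinearMap.ext fun x => h.eq_of_smul hr (LinearMap.congr_fun hfg x),
    fun f => ?_⟩
  let E := LinearEquiv.ofBijective (LinearMap.lsmul R N r) (h r hr)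
  exact ⟨E.symm.toLinearMap.comp f, LinearMap.ext fun x => E.apply_symm_apply (f x)⟩

lemma IsLocal.pi {ι : Type*} {N : ι → Type*} [∀ i, AddCommGroup (N i)] [∀ i, Module R (N i)]
    (h : ∀ i, IsLocal R (N i)) : IsLocal R (∀ i, N i) := fun r hr => by
  refine ⟨fun f g hfg => funext fun x => (h x).eq_of_smul hr (congrFun hfg x), fun f => ?_⟩
  choose g hg using fun i => (h i r hr).2 (f i)
  exact ⟨g, funext hg⟩

end Local

namespace LC

variable {R : Type u} [CommRing R] {H : DGCat.{u} R} {B : SCat.{u} R} {e : H.Obj → B.Obj}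
  {Z U V W : H.Obj} {Y : B.Obj} {n : ℕ}

/-- The map on letters given by a cochain. -/
def lett (j : AA H B e) (X Y : H.Obj) : Tot (H.Hom X Y) →ₗ[R] B.Hom (e X) (e Y) :=
  (j Y 0 X).comp (H.single X Y)

/-- A multiplicative cochain concentrated on words with one letter that identifies `B` with the
localization of `H` at the nonzero divisors of `R`. -/
structure IsLoc (j : AA H B e) : Prop where
  loc : ∀ X Y, IsLocalizedModule (nonZeroDivisors R) (lett j X Y)
  isLocal : ∀ X Y, IsLocal R (B.Hom X Y)
  mul : ∀ {X Y Z : H.Obj} (a : Tot (H.Hom Y Z)) (b : Tot (H.Hom X Y)),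
    lett j X Z (H.compTot X Y Z a b) = B.mul (lett j Y Z a) (lett j X Y b)
  sign : ∀ {X Y : H.Obj} (a : Tot (H.Hom X Y)),
    lett j X Y (totSign _ a) = B.sgn (lett j X Y a)
  sh : ∀ {X Y : H.Obj} (a : Tot (H.Hom X Y)), sh a (j Y) = 0

variable {j : AA H B e} (hj : IsLoc j)

namespace IsLoc

include hj

lemma local_LC : IsLocal R (LC H B e Z Y) :=
  IsLocal.pi fun _ => IsLocal.pi fun V => (hj.isLocal (e V) Y).hom _

lemma ext_of_lett {N : Type*} [AddCommGroup N] [Module R N] (hN : IsLocal R N)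
    {g g' : B.Hom (e U) (e Z) →ₗ[R] N} (h : ∀ a, g (lett j U Z a) = g' (lett j U Z a)) : g = g' := by
  have := hj.loc U Z
  exact IsLocalizedModule.ext (nonZeroDivisors R) (lett j U Z) hN.isUnit (LinearMap.ext h)

end IsLoc

/-- Prepend a letter in the localization to the argument of a cochain. -/
def shL (Z U : H.Obj) (Y : B.Obj) : B.Hom (e U) (e Z) →ₗ[R] LC H B e Z Y →ₗ[R] LC H B e U Y :=
  have := hj.loc U Z
  IsLocalizedModule.lift (nonZeroDivisors R) (lett j U Z) sh (hj.local_LC.hom _).isUnit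

lemma shL_lett (a : Tot (H.Hom U Z)) (φ : LC H B e Z Y) : shL hj Z U Y (lett j U Z a) φ = sh a φ := by
  have := hj.loc U Z
  exact LinearMap.congr_fun (IsLocalizedModule.lift_apply (nonZeroDivisors R) (lett j U Z) sh
    (hj.local_LC.hom _).isUnit a) φ

/-- The value of a cochain on a letter in the localization. -/
def evL (Z U : H.Obj) (Y : B.Obj) : B.Hom (e U) (e Z) →ₗ[R] LC H B e Z Y →ₗ[R] B.Hom (e U) Y :=
  have := hj.loc U Z
  IsLocalizedModule.lift (nonZeroDivisors R) (lett j U Z)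
    (LinearMap.mk₂ R (fun a (φ : LC H B e Z Y) => φ 0 U (H.single U Z a))
      (fun a a' φ => by simp) (fun r a φ => by simp) (fun a φ φ' => by simp)
      (fun r a φ => by simp))
    ((hj.isLocal _ _).hom _).isUnit

lemma evL_lett (a : Tot (H.Hom U Z)) (φ : LC H B e Z Y) :
    evL hj Z U Y (lett j U Z a) φ = φ 0 U (H.single U Z a) := by
  have := hj.loc U Z
  exact LinearMap.congr_fun (IsLocalizedModule.lift_apply (nonZeroDivisors R) (lett j U Z) _
    ((hj.isLocal _ _).hom _).isUnit a) φ

/-- The recursion step for the components of `insL`. -/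
def insStep (n : ℕ) (Z U : H.Obj) (Y : B.Obj) (V : H.Obj) (I : ∀ X : H.Obj,
      LC H B e Z Y →ₗ[R] LC H B e X (e Z) →ₗ[R] H.Word n V X →ₗ[R] B.Hom (e V) Y) :
    LC H B e Z Y →ₗ[R] LC H B e U (e Z) →ₗ[R] H.Word (n + 1) V U →ₗ[R] B.Hom (e V) Y :=
  LinearMap.mk₂ R (fun φ v => H.wordLift n V U fun X =>
        LinearMap.mk₂ R (fun a w => shL hj Z X Y (v 0 X (H.single X U a)) φ n V w +
            I X φ (sh a v) w)
          (fun a a' w => by simp only [map_add, LinearMap.add_apply, Pi.add_apply]; abel)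
          (fun r a w => by simp only [map_smul, LinearMap.smul_apply, Pi.smul_apply, smul_add])
          (fun a w w' => by simp only [map_add]; abel)
          (fun r a w => by simp only [map_smul, smul_add]))
      (fun φ φ' v => H.word_ext fun X a w => by
        simp only [H.wordLift_cons, LinearMap.add_apply, LinearMap.mk₂_apply, map_add,
          Pi.add_apply]
        abel)
      (fun r φ v => H.word_ext fun X a w => by
        simp only [H.wordLift_cons, LinearMap.smul_apply, LinearMap.mk₂_apply, map_smul,
          Pi.smul_apply, smul_add])
      (fun φ v v' => H.word_ext fun X a w => by
        simp only [H.wordLift_cons, LinearMap.add_apply, LinearMap.mk₂_apply, map_add,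
          Pi.add_apply]
        abel)
      (fun r φ v => H.word_ext fun X a w => by
        simp only [H.wordLift_cons, LinearMap.smul_apply, LinearMap.mk₂_apply, map_smul,
          Pi.smul_apply, smul_add])

lemma insStep_cons (n : ℕ) (Z U : H.Obj) (Y : B.Obj) (V : H.Obj) (I : ∀ X : H.Obj,
      LC H B e Z Y →ₗ[R] LC H B e X (e Z) →ₗ[R] H.Word n V X →ₗ[R] B.Hom (e V) Y)
    (φ : LC H B e Z Y) (v : LC H B e U (e Z)) (a : Tot (H.Hom W U)) (w : H.Word n V W) :
    insStep hj n Z U Y V I φ v (H.cons n V W U a w) =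
      shL hj Z W Y (v 0 W (H.single W U a)) φ n V w + I W φ (sh a v) w := by
  rw [insStep, LinearMap.mk₂_apply, H.wordLift_cons]
  rfl

/-- The components of `insL`. -/
def insN : ∀ (n : ℕ) (Z U : H.Obj) (Y : B.Obj) (V : H.Obj),
    LC H B e Z Y →ₗ[R] LC H B e U (e Z) →ₗ[R] H.Word n V U →ₗ[R] B.Hom (e V) Y
  | 0, Z, U, Y, V => LinearMap.mk₂ R (fun φ v => ((evL hj Z V Y).flip φ).comp (v 0 V))
      (fun φ φ' v => by ext w; simp) (fun r φ v => by ext w; simp)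
      (fun φ v v' => by ext w; simp) (fun r φ v => by ext w; simp)
  | n + 1, Z, U, Y, V => insStep hj n Z U Y V fun X => insN n Z X Y V

/-- Insertion of a cochain `v` into the first letter of a cochain `φ`: the sum of
`φ(v(w₁) ⊗ w₂)` over the splittings of a word into two words `w₁`, `w₂` with `w₁` nonempty. -/
def insL : LC H B e Z Y →ₗ[R] LC H B e U (e Z) →ₗ[R] LC H B e U Y :=
  LinearMap.mk₂ R (fun φ v n V => insN hj n Z U Y V φ v)
    (fun φ φ' v => by funext n V; simp)
    (fun r φ v => by funext n V; simp)
    (fun φ v v' => by funext n V; simp)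
    (fun r φ v => by funext n V; simp)

lemma insL_zero (φ : LC H B e Z Y) (v : LC H B e U (e Z)) (w : H.Word 0 V U) :
    insL hj φ v 0 V w = evL hj Z V Y (v 0 V w) φ := rfl

lemma sh_insL (φ : LC H B e Z Y) (v : LC H B e U (e Z)) (a : Tot (H.Hom W U)) :
    sh a (insL hj φ v) = shL hj Z W Y (v 0 W (H.single W U a)) φ + insL hj φ (sh a v) := by
  funext n V
  ext w
  rw [sh_apply]
  exact insStep_cons hj n Z U Y V (fun X => insN hj n Z X Y V) φ v a w

/-- The recursion step for the components of `ins`. -/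
def insStarStep (s : ∀ X Y : H.Obj, Tot (H.Hom X Y) →ₗ[R] Tot (H.Hom X Y)) (n : ℕ) (Z : H.Obj)
    (Y : B.Obj) (V : H.Obj)
    (I : ∀ U : H.Obj, LC H B e U Y →ₗ[R] AA H B e →ₗ[R] H.Word n V U →ₗ[R] B.Hom (e V) Y) :
    LC H B e Z Y →ₗ[R] AA H B e →ₗ[R] H.Word (n + 1) V Z →ₗ[R] B.Hom (e V) Y :=
  LinearMap.mk₂ R (fun φ v => insL hj φ (v Z) (n + 1) V +
        H.wordLift n V Z fun U => ((I U).flip v).comp ((sh.flip φ).comp (s U Z)))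
      (fun φ φ' v => H.word_ext fun X a w => by
        simp only [H.wordLift_cons, LinearMap.add_apply, LinearMap.comp_apply, map_add,
          LinearMap.flip_apply, Pi.add_apply]
        abel)
      (fun r φ v => H.word_ext fun X a w => by
        simp only [H.wordLift_cons, LinearMap.add_apply, LinearMap.comp_apply, map_smul,
          LinearMap.flip_apply, Pi.smul_apply, LinearMap.smul_apply, smul_add])
      (fun φ v v' => H.word_ext fun X a w => by
        simp only [H.wordLift_cons, LinearMap.add_apply, LinearMap.comp_apply, map_add,
          LinearMap.flip_apply, Pi.add_apply]
        abel)
      (fun r φ v => H.word_ext fun X a w => by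
        simp only [H.wordLift_cons, LinearMap.add_apply, LinearMap.comp_apply, map_smul,
          LinearMap.flip_apply, Pi.smul_apply, LinearMap.smul_apply, smul_add])

lemma insStarStep_cons (s : ∀ X Y : H.Obj, Tot (H.Hom X Y) →ₗ[R] Tot (H.Hom X Y)) (n : ℕ)
    (Z : H.Obj) (Y : B.Obj) (V : H.Obj)
    (I : ∀ U : H.Obj, LC H B e U Y →ₗ[R] AA H B e →ₗ[R] H.Word n V U →ₗ[R] B.Hom (e V) Y)
    (φ : LC H B e Z Y) (v : AA H B e) (a : Tot (H.Hom W Z)) (w : H.Word n V W) :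
    insStarStep hj s n Z Y V I φ v (H.cons n V W Z a w) =
      insL hj φ (v Z) (n + 1) V (H.cons n V W Z a w) + I W (sh (s W Z a) φ) v w := by
  rw [insStarStep, LinearMap.mk₂_apply, LinearMap.add_apply, H.wordLift_cons]
  rfl

/-- The components of `ins`. -/
def insStarN (s : ∀ X Y : H.Obj, Tot (H.Hom X Y) →ₗ[R] Tot (H.Hom X Y)) :
    ∀ (n : ℕ) (Z : H.Obj) (Y : B.Obj) (V : H.Obj),
    LC H B e Z Y →ₗ[R] AA H B e →ₗ[R] H.Word n V Z →ₗ[R] B.Hom (e V) Y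
  | 0, Z, Y, V => LinearMap.mk₂ R (fun φ v => insL hj φ (v Z) 0 V)
      (fun φ φ' v => by simp) (fun r φ v => by simp) (fun φ v v' => by simp)
      (fun r φ v => by simp)
  | n + 1, Z, Y, V => insStarStep hj s n Z Y V fun U => insStarN s n U Y V

variable (s : ∀ X Y : H.Obj, Tot (H.Hom X Y) →ₗ[R] Tot (H.Hom X Y))

/-- Insertion of a cochain `v` into a cochain `φ`: the sum of `φ(s w₁ ⊗ v(w₂) ⊗ w₃)` over the
splittings of a word, where `s` is applied to every letter of `w₁`. -/
def ins : LC H B e Z Y →ₗ[R] AA H B e →ₗ[R] LC H B e Z Y :=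
  LinearMap.mk₂ R (fun φ v n V => insStarN hj s n Z Y V φ v)
    (fun φ φ' v => by funext n V; simp)
    (fun r φ v => by funext n V; simp)
    (fun φ v v' => by funext n V; simp)
    (fun r φ v => by funext n V; simp)

lemma ins_zero (φ : LC H B e Z Y) (v : AA H B e) (w : H.Word 0 V Z) :
    ins hj s φ v 0 V w = evL hj Z V Y (v Z 0 V w) φ := rfl

lemma sh_ins (φ : LC H B e Z Y) (v : AA H B e) (a : Tot (H.Hom W Z)) :
    sh a (ins hj s φ v) = sh a (insL hj φ (v Z)) + ins hj s (sh (s W Z a) φ) v := by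
  funext n V
  ext w
  rw [sh_apply]
  exact insStarStep_cons hj s n Z Y V (fun U => insStarN hj s n U Y V) φ v a w

end LC

namespace LC

variable {R : Type u} [CommRing R] {H : DGCat.{u} R} {B : SCat.{u} R} {e : H.Obj → B.Obj}
  {Z U V W : H.Obj} {Y : B.Obj} {n : ℕ} {j : AA H B e} (hj : IsLoc j)

lemma shL_lett_mul (h : Tot (H.Hom W Z)) (b : B.Hom (e U) (e W)) (φ : LC H B e Z Y) :
    shL hj Z U Y (B.mul (lett j W Z h) b) φ = shL hj W U Y b (ract h φ) := by
  refine LinearMap.congr_fun (hj.ext_of_lett hj.local_LC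
    (g := ((shL hj Z U Y).flip φ).comp (B.mul (lett j W Z h)))
    (g' := (shL hj W U Y).flip (ract h φ)) fun a => ?_) b
  simp only [LinearMap.comp_apply, LinearMap.flip_apply, ← hj.mul, shL_lett, sh_ract]

lemma evL_lett_mul (h : Tot (H.Hom W Z)) (b : B.Hom (e U) (e W)) (φ : LC H B e Z Y) :
    evL hj Z U Y (B.mul (lett j W Z h) b) φ = evL hj W U Y b (ract h φ) := by
  refine LinearMap.congr_fun (hj.ext_of_lett (hj.isLocal _ _)
    (g := ((evL hj Z U Y).flip φ).comp (B.mul (lett j W Z h)))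
    (g' := (evL hj W U Y).flip (ract h φ)) fun a => ?_) b
  simp only [LinearMap.comp_apply, LinearMap.flip_apply, ← hj.mul, evL_lett, ract_apply,
    H.mulFirst_single]

lemma insL_lact_self (h : Tot (H.Hom U Z)) (φ : LC H B e Z Y) :
    insL hj φ (lact (lett j U Z h) (j U)) = ract h φ := by
  refine ext' (fun V a => ?_) fun n V X a w => ?_
  · rw [insL_zero, lact_apply]
    change evL hj Z V Y (B.mul (lett j U Z h) (lett j V U a)) φ = _
    rw [← hj.mul, evL_lett, ract_apply, H.mulFirst_single]
  · rw [← sh_apply, ← sh_apply, sh_insL, sh_lact, hj.sh, map_zero, map_zero, add_zero, lact_apply]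
    change shL hj Z X Y (B.mul (lett j U Z h) (lett j X U a)) φ n V w = _
    rw [← hj.mul, shL_lett, sh_ract]

lemma shL_pb (b : B.Hom (e U) (e Z)) (φ : LC H B e Z Y) :
    shL hj Z U Y b (pb φ) = insL hj φ (lact (B.sgn b) (j U)) - pb (shL hj Z U Y (B.sgn b) φ) := by
  refine LinearMap.congr_fun (hj.ext_of_lett hj.local_LC
    (g := (shL hj Z U Y).flip (pb φ))
    (g' := ((insL hj φ).comp (lact.flip (j U))).comp B.sgn -
      (pb.comp ((shL hj Z U Y).flip φ)).comp B.sgn) fun a => ?_) b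
  simp only [LinearMap.comp_apply, LinearMap.flip_apply, LinearMap.sub_apply, ← hj.sign, shL_lett,
    insL_lact_self, sh_pb]

lemma shL_cup (b : B.Hom (e U) (e Z)) (φ : LC H B e Z Y) (g : AA H B e) :
    shL hj Z U Y b (cup φ g) = lact (evL hj Z U Y b φ) (g U) + cup (shL hj Z U Y b φ) g := by
  refine LinearMap.congr_fun (hj.ext_of_lett hj.local_LC
    (g := (shL hj Z U Y).flip (cup φ g))
    (g' := (lact.flip (g U)).comp ((evL hj Z U Y).flip φ) +
      (cup.flip g).comp ((shL hj Z U Y).flip φ)) fun a => ?_) b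
  simp only [LinearMap.comp_apply, LinearMap.flip_apply, LinearMap.add_apply, shL_lett, evL_lett,
    sh_cup]

lemma shL_sg (b : B.Hom (e U) (e Z)) (φ : LC H B e Z Y) :
    shL hj Z U Y b (sg φ) = sg (shL hj Z U Y b φ) := by
  refine LinearMap.congr_fun (hj.ext_of_lett hj.local_LC
    (g := (shL hj Z U Y).flip (sg φ)) (g' := sg.comp ((shL hj Z U Y).flip φ)) fun a => ?_) b
  simp only [LinearMap.comp_apply, LinearMap.flip_apply, shL_lett, sh_sg]

lemma evL_sg (b : B.Hom (e U) (e Z)) (φ : LC H B e Z Y) :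
    evL hj Z U Y b (sg φ) = B.sgn (evL hj Z U Y b φ) := by
  refine LinearMap.congr_fun (hj.ext_of_lett (hj.isLocal _ _)
    (g := (evL hj Z U Y).flip (sg φ)) (g' := B.sgn.comp ((evL hj Z U Y).flip φ)) fun a => ?_) b
  simp only [LinearMap.comp_apply, LinearMap.flip_apply, evL_lett, sg_apply]

lemma evL_eq_zero {φ : LC H B e Z Y} (h : φ 0 U = 0) (b : B.Hom (e U) (e Z)) :
    evL hj Z U Y b φ = 0 := by
  refine LinearMap.congr_fun (hj.ext_of_lett (hj.isLocal _ _)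
    (g := (evL hj Z U Y).flip φ) (g' := 0) fun a => ?_) b
  simp only [LinearMap.flip_apply, evL_lett, h, LinearMap.zero_apply]

lemma evL_self (b : B.Hom (e U) (e Z)) : evL hj Z U (e Z) b (j Z) = b :=
  LinearMap.congr_fun (hj.ext_of_lett (hj.isLocal _ _)
    (g := (evL hj Z U (e Z)).flip (j Z)) (g' := LinearMap.id) fun a => evL_lett hj a (j Z)) b

lemma shL_self (b : B.Hom (e U) (e Z)) : shL hj Z U (e Z) b (j Z) = 0 :=
  LinearMap.congr_fun (hj.ext_of_lett hj.local_LC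
    (g := (shL hj Z U (e Z)).flip (j Z)) (g' := 0) fun a =>
      (shL_lett hj a (j Z)).trans (hj.sh a)) b

lemma shL_van {q : ℕ} {φ : LC H B e Z Y} (h : Van (q + 1) φ) (b : B.Hom (e U) (e Z)) :
    Van q (shL hj Z U Y b φ) := by
  intro n hn V
  refine LinearMap.congr_fun (hj.ext_of_lett ((hj.isLocal _ _).hom _)
    (g := (LinearMap.proj V).comp ((LinearMap.proj n).comp ((shL hj Z U Y).flip φ)))
    (g' := 0) fun a => ?_) b
  simp only [LinearMap.comp_apply, LinearMap.flip_apply, shL_lett, LinearMap.zero_apply]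
  exact h.sh a n hn V

lemma ract_insL (h : Tot (H.Hom W U)) (φ : LC H B e Z Y) (v : LC H B e U (e Z)) :
    ract h (insL hj φ v) = insL hj φ (ract h v) := by
  ext V a
  · rw [ract_apply, H.mulFirst_single, insL_zero, insL_zero, ract_apply, H.mulFirst_single]
  · rw [← sh_apply, ← sh_apply, sh_ract, sh_insL, sh_insL, ract_apply, H.mulFirst_single, sh_ract]

lemma insL_lact (h : Tot (H.Hom W Z)) (φ : LC H B e Z Y) (v : LC H B e U (e W)) :
    insL hj φ (lact (lett j W Z h) v) = insL hj (ract h φ) v := by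
  funext n V
  induction n generalizing U with
  | zero => ext w; rw [insL_zero, insL_zero, lact_apply, evL_lett_mul]
  | succ n ih =>
    refine H.word_ext fun X a w => ?_
    have := LinearMap.congr_fun (ih (sh a v)) w
    rw [← sh_apply, ← sh_apply, sh_insL, sh_insL, lact_apply, sh_lact, shL_lett_mul]
    simp only [Pi.add_apply, LinearMap.add_apply, this]

lemma insL_cup (φ : LC H B e Z Y) (g : AA H B e) (v : LC H B e U (e Z)) :
    insL hj (cup φ g) v = cup (insL hj φ v) g := by
  funext n V
  induction n generalizing U with
  | zero => ext w; rw [insL_zero, evL_eq_zero hj rfl, cup_zero]; rfl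
  | succ n ih =>
    refine H.word_ext fun X a w => ?_
    have := LinearMap.congr_fun (ih (sh a v)) w
    rw [← sh_apply, ← sh_apply, sh_insL, sh_cup, shL_cup, sh_insL, insL_zero, map_add]
    simp only [Pi.add_apply, LinearMap.add_apply, this]
    abel

lemma insL_sg (φ : LC H B e Z Y) (v : LC H B e U (e Z)) :
    insL hj (sg φ) v = sg (insL hj φ v) := by
  funext n V
  induction n generalizing U with
  | zero => ext w; rw [insL_zero, evL_sg]; rfl
  | succ n ih =>
    refine H.word_ext fun X a w => ?_
    have := LinearMap.congr_fun (ih (sh a v)) w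
    rw [← sh_apply, ← sh_apply, sh_insL, sh_sg, sh_insL, shL_sg, map_add]
    simp only [Pi.add_apply, LinearMap.add_apply, this]

lemma insL_self (v : LC H B e U (e Z)) : insL hj (j Z) v = v := by
  funext n V
  induction n generalizing U with
  | zero => ext w; rw [insL_zero, evL_self]
  | succ n ih =>
    refine H.word_ext fun X a w => ?_
    rw [← sh_apply, sh_insL, shL_self, zero_add, ih]; rfl

lemma insL_van {q r : ℕ} {φ : LC H B e Z Y} (hφ : Van q φ) {v : LC H B e U (e Z)} (hv : Van r v) :
    Van (q + r) (insL hj φ v) := by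
  intro n hn V
  induction n generalizing U r with
  | zero =>
    ext w
    rw [insL_zero]
    rcases Nat.eq_zero_or_pos r with rfl | h
    · rw [evL_eq_zero hj (hφ 0 (by omega) V)]; rfl
    · rw [hv 0 h, LinearMap.zero_apply, map_zero]; rfl
  | succ n ih =>
    refine H.word_ext fun X a w => ?_
    rw [← sh_apply, sh_insL]
    rcases Nat.eq_zero_or_pos r with rfl | h
    · obtain ⟨q, rfl⟩ : ∃ q', q = q' + 1 := ⟨q - 1, by omega⟩
      rw [Pi.add_apply, Pi.add_apply, shL_van hj hφ _ n (by omega),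
        ih (r := 0) (v := sh a v) (fun n hn => absurd hn n.not_lt_zero) (by omega), add_zero]
      rfl
    · obtain ⟨r, rfl⟩ : ∃ q', r = q' + 1 := ⟨r - 1, by omega⟩
      rw [Pi.add_apply, Pi.add_apply, hv 0 (by omega), ih (hv.sh a) (by omega)]
      simp

/-- Insertion into the first letter commutes with the bar differential up to the failure of the
inserted cochain to be a derivation. -/
lemma insL_pb (φ : LC H B e Z Y) {v v' : LC H B e U (e Z)} (hv : sg v = -tw v') :
    insL hj (pb φ) v - pb (insL hj φ v') =
      insL hj φ (cup (sg v) j) - insL hj φ (pb v') := by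
  funext n V
  induction n generalizing U with
  | zero =>
    ext w
    simp only [Pi.sub_apply, LinearMap.sub_apply, insL_zero, pb_zero, cup_zero]
    rw [evL_eq_zero hj rfl]
    simp
  | succ n ih =>
    refine H.word_ext fun X a w => ?_
    have h1 : sg (sh a v) = -tw (-sh (totSign _ a) v') := by
      rw [← sh_sg, hv, map_neg, sh_tw, map_neg]
    have h2 : B.sgn (v 0 X (H.single X U a)) = v' 0 X (H.single X U (totSign _ a)) := by
      have := LinearMap.congr_fun (congrFun (congrFun hv 0) X) (H.single X U a)
      rw [sg_apply] at this
      rw [this]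
      change -(v' 0 X (H.wSgn 0 X U _)) = _
      rw [H.wSgn_single, map_neg, neg_neg]
    have h3 : ∀ ψ : LC H B e U (e Z), ψ 0 X = 0 → sh a (insL hj φ ψ) = insL hj φ (sh a ψ) :=
      fun ψ hψ => by rw [sh_insL, hψ, LinearMap.zero_apply, map_zero, LinearMap.zero_apply, zero_add]
    have h4 := LinearMap.congr_fun (ih h1) w
    rw [← sh_apply, ← sh_apply, map_sub, map_sub, h3 _ rfl, h3 _ rfl, sh_insL, sh_pb, shL_pb,
      sh_cup, sh_pb, sh_insL, ract_insL, sg_apply, h2, map_add, map_add, map_sub, sh_sg]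
    simp only [Pi.add_apply, Pi.sub_apply, LinearMap.add_apply, LinearMap.sub_apply, map_neg,
      Pi.neg_apply, sub_neg_eq_add] at h4 ⊢
    rw [← sub_eq_zero] at h4 ⊢
    rw [← h4]
    abel

section

variable (s : ∀ X Y : H.Obj, Tot (H.Hom X Y) →ₗ[R] Tot (H.Hom X Y))

lemma ins_sg (φ : LC H B e Z Y) (v : AA H B e) : ins hj s (sg φ) v = sg (ins hj s φ v) := by
  funext n V
  induction n generalizing Z with
  | zero => ext w; rw [ins_zero, evL_sg]; rfl
  | succ n ih =>
    refine H.word_ext fun X a w => ?_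
    have := LinearMap.congr_fun (ih (sh (s X Z a) φ)) w
    rw [← sh_apply, ← sh_apply, sh_ins, sh_sg, sh_sg, sh_ins, insL_sg, sh_sg, map_add]
    simp only [Pi.add_apply, LinearMap.add_apply, this]

lemma ins_self (v : AA H B e) : ins hj s (j Z) v = v Z := by
  ext V a
  · rw [ins_zero, evL_self]
  · rw [← sh_apply, sh_ins, hj.sh, map_zero, LinearMap.zero_apply, add_zero, insL_self]; rfl

lemma ins_van {q r : ℕ} {φ : LC H B e Z Y} (hφ : Van q φ) {v : AA H B e} (hv : ∀ X, Van r (v X)) :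
    Van (q + r) (ins hj s φ v) := by
  intro n hn V
  induction n generalizing Z q with
  | zero => exact insL_van hj hφ (hv Z) 0 hn V
  | succ n ih =>
    refine H.word_ext fun X a w => ?_
    rw [← sh_apply, sh_ins, Pi.add_apply, Pi.add_apply, LinearMap.add_apply, sh_apply,
      insL_van hj hφ (hv Z) (n + 1) hn V]
    rcases Nat.eq_zero_or_pos q with rfl | h
    · rw [ih (q := 0) (fun n hn => absurd hn n.not_lt_zero) (by omega)]; simp
    · obtain ⟨q, rfl⟩ : ∃ q', q = q' + 1 := ⟨q - 1, by omega⟩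
      rw [ih (hφ.sh _) (by omega)]; simp

end

lemma shL_lact {Y' : B.Obj} (b : B.Hom (e U) (e Z)) (c : B.Hom Y Y') (φ : LC H B e Z Y) :
    shL hj Z U Y' b (lact c φ) = lact c (shL hj Z U Y b φ) := by
  refine LinearMap.congr_fun (hj.ext_of_lett hj.local_LC
    (g := (shL hj Z U Y').flip (lact c φ)) (g' := (lact c).comp ((shL hj Z U Y).flip φ))
    fun a => ?_) b
  simp only [LinearMap.comp_apply, LinearMap.flip_apply, shL_lett, sh_lact]

lemma evL_lact {Y' : B.Obj} (b : B.Hom (e U) (e Z)) (c : B.Hom Y Y') (φ : LC H B e Z Y) :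
    evL hj Z U Y' b (lact c φ) = B.mul c (evL hj Z U Y b φ) := by
  refine LinearMap.congr_fun (hj.ext_of_lett (hj.isLocal _ _)
    (g := (evL hj Z U Y').flip (lact c φ)) (g' := (B.mul c).comp ((evL hj Z U Y).flip φ))
    fun a => ?_) b
  simp only [LinearMap.comp_apply, LinearMap.flip_apply, evL_lett, lact_apply]

lemma lact_insL {Y' : B.Obj} (c : B.Hom Y Y') (φ : LC H B e Z Y) (v : LC H B e U (e Z)) :
    insL hj (lact c φ) v = lact c (insL hj φ v) := by
  funext n V
  induction n generalizing U with
  | zero => ext w; rw [insL_zero, evL_lact]; rfl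
  | succ n ih =>
    refine H.word_ext fun X a w => ?_
    have := LinearMap.congr_fun (ih (sh a v)) w
    rw [← sh_apply, ← sh_apply, sh_insL, sh_lact, sh_insL, shL_lact, map_add]
    simp only [Pi.add_apply, LinearMap.add_apply, this]

lemma lact_ins (s) {Y' : B.Obj} (c : B.Hom Y Y') (φ : LC H B e Z Y) (v : AA H B e) :
    ins hj s (lact c φ) v = lact c (ins hj s φ v) := by
  funext n V
  induction n generalizing Z with
  | zero => ext w; rw [ins_zero, evL_lact]; rfl
  | succ n ih =>
    refine H.word_ext fun X a w => ?_
    have := LinearMap.congr_fun (ih (sh (s X Z a) φ)) w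
    rw [← sh_apply, ← sh_apply, sh_ins, sh_lact, sh_lact, sh_ins, lact_insL, sh_lact, map_add]
    simp only [Pi.add_apply, LinearMap.add_apply, this]

lemma ins_cup (φ : LC H B e Z Y) (g v : AA H B e) :
    ins hj (fun _ _ => LinearMap.id) (cup φ g) v = cup (ins hj (fun _ _ => LinearMap.id) φ v) g +
      cup φ (fun X => ins hj (fun _ _ => LinearMap.id) (g X) v) := by
  funext n V
  induction n generalizing Z with
  | zero =>
    ext w
    rw [ins_zero, evL_eq_zero hj rfl, Pi.add_apply, Pi.add_apply, cup_zero, cup_zero]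
    simp
  | succ n ih =>
    refine H.word_ext fun X a w => ?_
    have h1 := LinearMap.congr_fun (ih (sh a φ)) w
    rw [← sh_apply, ← sh_apply, sh_ins, map_add, LinearMap.id_apply, sh_cup a φ g, insL_cup,
      sh_cup, sh_cup, sh_cup, sh_ins, map_add, LinearMap.add_apply, lact_ins, ins_zero, insL_zero,
      map_add, LinearMap.add_apply]
    simp only [Pi.add_apply, LinearMap.add_apply, LinearMap.id_apply] at h1 ⊢
    rw [h1]
    abel

/-- Multiplying the first letter of the argument commutes with insertion up to insertion into
the first letter. -/
lemma ract_ins (s) (h : Tot (H.Hom U Z)) (hs : ∀ V a, H.compTot V U Z h (s V U a) =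
    s V Z (H.compTot V U Z h a)) (φ : LC H B e Z Y) (v : AA H B e) :
    ract h (ins hj s φ v) + insL hj φ (lact (lett j U Z h) (v U)) =
      ins hj s (ract h φ) v + insL hj φ (ract h (v Z)) := by
  refine ext' (fun V a => ?_) fun n V X a w => ?_
  · simp only [Pi.add_apply, LinearMap.add_apply, ract_apply, H.mulFirst_single, ins_zero,
      insL_zero, lact_apply, evL_lett_mul]
    exact add_comm _ _
  · rw [← sh_apply, ← sh_apply, map_add, map_add, sh_ract, sh_ins, sh_ins, sh_ract, hs, insL_lact,
      ← ract_insL, sh_ract]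
    simp only [Pi.add_apply, LinearMap.add_apply]
    abel

/-- The failure of a cochain `v` to be a derivation along `j`. -/
def derErr (j v : AA H B e) : AA H B e := fun X =>
  cup (sg (v X)) j - pb (v X) + cup (sg (j X)) v

/-- Inserting `v` commutes with the bar differential up to the insertion of the failure of `v` to be
a derivation along `j`. -/
lemma ins_pb {v : AA H B e} (hv : ∀ X, sg (v X) = -tw (v X)) (φ : LC H B e Z Y) :
    ins hj (fun _ _ => LinearMap.id) (pb φ) v = pb (ins hj (fun _ _ => LinearMap.id) φ v) +
      ins hj (fun _ _ => -totSign _) φ (derErr j v) := by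
  funext n V
  induction n generalizing Z with
  | zero =>
    ext w
    rw [ins_zero, evL_eq_zero hj rfl, Pi.add_apply, Pi.add_apply, LinearMap.add_apply, pb_zero,
      ins_zero, derErr]
    simp only [Pi.add_apply, Pi.sub_apply, cup_zero, LinearMap.sub_apply, LinearMap.zero_apply,
      pb_zero, map_zero, sub_zero, add_zero]
  | succ n ih =>
    refine H.word_ext fun X a w => ?_
    have h1 := LinearMap.congr_fun (ih (sh (totSign _ a) φ)) w
    have h2 := congrArg (fun ψ => sh a ψ n V w) (insL_pb hj φ (hv Z))
    have h3 := congrFun (congrFun (ract_ins hj (fun _ _ => LinearMap.id) (totSign _ a)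
      (fun _ _ => rfl) φ v) n) V
    have h3' := LinearMap.congr_fun h3 w
    have h4 : sh a (insL hj φ (cup (sg (j Z)) v)) =
        insL hj φ (lact (lett j X Z (totSign _ a)) (v X)) := by
      rw [sh_insL, cup_zero, LinearMap.zero_apply, map_zero, LinearMap.zero_apply, zero_add, sh_cup,
        sh_sg, hj.sh, map_zero, map_zero, LinearMap.zero_apply, add_zero, hj.sign]
      rfl
    rw [← sh_apply, ← sh_apply, sh_ins, map_add, LinearMap.id_apply, sh_pb, sh_pb, sh_ins, sh_ins,
      LinearMap.neg_apply, derErr, map_add (insL hj φ), map_sub (insL hj φ), map_add (sh a), h4,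
      map_sub, LinearMap.sub_apply, map_neg, LinearMap.id_apply]
    rw [map_sub, map_sub, sh_pb] at h2
    simp only [Pi.add_apply, Pi.sub_apply, LinearMap.add_apply, LinearMap.sub_apply, map_add,
      map_sub, Pi.neg_apply, LinearMap.neg_apply, map_neg, ract_insL] at h1 h2 h3' ⊢
    rw [h1]
    rw [← sub_eq_zero] at h2 h3' ⊢
    refine Eq.trans ?_ ((congrArg₂ (· - ·) h2 h3').trans (sub_zero 0))
    abel

end LC

namespace LC

variable {R : Type u} [CommRing R] {H : DGCat.{u} R} {B : SCat.{u} R} {e : H.Obj → B.Obj}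
  {Z U V W : H.Obj} {Y : B.Obj} {n : ℕ}

/-- The Euler operator, which multiplies a cochain by `n` on words with `n + 1` letters. -/
def eul : LC H B e Z Y →ₗ[R] LC H B e Z Y where
  toFun φ n V := (n : R) • φ n V
  map_add' φ ψ := by funext n V; simp
  map_smul' r φ := by funext n V; exact smul_comm (n : R) r (φ n V)

lemma eul_apply (φ : LC H B e Z Y) (w : H.Word n V Z) : eul φ n V w = (n : R) • φ n V w := rfl

lemma sh_eul (a : Tot (H.Hom U Z)) (φ : LC H B e Z Y) : sh a (eul φ) = eul (sh a φ) + sh a φ := by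
  funext n V; ext w
  rw [Pi.add_apply, Pi.add_apply, LinearMap.add_apply, eul_apply, sh_apply, sh_apply, eul_apply]
  push_cast; rw [add_smul, one_smul]

lemma eul_lact {Y' : B.Obj} (c : B.Hom Y Y') (φ : LC H B e Z Y) :
    eul (lact c φ) = lact c (eul φ) := by
  funext n V; ext w
  rw [eul_apply, lact_apply, lact_apply, eul_apply, map_smul]

lemma eul_sg (φ : LC H B e Z Y) : eul (sg φ) = sg (eul φ) := by
  funext n V; ext w
  rw [eul_apply, sg_apply, sg_apply, eul_apply, map_smul]

lemma eul_pb (φ : LC H B e Z Y) : pb (eul φ) = eul (pb φ) - pb φ := by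
  funext n V; ext w
  cases n with
  | zero => simp [eul_apply, pb_zero]
  | succ n =>
    simp only [Pi.sub_apply, LinearMap.sub_apply, eul_apply, pb_succ]
    push_cast; rw [add_smul, one_smul, add_sub_cancel_right]

lemma eul_cup (φ : LC H B e Z Y) (g : AA H B e) :
    cup (eul φ) g + cup φ (fun X => eul (g X)) = eul (cup φ g) - cup φ g := by
  funext n V
  induction n generalizing Z with
  | zero => ext w; simp [eul_apply, cup_zero]
  | succ n ih =>
    refine H.word_ext fun X a w => ?_
    have h1 := LinearMap.congr_fun (ih (sh a φ)) w
    rw [← sh_apply, ← sh_apply, map_sub, map_add, sh_eul, sh_cup, sh_cup, sh_cup, sh_eul,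
      eul_apply, map_add, map_add, eul_lact]
    simp only [Pi.add_apply, Pi.sub_apply, LinearMap.add_apply, LinearMap.sub_apply, Nat.cast_zero,
      zero_smul, map_zero, LinearMap.zero_apply, Pi.zero_apply] at h1 ⊢
    rw [← sub_eq_zero] at h1 ⊢
    refine Eq.trans ?_ h1
    abel

lemma IsHomog.eul {k : ℤ} {φ : LC H B e Z Y} (h : IsHomog k φ) : IsHomog k (eul φ) :=
  fun n V => (h n V).smul _

lemma _root_.Homog.of_smul {M : Type u} [AddCommGroup M] [Module R M] {D : ℤ → Submodule R M}
    {r : R} (hD : ∀ k x, r • x ∈ D k → x ∈ D k) {X Y : H.Obj} {k : ℤ} {φ : H.Word n X Y →ₗ[R] M}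
    (h : Homog D n k (r • φ)) : Homog D n k φ := by
  induction n generalizing Y k with
  | zero => exact fun i a => hD _ _ (h i a)
  | succ n ih => exact fun Z i a => ih (h Z i a)

variable {j : AA H B e} (hj : IsLoc j)

section Homogeneous

variable (P : B.Proj) (hjh : ∀ X Y i (a : (H.Hom X Y).X i),
  lett j X Y (tof _ i a) ∈ B.deg (X := e X) (Y := e Y) i)

include hj P

lemma deg_of_smul {X Y : B.Obj} {r : R} (hr : r ∈ nonZeroDivisors R) (k : ℤ) (x : B.Hom X Y)
    (h : r • x ∈ B.deg (X := X) (Y := Y) k) : x ∈ B.deg (X := X) (Y := Y) k := by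
  have : P.ρ k x = x := (hj.isLocal X Y).eq_of_smul hr (by rw [← map_smul, P.eq_self k _ h])
  rw [← this]; exact P.mem k x

include hjh

lemma exists_smul_eq_lett {k : ℤ} {b : B.Hom (e U) (e Z)}
    (hb : b ∈ B.deg (X := e U) (Y := e Z) k) :
    ∃ r ∈ nonZeroDivisors R, ∃ a, r • b = lett j U Z (tof _ k a) := by
  have := hj.loc U Z
  obtain ⟨⟨a, r⟩, h⟩ := IsLocalizedModule.surj (nonZeroDivisors R) (lett j U Z) b
  have key : ∀ a, P.ρ k (lett j U Z a) = lett j U Z (tof _ k (tcomp _ k a)) := fun a => by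
    induction a using tot_induction with
    | h0 => simp only [map_zero]
    | h2 x y hx hy => simp only [map_add, hx, hy]
    | h1 i a =>
      by_cases hik : i = k
      · subst hik; rw [tcomp_tof, P.eq_self i _ (hjh U Z i a)]
      · rw [tcomp_tof_ne hik, map_zero, map_zero, P.eq_zero i k _ (hjh U Z i a) hik]
  refine ⟨r, r.2, tcomp _ k a, ?_⟩
  rw [← key, ← h, ← P.eq_self k _ hb]
  exact (P.eq_self k _ ((B.deg (X := e U) (Y := e Z) k).smul_mem (r : R) (P.mem k b))).symm

lemma IsHomog.shL {k : ℤ} {φ : LC H B e Z Y} (hφ : IsHomog k φ) {i : ℤ} {b : B.Hom (e U) (e Z)}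
    (hb : b ∈ B.deg (X := e U) (Y := e Z) i) : IsHomog (k + i - 1) (shL hj Z U Y b φ) := by
  obtain ⟨r, hr, a, h⟩ := exists_smul_eq_lett hj P hjh hb
  intro n V
  refine Homog.of_smul (r := r) (deg_of_smul hj P hr) ?_
  have : r • LC.shL hj Z U Y b φ = LC.sh (tof _ i a) φ := by
    rw [← shL_lett hj, ← h, map_smul, LinearMap.smul_apply]
  exact (congrArg (fun ψ : LC H B e U Y => Homog _ n (k + i - 1 - n) (ψ n V)) this).mpr
    (hφ.sh i a n V)

lemma evL_mem {k : ℤ} {φ : LC H B e Z Y} (hφ : IsHomog k φ) {i : ℤ} {b : B.Hom (e U) (e Z)}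
    (hb : b ∈ B.deg (X := e U) (Y := e Z) i) :
    evL hj Z U Y b φ ∈ B.deg (X := e U) (Y := Y) (k + i) := by
  obtain ⟨r, hr, a, h⟩ := exists_smul_eq_lett hj P hjh hb
  refine deg_of_smul hj P hr _ _ ?_
  rw [← LinearMap.smul_apply, ← map_smul, h, evL_lett]
  exact hφ.apply i a

lemma IsHomog.insL {k l : ℤ} {φ : LC H B e Z Y} (hφ : IsHomog k φ) {v : LC H B e U (e Z)}
    (hv : IsHomog l v) : IsHomog (k + l) (insL hj φ v) := by
  intro n V
  induction n generalizing U l with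
  | zero =>
    intro i a
    have := evL_mem hj P hjh hφ (hv.apply (V := V) i a)
    simpa [insL_zero, add_assoc] using this
  | succ n ih =>
    intro X i a
    have h1 := (hφ.shL hj P hjh (hv.apply (V := X) i a) n V).add
      ((ih (hv.sh i a)).of_eq (show _ = k + (l + i) - 1 - n by omega))
    refine Homog.of_eq (?_ : Homog _ n _ (LC.sh (tof _ i a) (LC.insL hj φ v) n V))
      (show (k + (l + i) - 1 - n : ℤ) = _ by push_cast; omega)
    rw [sh_insL]; exact h1

lemma IsHomog.ins {k l : ℤ} {φ : LC H B e Z Y} (hφ : IsHomog k φ) {v : AA H B e}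
    (hv : ∀ X, IsHomog l (v X)) : IsHomog (k + l) (ins hj (fun _ _ => LinearMap.id) φ v) := by
  intro n V
  induction n generalizing Z k with
  | zero => exact hφ.insL hj P hjh (hv Z) 0 V
  | succ n ih =>
    intro X i a
    have h1 := (((hφ.insL hj P hjh (hv Z)).sh i a) n V).add
      ((ih (hφ.sh i a)).of_eq (show _ = k + l + i - 1 - n by omega))
    refine Homog.of_eq (?_ : Homog _ n _
      (LC.sh (tof _ i a) (LC.ins hj (fun _ _ => LinearMap.id) φ v) n V))
      (show (k + l + i - 1 - n : ℤ) = _ by push_cast; omega)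
    rw [sh_ins]; exact h1

end Homogeneous

section Solve

variable (s : ∀ X Y : H.Obj, Tot (H.Hom X Y) →ₗ[R] Tot (H.Hom X Y)) {f : AA H B e}
  (hf : ∀ X, Van 1 (f X - j X))

include hf in
lemma ins_leading {r : ℕ} {v : AA H B e} (hv : ∀ X, Van r (v X)) (X : H.Obj) :
    Van (r + 1) (ins hj s (f X) v - v X) := by
  have h1 := ins_van hj s (hf X) hv
  rw [map_sub, LinearMap.sub_apply, ins_self, add_comm] at h1
  exact h1

include hf in
/-- The equation `ins f v = r` can be solved up to any word length. -/
lemma exists_ins_eq (P : B.Proj) (hjh : ∀ X Y i (a : (H.Hom X Y).X i),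
      lett j X Y (tof _ i a) ∈ B.deg (X := e X) (Y := e Y) i)
    (hfh : ∀ X, IsHomog 0 (f X)) {r : AA H B e} (hr : ∀ X, IsHomog 0 (r X))
    (hr1 : ∀ X, Van 1 (r X)) (N : ℕ) :
    ∃ v : AA H B e, (∀ X, IsHomog 0 (v X)) ∧ (∀ X, Van 1 (v X)) ∧
      (∀ X, ∀ n ≥ N + 1, ∀ V, v X n V = 0) ∧
      ∀ X, Van (N + 1) (ins hj (fun _ _ => LinearMap.id) (f X) v - r X) := by
  induction N with
  | zero =>
    refine ⟨0, fun X => IsHomog.zero 0, fun X n hn V => rfl, fun X n hn V => rfl, fun X => ?_⟩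
    rw [map_zero, zero_sub]; exact (hr1 X).neg
  | succ N ih =>
    obtain ⟨v, hv, hv1, hvN, hE⟩ := ih
    set δ : AA H B e := fun X =>
      only (N + 1) (ins hj (fun _ _ => LinearMap.id) (f X) v - r X) with hδ
    have hδv : ∀ X, Van (N + 1) (δ X) := fun X => van_only _ _
    refine ⟨v - δ, fun X => (hv X).sub ((((hfh X).ins hj P hjh hv).sub (hr X)).only _),
      fun X => (hv1 X).sub ((hδv X).mono (by omega)), fun X n hn V => ?_, fun X => ?_⟩
    · change v X n V - δ X n V = 0
      rw [hvN X n (by omega) V, show δ X n V = 0 from only_ne _ (by omega), sub_zero]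
    · have h1 := (van_sub_only (hE X)).sub (ins_leading hj (fun _ _ => LinearMap.id) hf hδv X)
      convert h1 using 1
      rw [map_sub]
      abel

end Solve

lemma cup_succ_eq_zero {φ : LC H B e Z Y} {g : AA H B e} (h : ∀ V, φ n V = 0)
    (hg : ∀ {X Y : H.Obj} (a : Tot (H.Hom X Y)), sh a (g Y) = 0) : cup φ g (n + 1) V = 0 := by
  induction n generalizing Z with
  | zero =>
    refine H.word_ext fun X a w => ?_
    rw [cup_cons, h X, cup_zero]; simp
  | succ n ih =>
    refine H.word_ext fun X a w => ?_
    have h1 : g X (n + 1) V = 0 := H.word_ext fun Y b w => by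
      rw [← sh_apply, hg]; rfl
    rw [cup_cons, h1, ih (φ := sh a φ) fun W => by ext w; rw [sh_apply, h]; rfl]
    simp

lemma isLoc_of_locQI {f : AA H B e} (hB : ∀ X Y (x : B.Hom X Y), B.d x = 0)
    (hl : ∀ X Y, IsLocal R (B.Hom X Y)) (hf : ∀ X, IsHomog 0 (f X)) (hκ : ∀ X, Van 2 (curv f X))
    (hL : LocQI f) : IsLoc (fun X => only 0 (f X)) := by
  have hsg : ∀ {X Y : H.Obj} (a : Tot (H.Hom X Y)), lett f X Y (totSign _ a) =
      B.sgn (lett f X Y a) := fun {X Y} a => by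
    have := LinearMap.congr_fun (congrFun (congrFun (hf Y).odd 0) X) (H.single X Y a)
    change B.sgn (f Y 0 X _) = -f Y 0 X (H.wSgn 0 X Y _) at this
    rw [H.wSgn_single, map_neg, neg_neg] at this
    exact this.symm
  refine ⟨fun X Y => ⟨(hl _ _).isUnit, fun b => ?_, fun {x x'} h => ⟨1, ?_⟩⟩, hl,
    fun {X Y Z} a b => ?_, fun {X Y} a => hsg a, fun {X Y} a => ?_⟩
  · obtain ⟨r, hr, a, y, h⟩ := hL.surj X Y b (hB _ _ _)
    rw [hB, add_zero] at h
    exact ⟨(a, ⟨r, hr⟩), h⟩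
  · rw [one_smul, one_smul, ← sub_eq_zero]
    refine hL.inj X Y _ ⟨0, ?_⟩
    rw [map_zero, map_sub, map_sub, sub_eq_zero]
    exact h
  · have h1 := LinearMap.congr_fun (hκ Z 1 (by omega) X) (H.cons 0 X Y Z (totSign _ a)
      (H.single X Y b))
    have h2 : curv f Z 1 X = dd (f Z) 1 X + pb (f Z) 1 X - cup (sg (f Z)) f 1 X := rfl
    rw [h2, LinearMap.sub_apply, LinearMap.add_apply, dd_apply, hB, zero_add, pb_succ, H.bS_zero,
      totSign_totSign, H.mulFirst_single, cup_cons, cup_zero, LinearMap.zero_apply, add_zero,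
      sg_apply, LinearMap.zero_apply, sub_eq_zero] at h1
    refine h1.trans ?_
    change B.mul (B.sgn (lett f Y Z (totSign _ a))) _ = B.mul (lett f Y Z a) _
    rw [hsg, B.sgn_sgn]
    rfl
  · funext n V
    ext w
    rw [sh_apply, only_ne _ (Nat.succ_ne_zero n)]; rfl

/-- Twisting cochains with values in the localization of `H` extend. The Euler operator
`f ↦ (n ↦ n fₙ)` is the insertion of a cochain `v` into `f` up to the top word length; solving
for the top component of `f` makes this true there as well, and then the curvature vanishes. -/
theorem HasExtensions.of_isLocal [IsDomain R] [CharZero R] (P : B.Proj)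
    (hB : ∀ X Y (x : B.Hom X Y), B.d x = 0) (hl : ∀ X Y, IsLocal R (B.Hom X Y)) :
    HasExtensions H B := by
  intro e p f hp hf hκ hL
  obtain ⟨p, rfl⟩ : ∃ q, p = q + 2 := ⟨p - 2, by omega⟩
  have hj := isLoc_of_locQI hB hl hf (fun X => (hκ X).mono hp) hL
  set j : AA H B e := fun X => only 0 (f X) with hjdef
  have hjh : ∀ X Y i (a : (H.Hom X Y).X i),
      lett j X Y (tof _ i a) ∈ B.deg (X := e X) (Y := e Y) i := fun X Y i a => by
    have := (hf Y).apply (V := X) i a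
    rw [zero_add] at this
    exact this
  have hfj : ∀ X, Van 1 (f X - j X) := fun X => van_sub_only fun n hn => absurd hn n.not_lt_zero
  set S : ∀ X Y : H.Obj, Tot (H.Hom X Y) →ₗ[R] Tot (H.Hom X Y) := fun _ _ => LinearMap.id with hS
  obtain ⟨v, hv, hv1, hvN, hvE⟩ := exists_ins_eq hj hfj P hjh hf (fun X => (hf X).eul)
    (r := fun X => eul (f X)) (fun X n hn V => by
      obtain rfl : n = 0 := by omega
      ext w; rw [eul_apply]; simp) p
  -- the correction of the top component, multiplied by `p + 1`
  have hp1 : ((p + 1 : ℕ) : R) ∈ nonZeroDivisors R :=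
    mem_nonZeroDivisors_of_ne_zero (Nat.cast_ne_zero.2 p.succ_ne_zero)
  have hloc : ∀ X, IsLocal R (LC H B e X (e X)) := fun X => hj.local_LC
  choose δ hδ using fun X => (hloc X _ hp1).2 (only (p + 1) (ins hj S (f X) v - eul (f X)))
  have hδ' : ∀ X, ((p + 1 : ℕ) : R) • δ X = only (p + 1) (ins hj S (f X) v - eul (f X)) := hδ
  have hδv : ∀ X n, n ≠ p + 1 → ∀ V, δ X n V = 0 := fun X n hn V => by
    refine ((hj.isLocal _ _).hom _).eq_of_smul hp1 ?_
    have := congrFun (congrFun (hδ' X) n) V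
    rw [smul_zero]
    exact this.trans (only_ne _ hn)
  have hδh : ∀ X, IsHomog 0 (δ X) := fun X n V => by
    refine Homog.of_smul (r := ((p + 1 : ℕ) : R)) (deg_of_smul hj P hp1) ?_
    have := congrFun (congrFun (hδ' X) n) V
    refine (congrArg (Homog _ n _) this).mpr ?_
    exact (((((hf X).ins hj P hjh hv).of_eq (zero_add 0)).sub (hf X).eul).only (p + 1)) n V
  have hδV : ∀ X, Van (p + 1) (δ X) := fun X n hn => hδv X n hn.ne
  set g : AA H B e := f + δ with hg
  have hgh : ∀ X, IsHomog 0 (g X) := fun X => (hf X).add (hδh X)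
  have hgf : ∀ X, Van (p + 1) (g X - f X) := fun X => by
    rw [hg, Pi.add_apply, add_sub_cancel_left]; exact hδV X
  have hgj : ∀ X, Van 1 (g X - j X) := fun X => by
    convert (hfj X).add ((hδV X).mono (show 1 ≤ p + 1 by omega)) using 1
    rw [hg, Pi.add_apply]; abel
  have hdd : ∀ {Z} {Y} (φ : LC H B e Z Y), dd φ = 0 := fun φ => by
    funext n V; ext w; exact hB _ _ _
  have hgκ : ∀ X, Van (p + 2) (curv g X) := fun X => by
    have h1 := van_curv_sub hgf X
    rw [hdd, sub_zero] at h1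
    convert h1.add (hκ X) using 1
    abel
  -- insertion of `v` into `g` is the Euler operator on words with at most `p + 2` letters
  have hgv : ∀ X, Van (p + 2) (ins hj S (g X) v - eul (g X)) := fun X => by
    have h1 : Van (p + 2) (ins hj S (f X) v - eul (f X) - ((p + 1 : ℕ) : R) • δ X) := by
      rw [hδ']; exact van_sub_only (hvE X)
    have h2 : Van (p + 2) (((p + 1 : ℕ) : R) • δ X - eul (δ X)) := by
      intro n hn V
      ext w
      change ((p + 1 : ℕ) : R) • δ X n V w - (n : R) • δ X n V w = 0
      by_cases h : n = p + 1
      · subst h; rw [sub_self]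
      · rw [hδv X n h]; simp
    convert (h1.add h2).add (ins_van hj S (hδV X) hv1) using 1
    rw [hg]
    simp only [Pi.add_apply, map_add, LinearMap.add_apply]
    abel
  have hvo : ∀ X, sg (v X) = -tw (v X) := fun X => (hv X).odd
  -- the Euler operator on the curvature
  have key : ∀ X, Van (p + 3) (eul (curv g X) - curv g X +
      ins hj (fun _ _ => -totSign _) (g X) (derErr j v)) := fun X => by
    have h1 : Van (p + 3) (ins hj S (curv g X) v) := ins_van hj S (hgκ X) hv1
    have h2 := (hgv X).pb
    have h3 : Van (p + 3) (cup (sg (ins hj S (g X) v - eul (g X))) g) := (hgv X).sg.cup_left g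
    have h4 : Van (p + 3) (cup (sg (g X)) (fun X => ins hj S (g X) v - eul (g X))) :=
      Van.cup_right _ hgv
    have h5 := eul_cup (sg (g X)) g
    have h6 := eul_pb (g X)
    have h7 : curv g X = pb (g X) - cup (sg (g X)) g := by rw [curv, hdd, zero_add]
    rw [h7, map_sub, LinearMap.sub_apply, ins_pb hj hvo, ins_cup, ins_sg] at h1
    convert ((h1.sub h2).add h3).add h4 using 1
    rw [h7]
    have h8 : (fun X => ins hj S (g X) v - eul (g X)) = (fun X => ins hj S (g X) v) -
      fun X => eul (g X) := rfl
    rw [h8]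
    simp only [map_sub, LinearMap.sub_apply, h6]
    rw [← eul_sg] at *
    rw [← sub_eq_zero] at h5 ⊢
    rw [← h5]
    abel
  have hu : ∀ m ≤ p + 2, ∀ X, Van m (derErr j v X) := by
    intro m hm
    induction m with
    | zero => exact fun X n hn => absurd hn n.not_lt_zero
    | succ m ih =>
      intro X
      have h1 := ins_leading hj (fun _ _ => -totSign _) hgj (ih (by omega)) X
      have h2 : Van (p + 2) (eul (curv g X) - curv g X) := by
        refine Van.sub (fun n hn V => ?_) (hgκ X)
        ext w; rw [eul_apply, hgκ X n hn]; simp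
      convert (((key X).mono (show m + 1 ≤ p + 3 by omega)).sub (h2.mono hm)).sub h1 using 1
      abel
  have hu' : ∀ X, Van (p + 3) (derErr j v X) := fun X => by
    refine Van.succ (hu _ le_rfl X) fun V => ?_
    have hv0 : ∀ Y W, v Y (p + 1) W = 0 := fun Y W => hvN Y (p + 1) le_rfl W
    have h1 : cup (sg (v X)) j (p + 2) V = 0 := cup_succ_eq_zero (fun W => by
      ext w; rw [sg_apply, hv0]; simp) hj.sh
    have h2 : pb (v X) (p + 2) V = 0 := by
      ext w; rw [pb_succ, hv0]; rfl
    have h3 : cup (sg (j X)) v (p + 2) V = 0 := H.word_ext fun Y a w => by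
      rw [cup_cons, hv0, sh_sg, hj.sh]; simp
    change cup (sg (v X)) j (p + 2) V - pb (v X) (p + 2) V + cup (sg (j X)) v (p + 2) V = 0
    rw [h1, h2, h3, sub_zero, add_zero]
  refine ⟨g, hgh, fun X => (hgf X).mono (by omega), fun X => Van.succ (hgκ X) fun V => ?_⟩
  refine ((hj.isLocal _ _).hom _).eq_of_smul hp1 ?_
  have h1 := ins_van hj (fun _ _ => -totSign _) (q := 0) (φ := g X)
    (fun n hn => absurd hn n.not_lt_zero) hu'
  have h2 := ((key X).sub (h1.mono (by omega))) (p + 2) (by omega) V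
  rw [add_sub_cancel_right] at h2
  rw [smul_zero, ← h2]
  ext w
  change ((p + 1 : ℕ) : R) • curv g X (p + 2) V w = ((p + 2 : ℕ) : R) • curv g X (p + 2) V w -
    curv g X (p + 2) V w
  push_cast
  module

end LC

/-! ### Words read from the right and the Hochschild differential -/

namespace DGCat

variable {R : Type u} [CommRing R] (H : DGCat.{u} R)

section Snoc

variable {M : Type u} [AddCommGroup M] [Module R M] {n : ℕ} {U V X Y Z : H.Obj}

/-- Append a letter at the end of a word. -/
def snoc : ∀ (n : ℕ) (X V Y : H.Obj),
    H.Word n V Y →ₗ[R] Tot (H.Hom X V) →ₗ[R] H.Word (n + 1) X Y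
  | 0, X, V, Y => (H.cons 0 X V Y).compl₂ (H.single X V)
  | n + 1, X, V, Y => H.wordLift n V Y fun Z =>
      LinearMap.mk₂ R (fun a w => (H.cons (n + 1) X Z Y a).comp (snoc n X V Z w))
        (fun a a' w => by ext l; simp) (fun r a w => by ext l; simp)
        (fun a w w' => by ext l; simp) (fun r a w => by ext l; simp)

lemma snoc_single (a : Tot (H.Hom V Y)) (l : Tot (H.Hom X V)) :
    H.snoc 0 X V Y (H.single V Y a) l = H.cons 0 X V Y a (H.single X V l) := rfl

lemma snoc_cons (a : Tot (H.Hom Z Y)) (w : H.Word n V Z) (l : Tot (H.Hom X V)) :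
    H.snoc (n + 1) X V Y (H.cons n V Z Y a w) l = H.cons (n + 1) X Z Y a (H.snoc n X V Z w l) := by
  rw [snoc, wordLift_cons]; rfl

/-- Multiply the last letter of a word. -/
def rmul : ∀ (n : ℕ) (X V Y : H.Obj),
    H.Word n V Y →ₗ[R] Tot (H.Hom X V) →ₗ[R] H.Word n X Y
  | 0, X, V, Y => H.compTot X V Y
  | n + 1, X, V, Y => H.wordLift n V Y fun Z =>
      LinearMap.mk₂ R (fun a w => (H.cons n X Z Y a).comp (rmul n X V Z w))
        (fun a a' w => by ext l; simp) (fun r a w => by ext l; simp)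
        (fun a w w' => by ext l; simp) (fun r a w => by ext l; simp)

lemma rmul_single (a : Tot (H.Hom V Y)) (l : Tot (H.Hom X V)) :
    H.rmul 0 X V Y (H.single V Y a) l = H.single X Y (H.compTot X V Y a l) := rfl

lemma rmul_cons (a : Tot (H.Hom Z Y)) (w : H.Word n V Z) (l : Tot (H.Hom X V)) :
    H.rmul (n + 1) X V Y (H.cons n V Z Y a w) l = H.cons n X Z Y a (H.rmul n X V Z w l) := by
  rw [rmul, wordLift_cons]; rfl

lemma rmul_snoc (w : H.Word n U Y) (l : Tot (H.Hom V U)) (l' : Tot (H.Hom X V)) :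
    H.rmul (n + 1) X V Y (H.snoc n V U Y w l) l' =
      H.snoc n X U Y w (H.compTot X V U l l') := by
  induction n generalizing Y with
  | zero =>
    obtain ⟨b, rfl⟩ := H.single_surjective w
    rw [snoc_single, rmul_cons, rmul_single, snoc_single]
  | succ n ih =>
    induction w using word_induction with
    | h0 => simp
    | h1 Z a w => rw [snoc_cons, rmul_cons, ih, snoc_cons]
    | h2 x y hx hy => simp only [map_add, LinearMap.add_apply, hx, hy]

lemma mulFirst_snoc (a : Tot (H.Hom Y Z)) (w : H.Word n V Y) (l : Tot (H.Hom X V)) :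
    H.mulFirst (n + 1) X Y Z a (H.snoc n X V Y w l) =
      H.snoc n X V Z (H.mulFirst n V Y Z a w) l := by
  cases n with
  | zero =>
    obtain ⟨b, rfl⟩ := H.single_surjective w
    rw [snoc_single, mulFirst_cons, mulFirst_single, snoc_single]
  | succ n =>
    induction w using word_induction with
    | h0 => simp
    | h1 U b w => rw [snoc_cons, mulFirst_cons, mulFirst_cons, snoc_cons]
    | h2 x y hx hy => simp only [map_add, LinearMap.add_apply, hx, hy]

lemma bar_mulFirst (a : Tot (H.Hom Y Z)) (w : H.Word (n + 1) X Y) :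
    H.bar n X Z (H.mulFirst (n + 1) X Y Z a w) = H.mulFirst n X Y Z a (H.bar n X Y w) := by
  induction w using word_induction with
  | h0 => simp
  | h2 x y hx hy => simp only [map_add, hx, hy]
  | h1 U b w =>
    cases n with
    | zero => rw [mulFirst_cons, bar_zero, bar_zero, mulFirst_mulFirst]
    | succ n => rw [mulFirst_cons, bar_succ, bar_succ, map_sub, mulFirst_mulFirst, mulFirst_cons]

lemma bar_bar (w : H.Word (n + 2) X Y) : H.bar n X Y (H.bar (n + 1) X Y w) = 0 := by
  induction n generalizing Y with
  | zero =>
    induction w using word_induction with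
    | h0 => simp
    | h2 x y hx hy => simp only [map_add, hx, hy, add_zero]
    | h1 U b w => rw [bar_succ, map_sub, bar_mulFirst, bar_zero, sub_self]
  | succ n ih =>
    induction w using word_induction with
    | h0 => simp
    | h2 x y hx hy => simp only [map_add, hx, hy, add_zero]
    | h1 U b w =>
      rw [bar_succ, map_sub, bar_mulFirst, bar_succ, ih, map_zero, sub_zero, sub_self]

lemma bar_snoc_zero (w : H.Word 0 V Y) (l : Tot (H.Hom X V)) :
    H.bar 0 X Y (H.snoc 0 X V Y w l) = H.rmul 0 X V Y w l := by
  obtain ⟨b, rfl⟩ := H.single_surjective w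
  rw [snoc_single, bar_zero, mulFirst_single, rmul_single]

lemma bar_snoc (w : H.Word (n + 1) V Y) (l : Tot (H.Hom X V)) :
    H.bar (n + 1) X Y (H.snoc (n + 1) X V Y w l) = H.snoc n X V Y (H.bar n V Y w) l +
      (-1 : R) ^ (n + 1) • H.rmul (n + 1) X V Y w l := by
  induction n generalizing Y with
  | zero =>
    induction w using word_induction with
    | h0 => simp
    | h2 x y hx hy => simp only [map_add, LinearMap.add_apply, hx, hy, smul_add]; abel
    | h1 U b w =>
      rw [snoc_cons, bar_succ, mulFirst_snoc, bar_snoc_zero, bar_zero, rmul_cons]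
      simp [sub_eq_add_neg]
  | succ n ih =>
    induction w using word_induction with
    | h0 => simp
    | h2 x y hx hy => simp only [map_add, LinearMap.add_apply, hx, hy, smul_add]; abel
    | h1 U b w =>
      rw [snoc_cons, bar_succ, mulFirst_snoc, ih, bar_succ, rmul_cons, map_add, map_smul, map_sub,
        LinearMap.sub_apply, snoc_cons, pow_succ (-1 : R) (n + 1)]
      simp only [mul_neg, mul_one, neg_smul]
      abel

end Snoc

section Degrees

variable {n : ℕ} {U V X Y Z : H.Obj} {d : ℤ}

lemma single_mem (i : ℤ) (a : (H.Hom X Y).X i) : H.single X Y (tof _ i a) ∈ H.wordDeg 0 X Y i :=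
  ⟨a, rfl⟩

lemma cons_mem (i : ℤ) (a : (H.Hom Z Y).X i) {w : H.Word n X Z} (hw : w ∈ H.wordDeg n X Z d) :
    H.cons n X Z Y (tof _ i a) w ∈ H.wordDeg (n + 1) X Y (i + d) :=
  Submodule.subset_span ⟨Z, i, d, a, w, rfl, hw, rfl⟩

lemma wordDeg_succ_le {S : Submodule R (H.Word (n + 1) X Y)}
    (h : ∀ Z i j (a : (H.Hom Z Y).X i) (w : H.Word n X Z), i + j = d → w ∈ H.wordDeg n X Z j →
      H.cons n X Z Y (tof _ i a) w ∈ S) : H.wordDeg (n + 1) X Y d ≤ S := by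
  refine Submodule.span_le.2 ?_
  rintro _ ⟨Z, i, j, a, w, hij, hw, rfl⟩
  exact h Z i j a w hij hw

/-- Every word is a sum of homogeneous words. -/
lemma iSup_wordDeg (w : H.Word n X Y) : w ∈ ⨆ d, H.wordDeg n X Y d := by
  induction n generalizing Y with
  | zero =>
    obtain ⟨a, rfl⟩ := H.single_surjective w
    induction a using tot_induction with
    | h0 => simp
    | h1 i a => exact Submodule.mem_iSup_of_mem i (H.single_mem i a)
    | h2 x y hx hy => rw [map_add]; exact Submodule.add_mem _ hx hy
  | succ n ih =>
    induction w using word_induction with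
    | h0 => exact Submodule.zero_mem _
    | h2 x y hx hy => exact Submodule.add_mem _ hx hy
    | h1 Z a w =>
      induction a using tot_induction with
      | h0 => simp
      | h2 x y hx hy => rw [map_add]; exact Submodule.add_mem _ hx hy
      | h1 i a =>
        suffices h : ⨆ d, H.wordDeg n X Z d ≤
            (⨆ d, H.wordDeg (n + 1) X Y d).comap (H.cons n X Z Y (tof _ i a)) from h (ih w)
        exact iSup_le fun d w hw => Submodule.mem_iSup_of_mem (i + d) (H.cons_mem i a hw)

lemma mulFirst_mem (i : ℤ) (a : (H.Hom Z Y).X i) {w : H.Word n X Z}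
    (hw : w ∈ H.wordDeg n X Z d) :
    H.mulFirst n X Z Y (tof _ i a) w ∈ H.wordDeg n X Y (i + d) := by
  cases n with
  | zero =>
    obtain ⟨b, rfl⟩ := hw
    change H.mulFirst 0 X Z Y (tof _ i a) (H.single X Z (tof _ d b)) ∈ _
    rw [mulFirst_single, H.compTot_tof i d _ rfl]
    exact H.single_mem _ _
  | succ n =>
    refine (H.wordDeg_succ_le (S := (H.wordDeg (n + 1) X Y (i + d)).comap
      (H.mulFirst (n + 1) X Z Y (tof _ i a))) ?_) hw
    rintro V k j b w rfl hw
    rw [Submodule.mem_comap, mulFirst_cons, H.compTot_tof i k _ rfl, ← add_assoc]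
    exact H.cons_mem _ _ hw

lemma bar_mem {w : H.Word (n + 1) X Y} (hw : w ∈ H.wordDeg (n + 1) X Y d) :
    H.bar n X Y w ∈ H.wordDeg n X Y d := by
  induction n generalizing Y d with
  | zero =>
    refine (H.wordDeg_succ_le (S := (H.wordDeg 0 X Y d).comap (H.bar 0 X Y)) ?_) hw
    rintro V k j b w rfl hw
    rw [Submodule.mem_comap, bar_zero]
    exact H.mulFirst_mem _ _ hw
  | succ n ih =>
    refine (H.wordDeg_succ_le (S := (H.wordDeg (n + 1) X Y d).comap (H.bar (n + 1) X Y)) ?_) hw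
    rintro V k j b w rfl hw
    rw [Submodule.mem_comap, bar_succ]
    exact Submodule.sub_mem _ (H.mulFirst_mem _ _ hw) (H.cons_mem _ _ (ih hw))

lemma snoc_mem {w : H.Word n V Y} (hw : w ∈ H.wordDeg n V Y d) (i : ℤ) (l : (H.Hom X V).X i) :
    H.snoc n X V Y w (tof _ i l) ∈ H.wordDeg (n + 1) X Y (d + i) := by
  induction n generalizing Y d with
  | zero =>
    obtain ⟨b, rfl⟩ := hw
    exact H.cons_mem d b (H.single_mem i l)
  | succ n ih =>
    refine (H.wordDeg_succ_le (S := (H.wordDeg (n + 2) X Y (d + i)).comap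
      ((H.snoc (n + 1) X V Y).flip (tof _ i l))) ?_) hw
    rintro Z k j b w rfl hw
    rw [Submodule.mem_comap, LinearMap.flip_apply, snoc_cons, add_assoc k j i]
    exact H.cons_mem _ _ (ih hw)

/-- Words of length at least two are sums of words `u ⊗ l` with `u` and `l` homogeneous. -/
lemma snoc_induction {p : H.Word (n + 1) X Y → Prop} (w : H.Word (n + 1) X Y) (h0 : p 0)
    (h1 : ∀ V d i u (l : (H.Hom X V).X i), u ∈ H.wordDeg n V Y d →
      p (H.snoc n X V Y u (tof _ i l)))
    (h2 : ∀ x y, p x → p y → p (x + y)) : p w := by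
  induction n generalizing Y with
  | zero =>
    induction w using word_induction with
    | h0 => exact h0
    | h2 x y hx hy => exact h2 x y hx hy
    | h1 Z a w =>
      obtain ⟨l, rfl⟩ := H.single_surjective w
      induction a using tot_induction with
      | h0 => simpa using h0
      | h2 x y hx hy => rw [map_add, LinearMap.add_apply]; exact h2 _ _ hx hy
      | h1 i a =>
        induction l using tot_induction with
        | h0 => simpa using h0
        | h2 x y hx hy => rw [map_add, map_add]; exact h2 _ _ hx hy
        | h1 j l => exact h1 Z i j (H.single Z Y (tof _ i a)) l (H.single_mem i a)
  | succ n ih =>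
    induction w using word_induction with
    | h0 => exact h0
    | h2 x y hx hy => exact h2 x y hx hy
    | h1 Z a w =>
      induction a using tot_induction with
      | h0 => simpa using h0
      | h2 x y hx hy => rw [map_add, LinearMap.add_apply]; exact h2 _ _ hx hy
      | h1 i a =>
        refine ih (p := fun w => p (H.cons (n + 1) X Z Y (tof _ i a) w)) w (by simpa using h0)
          (fun V d j u l hu => ?_) fun x y hx hy => by rw [map_add]; exact h2 _ _ hx hy
        rw [← snoc_cons]
        exact h1 V (i + d) j _ l (H.cons_mem i a hu)

end Degrees

section Hochschild

variable {M : Type u} [AddCommMonoid M] [Module R M] {n : ℕ} {U V X Y Z : H.Obj} {d : ℤ}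

lemma rotatedLift_mk (q : ∀ V : H.Obj, Tot (H.Hom X V) →ₗ[R] H.Word n V Y →ₗ[R] M)
    (f : Tot (H.Hom X V)) (w : H.Word n V Y) :
    H.rotatedLift n X Y q (H.rotatedMk n X V Y f w) = q V f w := by
  classical
  exact (DirectSum.toModule_lof (M := fun V => Tot (H.Hom X V) ⊗[R] H.Word n V Y) R V
    (f ⊗ₜ[R] w)).trans (TensorProduct.lift.tmul f w)

lemma rotatedCons_mk (i j : ℤ) (a : (H.Hom Z Y).X j) (f : (H.Hom X V).X i) (w : H.Word n V Z) :
    H.rotatedCons n X Z Y (tof _ j a) (H.rotatedMk n X V Z (tof _ i f) w) =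
      (((i * j).negOnePow : ℤ) : R) •
        H.rotatedMk (n + 1) X V Y (tof _ i f) (H.cons n V Z Y (tof _ j a) w) := by
  rw [rotatedCons, LinearMap.flip_apply]
  refine (LinearMap.congr_fun (H.rotatedLift_mk _ (tof _ i f) w) (tof _ j a)).trans ?_
  exact (LinearMap.congr_fun (totTwist_tof _ i j f a) w).trans rfl

lemma wordLift_cons_monoid (f : ∀ Z : H.Obj, Tot (H.Hom Z Y) →ₗ[R] H.Word n X Z →ₗ[R] M)
    (a : Tot (H.Hom Z Y)) (w : H.Word n X Z) :
    H.wordLift n X Y f (H.cons n X Z Y a w) = f Z a w := by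
  classical
  exact (DirectSum.toModule_lof (M := fun Z => Tot (H.Hom Z Y) ⊗[R] H.Word n X Z) R Z
    (a ⊗ₜ[R] w)).trans (TensorProduct.lift.tmul a w)

/-- The Koszul symmetry of words of length two. -/
def swapTwo (X V Y : H.Obj) : Tot (H.Hom V Y) →ₗ[R] H.Word 0 X V →ₗ[R] H.Rotated 0 X Y :=
  totTwist (H.rotatedMk 0 X V Y).flip

lemma swapTwo_tof (i j : ℤ) (a : (H.Hom V Y).X i) (l : (H.Hom X V).X j) :
    H.swapTwo X V Y (tof _ i a) (H.single X V (tof _ j l)) = (((i * j).negOnePow : ℤ) : R) •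
      H.rotatedMk 0 X V Y (tof _ j l) (H.single V Y (tof _ i a)) :=
  totTwist_tof (A := H.Hom V Y) (B := H.Hom X V) (M := H.Rotated 0 X Y) _ i j a l

lemma lastToFront_zero : H.lastToFront 0 X Y = H.wordLift 0 X Y fun V => H.swapTwo X V Y := by
  rw [lastToFront]; rfl

lemma lastToFront_succ (a : Tot (H.Hom Z Y)) (w : H.Word (n + 1) X Z) :
    H.lastToFront (n + 1) X Y (H.cons (n + 1) X Z Y a w) =
      H.rotatedCons n X Z Y a (H.lastToFront n X Z w) := by
  rw [lastToFront]
  exact H.wordLift_cons_monoid (fun Z => (H.rotatedCons n X Z Y).compl₂ (H.lastToFront n X Z)) a w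

lemma lastToFront_snoc {u : H.Word n V Y} (hu : u ∈ H.wordDeg n V Y d) (i : ℤ)
    (l : (H.Hom X V).X i) : H.lastToFront n X Y (H.snoc n X V Y u (tof _ i l)) =
      (((i * d).negOnePow : ℤ) : R) • H.rotatedMk n X V Y (tof _ i l) u := by
  induction n generalizing Y d with
  | zero =>
    obtain ⟨a, rfl⟩ := hu
    rw [lastToFront_zero, mul_comm]
    exact (H.wordLift_cons_monoid (fun V => H.swapTwo X V Y) _ _).trans (H.swapTwo_tof d i a l)
  | succ n ih =>
    refine (H.wordDeg_succ_le (S := LinearMap.eqLocus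
      ((H.lastToFront (n + 1) X Y).comp ((H.snoc (n + 1) X V Y).flip (tof _ i l)))
      ((((i * d).negOnePow : ℤ) : R) • H.rotatedMk (n + 1) X V Y (tof _ i l))) ?_) hu
    rintro Z k j b w rfl hw
    rw [LinearMap.mem_eqLocus, LinearMap.comp_apply, LinearMap.flip_apply, snoc_cons,
      lastToFront_succ, ih hw, map_smul, rotatedCons_mk, smul_smul, LinearMap.smul_apply,
      mul_add, Int.negOnePow_add]
    push_cast
    rw [mul_comm]

lemma hochB_chainsOf (w : H.Word (n + 1) X X) : H.hochB n (H.chainsOf (n + 1) X w) =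
    H.chainsOf n X (H.bar n X X w) + (-1 : R) ^ (n + 1) • H.rotatedLift n X X (fun V =>
        (H.mulFirst n V X V).compr₂ (H.chainsOf n V)) (H.lastToFront n X X w) := by
  classical
  exact DirectSum.toModule_lof (M := fun X => H.Word (n + 1) X X) R X w

lemma hochB_snoc {u : H.Word n V X} (hu : u ∈ H.wordDeg n V X d) (i : ℤ) (l : (H.Hom X V).X i) :
    H.hochB n (H.chainsOf (n + 1) X (H.snoc n X V X u (tof _ i l))) =
      H.chainsOf n X (H.bar n X X (H.snoc n X V X u (tof _ i l))) +
        ((-1 : R) ^ (n + 1) * (((i * d).negOnePow : ℤ) : R)) •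
          H.chainsOf n V (H.mulFirst n V X V (tof _ i l) u) := by
  rw [hochB_chainsOf, H.lastToFront_snoc hu, map_smul, rotatedLift_mk, smul_smul]; rfl

lemma chains_induction {p : H.Chains n → Prop} (x : H.Chains n) (h0 : p 0)
    (h1 : ∀ X w, p (H.chainsOf n X w)) (h2 : ∀ x y, p x → p y → p (x + y)) : p x := by
  classical
  exact DirectSum.induction_on (motive := p) x h0 h1 h2

lemma hochB_hochB (x : H.Chains (n + 2)) : H.hochB n (H.hochB (n + 1) x) = 0 := by
  induction x using chains_induction with
  | h0 => simp
  | h2 x y hx hy => simp only [map_add, hx, hy, add_zero]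
  | h1 X w =>
  induction w using snoc_induction with
  | h0 => simp
  | h2 x y hx hy => simp only [map_add, hx, hy, add_zero]
  | h1 V d' i v l hv' =>
  clear hv'
  induction v using snoc_induction with
  | h0 => simp
  | h2 x y hx hy => simp only [map_add, LinearMap.add_apply, hx, hy, add_zero]
  | h1 U d j u l' hu =>
    have hv := H.snoc_mem hu j l'
    have hs : (((i * (d + j)).negOnePow : ℤ) : R) * (((j * (i + d)).negOnePow : ℤ) : R) =
        ((((j + i) * d).negOnePow : ℤ) : R) := by
      rw [← Int.cast_mul, ← Units.val_mul, ← Int.negOnePow_add,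
        show i * (d + j) + j * (i + d) = (j + i) * d + 2 * (i * j) by ring, Int.negOnePow_add,
        Int.negOnePow_two_mul, mul_one]
    have hb := congrArg (H.chainsOf n X) (H.bar_bar (H.snoc (n + 1) X V X
      (H.snoc n V U X u (tof _ j l')) (tof _ i l)))
    have h1 := H.hochB_snoc (H.bar_mem hv) i l
    have h2 := H.hochB_snoc hu (j + i) (H.comp j i (j + i) rfl l' l)
    have h3 := H.hochB_snoc (H.mulFirst_mem i l hu) j l'
    rw [H.hochB_snoc hv, map_add, map_smul, mulFirst_snoc, h3, ← H.mulFirst_snoc, bar_mulFirst,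
      mulFirst_mulFirst, H.compTot_tof j i _ rfl]
    rw [bar_snoc, map_add, map_smul, rmul_snoc, H.compTot_tof j i _ rfl] at hb ⊢
    rw [map_add, map_smul, map_zero] at hb
    rw [map_add, map_smul, h1, h2, ← hs]
    rw [pow_succ (-1 : R) (n + 1)]
    generalize (-1 : R) ^ (n + 1) = ε at *
    simp only [smul_add, smul_smul]
    linear_combination (norm := module) hb

end Hochschild

end DGCat

section TotPow

variable {R : Type u} [CommRing R] {A : CochainComplex (ModuleCat.{u} R) ℤ}

/-- The `k`-th power `a ↦ (-1)^(k|a|) a` of the sign involution. -/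
def totPow (A : CochainComplex (ModuleCat.{u} R) ℤ) (k : ℤ) : Tot A →ₗ[R] Tot A :=
  totToModule fun i => (k * i).negOnePow • tof A i

lemma totPow_tof (k i : ℤ) (a : A.X i) : totPow A k (tof A i a) = (k * i).negOnePow • tof A i a :=
  totToModule_tof _ i a

lemma totPow_totPow (k l : ℤ) (x : Tot A) : totPow A k (totPow A l x) = totPow A (k + l) x := by
  induction x using tot_induction with
  | h0 => simp
  | h1 i a => rw [totPow_tof, units_smul_map, totPow_tof, totPow_tof, smul_smul, add_mul,
      Int.negOnePow_add, mul_comm]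
  | h2 x y hx hy => simp only [map_add, hx, hy]

lemma totPow_one (x : Tot A) : totPow A 1 x = totSign A x := by
  induction x using tot_induction with
  | h0 => simp
  | h1 i a => rw [totPow_tof, totSign_tof, one_mul]
  | h2 x y hx hy => simp only [map_add, hx, hy]

lemma totPow_totSign (k : ℤ) (x : Tot A) : totPow A k (totSign A x) = totPow A (k + 1) x := by
  rw [← totPow_one, totPow_totPow]

lemma totPow_even (k : ℤ) (x : Tot A) : totPow A (k + k) x = x := by
  induction x using tot_induction with
  | h0 => simp
  | h1 i a => rw [totPow_tof, show (k + k) * i = 2 * (k * i) by ring, Int.negOnePow_two_mul,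
      one_smul]
  | h2 x y hx hy => simp only [map_add, hx, hy]

lemma totPow_odd (k : ℤ) (x : Tot A) : totPow A (k + (k + 1)) x = totSign A x := by
  rw [← add_assoc, add_comm, ← totPow_totPow, totPow_even, totPow_one]

end TotPow

namespace DGCat

variable {R : Type u} [CommRing R] (H : DGCat.{u} R)

lemma totPow_compTot {X Y Z : H.Obj} (k : ℤ) (g : Tot (H.Hom Y Z)) (f : Tot (H.Hom X Y)) :
    totPow _ k (H.compTot X Y Z g f) = H.compTot X Y Z (totPow _ k g) (totPow _ k f) := by
  induction g using tot_induction with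
  | h0 => simp
  | h2 x y hx hy => simp only [map_add, LinearMap.add_apply, hx, hy]
  | h1 i g =>
  induction f using tot_induction with
  | h0 => simp
  | h2 x y hx hy => simp only [map_add, hx, hy]
  | h1 j f =>
    rw [H.compTot_tof i j _ rfl, totPow_tof, totPow_tof, totPow_tof, units_smul_map,
      units_smul_map₂, H.compTot_tof i j _ rfl, smul_smul, mul_add, Int.negOnePow_add, mul_comm]

section Suspension

variable {n : ℕ} {U V X Y Z : H.Obj} {d : ℤ}

/-- The passage from words to suspended words: the letter that is followed by `n` letters
is multiplied with the sign `(-1)^((k + n) * degree)`. It exchanges `bar` and `bS`. -/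
def th (k : ℤ) : ∀ (n : ℕ) (X Y : H.Obj), H.Word n X Y →ₗ[R] H.Word n X Y
  | 0, X, Y => (H.single X Y).comp (totPow (H.Hom X Y) k)
  | n + 1, X, Y => H.wordLift n X Y fun Z =>
      (H.cons n X Z Y).compl₁₂ (totPow (H.Hom Z Y) (k + n + 1)) (th k n X Z)

lemma th_single (k : ℤ) (a : Tot (H.Hom X Y)) :
    H.th k 0 X Y (H.single X Y a) = H.single X Y (totPow _ k a) := rfl

lemma th_cons (k : ℤ) (a : Tot (H.Hom Z Y)) (w : H.Word n X Z) :
    H.th k (n + 1) X Y (H.cons n X Z Y a w) =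
      H.cons n X Z Y (totPow _ (k + n + 1) a) (H.th k n X Z w) := by
  rw [th, wordLift_cons]; rfl

lemma th_mulFirst (k : ℤ) (a : Tot (H.Hom Z Y)) (w : H.Word n X Z) :
    H.th k n X Y (H.mulFirst n X Z Y a w) =
      H.mulFirst n X Z Y (totPow _ (k + n) a) (H.th k n X Z w) := by
  cases n with
  | zero =>
    obtain ⟨b, rfl⟩ := H.single_surjective w
    rw [mulFirst_single, th_single, th_single, mulFirst_single, totPow_compTot, Nat.cast_zero,
      add_zero]
  | succ n =>
    induction w using word_induction with
    | h0 => simp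
    | h2 x y hx hy => simp only [map_add, hx, hy]
    | h1 V b w =>
      rw [mulFirst_cons, th_cons, th_cons, mulFirst_cons, totPow_compTot, Nat.cast_succ, add_assoc]

lemma bar_th (k : ℤ) (w : H.Word (n + 1) X Y) :
    H.bar n X Y (H.th k (n + 1) X Y w) = H.th k n X Y (H.bS n X Y w) := by
  induction n generalizing Y with
  | zero =>
    induction w using word_induction with
    | h0 => simp
    | h2 x y hx hy => simp only [map_add, hx, hy]
    | h1 Z a w =>
      rw [th_cons, bar_zero, bS_zero, th_mulFirst, totPow_totSign]
  | succ n ih =>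
    induction w using word_induction with
    | h0 => simp
    | h2 x y hx hy => simp only [map_add, hx, hy]
    | h1 Z a w =>
      rw [th_cons, bar_succ, bS_succ, map_sub, th_mulFirst, th_cons, ih, totPow_totSign,
        totPow_totSign, Nat.cast_succ]
      simp only [add_assoc]

lemma th_th (k : ℤ) (w : H.Word n X Y) : H.th k n X Y (H.th k n X Y w) = w := by
  induction n generalizing Y with
  | zero =>
    obtain ⟨b, rfl⟩ := H.single_surjective w
    rw [th_single, th_single, totPow_totPow, totPow_even]
  | succ n ih =>
    induction w using word_induction with
    | h0 => simp
    | h2 x y hx hy => simp only [map_add, hx, hy]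
    | h1 Z a w => rw [th_cons, th_cons, totPow_totPow, totPow_even, ih]

lemma th_snoc (k : ℤ) (u : H.Word n V Y) (l : Tot (H.Hom X V)) :
    H.th k (n + 1) X Y (H.snoc n X V Y u l) =
      H.snoc n X V Y (H.th (k + 1) n V Y u) (totPow _ k l) := by
  induction n generalizing Y with
  | zero =>
    obtain ⟨b, rfl⟩ := H.single_surjective u
    rw [snoc_single, th_cons, th_single, th_single, snoc_single, Nat.cast_zero, add_zero]
  | succ n ih =>
    induction u using word_induction with
    | h0 => simp
    | h2 x y hx hy => simp only [map_add, LinearMap.add_apply, hx, hy]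
    | h1 Z a w =>
      rw [snoc_cons, th_cons, ih, th_cons, snoc_cons, Nat.cast_succ,
        show k + ((n : ℤ) + 1) + 1 = k + 1 + n + 1 by ring]

lemma th_mem (k : ℤ) {w : H.Word n X Y} (hw : w ∈ H.wordDeg n X Y d) :
    H.th k n X Y w ∈ H.wordDeg n X Y d := by
  induction n generalizing Y d with
  | zero =>
    obtain ⟨a, rfl⟩ := hw
    change H.th k 0 X Y (H.single X Y (tof _ d a)) ∈ _
    rw [th_single, totPow_tof, units_smul_map]
    exact (H.wordDeg 0 X Y d).toAddSubgroup.zsmul_mem (H.single_mem d a) _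
  | succ n ih =>
    refine (H.wordDeg_succ_le (S := (H.wordDeg (n + 1) X Y d).comap (H.th k (n + 1) X Y)) ?_) hw
    rintro Z i j a w rfl hw
    rw [Submodule.mem_comap, th_cons, totPow_tof, units_smul_map₂]
    exact (H.wordDeg (n + 1) X Y _).toAddSubgroup.zsmul_mem (H.cons_mem i a (ih hw)) _

lemma th_th_succ (k : ℤ) {w : H.Word n X Y} (hw : w ∈ H.wordDeg n X Y d) :
    H.th k n X Y (H.th (k + 1) n X Y w) = ((d.negOnePow : ℤ) : R) • w := by
  induction n generalizing Y d with
  | zero =>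
    obtain ⟨a, rfl⟩ := hw
    change H.th k 0 X Y (H.th (k + 1) 0 X Y (H.single X Y (tof _ d a))) =
      ((d.negOnePow : ℤ) : R) • H.single X Y (tof _ d a)
    rw [th_single, th_single, totPow_totPow, totPow_odd, totSign_tof, units_smul_map,
      Units.smul_def, Int.cast_smul_eq_zsmul]
  | succ n ih =>
    refine (H.wordDeg_succ_le (S := LinearMap.eqLocus
      ((H.th k (n + 1) X Y).comp (H.th (k + 1) (n + 1) X Y))
      (((d.negOnePow : ℤ) : R) • LinearMap.id)) ?_) hw
    rintro Z i j a w rfl hw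
    rw [LinearMap.mem_eqLocus, LinearMap.comp_apply, th_cons, th_cons, totPow_totPow, ih hw,
      show k + (n : ℤ) + 1 + (k + 1 + n + 1) = (k + n + 1) + ((k + n + 1) + 1) by ring,
      totPow_odd, totSign_tof, units_smul_map₂, map_smul, Int.negOnePow_add, Units.smul_def,
      ← Int.cast_smul_eq_zsmul R, smul_smul]
    push_cast
    rfl

end Suspension

section Splitting

variable {m : ℕ}

/-- The homogeneous chains. -/
def chainsDeg (m : ℕ) (d : ℤ) : Submodule R (H.Chains m) :=
  ⨆ X, (H.wordDeg m X X d).map (H.chainsOf m X)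

lemma chainsOf_mem {X : H.Obj} {d : ℤ} {w : H.Word m X X} (hw : w ∈ H.wordDeg m X X d) :
    H.chainsOf m X w ∈ H.chainsDeg m d :=
  Submodule.mem_iSup_of_mem X (Submodule.mem_map_of_mem hw)

lemma wordDeg_le_of_snoc {X Y : H.Obj} {d : ℤ} {S : Submodule R (H.Word (m + 1) X Y)}
    (h : ∀ V i j (u : H.Word m V Y) (l : (H.Hom X V).X i), j + i = d → u ∈ H.wordDeg m V Y j →
      H.snoc m X V Y u (tof _ i l) ∈ S) : H.wordDeg (m + 1) X Y d ≤ S := by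
  induction m generalizing Y d with
  | zero =>
    refine H.wordDeg_succ_le ?_
    rintro Z i j a w hij ⟨l, rfl⟩
    exact h Z j i (H.single Z Y (tof _ i a)) l hij (H.single_mem i a)
  | succ m ih =>
    refine H.wordDeg_succ_le ?_
    rintro Z i j a w rfl hw
    refine ih (S := S.comap (H.cons (m + 1) X Z Y (tof _ i a))) ?_ hw
    rintro V i' j' u l rfl hu
    rw [Submodule.mem_comap, ← snoc_cons]
    exact h V i' (i + j') _ l (by ring) (H.cons_mem i a hu)

lemma hochB_mem {d : ℤ} {x : H.Chains (m + 1)} (hx : x ∈ H.chainsDeg (m + 1) d) :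
    H.hochB m x ∈ H.chainsDeg m d := by
  suffices h : H.chainsDeg (m + 1) d ≤ (H.chainsDeg m d).comap (H.hochB m) from h hx
  refine iSup_le fun X => Submodule.map_le_iff_le_comap.2 (H.wordDeg_le_of_snoc ?_)
  rintro V i j u l rfl hu
  rw [Submodule.mem_comap, Submodule.mem_comap, H.hochB_snoc hu]
  refine Submodule.add_mem _ (H.chainsOf_mem (H.bar_mem (H.snoc_mem hu i l)))
    (Submodule.smul_mem _ _ (H.chainsOf_mem ?_))
  rw [add_comm j i]
  exact H.mulFirst_mem i l hu

section

variable (hd : ∀ X Y i j, (H.Hom X Y).d i j = 0)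

include hd

lemma totD_eq_zero (X Y : H.Obj) : totD (H.Hom X Y) = 0 :=
  tot_hom_ext fun i x => by rw [totD_tof, hd]; simp

lemma wordD_eq_zero (X Y : H.Obj) : H.wordD m X Y = 0 := by
  induction m generalizing Y with
  | zero => exact H.totD_eq_zero hd X Y
  | succ m ih =>
    refine H.word_ext fun Z a w => ?_
    rw [wordD, wordLift_cons, ih, totD_eq_zero H hd]
    simp

lemma chainsD_eq_zero : H.chainsD m = 0 := by
  classical
  ext x
  induction x using chains_induction with
  | h0 => simp
  | h2 x y hx hy => simp only [map_add, hx, hy]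
  | h1 X w =>
    refine (DirectSum.toModule_lof (M := fun X => H.Word m X X) R X w).trans ?_
    rw [LinearMap.comp_apply, wordD_eq_zero H hd, LinearMap.zero_apply, map_zero]; rfl

lemma hochD_zero (x : H.Chains 0) : H.hochD (H.hochOf 0 x) = 0 := by
  refine (DirectSum.toModule_lof (M := fun n => H.Chains n) R 0 x).trans ?_
  rw [LinearMap.comp_apply, chainsD_eq_zero H hd, LinearMap.zero_apply, map_zero]

lemma hochD_succ (x : H.Chains (m + 1)) :
    H.hochD (H.hochOf (m + 1) x) = H.hochOf m (H.hochB m x) := by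
  refine (DirectSum.toModule_lof (M := fun n => H.Chains n) R (m + 1) x).trans ?_
  change H.hochOf m (H.hochB m x) + (-1 : R) ^ (m + 1) • H.hochOf (m + 1) (H.chainsD (m + 1) x) = _
  rw [chainsD_eq_zero H hd, LinearMap.zero_apply, map_zero, smul_zero, add_zero]

/-- The component of a Hochschild chain with `m + 1` letters. -/
def hochComp (m : ℕ) : H.HochschildChains →ₗ[R] H.Chains m :=
  DirectSum.component R ℕ (fun n => H.Chains n) m

omit hd in
lemma hochComp_hochOf (x : H.Chains m) : H.hochComp m (H.hochOf m x) = x :=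
  DirectSum.component.lof_self (M := fun n => H.Chains n) R m x

omit hd in
lemma hochComp_hochOf_ne {n : ℕ} (h : n ≠ m) (x : H.Chains n) :
    H.hochComp m (H.hochOf n x) = 0 := by
  refine (DirectSum.component.of (M := fun n => H.Chains n) R m n x).trans ?_
  rw [dif_neg h]

omit hd in
lemma hoch_induction {p : H.HochschildChains → Prop} (h0 : p 0)
    (h1 : ∀ n (x : H.Chains n), p (H.hochOf n x)) (h2 : ∀ x y, p x → p y → p (x + y))
    (x : H.HochschildChains) : p x :=
  DirectSum.induction_on (motive := p) x h0 h1 h2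

lemma hochComp_hochD (x : H.HochschildChains) :
    H.hochComp m (H.hochD x) = H.hochB m (H.hochComp (m + 1) x) := by
  induction x using hoch_induction with
  | h0 => simp only [map_zero]
  | h2 x y hx hy => simp only [map_add, hx, hy]
  | h1 n x =>
    cases n with
    | zero => rw [hochD_zero H hd, hochComp_hochOf_ne H (by omega), map_zero, map_zero]
    | succ n =>
      rw [hochD_succ H hd]
      by_cases h : n = m
      · subst h; rw [hochComp_hochOf, hochComp_hochOf]
      · rw [hochComp_hochOf_ne H h, hochComp_hochOf_ne H (by omega), map_zero]

variable [hproj : ∀ X Y i, Module.Projective R ((H.Hom X Y).X i)]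

omit hd in
lemma chains_projective : Module.Projective R (H.Chains m) := by
  classical
  change Module.Projective R (⨁ X : H.Obj, H.Word m X X)
  infer_instance

omit hproj in
/-- If the Hochschild homology is projective, a projection of the chains to the cycles that
fixes the boundaries can be corrected to a projection to the boundaries. -/
lemma exists_boundary_projection_of_cycle [hHH : Module.Projective R H.HochschildHomology]
    (π : H.Chains m →ₗ[R] H.Chains m) (hπ : ∀ x, H.hochD (H.hochOf m (π x)) = 0)
    (hπ' : ∀ y, π (H.hochB m y) = H.hochB m y) :
    ∃ ρ : H.Chains m →ₗ[R] H.Chains m, (∀ y, ρ (H.hochB m y) = H.hochB m y) ∧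
      ∀ x, ∃ y, ρ x = H.hochB m y := by
  set B := (LinearMap.range H.hochD).comap (LinearMap.ker H.hochD).subtype with hB
  obtain ⟨σ, hσ⟩ := Module.projective_lifting_property B.mkQ
    (LinearMap.id : H.HochschildHomology →ₗ[R] H.HochschildHomology) B.mkQ_surjective
  have h1 : ∀ z : LinearMap.ker H.hochD, ∃ Y, ((z - σ (B.mkQ z) : LinearMap.ker H.hochD) :
      H.HochschildChains) = H.hochD Y := fun z => by
    have : z - σ (B.mkQ z) ∈ B := by
      refine (Submodule.Quotient.mk_eq_zero B).1 ?_
      change B.mkQ (z - σ (B.mkQ z)) = 0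
      rw [map_sub, sub_eq_zero]
      exact (LinearMap.congr_fun hσ _).symm
    exact (this : _ ∈ LinearMap.range _).imp fun _ => Eq.symm
  have h2 : ∀ z : LinearMap.ker H.hochD, (z : H.HochschildChains) ∈ LinearMap.range H.hochD →
      σ (B.mkQ z) = 0 := fun z hz => by
    have h3 : B.mkQ z = 0 := (Submodule.Quotient.mk_eq_zero B).2 hz
    rw [h3, map_zero]
  let c : H.Chains m →ₗ[R] LinearMap.ker H.hochD :=
    ((H.hochOf m).comp π).codRestrict (LinearMap.ker H.hochD) hπ
  refine ⟨(H.hochComp m).comp ((LinearMap.ker H.hochD).subtype.comp (c - σ.comp (B.mkQ.comp c))),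
    fun y => ?_, fun x => ?_⟩
  · change H.hochComp m ((c (H.hochB m y) - σ (B.mkQ (c (H.hochB m y))) :
      LinearMap.ker H.hochD) : H.HochschildChains) = _
    have hc : (c (H.hochB m y) : H.HochschildChains) = H.hochOf m (H.hochB m y) :=
      congrArg (H.hochOf m) (hπ' y)
    rw [h2 _ ⟨H.hochOf (m + 1) y, by rw [hochD_succ H hd, hc]⟩, sub_zero, hc, hochComp_hochOf]
  · obtain ⟨Y, hY⟩ := h1 (c x)
    refine ⟨H.hochComp (m + 1) Y, ?_⟩
    rw [← hochComp_hochD H hd, ← hY]; rfl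

/-- If the Hochschild homology is projective, the boundaries form a direct summand of the
Hochschild chains with a given number of letters. -/
lemma exists_boundary_projection [hHH : Module.Projective R H.HochschildHomology] (m : ℕ) :
    ∃ ρ : H.Chains m →ₗ[R] H.Chains m, (∀ y, ρ (H.hochB m y) = H.hochB m y) ∧
      ∀ x, ∃ y, ρ x = H.hochB m y := by
  induction m with
  | zero =>
    exact exists_boundary_projection_of_cycle H hd LinearMap.id (fun x => hochD_zero H hd x)
      fun _ => rfl
  | succ m ih =>
    obtain ⟨ρ, hρ, hρ'⟩ := ih
    have := H.chains_projective (m := m)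
    obtain ⟨q, hq⟩ := exists_lift (H.hochB m) ρ hρ'
    replace hq : ∀ x, H.hochB m (q x) = ρ x := LinearMap.congr_fun hq
    refine exists_boundary_projection_of_cycle H hd (LinearMap.id - q.comp (H.hochB m))
      (fun x => ?_) fun y => ?_
    · rw [hochD_succ H hd]
      change H.hochOf m (H.hochB m (x - q (H.hochB m x))) = 0
      rw [map_sub, hq, hρ, sub_self, map_zero]
    · change H.hochB (m + 1) y - q (H.hochB m (H.hochB (m + 1) y)) = _
      rw [hochB_hochB, map_zero, sub_zero]

/-- If the Hochschild homology is projective, a map on chains that kills the cycles factors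
through the Hochschild differential. -/
lemma exists_factor_hochB [hHH : Module.Projective R H.HochschildHomology] {M : Type u}
    [AddCommGroup M] [Module R M] (o : H.Chains (m + 1) →ₗ[R] M)
    (ho : ∀ y, H.hochB m y = 0 → o y = 0) :
    ∃ ψ : H.Chains m →ₗ[R] M, ∀ y, o y = ψ (H.hochB m y) := by
  obtain ⟨ρ, hρ, hρ'⟩ := exists_boundary_projection H hd m
  have := H.chains_projective (m := m)
  obtain ⟨q, hq⟩ := exists_lift (H.hochB m) ρ hρ'
  replace hq : ∀ x, H.hochB m (q x) = ρ x := LinearMap.congr_fun hq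
  refine ⟨o.comp q, fun y => ?_⟩
  rw [LinearMap.comp_apply, ← sub_eq_zero, ← map_sub]
  exact ho _ (by rw [map_sub, hq, hρ, sub_self])

end

end Splitting

end DGCat

/-! ### Traces and the obstruction as a functional on Hochschild chains -/

/-- A functional on the endomorphisms in a signed category that kills boundaries and is graded
cyclic on cocycles. -/
structure SCat.Trace {R : Type u} [CommRing R] (B : SCat.{u} R) (M : Type u) [AddCommGroup M]
    [Module R M] where
  tr : ∀ X : B.Obj, B.Hom X X →ₗ[R] M
  tr_d : ∀ (X : B.Obj) (x : B.Hom X X), tr X (B.d x) = 0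
  comm : ∀ {X Y : B.Obj} (i j : ℤ) (x : B.Hom Y X) (y : B.Hom X Y), x ∈ B.deg (X := Y) i →
    y ∈ B.deg (X := X) j → B.d x = 0 → B.d y = 0 →
    tr X (B.mul x y) = (i * j).negOnePow • tr Y (B.mul y x)

namespace SCat.Trace

variable {R : Type u} [CommRing R] {B : SCat.{u} R} {M : Type u} [AddCommGroup M]
    [Module R M] (T : B.Trace M) {X Y : B.Obj}

lemma tr_d_mul (c : B.Hom Y X) {y : B.Hom X Y} (hy : B.d y = 0) :
    T.tr X (B.mul (B.d c) y) = 0 := by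
  have := T.tr_d X (B.mul c y)
  rwa [B.d_mul, hy, map_zero, add_zero] at this

lemma tr_mul_d {x : B.Hom Y X} (hx : B.d x = 0) (c : B.Hom X Y) :
    T.tr X (B.mul x (B.d c)) = 0 := by
  have := T.tr_d X (B.mul (B.sgn x) c)
  rwa [B.d_mul, ← neg_neg (B.d (B.sgn x)), ← B.sgn_d, hx, map_zero, neg_zero, map_zero,
    LinearMap.zero_apply, zero_add, B.sgn_sgn] at this

end SCat.Trace

namespace DGCat

variable {R : Type u} [CommRing R] {H : DGCat.{u} R} {X Y : H.Obj} {n : ℕ}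

lemma _root_.Homog.apply_mem {d : ℤ} {w : H.Word n X Y} (hw : w ∈ H.wordDeg n X Y d)
    {M : Type u} [AddCommGroup M] [Module R M] {D : ℤ → Submodule R M} {k : ℤ}
    {φ : H.Word n X Y →ₗ[R] M} (hφ : Homog D n k φ) : φ w ∈ D (k + d) := by
  induction n generalizing Y d k with
  | zero => obtain ⟨a, rfl⟩ := hw; exact hφ d a
  | succ n ih =>
    refine (H.wordDeg_succ_le (S := (D (k + d)).comap φ) ?_) hw
    rintro Z i j a w rfl hw
    rw [Submodule.mem_comap, ← add_assoc]
    exact ih hw (hφ Z i a)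

end DGCat

namespace LC

variable {R : Type u} [CommRing R] {H : DGCat.{u} R} {B : SCat.{u} R} {e : H.Obj → B.Obj}
  {U V X Y Z : H.Obj} {m n : ℕ}

lemma cup_snoc {Y : B.Obj} {φ : LC H B e Z Y} (hφ : Van n φ) (g : AA H B e) (u : H.Word n V Z)
    (l : Tot (H.Hom X V)) : cup φ g (n + 1) X (H.snoc n X V Z u l) =
      B.mul (φ n V u) (g V 0 X (H.single X V l)) := by
  induction n generalizing Z with
  | zero =>
    obtain ⟨a, rfl⟩ := H.single_surjective u
    rw [H.snoc_single, cup_cons, cup_zero, LinearMap.zero_apply, add_zero]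
  | succ n ih =>
    induction u using H.word_induction with
    | h0 => simp
    | h2 x y hx hy => simp only [map_add, LinearMap.add_apply, hx, hy]
    | h1 W a w =>
      rw [H.snoc_cons, cup_cons, hφ 0 (by omega), LinearMap.zero_apply, map_zero,
        LinearMap.zero_apply, zero_add, ih (hφ.sh a), sh_apply]

lemma cup_cons_of_van {Y : B.Obj} (φ : LC H B e Z Y) {g : AA H B e} (hg : ∀ X, Van n (g X))
    (a : Tot (H.Hom U Z)) (w : H.Word n V U) :
    cup φ g (n + 1) V (H.cons n V U Z a w) = B.mul (φ 0 U (H.single U Z a)) (g U n V w) := by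
  rw [cup_cons, Van.cup_right (sh a φ) hg n (by omega), LinearMap.zero_apply, add_zero]

lemma IsHomog.sgn_single {Y : B.Obj} {φ : LC H B e Z Y} (hφ : IsHomog 0 φ)
    (a : Tot (H.Hom U Z)) : B.sgn (φ 0 U (H.single U Z a)) =
      φ 0 U (H.single U Z (totSign _ a)) := by
  have := congrFun (congrFun hφ.odd 0) U
  have := LinearMap.congr_fun this (H.single U Z a)
  rw [sg_apply] at this
  rw [this]
  change -(tw φ 0 U (H.single U Z a)) = _
  rw [tw_apply, H.wSgn_single, map_neg, neg_neg]

section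

variable {f z : AA H B e} (hf : ∀ X, IsHomog 0 (f X)) (hκ : ∀ X, Van 2 (curv f X))
  {M : Type u} [AddCommGroup M] [Module R M] (T : B.Trace M)

include hf hκ in
/-- Against cycles, the trace does not see that `f` is multiplicative only up to a boundary. -/
lemma tr_mul_compTot (a : Tot (H.Hom Y X)) (b : Tot (H.Hom Z Y)) {y : B.Hom (e X) (e Z)}
    (hy : B.d y = 0) : T.tr (e X) (B.mul (f X 0 Z (H.single Z X (H.compTot Z Y X a b))) y) =
      T.tr (e X) (B.mul (B.mul (f X 0 Y (H.single Y X a)) (f Y 0 Z (H.single Z Y b))) y) := by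
  have h1 := LinearMap.congr_fun (hκ X 1 (by omega) Z)
    (H.cons 0 Z Y X (totSign _ a) (H.single Z Y b))
  simp only [curv, Pi.sub_apply, Pi.add_apply, LinearMap.sub_apply, LinearMap.add_apply, dd_apply,
    pb_succ, cup_cons, cup_zero, sg_apply, H.bS_zero, totSign_totSign, H.mulFirst_single,
    (hf X).sgn_single, LinearMap.zero_apply, add_zero] at h1
  rw [add_comm, add_sub_assoc, add_eq_zero_iff_eq_neg, neg_sub] at h1
  rw [h1, map_sub, LinearMap.sub_apply, map_sub, T.tr_d_mul _ hy, sub_zero]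

variable (f z) in
/-- The functional `a₀ ⊗ w ↦ tr(f₀(a₀) z(w))` on Hochschild chains, for words `w` with `m + 1`
letters, up to the signs that exchange words and suspended words. -/
def traceForm (k : ℤ) (m : ℕ) : H.Chains (m + 1) →ₗ[R] M := by
  classical
  exact DirectSum.toModule R H.Obj M fun X => H.wordLift m X X fun Z =>
    (B.mul.compl₁₂ ((f X 0 Z).comp (H.single Z X)) ((z Z m X).comp (H.th k m X Z))).compr₂
      (T.tr (e X))

lemma traceForm_cons (k : ℤ) (a : Tot (H.Hom Z X)) (w : H.Word m X Z) :
    traceForm f z T k m (H.chainsOf (m + 1) X (H.cons m X Z X a w)) =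
      T.tr (e X) (B.mul (f X 0 Z (H.single Z X a)) (z Z m X (H.th k m X Z w))) := by
  classical
  refine (DirectSum.toModule_lof (M := fun X => H.Word (m + 1) X X) R X
    (H.cons m X Z X a w)).trans ?_
  rw [H.wordLift_cons]; rfl

include hf hκ in
lemma traceForm_bar (hd : ∀ X V w, B.d (z X m V w) = 0) (hv : ∀ X, Van m (z X))
    (a : Tot (H.Hom Z X)) (w : H.Word (m + 1) X Z) :
    traceForm f z T m m (H.chainsOf (m + 1) X (H.bar (m + 1) X X
        (H.cons (m + 1) X Z X a (H.th m (m + 1) X Z w)))) =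
      T.tr (e X) (B.mul (f X 0 Z (H.single Z X a)) (cup (sg (f Z)) z (m + 1) X w)) -
      T.tr (e X) (B.mul (f X 0 Z (H.single Z X a)) (pb (z Z) (m + 1) X w)) := by
  rw [H.bar_succ, map_sub, map_sub, H.bar_th, traceForm_cons, H.th_th, pb_succ]
  congr 1
  induction w using H.word_induction with
  | h0 => simp
  | h2 x y hx hy => simp only [map_add, hx, hy]
  | h1 V b w =>
    rw [H.th_cons, H.mulFirst_cons, traceForm_cons, H.th_th, tr_mul_compTot hf hκ T _ _ (hd V X w),
      B.mul_assoc, cup_cons_of_van _ hv, sg_apply, (hf Z).sgn_single, add_assoc, totPow_odd]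

include hf hκ in
/-- The last summand of the Hochschild differential, which moves the last letter to the front,
becomes right multiplication by `f`, by the cyclic symmetry of the trace. -/
lemma traceForm_rotation (hz : ∀ X, IsHomog 0 (z X)) (hv : ∀ X, Van m (z X))
    (hd : ∀ X V w, B.d (z X m V w) = 0) (a : Tot (H.Hom Z X)) (w : H.Word (m + 1) X Z) :
    traceForm f z T m m (H.hochB (m + 1) (H.chainsOf (m + 2) X
        (H.cons (m + 1) X Z X a (H.th m (m + 1) X Z w)))) =
      traceForm f z T m m (H.chainsOf (m + 1) X (H.bar (m + 1) X X
        (H.cons (m + 1) X Z X a (H.th m (m + 1) X Z w)))) +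
      T.tr (e X) (B.mul (f X 0 Z (H.single Z X a)) (cup (sg (z Z)) f (m + 1) X w)) := by
  induction w using H.snoc_induction with
  | h0 => simp only [map_zero, add_zero]
  | h2 x y hx hy => simp only [map_add, hx, hy]; abel
  | h1 V d i u l hu =>
  induction a using tot_induction with
  | h0 => simp only [map_zero, LinearMap.zero_apply, add_zero]
  | h2 x y hx hy => simp only [map_add, LinearMap.add_apply, hx, hy]; abel
  | h1 j a =>
    rw [H.th_snoc, totPow_tof, units_smul_map, units_smul_map, ← H.snoc_cons,
      units_smul_map, units_smul_map, units_smul_map,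
      H.hochB_snoc (H.cons_mem j a (H.th_mem (m + 1) hu)), map_add, smul_add, units_smul_map,
      units_smul_map, units_smul_map]
    congr 1
    have hd0 : ∀ X Y a, B.d (f X 0 Y a) = 0 := fun X Y a => curv_zero_apply (by omega) (hκ X) a
    have h1 : z Z m V u ∈ B.deg (X := e V) (Y := e Z) (0 - m + d) := (hz Z m V).apply_mem hu
    have h2 : f X 0 Z (H.single Z X (tof _ j a)) ∈ B.deg (X := e Z) (Y := e X) (0 + j) :=
      (hf X).apply j a
    have h3 : f V 0 X (H.single X V (tof _ i l)) ∈ B.deg (X := e X) (Y := e V) (0 + i) :=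
      (hf V).apply i l
    rw [cup_snoc (hv Z).sg, map_smul, H.mulFirst_cons, traceForm_cons, H.th_th_succ m hu,
      map_smul, map_smul, map_smul, tr_mul_compTot hf hκ T _ _ (hd Z V u), B.mul_assoc,
      T.comm _ _ _ _ h3 (B.deg_mul _ _ _ _ h2 h1) (hd0 _ _ _)
        (by rw [B.d_mul, hd0, hd, map_zero, map_zero, LinearMap.zero_apply, add_zero]),
      sg_apply, B.sgn_deg _ _ h1, units_smul_map₂, units_smul_map, units_smul_map, B.mul_assoc,
      mul_smul, ← Int.cast_negOnePow_natCast, Int.cast_smul_eq_zsmul, Int.cast_smul_eq_zsmul,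
      Int.cast_smul_eq_zsmul, ← Units.smul_def, ← Units.smul_def, ← Units.smul_def]
    simp only [smul_smul, ← Int.negOnePow_add]
    congr 1
    rw [Int.negOnePow_eq_iff]
    exact ⟨m + 1 + i * j + i * d, by push_cast; ring⟩

include hf hκ in
/-- The change of the curvature of `f` on words with `m + 2` letters that is caused by a change
`z` on words with `m + 1` letters corresponds to the composition of the functional of `z` with
the Hochschild differential. -/
lemma traceForm_hochB (hz : ∀ X, IsHomog 0 (z X)) (hv : ∀ X, Van m (z X))
    (hd : ∀ X V w, B.d (z X m V w) = 0) (a : Tot (H.Hom Z X)) (w : H.Word (m + 1) X Z) :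
    traceForm f z T m m (H.hochB (m + 1) (H.chainsOf (m + 2) X
        (H.cons (m + 1) X Z X a (H.th m (m + 1) X Z w)))) =
      -T.tr (e X) (B.mul (f X 0 Z (H.single Z X a))
        ((pb (z Z) - cup (sg (f Z)) z - cup (sg (z Z)) f) (m + 1) X w)) := by
  rw [traceForm_rotation hf hκ T hz hv hd, traceForm_bar hf hκ T hd hv]
  simp only [Pi.sub_apply, LinearMap.sub_apply, map_sub]
  abel

end

end LC

/-! ### Removing the obstruction with a perfect pairing -/

namespace DGCat

variable {R : Type u} [CommRing R] {H : DGCat.{u} R} {X Y : H.Obj} {n m : ℕ} {d : ℤ}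

lemma chainsDeg_succ_le {S : Submodule R (H.Chains (m + 1))}
    (h : ∀ X Z i j (a : (H.Hom Z X).X i) (w : H.Word m X Z), i + j = d → w ∈ H.wordDeg m X Z j →
      H.chainsOf (m + 1) X (H.cons m X Z X (tof _ i a) w) ∈ S) : H.chainsDeg (m + 1) d ≤ S :=
  iSup_le fun X => Submodule.map_le_iff_le_comap.2 (H.wordDeg_succ_le fun Z i j a w hij hw =>
    h X Z i j a w hij hw)

lemma chains_hom_ext {M : Type u} [AddCommGroup M] [Module R M] {φ ψ : H.Chains m →ₗ[R] M}
    (h : ∀ d, ∀ y ∈ H.chainsDeg m d, φ y = ψ y) : φ = ψ := by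
  ext y
  induction y using chains_induction with
  | h0 => simp
  | h2 x y hx hy => simp only [map_add, hx, hy]
  | h1 X w =>
    have h1 : ⨆ d, H.wordDeg m X X d ≤ LinearMap.eqLocus (φ.comp (H.chainsOf m X))
        (ψ.comp (H.chainsOf m X)) :=
      iSup_le fun d w hw => h d _ (H.chainsOf_mem hw)
    exact h1 (H.iSup_wordDeg w)

lemma _root_.hpart_apply_of_mem {w : H.Word n X Y} (hw : w ∈ H.wordDeg n X Y d) {M : Type u}
    [AddCommGroup M] [Module R M] (ρ : ℤ → M →ₗ[R] M) (k : ℤ) (φ : H.Word n X Y →ₗ[R] M) :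
    hpart ρ n k φ w = ρ (k + d) (φ w) := by
  induction n generalizing Y d k with
  | zero => obtain ⟨a, rfl⟩ := hw; exact hpart_single ρ φ d a
  | succ n ih =>
    refine (H.wordDeg_succ_le
      (S := LinearMap.eqLocus (hpart ρ (n + 1) k φ) ((ρ (k + d)).comp φ)) ?_) hw
    rintro Z i j a w rfl hw
    rw [LinearMap.mem_eqLocus, ← LinearMap.comp_apply, hpart_cons, ih hw, add_assoc]
    rfl

end DGCat

namespace LC

variable {R : Type u} [CommRing R] {H : DGCat.{u} R} {B : SCat.{u} R} {e : H.Obj → B.Obj}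
  {X Z : H.Obj} {m n : ℕ} {f z : AA H B e} {M : Type u} [AddCommGroup M] [Module R M]

/-- Two functionals on Hochschild chains with at least two letters are equal if they agree on
chains whose words, apart from the first letter, are suspended. -/
lemma chains_th_ext (k : ℤ) {φ ψ : H.Chains (n + 1) →ₗ[R] M}
    (h : ∀ X Z a (w : H.Word n X Z), φ (H.chainsOf (n + 1) X (H.cons n X Z X a (H.th k n X Z w))) =
      ψ (H.chainsOf (n + 1) X (H.cons n X Z X a (H.th k n X Z w)))) (y : H.Chains (n + 1)) :
    φ y = ψ y := by
  induction y using H.chains_induction with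
  | h0 => simp
  | h2 x y hx hy => simp only [map_add, hx, hy]
  | h1 X w =>
    induction w using H.word_induction with
    | h0 => simp
    | h2 x y hx hy => simp only [map_add, hx, hy]
    | h1 Z a w => rw [← H.th_th k w]; exact h X Z a _

/-- The effect of a change `z` of a truncated twisting cochain on the functional of its
curvature. -/
lemma traceForm_curv_add (T : B.Trace M) (hf : ∀ X, IsHomog 0 (f X)) (hz : ∀ X, IsHomog 0 (z X))
    (hm : 1 ≤ m) (hκ : ∀ X, Van (m + 1) (curv f X)) (hv : ∀ X, Van m (z X))
    (hd : ∀ X V w, B.d (z X m V w) = 0) (y : H.Chains (m + 2)) :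
    traceForm f (curv (f + z)) T m (m + 1) y =
      traceForm f (curv f) T m (m + 1) y - traceForm f z T m m (H.hochB (m + 1) y) := by
  refine chains_th_ext m (φ := traceForm f (curv (f + z)) T m (m + 1))
    (ψ := traceForm f (curv f) T m (m + 1) - (traceForm f z T m m).comp (H.hochB (m + 1)))
    (fun X Z a w => ?_) y
  have hκ2 : ∀ X, Van 2 (curv f X) := fun X => (hκ X).mono (by omega)
  rw [LinearMap.sub_apply, LinearMap.comp_apply, traceForm_hochB hf hκ2 T hz hv hd,
    traceForm_cons, traceForm_cons, H.th_th, sub_neg_eq_add, ← map_add, ← map_add]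
  have h1 : cup (sg (z Z)) z (m + 1) X w = 0 := by
    induction w using H.word_induction with
    | h0 => simp
    | h2 x y hx hy => simp only [map_add, hx, hy, add_zero]
    | h1 V b w => rw [cup_cons_of_van _ hv, sg_apply, hv Z 0 (by omega)]; simp
  have h2 : curv (f + z) Z (m + 1) X w = curv f Z (m + 1) X w +
      (pb (z Z) - cup (sg (f Z)) z - cup (sg (z Z)) f) (m + 1) X w + B.d (z Z (m + 1) X w) := by
    have : curv (f + z) Z = curv f Z + (pb (z Z) - cup (sg (f Z)) z - cup (sg (z Z)) f) +
        dd (z Z) - cup (sg (z Z)) z := by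
      simp only [curv, Pi.add_apply, map_add, LinearMap.add_apply]; abel
    rw [this]
    simp only [Pi.sub_apply, Pi.add_apply, LinearMap.sub_apply, LinearMap.add_apply, h1, sub_zero]
    rfl
  rw [h2, map_add, map_add,
    T.tr_mul_d (curv_zero_apply (by omega : 0 < 2) (hκ2 X) _), add_zero]

/-- If a truncated twisting cochain extends, then the functional of its curvature is zero on the
Hochschild cycles. -/
lemma Extends.traceForm_eq (T : B.Trace M) (hf : ∀ X, IsHomog 0 (f X)) (hm : 1 ≤ m)
    (hκ : ∀ X, Van (m + 1) (curv f X)) (hE : Extends f (m + 1)) {y : H.Chains (m + 2)}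
    (hy : H.hochB (m + 1) y = 0) : traceForm f (curv f) T m (m + 1) y = 0 := by
  obtain ⟨f', hf', hv, hκ'⟩ := hE
  have hd := van_dd_sub hv hκ fun X => (hκ' X).mono (by omega)
  have h1 := traceForm_curv_add (z := f' - f) T hf (fun X => (hf' X).sub (hf X)) hm hκ hv
    (fun X V w => LinearMap.congr_fun (hd X m (by omega) V) w) y
  rw [hy, map_zero, sub_zero, add_sub_cancel] at h1
  rw [← h1]
  refine chains_th_ext m (φ := traceForm f (curv f') T m (m + 1)) (ψ := 0) (fun X Z a w => ?_) y
  rw [traceForm_cons, hκ' Z (m + 1) (by omega)]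
  simp

/-- The trace induces a pairing of degree `-N` between `H` and the morphisms of `B` along `f₀`
that is perfect on cohomology. -/
structure IsPerfectPairing (f : AA H B e) (T : B.Trace M) (P : B.Proj) (N : ℤ) : Prop where
  degree : ∀ {X Y : B.Obj} (i : ℤ) (a : B.Hom Y X) (y : B.Hom X Y), a ∈ B.deg (X := Y) i →
    T.tr X (B.mul a y) = T.tr X (B.mul a (P.ρ (N - i) y))
  inj : ∀ {X Z : H.Obj} (y : B.Hom (e X) (e Z)), B.d y = 0 →
    (∀ a, T.tr (e X) (B.mul (f X 0 Z (H.single Z X a)) y) = 0) → ∃ c, y = B.d c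
  surj : ∀ {X Z : H.Obj} (l : Tot (H.Hom Z X) →ₗ[R] M), ∃ y : B.Hom (e X) (e Z), B.d y = 0 ∧
    ∀ a, T.tr (e X) (B.mul (f X 0 Z (H.single Z X a)) y) = l a

section

variable {T : B.Trace M} {P : B.Proj} {N : ℤ} (hf : ∀ X, IsHomog 0 (f X))

include hf in
lemma IsPerfectPairing.traceForm_eq_zero (hT : IsPerfectPairing f T P N) {k : ℤ}
    (hz : ∀ X, IsHomog k (z X)) (l : ℤ) {d : ℤ} (hd : d + k - n ≠ N) {y : H.Chains (n + 1)}
    (hy : y ∈ H.chainsDeg (n + 1) d) : traceForm f z T l n y = 0 := by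
  refine (H.chainsDeg_succ_le (S := LinearMap.ker (traceForm f z T l n)) ?_) hy
  rintro X Z i j a w rfl hw
  rw [LinearMap.mem_ker, traceForm_cons, hT.degree (0 + i) _ _ ((hf X).apply i a),
    P.eq_zero _ _ _ ((hz Z n X).apply_mem (H.th_mem l hw)) (by omega), map_zero, map_zero]

variable [∀ X Y i, Module.Projective R ((H.Hom X Y).X i)]

include hf in
/-- By perfectness, every functional on Hochschild chains is represented, in the relevant
degree, by a closed cochain. -/
lemma IsPerfectPairing.exists_traceForm_eq (hT : IsPerfectPairing f T P N) (m : ℕ)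
    (ψ : H.Chains (m + 1) →ₗ[R] M) : ∃ g : AA H B e, (∀ X, IsHomog 0 (g X)) ∧
      (∀ X, Van m (g X)) ∧ (∀ X, dd (g X) = 0) ∧
      ∀ y ∈ H.chainsDeg (m + 1) (N + m), traceForm f g T m m y = ψ y := by
  -- the functionals on the first letter, and the pairing on cocycles
  let φ (Z V : H.Obj) : H.Word m V Z →ₗ[R] Tot (H.Hom Z V) →ₗ[R] M :=
    (((H.cons m V Z V).flip.comp (H.th m m V Z))).compr₂ (ψ.comp (H.chainsOf (m + 1) V))
  let c (Z V : H.Obj) : LinearMap.ker (B.d (X := e V) (Y := e Z)) →ₗ[R] Tot (H.Hom Z V) →ₗ[R] M :=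
    ((B.mul.flip.compl₂ ((f V 0 Z).comp (H.single Z V))).compr₂ (T.tr (e V))).comp
      (LinearMap.ker (B.d (X := e V) (Y := e Z))).subtype
  have hc : ∀ Z V, ∃ g : H.Word m V Z →ₗ[R] LinearMap.ker (B.d (X := e V) (Y := e Z)),
      (c Z V).comp g = φ Z V := fun Z V => exists_lift (c Z V) (φ Z V) fun w => by
    obtain ⟨y, hy, hy'⟩ := hT.surj (φ Z V w)
    exact ⟨⟨y, hy⟩, LinearMap.ext fun a => (hy' a).symm⟩
  choose g hg using hc
  let g' (Z V : H.Obj) : H.Word m V Z →ₗ[R] B.Hom (e V) (e Z) :=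
    hpart P.ρ m (0 - m) ((LinearMap.ker (B.d (X := e V) (Y := e Z))).subtype.comp (g Z V))
  have hg' : ∀ Z V, (B.d).comp (g' Z V) = 0 := fun Z V => by
    have h1 : (B.d).comp ((LinearMap.ker (B.d (X := e V) (Y := e Z))).subtype.comp (g Z V)) = 0 :=
      LinearMap.ext fun w => (g Z V w).2
    have h2 := comp_hpart P.ρ (ρ' := P.ρ) (n := m) (k := 0 - m)
      ((LinearMap.ker (B.d (X := e V) (Y := e Z))).subtype.comp (g Z V)) B.d (j := 1)
      fun i x => P.comm_d i x
    rw [h1, map_zero] at h2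
    exact h2
  refine ⟨fun Z => supp m (g' Z), fun Z => isHomog_supp fun V =>
    homog_hpart _ _ P.mem, fun Z => van_supp, fun Z => ?_, fun y hy => ?_⟩
  · funext n V
    by_cases hn : n = m
    · subst hn
      change (B.d).comp (supp n (g' Z) n V) = 0
      rw [supp_self, hg']
    · change (B.d).comp (supp m (g' Z) n V) = 0
      rw [supp_ne hn, LinearMap.comp_zero]
  · refine (H.chainsDeg_succ_le (S := LinearMap.eqLocus
      (traceForm f (fun Z => supp m (g' Z)) T m m) ψ) ?_) hy
    intro X Z i j a w hij hw
    rw [LinearMap.mem_eqLocus, traceForm_cons, supp_self]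
    dsimp only [g']
    rw [hpart_apply_of_mem (H.th_mem m hw), show (0 - (m : ℤ) + j) = N - (0 + i) by omega,
      ← hT.degree (0 + i) _ _ ((hf X).apply i a)]
    refine (LinearMap.congr_fun (LinearMap.congr_fun (hg Z X) (H.th m m X Z w))
      (tof _ i a)).trans ?_
    change ψ (H.chainsOf (m + 1) X (H.cons m X Z X _ (H.th m m X Z (H.th m m X Z w)))) = _
    rw [H.th_th]

include hf in
/-- A truncated twisting cochain extends if the functional of its curvature factors through the
Hochschild differential. -/
theorem IsPerfectPairing.extends (hT : IsPerfectPairing f T P N) (hm : 1 ≤ m)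
    (hκ : ∀ X, Van (m + 1) (curv f X)) (ψ : H.Chains (m + 1) →ₗ[R] M)
    (hψ : ∀ y, traceForm f (curv f) T m (m + 1) y = ψ (H.hochB (m + 1) y)) :
    Extends f (m + 1) := by
  obtain ⟨g, hg, hgv, hgd, hgψ⟩ := hT.exists_traceForm_eq hf m ψ
  have hκ' := curv_add_closed hκ hgv hgd
  have hfg : ∀ X, IsHomog 0 ((f + g) X) := fun X => (hf X).add (hg X)
  have h1 : traceForm f (curv (f + g)) T m (m + 1) = 0 := by
    refine H.chains_hom_ext fun d y hy => ?_
    rw [traceForm_curv_add T hf hg hm hκ hgv (fun X V w =>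
      LinearMap.congr_fun (congrFun (congrFun (hgd X) m) V) w), LinearMap.zero_apply]
    by_cases hd : d = N + m
    · subst hd
      rw [hgψ _ (H.hochB_mem hy), hψ, sub_self]
    · rw [hT.traceForm_eq_zero hf (curv_homog hf) m (by push_cast; omega) hy,
        hT.traceForm_eq_zero hf hg m (by omega) (H.hochB_mem hy), sub_zero]
  obtain ⟨f₁, hf₁, hv₁, hκ₁⟩ := exists_extend P hfg hκ' fun Z X w => by
    refine hT.inj _ ?_ fun a => ?_
    · exact LinearMap.congr_fun (dd_curv_eq_zero hfg hκ' Z (m + 1) (by omega) X) w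
    · have h2 := LinearMap.congr_fun h1 (H.chainsOf (m + 2) X (H.cons (m + 1) X Z X a
        (H.th m (m + 1) X Z w)))
      rwa [traceForm_cons, H.th_th] at h2
  refine ⟨f₁, hf₁, fun X => ?_, hκ₁⟩
  change Van m _
  convert ((hv₁ X).mono (Nat.le_succ m)).add (hgv X) using 1
  rw [Pi.add_apply]; abel

end

section

variable {B' : SCat.{u} R} {M' : Type u} [AddCommGroup M'] [Module R M']

lemma traceForm_push (G : SCat.Fun B B') (T : B.Trace M) (T' : B'.Trace M') (ι : M →ₗ[R] M')
    (hG : ∀ X x, T'.tr (G.obj X) (G.map x) = ι (T.tr X x)) (k : ℤ) (y : H.Chains (n + 1)) :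
    traceForm (e := fun X => G.obj (e X)) (fun X => push G (f X)) (fun X => push G (z X)) T' k n y =
      ι (traceForm f z T k n y) := by
  induction y using H.chains_induction with
  | h0 => simp
  | h2 x y hx hy => simp only [map_add, hx, hy]
  | h1 X w =>
    induction w using H.word_induction with
    | h0 => simp
    | h2 x y hx hy => simp only [map_add, hx, hy]
    | h1 Z a w => rw [traceForm_cons, traceForm_cons, ← hG, G.map_mul]; rfl

variable [∀ X Y i, Module.Projective R ((H.Hom X Y).X i)]
  [Module.Projective R H.HochschildHomology]

/-- If the Hochschild homology of `H` is projective and the trace pairing is perfect, then a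
truncated twisting cochain extends as soon as it does after applying a functor along which the
trace is injective on values. -/
theorem IsPerfectPairing.extends_of_push (hd : ∀ X Y i j, (H.Hom X Y).d i j = 0)
    {T : B.Trace M} {P : B.Proj} {N : ℤ} (hT : IsPerfectPairing f T P N)
    (hf : ∀ X, IsHomog 0 (f X)) (hm : 1 ≤ m) (hκ : ∀ X, Van (m + 1) (curv f X))
    (G : SCat.Fun B B') (T' : B'.Trace M') (ι : M →ₗ[R] M') (hι : Function.Injective ι)
    (hG : ∀ X x, T'.tr (G.obj X) (G.map x) = ι (T.tr X x))
    (hE : Extends (e := fun X => G.obj (e X)) (fun X => push G (f X)) (m + 1)) :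
    Extends f (m + 1) := by
  obtain ⟨ψ, hψ⟩ := H.exists_factor_hochB hd (traceForm f (curv f) T m (m + 1)) fun y hy => by
    refine hι ?_
    rw [map_zero, ← traceForm_push G T T' ι hG]
    have hc : (fun X => push G (curv f X)) =
        curv (e := fun X => G.obj (e X)) (fun X => push G (f X)) := funext fun X => push_curv G f X
    rw [hc]
    exact hE.traceForm_eq T' (fun X => (hf X).push G) hm
      (fun X => by rw [← push_curv]; exact (hκ X).push G) hy
  exact hT.extends hf hm hκ ψ hψ

end

end LC

/-! ### Quasi-isomorphisms in terms of elements -/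

section QuasiIso

variable {R : Type u} [CommRing R]

open ShortComplex in
lemma moduleCat_shortComplex_quasiIso_iff {S T : ShortComplex (ModuleCat.{u} R)} (φ : S ⟶ T) :
    QuasiIso φ ↔ (∀ x : S.X₂, S.g x = 0 → (∃ y, φ.τ₂ x = T.f y) → ∃ z, x = S.f z) ∧
      ∀ y : T.X₂, T.g y = 0 → ∃ x, S.g x = 0 ∧ ∃ z, y = φ.τ₂ x + T.f z := by
  rw [quasiIso_iff_isIso_leftHomologyMap' φ S.moduleCatLeftHomologyData T.moduleCatLeftHomologyData,
    ConcreteCategory.isIso_iff_bijective]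
  set ψ := leftHomologyMap' φ S.moduleCatLeftHomologyData T.moduleCatLeftHomologyData with hψ
  have hg : ∀ x : S.X₂, S.g x = 0 → T.g (φ.τ₂ x) = 0 := fun x hx => by
    have := ConcreteCategory.congr_hom φ.comm₂₃ x
    simp only [ConcreteCategory.comp_apply] at this
    rw [this, hx, map_zero]
  have h1 : ∀ (x : S.X₂) (hx : S.g x = 0),
      ψ (S.moduleCatLeftHomologyData.π (⟨x, hx⟩ : LinearMap.ker S.g.hom)) =
        T.moduleCatLeftHomologyData.π (⟨φ.τ₂ x, hg x hx⟩ : LinearMap.ker T.g.hom) := by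
    intro x hx
    have h2 : ψ (S.moduleCatLeftHomologyData.π (⟨x, hx⟩ : LinearMap.ker S.g.hom)) =
        T.moduleCatLeftHomologyData.π (cyclesMap' φ S.moduleCatLeftHomologyData
          T.moduleCatLeftHomologyData (⟨x, hx⟩ : LinearMap.ker S.g.hom)) :=
      ConcreteCategory.congr_hom (leftHomologyπ_naturality' φ S.moduleCatLeftHomologyData
        T.moduleCatLeftHomologyData) (⟨x, hx⟩ : LinearMap.ker S.g.hom)
    have h3 : T.moduleCatLeftHomologyData.i (cyclesMap' φ S.moduleCatLeftHomologyData
          T.moduleCatLeftHomologyData (⟨x, hx⟩ : LinearMap.ker S.g.hom)) = φ.τ₂ x :=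
      ConcreteCategory.congr_hom (cyclesMap'_i φ S.moduleCatLeftHomologyData
        T.moduleCatLeftHomologyData) (⟨x, hx⟩ : LinearMap.ker S.g.hom)
    refine h2.trans (congrArg _ (Subtype.ext h3))
  have hS : ∀ (x : S.X₂) (hx : S.g x = 0),
      S.moduleCatLeftHomologyData.π (⟨x, hx⟩ : LinearMap.ker S.g.hom) = 0 ↔ ∃ z, x = S.f z := by
    intro x hx
    refine (Submodule.Quotient.mk_eq_zero _).trans ⟨?_, ?_⟩
    · rintro ⟨z, hz⟩; exact ⟨z, (congrArg Subtype.val hz).symm⟩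
    · rintro ⟨z, hz⟩; exact ⟨z, Subtype.ext hz.symm⟩
  have hT : ∀ (x : T.X₂) (hx : T.g x = 0),
      T.moduleCatLeftHomologyData.π (⟨x, hx⟩ : LinearMap.ker T.g.hom) = 0 ↔ ∃ z, x = T.f z := by
    intro x hx
    refine (Submodule.Quotient.mk_eq_zero _).trans ⟨?_, ?_⟩
    · rintro ⟨z, hz⟩; exact ⟨z, (congrArg Subtype.val hz).symm⟩
    · rintro ⟨z, hz⟩; exact ⟨z, Subtype.ext hz.symm⟩
  refine and_congr ⟨fun h x hx hy => ?_, fun h => ?_⟩ ⟨fun h y hy => ?_, fun h y => ?_⟩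
  · refine (hS x hx).1 (h ?_)
    rw [map_zero, h1, hT]; exact hy
  · refine (injective_iff_map_eq_zero ψ.hom).2 fun x hx => ?_
    obtain ⟨⟨x, hx'⟩, rfl⟩ := Submodule.Quotient.mk_surjective _ x
    refine (hS x hx').2 (h x hx' ?_)
    rw [← hT _ (hg x hx'), ← h1]; exact hx
  · obtain ⟨x, hx⟩ := h (T.moduleCatLeftHomologyData.π (⟨y, hy⟩ : LinearMap.ker T.g.hom))
    obtain ⟨⟨x, hx'⟩, rfl⟩ := Submodule.Quotient.mk_surjective _ x
    obtain ⟨z, hz⟩ := (hT (y - φ.τ₂ x) (by rw [map_sub, hy, hg x hx', sub_zero])).1 (by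
      refine Eq.trans (map_sub T.moduleCatLeftHomologyData.π.hom
        (⟨y, hy⟩ : LinearMap.ker T.g.hom) ⟨φ.τ₂ x, hg x hx'⟩) ?_
      exact sub_eq_zero.2 (hx.symm.trans (h1 x hx')))
    exact ⟨x, hx', z, by rw [← hz]; abel⟩
  · obtain ⟨⟨y, hy⟩, rfl⟩ := Submodule.Quotient.mk_surjective _ y
    obtain ⟨x, hx, z, hz⟩ := h y hy
    refine ⟨S.moduleCatLeftHomologyData.π (⟨x, hx⟩ : LinearMap.ker S.g.hom), ?_⟩
    refine (h1 x hx).trans (sub_eq_zero.1 ?_)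
    refine Eq.trans (map_sub T.moduleCatLeftHomologyData.π.hom
        (⟨φ.τ₂ x, hg x hx⟩ : LinearMap.ker T.g.hom) ⟨y, hy⟩).symm ?_
    refine (hT (φ.τ₂ x - y) (by rw [map_sub, hy, hg x hx, sub_zero])).2 ⟨-z, ?_⟩
    rw [map_neg, hz]; abel

variable {A B : CochainComplex (ModuleCat.{u} R) ℤ}

lemma quasiIso_iff_elements (f : A ⟶ B) : QuasiIso f ↔
    ∀ i, (∀ x : A.X i, A.d i (i + 1) x = 0 → (∃ y, f.f i x = B.d (i - 1) i y) →
        ∃ z, x = A.d (i - 1) i z) ∧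
      ∀ y : B.X i, B.d i (i + 1) y = 0 → ∃ x, A.d i (i + 1) x = 0 ∧
        ∃ z, y = f.f i x + B.d (i - 1) i z := by
  rw [_root_.quasiIso_iff]
  refine forall_congr' fun i => ?_
  rw [quasiIsoAt_iff' f (i - 1) i (i + 1) (by simp) (by simp), moduleCat_shortComplex_quasiIso_iff]
  rfl

/-- A quasi-isomorphism from a complex without differential to a K-projective complex has a
left inverse. -/
lemma exists_retraction (s : A ⟶ B) [QuasiIso s] [B.IsKProjective] (hA : ∀ i j, A.d i j = 0) :
    ∃ (r : B ⟶ A) (k : ∀ i j, B.X i ⟶ B.X j), (∀ i x, r.f i (s.f i x) = x) ∧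
      ∀ i j l, i + 1 = j → j + 1 = l → ∀ x : B.X j,
        s.f j (r.f j x) = k l j (B.d j l x) + B.d i j (k j i x) + x := by
  let := HasDerivedCategory.standard (ModuleCat.{u} R)
  obtain ⟨g, hg⟩ := (CochainComplex.IsKProjective.Qh_map_bijective B
    ((HomotopyCategory.quotient _ _).obj A)).surjective
    ((DerivedCategory.quotientCompQhIso _).hom.app B ≫ inv (DerivedCategory.Q.map s) ≫
      (DerivedCategory.quotientCompQhIso _).inv.app A)
  obtain ⟨r, rfl⟩ := (HomotopyCategory.quotient _ _).map_surjective g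
  have h1 : (HomotopyCategory.quotient _ _).map (r ≫ s) =
      (HomotopyCategory.quotient _ _).map (𝟙 B) := by
    refine (CochainComplex.IsKProjective.Qh_map_bijective B _).injective ?_
    simp [hg, ← DerivedCategory.quotientCompQhIso_inv_naturality s, -NatTrans.naturality]
  let h := HomotopyCategory.homotopyOfEq _ _ h1
  have h2 : ∀ i x, s.f i (r.f i x) = h.hom (i + 1) i (B.d i (i + 1) x) +
      B.d (i - 1) i (h.hom i (i - 1) x) + x := fun i x => by
    have := ConcreteCategory.congr_hom (h.comm i) x
    rw [dNext_eq _ (show (ComplexShape.up ℤ).Rel i (i + 1) by simp),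
      prevD_eq _ (show (ComplexShape.up ℤ).Rel (i - 1) i by simp)] at this
    exact this
  refine ⟨r, h.hom, fun i x => ?_, fun i j l hi hl x => by
    obtain rfl : i = j - 1 := by omega
    subst hl
    exact h2 j x⟩
  have h3 := ((quasiIso_iff_elements s).1 inferInstance i).1 (r.f i (s.f i x) - x)
    (by rw [hA]; rfl) ⟨h.hom i (i - 1) (s.f i x), by
      have h4 : B.d i (i + 1) (s.f i x) = 0 := by
        have h5 : B.d i (i + 1) (s.f i x) = s.f (i + 1) (A.d i (i + 1) x) :=
          ConcreteCategory.congr_hom (s.comm i (i + 1)) x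
        rw [h5, hA]
        exact map_zero (s.f (i + 1)).hom
      rw [map_sub, h2, h4, map_zero, zero_add, add_sub_cancel_right]⟩
  obtain ⟨z, hz⟩ := h3
  rw [hA] at hz
  exact sub_eq_zero.1 (hz.trans rfl)

end QuasiIso

/-! ### The perfect pairing of a Calabi–Yau structure -/

namespace DGCat

variable {R : Type u} [CommRing R]

/-- The projections of the total modules to their homogeneous parts. -/
def toSProj (C : DGCat.{u} R) : C.toS.Proj where
  ρ {X Y} k := totProj (C.Hom X Y) k
  mem k x := totProj_mem k x
  eq_self _ _ h := totProj_of_mem h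
  eq_zero _ _ _ h hkl := totProj_of_mem_ne h hkl
  comm_d k x := totD_totProj k x

lemma totD_tof' {A : CochainComplex (ModuleCat.{u} R) ℤ} {i j : ℤ} (h : i + 1 = j) (x : A.X i) :
    totD A (tof A i x) = tof A j (A.d i j x) := by
  subst h; exact totD_tof i x

lemma tcomp_totD' {A : CochainComplex (ModuleCat.{u} R) ℤ} {i j : ℤ} (h : i + 1 = j) (x : Tot A) :
    tcomp A j (totD A x) = A.d i j (tcomp A i x) := by
  subst h; exact tcomp_totD i x

lemma totD_eq_zero_iff {A : CochainComplex (ModuleCat.{u} R) ℤ} {i : ℤ} (x : A.X i) :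
    totD A (tof A i x) = 0 ↔ A.d i (i + 1) x = 0 := by
  rw [totD_tof]
  refine ⟨fun h => ?_, fun h => by rw [h, map_zero]⟩
  rw [← tcomp_tof (i + 1) (A.d i (i + 1) x), h, map_zero]

lemma exists_totD_eq {A : CochainComplex (ModuleCat.{u} R) ℤ} {y : Tot A}
    (h : ∀ j, ∃ z, tcomp _ j y = A.d (j - 1) j z) : ∃ z, y = totD A z := by
  classical
  choose z hz using h
  refine ⟨∑ j ∈ DFinsupp.support y, tof _ (j - 1) (z j), ?_⟩
  rw [map_sum]
  conv_lhs => rw [← DirectSum.sum_support_of y]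
  refine Finset.sum_congr rfl fun j _ => ?_
  rw [totD_tof' (sub_add_cancel j 1), ← hz]
  rfl

section Trace

variable {D : DGCat.{u} R} {n : ℤ} (c : D.HochschildCocycle n)

/-- The restriction of a Hochschild cocycle to endomorphisms, as a functional on the total
module. -/
def HochschildCocycle.trTot (X : D.Obj) : Tot (D.Hom X X) →ₗ[R] R :=
  c.φ.comp ((D.hochOf 0).comp ((D.chainsOf 0 X).comp (D.single X X)))

lemma HochschildCocycle.trTot_tof (X : D.Obj) (k : ℤ) (x : (D.Hom X X).X k) :
    c.trTot X (tof _ k x) = c.trace X k x := rfl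

lemma HochschildCocycle.trTot_tof_eq_zero (X : D.Obj) {k : ℤ} (hk : k ≠ n)
    (x : (D.Hom X X).X k) : c.trTot X (tof _ k x) = 0 :=
  c.degree 0 X k _ (D.single_mem k x) (by simpa using hk)

lemma HochschildCocycle.trTot_d (X : D.Obj) (x : Tot (D.Hom X X)) :
    c.trTot X (totD _ x) = 0 := by
  induction x using tot_induction with
  | h0 => simp
  | h2 x y hx hy => simp only [map_add, hx, hy, add_zero]
  | h1 k x => rw [totD_tof, trTot_tof]; exact c.trace_d X k (k + 1) rfl x

lemma HochschildCocycle.trTot_comm {X Y : D.Obj} {i j : ℤ} (x : (D.Hom Y X).X i)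
    (y : (D.Hom X Y).X j) (hx : totD _ (tof _ i x) = 0) (hy : totD _ (tof _ j y) = 0) :
    c.trTot X (D.compTot X Y X (tof _ i x) (tof _ j y)) =
      (i * j).negOnePow • c.trTot Y (D.compTot Y X Y (tof _ j y) (tof _ i x)) := by
  classical
  have h1 := LinearMap.congr_fun c.closed (D.hochOf 1 (D.chainsOf 1 X
    (D.cons 0 X Y X (tof _ i x) (D.single X Y (tof _ j y)))))
  have h2 (w : D.Chains 1) : D.hochD (D.hochOf 1 w) = D.hochOf 0 (D.hochB 0 w) +
      (-1 : R) ^ 1 • D.hochOf 1 (D.chainsD 1 w) :=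
    DirectSum.toModule_lof (M := fun n => D.Chains n) R 1 w
  have h3 (w : D.Word 1 X X) : D.chainsD 1 (D.chainsOf 1 X w) = D.chainsOf 1 X (D.wordD 1 X X w) :=
    DirectSum.toModule_lof (M := fun X => D.Word 1 X X) R X w
  have h4 : D.wordD 1 X X (D.cons 0 X Y X (tof _ i x) (D.single X Y (tof _ j y))) = 0 := by
    have h5 : D.wordD 0 X Y (D.single X Y (tof _ j y)) = 0 := hy
    rw [wordD, wordLift_cons]
    simp only [LinearMap.add_apply, LinearMap.comp_apply, LinearMap.compl₁₂_apply, hx, h5, map_zero,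
      LinearMap.zero_apply, add_zero]
  rw [LinearMap.comp_apply, h2, h3, h4, map_zero, map_zero, smul_zero, add_zero,
    ← D.snoc_single, D.hochB_snoc (D.single_mem i x), D.snoc_single, D.bar_zero, D.mulFirst_single,
    map_add, map_add, map_smul, map_smul, D.mulFirst_single, LinearMap.zero_apply, zero_add, pow_one,
    neg_one_mul, neg_smul, ← sub_eq_add_neg, sub_eq_zero, Int.cast_smul_eq_zsmul,
    ← Units.smul_def, mul_comm j i] at h1
  exact h1

/-- The trace of a Hochschild cocycle. -/
def HochschildCocycle.toTrace : D.toS.Trace R where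
  tr := c.trTot
  tr_d := c.trTot_d
  comm := by
    rintro X Y i j _ _ ⟨x, rfl⟩ ⟨y, rfl⟩ hx hy
    exact c.trTot_comm x y hx hy

lemma HochschildCocycle.toTrace_degree {X Y : D.Obj} (i : ℤ) (a : D.toS.Hom Y X)
    (y : D.toS.Hom X Y) (ha : a ∈ D.toS.deg (X := Y) i) : c.toTrace.tr X (D.toS.mul a y) =
      c.toTrace.tr X (D.toS.mul a (D.toSProj.ρ (n - i) y)) := by
  obtain ⟨a, rfl⟩ := ha
  change c.trTot X (D.compTot X Y X (tof _ i a) y) =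
    c.trTot X (D.compTot X Y X (tof _ i a) (totProj _ (n - i) y))
  change Tot (D.Hom X Y) at y
  induction y using tot_induction with
  | h0 => simp
  | h2 x y hx hy => simp only [map_add, hx, hy]
  | h1 j y =>
    by_cases hj : j = n - i
    · rw [totProj_of_mem (tof_mem j y |> hj.subst (motive := fun k => _ ∈ totDeg _ k))]
    · rw [totProj_of_mem_ne (tof_mem j y) hj, D.compTot_tof i j _ rfl,
        c.trTot_tof_eq_zero X (by omega), map_zero, map_zero]

end Trace

end DGCat

/-- A cochain that induces an isomorphism from `H` to the cohomology of `B`. -/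
structure LC.QI {R : Type u} [CommRing R] {H : DGCat.{u} R} {B : SCat.{u} R} {e : H.Obj → B.Obj}
    (f : AA H B e) : Prop where
  closed : ∀ (X Y : H.Obj) (a : Tot (H.Hom X Y)), B.d (f Y 0 X (H.single X Y a)) = 0
  inj : ∀ (X Y : H.Obj) (a : Tot (H.Hom X Y)),
    (∃ y, f Y 0 X (H.single X Y a) = B.d y) → a = 0
  surj : ∀ (X Y : H.Obj) (b : B.Hom (e X) (e Y)), B.d b = 0 →
    ∃ a y, b = f Y 0 X (H.single X Y a) + B.d y

namespace DGCat

section Section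

variable {R : Type u} [CommRing R] {H D : DGCat.{u} R} {e : H.Obj → D.Obj} {f : AA H D.toS e}
  (hf : ∀ X, LC.IsHomog 0 (f X)) (hq : LC.QI f) (hd : ∀ X Y i j, (H.Hom X Y).d i j = 0)

variable (f) in
/-- The component of a cochain on single letters. -/
def sec (X Z : H.Obj) : Tot (H.Hom Z X) →ₗ[R] Tot (D.Hom (e Z) (e X)) :=
  (f X 0 Z).comp (H.single Z X)

include hq in
lemma totD_sec (X Z : H.Obj) (a : Tot (H.Hom Z X)) : totD _ (sec f X Z a) = 0 := hq.closed Z X a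

include hf in
lemma sec_mem (X Z : H.Obj) (i : ℤ) (a : (H.Hom Z X).X i) :
    sec f X Z (tof _ i a) ∈ totDeg (D.Hom (e Z) (e X)) i := by
  have := (hf X).apply (V := Z) i a
  rwa [zero_add] at this

/-- The component on single letters of a cochain that induces an isomorphism on cohomology, as a
morphism of complexes. -/
def sectionMap (X Z : H.Obj) : H.Hom Z X ⟶ D.Hom (e Z) (e X) where
  f i := ModuleCat.ofHom ((tcomp (D.Hom (e Z) (e X)) i).comp
    ((sec f X Z).comp (tof (H.Hom Z X) i)))
  comm' i j hij := by
    obtain rfl : i + 1 = j := hij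
    ext a
    rw [hd]
    change (D.Hom (e Z) (e X)).d i (i + 1) (tcomp _ i (sec f X Z (tof _ i a))) =
      tcomp _ (i + 1) (sec f X Z (tof _ (i + 1) 0))
    rw [← tcomp_totD, totD_sec hq]
    simp only [map_zero]

include hf in
lemma tof_sectionMap (X Z : H.Obj) (i : ℤ) (a : (H.Hom Z X).X i) :
    tof _ i ((sectionMap hq hd X Z).f i a) = sec f X Z (tof _ i a) :=
  totProj_of_mem (sec_mem hf X Z i a)

include hf in
lemma tcomp_sec (X Z : H.Obj) (i : ℤ) (a : Tot (H.Hom Z X)) :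
    tcomp _ i (sec f X Z a) = (sectionMap hq hd X Z).f i (tcomp _ i a) := by
  induction a using tot_induction with
  | h0 => simp only [map_zero]
  | h2 x y hx hy => simp only [map_add, hx, hy]
  | h1 j a =>
    rw [← tof_sectionMap hf hq hd]
    by_cases h : j = i
    · subst h; rw [tcomp_tof, tcomp_tof]
    · rw [tcomp_tof_ne h, tcomp_tof_ne h, map_zero]

include hf in
lemma quasiIso_sectionMap (X Z : H.Obj) : QuasiIso (sectionMap hq hd X Z) := by
  refine (quasiIso_iff_elements _).2 fun i => ⟨fun x _ => ?_, fun y hy => ?_⟩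
  · rintro ⟨y, hy⟩
    have h1 : sec f X Z (tof _ i x) = totD _ (tof _ (i - 1) y) := by
      rw [← tof_sectionMap hf hq hd, hy, totD_tof' (sub_add_cancel i 1)]
    replace h1 := hq.inj Z X (tof _ i x) ⟨_, h1⟩
    refine ⟨0, ?_⟩
    rw [map_zero, ← tcomp_tof i x, h1, map_zero]
  · obtain ⟨a, z, haz⟩ := hq.surj Z X (tof _ i y) ((totD_eq_zero_iff y).2 hy)
    refine ⟨tcomp _ i a, by rw [hd]; rfl, tcomp _ (i - 1) z, ?_⟩
    change Tot (D.Hom (e Z) (e X)) at z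
    replace haz : tof _ i y = sec f X Z a + totD _ z := haz
    replace haz := congrArg (tcomp _ i) haz
    rwa [map_add, tcomp_sec hf hq hd, tcomp_tof, tcomp_totD' (sub_add_cancel i 1)] at haz

variable {n : ℤ} (c : D.HochschildCocycle n) (hc : ∀ X Y : D.Obj, QuasiIso (c.pairing X Y))
  (hK : ∀ X Y : D.Obj, (D.Hom X Y).IsKProjective)

include hf in
lemma trTot_section_comm {X Z : H.Obj} {i j : ℤ} (hij : i + j = n) (a : (H.Hom Z X).X i)
    (y : (D.Hom (e X) (e Z)).X j) (hy : (D.Hom (e X) (e Z)).d j (j + 1) y = 0) :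
    c.trTot _ (D.compTot _ _ _ (sec f X Z (tof _ i a)) (tof _ j y)) =
      (i * j).negOnePow • c.trace (e Z) n (D.comp j i n (by omega) y
        ((sectionMap hq hd X Z).f i a)) := by
  rw [← tof_sectionMap hf hq hd, c.trTot_comm _ _ ?_ ((totD_eq_zero_iff y).2 hy),
    D.compTot_tof j i n (by omega), c.trTot_tof]
  rw [tof_sectionMap hf hq hd, totD_sec hq]

include hf hq hd hc hK in
lemma exists_eq_d_of_pairing (X Z : H.Obj) (j : ℤ) (y : (D.Hom (e X) (e Z)).X j)
    (hy : (D.Hom (e X) (e Z)).d j (j + 1) y = 0)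
    (h : ∀ i (a : (H.Hom Z X).X i), i + j = n →
      c.trTot _ (D.compTot _ _ _ (sec f X Z (tof _ i a)) (tof _ j y)) = 0) :
    ∃ z, y = (D.Hom (e X) (e Z)).d (j - 1) j z := by
  have := quasiIso_sectionMap hf hq hd X Z
  have := hK (e Z) (e X)
  obtain ⟨r, k, -, hk⟩ := exists_retraction (sectionMap hq hd X Z) (hd Z X)
  refine ((quasiIso_iff_elements (c.pairing (e X) (e Z))).1 (hc _ _) j).1 y hy
    ⟨(j - 1).negOnePow • ((c.trace (e Z) n).comp (D.comp j (n - j) n (by omega) y)).comp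
      (k (n - (j - 1)) (n - j)).hom, LinearMap.ext fun g => ?_⟩
  have h1 := hk (n - j - 1) (n - j) (n - (j - 1)) (by omega) (by omega) g
  have h2 : c.trace (e Z) n (D.comp j (n - j) n (by omega) y
      ((sectionMap hq hd X Z).f (n - j) (r.f (n - j) g))) = 0 := by
    have h3 := trTot_section_comm hf hq hd c (show n - j + j = n by omega) (r.f (n - j) g) y hy
    rw [h _ _ (by omega)] at h3
    exact ((smul_eq_zero_iff_eq _).1 h3.symm)
  have h4 : c.trace (e Z) n (D.comp j (n - j) n (by omega) y
      ((D.Hom (e Z) (e X)).d (n - j - 1) (n - j) (k (n - j) (n - j - 1) g))) = 0 := by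
    have h5 := c.trace_d (e Z) (n - 1) n (by omega)
      (D.comp j (n - j - 1) (n - 1) (by omega) y (k (n - j) (n - j - 1) g))
    rw [D.leibniz j (n - j - 1) (j + 1) (n - j) (n - 1) n (by omega) (by omega) (by omega) rfl
      (by omega), hy, map_zero, LinearMap.zero_apply, zero_add, units_smul_map] at h5
    exact ((smul_eq_zero_iff_eq _).1 h5)
  have h6 : c.trace (e Z) n (D.comp j (n - j) n (by omega) y g) =
      -c.trace (e Z) n (D.comp j (n - j) n (by omega) y (k (n - (j - 1)) (n - j)
        ((D.Hom (e Z) (e X)).d (n - j) (n - (j - 1)) g))) := by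
    rw [h1, map_add, map_add, map_add, map_add, h4, add_zero, add_comm] at h2
    exact eq_neg_of_add_eq_zero_left h2
  refine Eq.trans h6 ?_
  change _ = -((j - 1).negOnePow • (j - 1).negOnePow • c.trace (e Z) n (D.comp j (n - j) n _ y
    (k (n - (j - 1)) (n - j) ((D.Hom (e Z) (e X)).d (n - j) (n - (j - 1)) g))))
  rw [smul_smul, ← Int.negOnePow_add, Int.negOnePow_even _ ⟨_, rfl⟩, one_smul]

include hf hq hd hc hK in
lemma exists_pairing_eq (X Z : H.Obj) (i j : ℤ) (hij : i + j = n) (l : (H.Hom Z X).X i →ₗ[R] R) :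
    ∃ y : (D.Hom (e X) (e Z)).X j, (D.Hom (e X) (e Z)).d j (j + 1) y = 0 ∧ ∀ a,
      c.trTot _ (D.compTot _ _ _ (sec f X Z (tof _ i a)) (tof _ j y)) = l a := by
  have := quasiIso_sectionMap hf hq hd X Z
  have := hK (e Z) (e X)
  obtain ⟨r, k, hr, -⟩ := exists_retraction (sectionMap hq hd X Z) (hd Z X)
  obtain rfl : i = n - j := by omega
  obtain ⟨y, hy, (ψ : Module.Dual R ((D.Hom (e Z) (e X)).X (n - (j - 1)))), hψ⟩ :=
    ((quasiIso_iff_elements (c.pairing (e X) (e Z))).1 (hc _ _) j).2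
    (l.comp (r.f (n - j)).hom) (LinearMap.ext fun g => by
      change -(j.negOnePow • l (r.f (n - j) ((D.Hom (e Z) (e X)).d (n - (j + 1)) (n - j) g))) = 0
      have h1 : r.f (n - j) ((D.Hom (e Z) (e X)).d (n - (j + 1)) (n - j) g) =
          (H.Hom Z X).d (n - (j + 1)) (n - j) (r.f (n - (j + 1)) g) :=
        (ConcreteCategory.congr_hom (r.comm (n - (j + 1)) (n - j)) g).symm
      rw [h1, hd]
      change -(j.negOnePow • l 0) = 0
      rw [map_zero, smul_zero, neg_zero])
  refine ⟨((n - j) * j).negOnePow • y, ?_, fun a => ?_⟩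
  · rw [units_smul_map, hy, smul_zero]
  · rw [units_smul_map, units_smul_map, units_smul_map, trTot_section_comm hf hq hd c hij a y hy,
      smul_smul, ← Int.negOnePow_add, Int.negOnePow_even _ ⟨_, rfl⟩, one_smul]
    have h2 := LinearMap.congr_fun hψ ((sectionMap hq hd X Z).f (n - j) a)
    have h3 : (D.Hom (e Z) (e X)).d (n - j) (n - (j - 1)) ((sectionMap hq hd X Z).f (n - j) a) =
        (sectionMap hq hd X Z).f (n - (j - 1)) ((H.Hom Z X).d (n - j) (n - (j - 1)) a) :=
      ConcreteCategory.congr_hom ((sectionMap hq hd X Z).comm _ _) a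
    change l (r.f (n - j) ((sectionMap hq hd X Z).f (n - j) a)) = c.trace (e Z) n
        (D.comp j (n - j) n _ y ((sectionMap hq hd X Z).f (n - j) a)) +
      -((j - 1).negOnePow • ψ ((D.Hom (e Z) (e X)).d (n - j) (n - (j - 1))
        ((sectionMap hq hd X Z).f (n - j) a))) at h2
    rw [hr, h3, hd] at h2
    refine Eq.trans ?_ h2.symm
    change _ = _ + -((j - 1).negOnePow • ψ ((sectionMap hq hd X Z).f (n - (j - 1)) 0))
    rw [map_zero, map_zero, smul_zero, neg_zero, add_zero]

include hf in
lemma trTot_sec (X Z : H.Obj) (i : ℤ) (a : (H.Hom Z X).X i) (y : Tot (D.Hom (e X) (e Z))) :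
    c.trTot _ (D.compTot _ _ _ (sec f X Z (tof _ i a)) y) =
      c.trTot _ (D.compTot _ _ _ (sec f X Z (tof _ i a)) (totProj _ (n - i) y)) :=
  c.toTrace_degree i _ y (sec_mem hf X Z i a)

include hf hq hd hc hK in
lemma exists_eq_totD_of_pairing (X Z : H.Obj) (y : Tot (D.Hom (e X) (e Z))) (hy : totD _ y = 0)
    (h : ∀ a, c.trTot _ (D.compTot _ _ _ (sec f X Z a) y) = 0) : ∃ z, y = totD _ z :=
  exists_totD_eq fun j => by
    refine exists_eq_d_of_pairing hf hq hd c hc hK X Z j _ ?_ fun i a hij => ?_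
    · rw [← tcomp_totD, hy, map_zero]
    · have h2 := trTot_sec hf c X Z i a y
      rw [show n - i = j by omega] at h2
      exact h2.symm.trans (h (tof _ i a))

include hf hq hd hc hK in
lemma exists_trTot_eq (X Z : H.Obj)
    (hb : ∃ S : Finset ℤ, ∀ i ∉ S, Subsingleton ((H.Hom Z X).X i)) (l : Tot (H.Hom Z X) →ₗ[R] R) :
    ∃ y : Tot (D.Hom (e X) (e Z)), totD _ y = 0 ∧
      ∀ a, c.trTot _ (D.compTot _ _ _ (sec f X Z a) y) = l a := by
  obtain ⟨S, hS⟩ := hb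
  choose y hy hl using fun i => exists_pairing_eq hf hq hd c hc hK X Z i (n - i) (by omega)
    (l.comp (tof _ i))
  refine ⟨∑ i ∈ S, tof _ (n - i) (y i), ?_, fun a => ?_⟩
  · rw [map_sum]
    exact Finset.sum_eq_zero fun i _ => (totD_eq_zero_iff _).2 (hy i)
  · induction a using tot_induction with
    | h0 => simp
    | h2 x y hx hy => simp only [map_add, LinearMap.add_apply, hx, hy]
    | h1 i a =>
      by_cases hi : i ∈ S
      · rw [trTot_sec hf, map_sum, Finset.sum_eq_single i, totProj_of_mem (tof_mem _ _), hl]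
        · rfl
        · intro j _ hj
          exact totProj_of_mem_ne (tof_mem _ _) (by omega)
        · exact fun h => absurd hi h
      · have := hS i hi
        rw [Subsingleton.elim a 0]
        simp only [map_zero, LinearMap.zero_apply]

include hf hq hd hc hK in
/-- A Calabi–Yau structure induces a perfect pairing along a cochain that identifies `H` with the
cohomology of `D`. -/
theorem isPerfectPairing (hb : ∀ X Y, ∃ S : Finset ℤ, ∀ i ∉ S, Subsingleton ((H.Hom X Y).X i)) :
    LC.IsPerfectPairing f c.toTrace D.toSProj n where
  degree := c.toTrace_degree
  inj {X Z} y hy h := exists_eq_totD_of_pairing hf hq hd c hc hK X Z y hy h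
  surj {X Z} l := exists_trTot_eq hf hq hd c hc hK X Z (hb Z X) l

end Section

end DGCat

/-! ### Base change to the field of fractions -/

section Localization

variable {R : Type u} [CommRing R] (K : Type u) [Field K] [Algebra R K] [IsFractionRing R K]

lemma exists_smul_eq_one_tmul {M : Type u} [AddCommGroup M] [Module R M] (x : K ⊗[R] M) :
    ∃ r ∈ nonZeroDivisors R, ∃ m, algebraMap R K r • x = 1 ⊗ₜ[R] m := by
  have : IsLocalizedModule (nonZeroDivisors R) (TensorProduct.mk R K M 1) :=
    (isLocalizedModule_iff_isBaseChange (nonZeroDivisors R) K _).2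
      (TensorProduct.isBaseChange R M K)
  obtain ⟨⟨m, s⟩, h⟩ := IsLocalizedModule.surj (nonZeroDivisors R) (TensorProduct.mk R K M 1) x
  refine ⟨s, s.2, m, ?_⟩
  rw [algebraMap_smul]
  exact h

lemma exists_smul_eq_zero_of_one_tmul {M : Type u} [AddCommGroup M] [Module R M] {m : M}
    (h : (1 : K) ⊗ₜ[R] m = 0) : ∃ r ∈ nonZeroDivisors R, r • m = 0 := by
  have : IsLocalizedModule (nonZeroDivisors R) (TensorProduct.mk R K M 1) :=
    (isLocalizedModule_iff_isBaseChange (nonZeroDivisors R) K _).2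
      (TensorProduct.isBaseChange R M K)
  obtain ⟨s, hs⟩ := (IsLocalizedModule.eq_zero_iff (nonZeroDivisors R)
    (TensorProduct.mk R K M 1)).1 h
  exact ⟨s, s.2, hs⟩

lemma algebraMap_ne_zero_of_mem {r : R} (hr : r ∈ nonZeroDivisors R) : algebraMap R K r ≠ 0 :=
  (IsLocalization.map_units K (⟨r, hr⟩ : nonZeroDivisors R)).ne_zero

section Modules

variable {M M' M'' N N' N'' : Type u} [AddCommGroup M] [Module R M] [AddCommGroup M'] [Module R M']
  [AddCommGroup M''] [Module R M''] [AddCommGroup N] [Module R N] [AddCommGroup N'] [Module R N']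
  [AddCommGroup N''] [Module R N'']

/-- A fraction that is a cocycle is a fraction of cocycles. -/
lemma exists_smul_eq_one_tmul_of_ker (d : M →ₗ[R] N) (x : K ⊗[R] M)
    (hx : d.baseChange K x = 0) :
    ∃ r ∈ nonZeroDivisors R, ∃ a, d a = 0 ∧ algebraMap R K r • x = 1 ⊗ₜ[R] a := by
  obtain ⟨r, hr, a, ha⟩ := exists_smul_eq_one_tmul K x
  have h1 : (1 : K) ⊗ₜ[R] d a = 0 := by
    rw [← LinearMap.baseChange_tmul, ← ha, map_smul, hx, smul_zero]
  obtain ⟨s, hs, h2⟩ := exists_smul_eq_zero_of_one_tmul K h1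
  refine ⟨s * r, mul_mem hs hr, s • a, by rw [map_smul, h2], ?_⟩
  rw [map_mul, mul_smul, tmul_smul, ha, algebraMap_smul]

lemma baseChange_inj (f : M →ₗ[R] N) (d : M →ₗ[R] M'') (d₁ : M' →ₗ[R] M) (d₂ : N' →ₗ[R] N)
    (h : ∀ x, d x = 0 → (∃ y, f x = d₂ y) → ∃ z, x = d₁ z) (x : K ⊗[R] M)
    (hx : d.baseChange K x = 0) (hy : ∃ y, f.baseChange K x = d₂.baseChange K y) :
    ∃ z, x = d₁.baseChange K z := by
  obtain ⟨y, hy⟩ := hy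
  obtain ⟨r, hr, a, ha, hra⟩ := exists_smul_eq_one_tmul_of_ker K d x hx
  obtain ⟨s, hs, b, hsb⟩ := exists_smul_eq_one_tmul K y
  have h1 : (1 : K) ⊗ₜ[R] (f (s • a) - d₂ (r • b)) = 0 := by
    rw [tmul_sub, ← LinearMap.baseChange_tmul, ← LinearMap.baseChange_tmul, tmul_smul, tmul_smul,
      ← hra, ← hsb, ← algebraMap_smul K r, ← algebraMap_smul K s, map_smul, map_smul, map_smul,
      map_smul, hy, smul_comm, sub_self]
  obtain ⟨t, ht, h2⟩ := exists_smul_eq_zero_of_one_tmul K h1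
  obtain ⟨z, hz⟩ := h (t • s • a) (by rw [map_smul, map_smul, ha, smul_zero, smul_zero])
    ⟨t • r • b, by rwa [smul_sub, sub_eq_zero, ← map_smul, ← map_smul] at h2⟩
  have h3 : algebraMap R K (t * s * r) ≠ 0 :=
    algebraMap_ne_zero_of_mem K (mul_mem (mul_mem ht hs) hr)
  refine ⟨(algebraMap R K (t * s * r))⁻¹ • (1 ⊗ₜ[R] z), ?_⟩
  rw [map_smul, LinearMap.baseChange_tmul, ← hz, eq_inv_smul_iff₀ h3, map_mul, mul_smul, hra,
    algebraMap_smul, mul_smul, ← tmul_smul, ← tmul_smul]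

lemma baseChange_surj (f : M →ₗ[R] N) (d : M →ₗ[R] M'') (d₀ : N →ₗ[R] N'') (d₂ : N' →ₗ[R] N)
    (h : ∀ y, d₀ y = 0 → ∃ x, d x = 0 ∧ ∃ z, y = f x + d₂ z) (y : K ⊗[R] N)
    (hy : d₀.baseChange K y = 0) :
    ∃ x, d.baseChange K x = 0 ∧ ∃ z, y = f.baseChange K x + d₂.baseChange K z := by
  obtain ⟨r, hr, b, hb, hrb⟩ := exists_smul_eq_one_tmul_of_ker K d₀ y hy
  obtain ⟨a, ha, z, rfl⟩ := h b hb
  refine ⟨(algebraMap R K r)⁻¹ • (1 ⊗ₜ[R] a), ?_, (algebraMap R K r)⁻¹ • (1 ⊗ₜ[R] z), ?_⟩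
  · rw [map_smul, LinearMap.baseChange_tmul, ha, tmul_zero, smul_zero]
  · rw [map_smul, map_smul, ← smul_add, eq_inv_smul_iff₀ (algebraMap_ne_zero_of_mem K hr), hrb,
      tmul_add, LinearMap.baseChange_tmul, LinearMap.baseChange_tmul]

end Modules

variable {A B : CochainComplex (ModuleCat.{u} R) ℤ}

omit [IsFractionRing R K] in
/-- The base change of a morphism of complexes. -/
def complexBaseChangeMap (f : A ⟶ B) : complexBaseChange K A ⟶ complexBaseChange K B where
  f i := ModuleCat.ofHom ((f.f i).hom.baseChange K)
  comm' i j _ := by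
    change ModuleCat.ofHom _ ≫ ModuleCat.ofHom _ = ModuleCat.ofHom _ ≫ ModuleCat.ofHom _
    rw [← ModuleCat.ofHom_comp, ← ModuleCat.ofHom_comp, ← LinearMap.baseChange_comp,
      ← LinearMap.baseChange_comp, ← ModuleCat.hom_comp, ← ModuleCat.hom_comp, f.comm]

lemma quasiIso_complexBaseChangeMap (f : A ⟶ B) (hf : QuasiIso f) :
    QuasiIso (complexBaseChangeMap K f) := by
  have hf := (quasiIso_iff_elements f).1 hf
  exact (quasiIso_iff_elements _).2 fun i =>
    ⟨baseChange_inj K (f.f i).hom (A.d i (i + 1)).hom (A.d (i - 1) i).hom (B.d (i - 1) i).hom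
      (hf i).1,
    baseChange_surj K (f.f i).hom (A.d i (i + 1)).hom (B.d i (i + 1)).hom (B.d (i - 1) i).hom
      (hf i).2⟩

end Localization

namespace DGCat

variable {R : Type u} [CommRing R] (K : Type u) [Field K] [Algebra R K]

/-- The base change of a dg functor. -/
def Functor.baseChange {C D : DGCat.{u} R} (F : Functor C D) :
    Functor (C.baseChange K) (D.baseChange K) where
  obj := F.obj
  map X Y := complexBaseChangeMap K (F.map X Y)
  map_id X := by
    change ((F.map X X).f 0).hom.baseChange K ((1 : K) ⊗ₜ[R] C.id X) = (1 : K) ⊗ₜ[R] D.id (F.obj X)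
    rw [LinearMap.baseChange_tmul]
    exact congrArg _ (F.map_id X)
  map_comp {X Y Z} i j k h g f := by
    change K ⊗[R] (C.Hom X Y).X j at f
    change K ⊗[R] (C.Hom Y Z).X i at g
    change ((F.map X Z).f k).hom.baseChange K (bilinBaseChange K (C.comp i j k h) g f) =
      bilinBaseChange K (D.comp i j k h) (((F.map Y Z).f i).hom.baseChange K g)
        (((F.map X Y).f j).hom.baseChange K f)
    induction g with
    | zero => simp
    | add x y hx hy => simp only [map_add, LinearMap.add_apply, hx, hy]
    | tmul a g =>
      induction f with
      | zero => simp
      | add x y hx hy => simp only [map_add, hx, hy]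
      | tmul b f =>
        simp only [bilinBaseChange_tmul, LinearMap.baseChange_tmul]
        exact congrArg _ (F.map_comp i j k h g f)

variable [IsFractionRing R K]

lemma Functor.IsQuasiIso.baseChange {C D : DGCat.{u} R} {F : Functor C D} (hF : F.IsQuasiIso) :
    (F.baseChange K).IsQuasiIso where
  bijective_obj := hF.bijective_obj
  quasiIso_map X Y := quasiIso_complexBaseChangeMap K _ (hF.quasiIso_map X Y)

lemma QuasiIsomorphic.baseChange {C D : DGCat.{u} R} (h : QuasiIsomorphic C D) :
    QuasiIsomorphic (C.baseChange K) (D.baseChange K) := by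
  induction h with
  | rel C D h =>
    obtain ⟨F, hF⟩ := h
    exact .rel _ _ ⟨F.baseChange K, hF.baseChange K⟩
  | refl C => exact .refl _
  | symm C D _ ih => exact ih.symm
  | trans C D E _ _ h₁ h₂ => exact h₁.trans _ _ _ h₂

section Cohomology

omit [IsFractionRing R K] in
/-- The linear extension of a semilinear map to the base change. -/
def _root_.semilinearLift {M N : Type u} [AddCommGroup M] [Module R M] [AddCommGroup N] [Module K N]
    (φ : M →ₛₗ[algebraMap R K] N) : K ⊗[R] M →ₗ[K] N :=
  let _ := Module.compHom N (algebraMap R K)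
  have : IsScalarTower R K N := ⟨fun r k n => by rw [Algebra.smul_def, mul_smul]; rfl⟩
  (TensorProduct.isBaseChange R M K).lift
    { toFun := φ, map_add' := φ.map_add', map_smul' := φ.map_smul' }

omit [IsFractionRing R K] in
lemma _root_.semilinearLift_tmul {M N : Type u} [AddCommGroup M] [Module R M] [AddCommGroup N]
    [Module K N] (φ : M →ₛₗ[algebraMap R K] N) (k : K) (m : M) :
    semilinearLift K φ (k ⊗ₜ m) = k • φ m := by
  have h1 : (k ⊗ₜ[R] m : K ⊗[R] M) = k • (1 ⊗ₜ m) := by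
    rw [TensorProduct.smul_tmul', smul_eq_mul, mul_one]
  rw [h1, map_smul]
  let _ := Module.compHom N (algebraMap R K)
  have : IsScalarTower R K N := ⟨fun r k n => by rw [Algebra.smul_def, mul_smul]; rfl⟩
  exact congrArg _ ((TensorProduct.isBaseChange R M K).lift_eq _ m)

omit [IsFractionRing R K] in
lemma _root_.semilinearLift_bilinBaseChange {M N P M' N' P' : Type u} [AddCommGroup M] [Module R M]
    [AddCommGroup N] [Module R N] [AddCommGroup P] [Module R P] [AddCommGroup M'] [Module K M']
    [AddCommGroup N'] [Module K N'] [AddCommGroup P'] [Module K P'] (μ : M →ₗ[R] N →ₗ[R] P)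
    (μ' : M' →ₗ[K] N' →ₗ[K] P') (φ : M →ₛₗ[algebraMap R K] M') (ψ : N →ₛₗ[algebraMap R K] N')
    (χ : P →ₛₗ[algebraMap R K] P') (h : ∀ m n, χ (μ m n) = μ' (φ m) (ψ n))
    (g : K ⊗[R] M) (f : K ⊗[R] N) :
    semilinearLift K χ (bilinBaseChange K μ g f) =
      μ' (semilinearLift K φ g) (semilinearLift K ψ f) := by
  induction g with
  | zero => simp
  | add x y hx hy => simp only [map_add, LinearMap.add_apply, hx, hy]
  | tmul a g =>
    induction f with
    | zero => simp
    | add x y hx hy => simp only [map_add, hx, hy]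
    | tmul b f =>
      rw [bilinBaseChange_tmul, semilinearLift_tmul, semilinearLift_tmul, semilinearLift_tmul,
        LinearMap.map_smul₂, map_smul, smul_smul, h]

omit [IsFractionRing R K] in
lemma one_tmul_mem_ker {A : CochainComplex (ModuleCat.{u} R) ℤ} {i : ℤ} {a : A.X i}
    (ha : A.d i (i + 1) a = 0) : (1 ⊗ₜ[R] a : K ⊗[R] A.X i) ∈
      LinearMap.ker ((complexBaseChange K A).d i (i + 1)).hom :=
  (congrArg (fun x => (1 : K) ⊗ₜ[R] x) ha).trans (tmul_zero _ _)

omit [IsFractionRing R K] in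
/-- The map `[a] ↦ [1 ⊗ a]` from the cohomology of a complex to that of its base change. -/
def cohToBaseChange (A : CochainComplex (ModuleCat.{u} R) ℤ) (i : ℤ) :
    Coh A i →ₛₗ[algebraMap R K] Coh (complexBaseChange K A) i :=
  Submodule.liftQ _
    { toFun := fun a => Submodule.Quotient.mk ⟨(1 ⊗ₜ[R] a.1 : K ⊗[R] A.X i),
        one_tmul_mem_ker K a.2⟩
      map_add' := fun a b => by
        rw [← Submodule.Quotient.mk_add]
        exact congrArg _ (Subtype.ext (tmul_add _ _ _))
      map_smul' := fun r a => by
        rw [← Submodule.Quotient.mk_smul]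
        refine congrArg _ (Subtype.ext ((tmul_smul r (1 : K) a.1).trans ?_))
        exact (algebraMap_smul K r (1 ⊗ₜ[R] a.1 : K ⊗[R] A.X i)).symm } (by
    rintro ⟨a, ha⟩ ⟨b, hb⟩
    exact (Submodule.Quotient.mk_eq_zero _).2 ⟨(1 ⊗ₜ[R] b : K ⊗[R] A.X (i - 1)),
      congrArg (fun x => (1 : K) ⊗ₜ[R] x) hb⟩)

omit [IsFractionRing R K] in
/-- The comparison map from the base change of the cohomology of a complex to the cohomology of
its base change. -/
def cohBaseChangeMap (A : CochainComplex (ModuleCat.{u} R) ℤ) :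
    complexBaseChange K (cohComplex A) ⟶ cohComplex (complexBaseChange K A) where
  f i := ModuleCat.ofHom (semilinearLift K (cohToBaseChange K A i))
  comm' i j _ := by
    have h : (complexBaseChange K (cohComplex A)).d i j = 0 :=
      ModuleCat.hom_ext (LinearMap.baseChange_zero (R := R) (A := K)
        (M := Coh A i) (N := Coh A j))
    rw [h]
    exact Limits.comp_zero.trans Limits.zero_comp.symm

lemma quasiIso_cohBaseChangeMap (A : CochainComplex (ModuleCat.{u} R) ℤ) :
    QuasiIso (cohBaseChangeMap K A) := by
  refine (quasiIso_iff_elements _).2 fun i => ⟨fun (x : K ⊗[R] Coh A i) _ => ?_,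
    fun (y : Coh (complexBaseChange K A) i) _ => ?_⟩
  · rintro ⟨y, (hy : semilinearLift K (cohToBaseChange K A i) x = 0)⟩
    suffices x = 0 from ⟨0, by rw [this, map_zero]; rfl⟩
    obtain ⟨r, hr, a, hra⟩ := exists_smul_eq_one_tmul K x
    obtain ⟨⟨a, ha⟩, rfl⟩ := Submodule.Quotient.mk_surjective _ a
    have h1 := congrArg (semilinearLift K (cohToBaseChange K A i)) hra
    rw [map_smul, hy, smul_zero, semilinearLift_tmul, one_smul] at h1
    obtain ⟨(z : K ⊗[R] A.X (i - 1)), (hz : (A.d (i - 1) i).hom.baseChange K z = 1 ⊗ₜ[R] a)⟩ :=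
      (Submodule.Quotient.mk_eq_zero _).1 h1.symm
    obtain ⟨s, hs, b, hsb⟩ := exists_smul_eq_one_tmul K z
    have h2 : (1 : K) ⊗ₜ[R] (s • a - A.d (i - 1) i b) = 0 := by
      rw [tmul_sub, tmul_smul, ← hz]
      have h3 := congrArg ((A.d (i - 1) i).hom.baseChange K) hsb
      rw [LinearMap.baseChange_tmul, map_smul, algebraMap_smul] at h3
      exact sub_eq_zero.2 h3
    obtain ⟨t, ht, h4⟩ := exists_smul_eq_zero_of_one_tmul K h2
    rw [smul_sub, sub_eq_zero] at h4
    have h5 : (t * s) • (Submodule.Quotient.mk ⟨a, ha⟩ : Coh A i) = 0 := by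
      rw [← Submodule.Quotient.mk_smul]
      exact (Submodule.Quotient.mk_eq_zero _).2 ⟨t • b, by
        rw [map_smul]; exact h4.symm.trans (smul_smul t s a)⟩
    have h6 : algebraMap R K (t * s * r) • x = 0 := by
      rw [map_mul, mul_smul, hra, algebraMap_smul, ← tmul_smul, h5, tmul_zero]
    exact (smul_eq_zero.1 h6).resolve_left
      (algebraMap_ne_zero_of_mem K (mul_mem (mul_mem ht hs) hr))
  · obtain ⟨⟨y, hy⟩, rfl⟩ := Submodule.Quotient.mk_surjective _ y
    change K ⊗[R] A.X i at y
    obtain ⟨r, hr, a, ha, hra⟩ := exists_smul_eq_one_tmul_of_ker K (A.d i (i + 1)).hom y hy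
    have hr0 := algebraMap_ne_zero_of_mem K hr
    refine ⟨((algebraMap R K r)⁻¹ ⊗ₜ[R] (Submodule.Quotient.mk ⟨a, ha⟩ : Coh A i) :
      K ⊗[R] Coh A i), ?_, 0, ?_⟩
    · exact LinearMap.congr_fun (LinearMap.baseChange_zero (R := R) (A := K)
        (M := Coh A i) (N := Coh A (i + 1))) _
    · rw [map_zero, add_zero]
      refine Eq.trans ?_ (semilinearLift_tmul K (cohToBaseChange K A i) _ _).symm
      refine (eq_inv_smul_iff₀ (α := K) (β := Coh (complexBaseChange K A) i) hr0).2 ?_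
      exact congrArg Submodule.Quotient.mk (Subtype.ext hra)

variable (C : DGCat.{u} R)

omit [IsFractionRing R K] in
/-- The functor from the base change of the cohomology category to the cohomology category of the
base change. -/
def cohomologyBaseChange : Functor (C.cohomology.baseChange K) (C.baseChange K).cohomology where
  obj X := X
  map X Y := cohBaseChangeMap K (C.Hom X Y)
  map_id X := (semilinearLift_tmul K _ 1 _).trans (one_smul _ _)
  map_comp {X Y Z} i j k h g f := by
    refine semilinearLift_bilinBaseChange K (M := Coh (C.Hom Y Z) i) (N := Coh (C.Hom X Y) j)
      (P := Coh (C.Hom X Z) k) (C.cohComp i j k h)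
      ((C.baseChange K).cohComp (X := X) (Y := Y) (Z := Z) i j k h) (cohToBaseChange K _ i)
      (cohToBaseChange K _ j) (cohToBaseChange K _ k) (fun g f => ?_) g f
    obtain ⟨f, rfl⟩ := Submodule.Quotient.mk_surjective _ f
    obtain ⟨g, rfl⟩ := Submodule.Quotient.mk_surjective _ g
    refine congrArg Submodule.Quotient.mk (Subtype.ext ?_)
    refine Eq.symm ((bilinBaseChange_tmul K _ _ _ _ _).trans ?_)
    rw [mul_one]

lemma isQuasiIso_cohomologyBaseChange : (cohomologyBaseChange K C).IsQuasiIso where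
  bijective_obj := Function.bijective_id
  quasiIso_map X Y := quasiIso_cohBaseChangeMap K (C.Hom X Y)

end Cohomology

/-- Formality is preserved by base change to the field of fractions. -/
theorem IsFormal.baseChange {C : DGCat.{u} R} (h : C.IsFormal) : (C.baseChange K).IsFormal :=
  (QuasiIsomorphic.baseChange K h).trans _ _ _
    (.rel _ _ ⟨cohomologyBaseChange K C, isQuasiIso_cohomologyBaseChange K C⟩)

end DGCat

/-! ### Signed categories over the field of fractions -/

section TotMap

variable {R : Type u} [CommRing R] {A B : CochainComplex (ModuleCat.{u} R) ℤ}

/-- The map of total modules induced by a morphism of complexes. -/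
def totMap (f : A ⟶ B) : Tot A →ₗ[R] Tot B :=
  DirectSum.toModule R ℤ _ fun i => (tof B i).comp (f.f i).hom

lemma totMap_tof (f : A ⟶ B) (i : ℤ) (x : A.X i) : totMap f (tof A i x) = tof B i (f.f i x) :=
  DirectSum.toModule_lof (M := fun i => A.X i) R i x

lemma tcomp_totMap (f : A ⟶ B) (k : ℤ) (x : Tot A) :
    tcomp B k (totMap f x) = f.f k (tcomp A k x) := by
  induction x using tot_induction with
  | h0 => simp only [map_zero]
  | h2 x y hx hy => simp only [map_add, hx, hy]
  | h1 j a =>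
    rw [totMap_tof]
    by_cases h : j = k
    · subst h; rw [tcomp_tof, tcomp_tof]
    · rw [tcomp_tof_ne h, tcomp_tof_ne h, map_zero]

lemma totMap_totProj (f : A ⟶ B) (k : ℤ) (x : Tot A) :
    totMap f (totProj A k x) = totProj B k (totMap f x) := by
  rw [totProj, totProj, LinearMap.comp_apply, LinearMap.comp_apply, totMap_tof, tcomp_totMap]

lemma totMap_totD (f : A ⟶ B) (x : Tot A) : totMap f (totD A x) = totD B (totMap f x) := by
  induction x using tot_induction with
  | h0 => simp only [map_zero]
  | h2 x y hx hy => simp only [map_add, hx, hy]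
  | h1 j a =>
    rw [totMap_tof, totD_tof, totD_tof, totMap_tof]
    exact congrArg _ (ConcreteCategory.congr_hom (f.comm j (j + 1)) a).symm

lemma totMap_totSign (f : A ⟶ B) (x : Tot A) :
    totMap f (totSign A x) = totSign B (totMap f x) := by
  induction x using tot_induction with
  | h0 => simp only [map_zero]
  | h2 x y hx hy => simp only [map_add, hx, hy]
  | h1 j a => rw [totMap_tof, totSign_tof, totSign_tof, units_smul_map, totMap_tof]

lemma totMap_inj (f : A ⟶ B) (hf : QuasiIso f) (x : Tot A) (hx : totD A x = 0)
    (h : ∃ y, totMap f x = totD B y) : ∃ z, x = totD A z := by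
  obtain ⟨y, hy⟩ := h
  refine DGCat.exists_totD_eq fun k => ((quasiIso_iff_elements f).1 hf k).1 _ ?_
    ⟨tcomp B (k - 1) y, ?_⟩
  · rw [← tcomp_totD, hx, map_zero]
  · rw [← tcomp_totMap, hy, DGCat.tcomp_totD' (sub_add_cancel k 1)]

lemma totMap_surj (f : A ⟶ B) (hf : QuasiIso f) (y : Tot B) (hy : totD B y = 0) :
    ∃ x, totD A x = 0 ∧ ∃ z, y = totMap f x + totD B z := by
  classical
  have h k := ((quasiIso_iff_elements f).1 hf k).2 (tcomp B k y) (by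
    rw [← tcomp_totD, hy, map_zero])
  choose x hx z hz using h
  refine ⟨∑ j ∈ DFinsupp.support y, tof _ j (x j), ?_, ∑ j ∈ DFinsupp.support y,
    tof _ (j - 1) (z j), ?_⟩
  · rw [map_sum]
    exact Finset.sum_eq_zero fun j _ => by rw [totD_tof, hx, map_zero]
  · rw [map_sum, map_sum, ← Finset.sum_add_distrib]
    conv_lhs => rw [← DirectSum.sum_support_of y]
    refine Finset.sum_congr rfl fun j _ => ?_
    rw [DGCat.totD_tof' (sub_add_cancel j 1), totMap_tof, ← map_add, ← hz]
    rfl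

end TotMap

namespace SCat

variable (R : Type u) [CommRing R] {K : Type u} [CommRing K] [Algebra R K] {B B' : SCat.{u} K}

/-- Restriction of scalars of a functor. -/
def Fun.restr (G : Fun B B') : Fun (B.restr R) (B'.restr R) where
  obj := G.obj
  map {X _} := ((ModuleCat.restrictScalars (algebraMap R K)).map
    (ModuleCat.ofHom (G.map (X := X)))).hom
  map_mul := G.map_mul
  map_sgn := G.map_sgn
  map_d := G.map_d
  map_deg := G.map_deg

lemma Fun.IsQI.restr {G : Fun B B'} (hG : G.IsQI) : (G.restr R).IsQI where
  inj := hG.inj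
  surj := hG.surj

/-- Restriction of scalars of the projections to homogeneous parts. -/
def Proj.restr (P : B.Proj) : (B.restr R).Proj where
  ρ {X _} k := ((ModuleCat.restrictScalars (algebraMap R K)).map
    (ModuleCat.ofHom (P.ρ (X := X) k))).hom
  mem := P.mem
  eq_self := P.eq_self
  eq_zero := P.eq_zero
  comm_d := P.comm_d

end SCat

namespace DGCat

section

variable {K : Type u} [CommRing K] {C D : DGCat.{u} K} (F : Functor C D)

lemma Functor.totMap_compTot {X Y Z : C.Obj} (g : Tot (C.Hom Y Z)) (f : Tot (C.Hom X Y)) :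
    totMap (F.map X Z) (C.compTot X Y Z g f) =
      D.compTot _ _ _ (totMap (F.map Y Z) g) (totMap (F.map X Y) f) := by
  induction g using tot_induction with
  | h0 => simp only [map_zero, LinearMap.zero_apply]
  | h2 x y hx hy => simp only [map_add, LinearMap.add_apply, hx, hy]
  | h1 i g =>
  induction f using tot_induction with
  | h0 => simp only [map_zero]
  | h2 x y hx hy => simp only [map_add, hx, hy]
  | h1 j f =>
    rw [C.compTot_tof i j _ rfl, totMap_tof, totMap_tof, totMap_tof, D.compTot_tof i j _ rfl,
      F.map_comp]

/-- The functor between signed categories induced by a dg functor. -/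
def Functor.toS : SCat.Fun C.toS D.toS where
  obj := F.obj
  map {X Y} := totMap (F.map X Y)
  map_mul := F.totMap_compTot
  map_sgn {X Y} := totMap_totSign (F.map X Y)
  map_d {X Y} := totMap_totD (F.map X Y)
  map_deg {X Y} k f := by
    rintro ⟨f, rfl⟩
    exact ⟨_, (totMap_tof (F.map X Y) k f).symm⟩

lemma Functor.IsQuasiIso.toS {F : Functor C D} (hF : F.IsQuasiIso) : F.toS.IsQI where
  inj {X Y} := totMap_inj (F.map X Y) (hF.quasiIso_map X Y)
  surj {X Y} := totMap_surj (F.map X Y) (hF.quasiIso_map X Y)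

end

section

variable {R : Type u} [CommRing R] {K : Type u} [CommRing K] [Algebra R K] {H : DGCat.{u} R}
  [∀ X Y i, Module.Projective R ((H.Hom X Y).X i)]

lemma QuasiIsomorphic.hasExtensions_iff {C D : DGCat.{u} K} (h : QuasiIsomorphic C D) :
    LC.HasExtensions H (C.toS.restr R) ↔ LC.HasExtensions H (D.toS.restr R) := by
  induction h with
  | rel C D h =>
    obtain ⟨F, hF⟩ := h
    exact ⟨fun h => h.of_source (hF.toS.restr R) (C.toSProj.restr R) (D.toSProj.restr R)
        (fun {X Y} k x => totMap_totProj (F.map X Y) k x) hF.bijective_obj.2,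
      fun h => h.of_target (hF.toS.restr R) (C.toSProj.restr R) (D.toSProj.restr R)
        (fun {X Y} k x => totMap_totProj (F.map X Y) k x)⟩
  | refl C => exact Iff.rfl
  | symm C D _ ih => exact ih.symm
  | trans C D E _ _ h₁ h₂ => exact h₁.trans h₂

end

section

variable {R : Type u} [CommRing R] [IsDomain R] [CharZero R] {K : Type u} [Field K] [Algebra R K]
  [IsFractionRing R K] {H : DGCat.{u} R} [∀ X Y i, Module.Projective R ((H.Hom X Y).X i)]

/-- Truncated twisting cochains with values in a formal dg category over the field of fractions
extend. -/
theorem IsFormal.hasExtensions {C : DGCat.{u} K} (h : C.IsFormal) :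
    LC.HasExtensions H (C.toS.restr R) := by
  refine (QuasiIsomorphic.hasExtensions_iff h).2
    (LC.HasExtensions.of_isLocal (C.cohomology.toSProj.restr R) (fun X Y x => ?_)
      fun X Y r hr => ?_)
  · change totD (cohComplex (C.Hom X Y)) x = 0
    change Tot (cohComplex (C.Hom X Y)) at x
    induction x using tot_induction with
    | h0 => exact map_zero _
    | h2 x y hx hy => rw [map_add, hx, hy, add_zero]
    | h1 j a => rw [totD_tof]; exact map_zero _
  · have h0 : algebraMap R K r ≠ 0 := algebraMap_ne_zero_of_mem K hr
    exact (MulAction.bijective₀ (α := Tot (cohComplex (C.Hom X Y))) h0)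

end

end DGCat

/-! ### Comparison of a dg category with its generic fibre -/

section

variable {R : Type u} [CommRing R] (K : Type u) [Field K] [Algebra R K]
  {A : CochainComplex (ModuleCat.{u} R) ℤ}

/-- The map `a ↦ 1 ⊗ a` in one degree. -/
def oneTmul (A : CochainComplex (ModuleCat.{u} R) ℤ) (i : ℤ) :
    A.X i →ₛₗ[algebraMap R K] (complexBaseChange K A).X i where
  toFun a := ((1 : K) ⊗ₜ[R] a : K ⊗[R] A.X i)
  map_add' a b := tmul_add (1 : K) a b
  map_smul' r a := (tmul_smul r (1 : K) a).trans (algebraMap_smul K r ((1 : K) ⊗ₜ[R] a)).symm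

lemma d_oneTmul (i j : ℤ) (a : A.X i) :
    (complexBaseChange K A).d i j (oneTmul K A i a) = oneTmul K A j (A.d i j a) := rfl

/-- The map `a ↦ 1 ⊗ a` on total modules. -/
def totOne (A : CochainComplex (ModuleCat.{u} R) ℤ) :
    Tot A →ₛₗ[algebraMap R K] Tot (complexBaseChange K A) where
  toFun := DirectSum.map (α := fun i => A.X i) (β := fun i => (complexBaseChange K A).X i)
    fun i => (oneTmul K A i).toAddMonoidHom
  map_add' := map_add _
  map_smul' r x := by
    induction x using tot_induction with
    | h0 => rw [smul_zero, map_zero, smul_zero]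
    | h2 x y hx hy => rw [smul_add, map_add, map_add, smul_add, hx, hy]
    | h1 j a =>
      rw [← map_smul]
      refine (DirectSum.map_of (α := fun i => A.X i) _ j (r • a)).trans ?_
      refine Eq.trans ?_ (congrArg (algebraMap R K r • ·)
        (DirectSum.map_of (α := fun i => A.X i) _ j a).symm)
      change tof (complexBaseChange K A) j (oneTmul K A j (r • a)) =
        algebraMap R K r • tof (complexBaseChange K A) j (oneTmul K A j a)
      rw [← map_smul, map_smulₛₗ]

lemma totOne_tof (i : ℤ) (a : A.X i) :
    totOne K A (tof A i a) = tof (complexBaseChange K A) i (oneTmul K A i a) :=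
  DirectSum.map_of (α := fun i => A.X i) (β := fun i => (complexBaseChange K A).X i)
    (fun i => (oneTmul K A i).toAddMonoidHom) i a

lemma tcomp_totOne (i : ℤ) (x : Tot A) :
    tcomp (complexBaseChange K A) i (totOne K A x) = oneTmul K A i (tcomp A i x) := by
  induction x using tot_induction with
  | h0 => simp only [map_zero]
  | h2 x y hx hy => simp only [map_add, hx, hy]
  | h1 j a =>
    rw [totOne_tof]
    by_cases h : j = i
    · subst h; rw [tcomp_tof, tcomp_tof]
    · rw [tcomp_tof_ne h, tcomp_tof_ne h, map_zero]

lemma totOne_totD (x : Tot A) : totOne K A (totD A x) = totD _ (totOne K A x) := by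
  induction x using tot_induction with
  | h0 => simp only [map_zero]
  | h2 x y hx hy => simp only [map_add, hx, hy]
  | h1 j a => rw [totOne_tof, totD_tof, totD_tof, totOne_tof, d_oneTmul]

lemma totOne_totSign (x : Tot A) : totOne K A (totSign A x) = totSign _ (totOne K A x) := by
  induction x using tot_induction with
  | h0 => simp only [map_zero]
  | h2 x y hx hy => simp only [map_add, hx, hy]
  | h1 j a =>
    rw [totOne_tof, totSign_tof, totSign_tof, Units.smul_def, map_zsmul, totOne_tof,
      ← Units.smul_def]

variable [IsFractionRing R K]

lemma exists_smul_eq_totOne (x : Tot (complexBaseChange K A)) :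
    ∃ r ∈ nonZeroDivisors R, ∃ a, algebraMap R K r • x = totOne K A a := by
  induction x using tot_induction with
  | h0 => exact ⟨1, one_mem _, 0, by rw [smul_zero, map_zero]⟩
  | h2 x y hx hy =>
    obtain ⟨r, hr, a, ha⟩ := hx
    obtain ⟨s, hs, b, hb⟩ := hy
    refine ⟨s * r, mul_mem hs hr, s • a + r • b, ?_⟩
    rw [map_add, map_smulₛₗ, map_smulₛₗ, ← ha, ← hb, smul_add, map_mul, mul_smul, mul_comm,
      mul_smul]
  | h1 j x =>
    obtain ⟨r, hr, a, ha⟩ := exists_smul_eq_one_tmul K (M := A.X j) x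
    exact ⟨r, hr, tof A j a, by rw [totOne_tof, ← map_smul]; exact congrArg _ ha⟩

lemma exists_smul_eq_zero_of_totOne {x : Tot A} (h : totOne K A x = 0) :
    ∃ r ∈ nonZeroDivisors R, r • x = 0 := by
  classical
  have h1 i : ∃ r ∈ nonZeroDivisors R, r • tcomp A i x = 0 :=
    exists_smul_eq_zero_of_one_tmul K (M := A.X i)
      ((tcomp_totOne K i x).symm.trans ((congrArg _ h).trans (map_zero _)))
  choose r hr hrx using h1
  refine ⟨∏ i ∈ DFinsupp.support x, r i, prod_mem fun i _ => hr i, ?_⟩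
  conv_lhs => arg 2; rw [← DirectSum.sum_support_of x]
  rw [Finset.smul_sum]
  refine Finset.sum_eq_zero fun i hi => ?_
  rw [← Finset.prod_erase_mul _ _ hi, mul_smul]
  have h2 : r i • (tof A i (tcomp A i x)) = 0 := by rw [← map_smul, hrx, map_zero]
  exact (congrArg (_ • ·) h2).trans (smul_zero _)

omit [IsFractionRing R K] in
/-- The linear extension of a functional on the total module. -/
def totFunctional (φ : Tot A →ₗ[R] R) : Tot (complexBaseChange K A) →ₗ[K] K :=
  DirectSum.toModule K ℤ K fun i => semilinearLift K (M := A.X i)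
    { toFun := fun a => algebraMap R K (φ (tof A i a))
      map_add' := fun a b => by rw [map_add, map_add, map_add]
      map_smul' := fun r a => by rw [map_smul, map_smul, smul_eq_mul, map_mul]; rfl }

omit [IsFractionRing R K] in
lemma totFunctional_totOne (φ : Tot A →ₗ[R] R) (x : Tot A) :
    totFunctional K φ (totOne K A x) = algebraMap R K (φ x) := by
  induction x using tot_induction with
  | h0 => simp only [map_zero]
  | h2 x y hx hy => simp only [map_add, hx, hy]
  | h1 j a =>
    rw [totOne_tof]
    refine (DirectSum.toModule_lof (M := fun i => (complexBaseChange K A).X i) K j _).trans ?_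
    exact (semilinearLift_tmul K _ 1 a).trans (one_smul _ _)

lemma totFunctional_totD (φ : Tot A →ₗ[R] R) (h : ∀ x, φ (totD _ x) = 0)
    (x : Tot (complexBaseChange K A)) : totFunctional K φ (totD _ x) = 0 := by
  obtain ⟨r, hr, a, ha⟩ := exists_smul_eq_totOne K x
  have h1 : algebraMap R K r • totFunctional K φ (totD _ x) = 0 := by
    rw [← map_smul, ← map_smul, ha, ← totOne_totD, totFunctional_totOne, h, map_zero]
  exact (smul_eq_zero.1 h1).resolve_left (algebraMap_ne_zero_of_mem K hr)

omit [IsFractionRing R K] in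
lemma totFunctional_smul (φ : Tot A →ₗ[R] R) (r : R) (x : Tot (complexBaseChange K A)) :
    totFunctional K φ (algebraMap R K r • x) = r • totFunctional K φ x := by
  rw [map_smul, algebraMap_smul]

end

namespace DGCat

variable {R : Type u} [CommRing R] (K : Type u) [Field K] [Algebra R K] (D : DGCat.{u} R)

/-- Composition in the base change, with the objects of the original category. -/
def baseComp (X Y Z : D.Obj) : Tot (complexBaseChange K (D.Hom Y Z)) →ₗ[K]
    Tot (complexBaseChange K (D.Hom X Y)) →ₗ[K] Tot (complexBaseChange K (D.Hom X Z)) :=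
  (D.baseChange K).compTot X Y Z

lemma totOne_compTot {X Y Z : D.Obj} (g : Tot (D.Hom Y Z)) (f : Tot (D.Hom X Y)) :
    totOne K _ (D.compTot X Y Z g f) = D.baseComp K X Y Z (totOne K _ g) (totOne K _ f) := by
  induction g using tot_induction with
  | h0 => simp only [map_zero, LinearMap.zero_apply]
  | h2 x y hx hy => simp only [map_add, LinearMap.add_apply, hx, hy]
  | h1 i g =>
  induction f using tot_induction with
  | h0 => simp only [map_zero]
  | h2 x y hx hy => simp only [map_add, hx, hy]
  | h1 j f =>
    rw [D.compTot_tof i j _ rfl, totOne_tof, totOne_tof, totOne_tof]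
    refine Eq.trans ?_ ((D.baseChange K).compTot_tof (X := X) (Y := Y) (Z := Z) i j _ rfl _ _).symm
    refine congrArg _ (Eq.trans ?_ (bilinBaseChange_tmul K _ _ _ _ _).symm)
    rw [mul_one]; rfl

/-- The functor from a dg category to its generic fibre. -/
def toGenericFibre : SCat.Fun D.toS ((D.baseChange K).toS.restr R) where
  obj X := X
  map {X Y} :=
    { toFun := totOne K (D.Hom X Y)
      map_add' := map_add _
      map_smul' := (totOne K (D.Hom X Y)).map_smulₛₗ }
  map_mul := D.totOne_compTot K
  map_sgn {X Y} := totOne_totSign K (A := D.Hom X Y)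
  map_d {X Y} := totOne_totD K (A := D.Hom X Y)
  map_deg {X Y} k f := by
    rintro ⟨f, rfl⟩
    exact ⟨_, (totOne_tof K k f).symm⟩

variable [IsFractionRing R K]

/-- A fraction that is a cocycle is a fraction of cocycles. -/
lemma exists_smul_tof_eq {X Y : D.Obj} {i : ℤ} (x : (complexBaseChange K (D.Hom X Y)).X i)
    (hx : (complexBaseChange K (D.Hom X Y)).d i (i + 1) x = 0) :
    ∃ r ∈ nonZeroDivisors R, ∃ a, totD _ (tof (D.Hom X Y) i a) = 0 ∧
      algebraMap R K r • tof (complexBaseChange K (D.Hom X Y)) i x = totOne K _ (tof _ i a) := by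
  obtain ⟨r, hr, a, ha, hra⟩ :=
    exists_smul_eq_one_tmul_of_ker K ((D.Hom X Y).d i (i + 1)).hom x hx
  refine ⟨r, hr, a, (totD_eq_zero_iff a).2 ha, ?_⟩
  rw [totOne_tof, ← map_smul]
  exact congrArg _ hra

variable {D} in
lemma totFunctional_comm (T : ∀ X : D.Obj, Tot (D.Hom X X) →ₗ[R] R)
    {X Y : D.Obj} (i j : ℤ)
    (hT : ∀ a b, totD (D.Hom Y X) (tof _ i a) = 0 → totD (D.Hom X Y) (tof _ j b) = 0 →
      T X (D.compTot X Y X (tof _ i a) (tof _ j b)) =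
        (i * j).negOnePow • T Y (D.compTot Y X Y (tof _ j b) (tof _ i a)))
    (x : (complexBaseChange K (D.Hom Y X)).X i) (y : (complexBaseChange K (D.Hom X Y)).X j)
    (hx : (complexBaseChange K (D.Hom Y X)).d i (i + 1) x = 0)
    (hy : (complexBaseChange K (D.Hom X Y)).d j (j + 1) y = 0) :
    totFunctional K (T X) (D.baseComp K X Y X (tof _ i x) (tof _ j y)) =
      (i * j).negOnePow • totFunctional K (T Y) (D.baseComp K Y X Y (tof _ j y) (tof _ i x)) := by
  obtain ⟨r, hr, a, ha, hra⟩ := D.exists_smul_tof_eq K x hx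
  obtain ⟨s, hs, b, hb, hsb⟩ := D.exists_smul_tof_eq K y hy
  have h1 : algebraMap R K (r * s) • totFunctional K (T X)
      (D.baseComp K X Y X (tof _ i x) (tof _ j y)) =
      algebraMap R K (T X (D.compTot X Y X (tof _ i a) (tof _ j b))) := by
    rw [← totFunctional_totOne, totOne_compTot, ← hra, ← hsb, LinearMap.map_smul₂, map_smul,
      map_smul, map_smul, smul_smul, map_mul]
  have h2 : algebraMap R K (r * s) • totFunctional K (T Y)
      (D.baseComp K Y X Y (tof _ j y) (tof _ i x)) =
      algebraMap R K (T Y (D.compTot Y X Y (tof _ j b) (tof _ i a))) := by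
    rw [← totFunctional_totOne, totOne_compTot, ← hra, ← hsb, LinearMap.map_smul₂, map_smul,
      map_smul, map_smul, smul_smul, map_mul, mul_comm]
  have h4 : algebraMap R K (r * s) ≠ 0 := algebraMap_ne_zero_of_mem K (mul_mem hr hs)
  refine smul_right_injective K h4 (h1.trans ?_)
  change _ = algebraMap R K (r * s) • _
  rw [hT a b ha hb, Units.smul_def, map_zsmul, ← h2, Units.smul_def, smul_comm]

variable {D} in
/-- The linear extension of a trace to the generic fibre. -/
def _root_.SCat.Trace.baseChange (T : D.toS.Trace R) : ((D.baseChange K).toS.restr R).Trace K where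
  tr X :=
    { toFun := totFunctional K (A := D.Hom X X) (T.tr X)
      map_add' := map_add (totFunctional K (A := D.Hom X X) (T.tr X))
      map_smul' := totFunctional_smul K (A := D.Hom X X) (T.tr X) }
  tr_d X := totFunctional_totD K (A := D.Hom X X) (T.tr X) (T.tr_d X)
  comm {X Y} i j x y := by
    rintro ⟨x, rfl⟩ ⟨y, rfl⟩ hx hy
    exact totFunctional_comm K (D := D) T.tr i j
      (fun a b => T.comm i j _ _ (tof_mem i a) (tof_mem j b)) x y
      ((totD_eq_zero_iff x).1 hx) ((totD_eq_zero_iff y).1 hy)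

variable {D} in
/-- A cochain that induces an isomorphism on cohomology does so, up to denominators, over the
generic fibre. -/
theorem _root_.LC.QI.locQI_push {H : DGCat.{u} R} [IsDomain R]
    [∀ X Y i, Module.Projective R ((H.Hom X Y).X i)] {e : H.Obj → D.Obj} {f : AA H D.toS e}
    (hf : LC.QI f) : LC.LocQI (B := (D.baseChange K).toS.restr R) (e := e)
      fun X => LC.push (D.toGenericFibre K) (f X) where
  inj X Y a := by
    rintro ⟨y, hy⟩
    change Tot (complexBaseChange K (D.Hom (e X) (e Y))) at y
    let a' : Tot (D.Hom (e X) (e Y)) := f Y 0 X (H.single X Y a)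
    change totOne K (D.Hom (e X) (e Y)) a' = totD _ y at hy
    obtain ⟨r, hr, b, hb⟩ := exists_smul_eq_totOne K y
    obtain ⟨t, ht, h⟩ := exists_smul_eq_zero_of_totOne K (x := r • a' - totD _ b) (by
      rw [map_sub, map_smulₛₗ, hy, totOne_totD, ← hb, map_smul, sub_self])
    rw [smul_sub, sub_eq_zero, smul_smul, ← map_smul] at h
    have h1 : (t * r) • a = 0 := hf.inj X Y _ ⟨t • b, by
      rw [map_smul, map_smul]; exact h⟩
    exact (smul_eq_zero.1 h1).resolve_left (nonZeroDivisors.ne_zero (mul_mem ht hr))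
  surj X Y y hy := by
    change Tot (complexBaseChange K (D.Hom (e X) (e Y))) at y
    change totD _ y = 0 at hy
    obtain ⟨r, hr, b, hb⟩ := exists_smul_eq_totOne K y
    obtain ⟨t, ht, h⟩ := exists_smul_eq_zero_of_totOne K (x := totD _ b) (by
      rw [totOne_totD, ← hb, map_smul, hy, smul_zero])
    obtain ⟨a, z, hz⟩ := hf.surj X Y (t • b) (by
      change totD (D.Hom (e X) (e Y)) (t • b) = 0
      rw [map_smul]; exact h)
    refine ⟨t * r, mul_mem ht hr, a, totOne K (D.Hom (e X) (e Y)) z, ?_⟩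
    have h1 : algebraMap R K (t * r) • y = totOne K (D.Hom (e X) (e Y)) (t • b) := by
      rw [map_mul, mul_smul, hb, map_smulₛₗ]
    refine h1.trans ((congrArg (totOne K (D.Hom (e X) (e Y))) hz).trans ?_)
    exact (map_add _ _ _).trans (congrArg _ (totOne_totD K (A := D.Hom (e X) (e Y)) z))

end DGCat

/-! ### The differential twisted by a twisting cochain -/

namespace LC

variable {R : Type u} [CommRing R] {H : DGCat.{u} R} {B : SCat.{u} R} {e : H.Obj → B.Obj}
  {Z U V : H.Obj} {Y Y' : B.Obj}

lemma tw_pb (φ : LC H B e Z Y) : tw (pb φ) = -pb (tw φ) := by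
  funext n V
  induction n generalizing Z with
  | zero => ext w; change (0 : B.Hom (e V) Y) = -0; rw [neg_zero]
  | succ n ih =>
    refine H.word_ext fun U a w => ?_
    have h1 : sh a (tw (pb φ)) = -ract (totSign _ a) (tw φ) + tw (pb (sh a φ)) := by
      rw [sh_tw, sh_pb, totSign_totSign, map_sub, tw_ract]; abel
    have h2 : sh a (-pb (tw φ)) = -ract (totSign _ a) (tw φ) - pb (tw (sh a φ)) := by
      rw [map_neg, sh_pb, sh_tw, totSign_totSign, map_neg]; abel
    rw [← sh_apply, ← sh_apply, h1, h2, sub_eq_add_neg, Pi.add_apply, Pi.add_apply, Pi.add_apply,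
      Pi.add_apply, ih]

lemma tw_cup (φ : LC H B e Z Y) (g : AA H B e) :
    tw (cup φ g) = cup (tw φ) fun X => tw (g X) := by
  funext n V
  induction n generalizing Z with
  | zero => ext w; rfl
  | succ n ih =>
    refine H.word_ext fun U a w => ?_
    have h1 : sh a (tw (cup φ g)) = -lact (φ 0 U (H.single U Z (totSign _ a))) (tw (g U)) -
        tw (cup (sh (totSign _ a) φ) g) := by
      rw [sh_tw, sh_cup, map_add, tw_lact]; abel
    have h2 : sh a (cup (tw φ) fun X => tw (g X)) =
        -lact (φ 0 U (H.single U Z (totSign _ a))) (tw (g U)) -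
          cup (tw (sh (totSign _ a) φ)) fun X => tw (g X) := by
      rw [sh_cup, sh_tw, tw_apply, H.wSgn_single, map_neg, map_neg, map_neg, LinearMap.neg_apply,
        LinearMap.neg_apply]
      abel
    rw [← sh_apply, ← sh_apply, h1, h2, Pi.sub_apply, Pi.sub_apply, Pi.sub_apply, Pi.sub_apply, ih]

/-- The sign involution of cochains. -/
def ts : LC H B e Z Y →ₗ[R] LC H B e Z Y := -tw.comp sg

lemma ts_apply (φ : LC H B e Z Y) : ts φ = -tw (sg φ) := rfl

lemma ts_ts (φ : LC H B e Z Y) : ts (ts φ) = φ := by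
  rw [ts_apply, ts_apply, map_neg, map_neg, neg_neg, sg_tw, sg_sg, tw_tw]

lemma IsHomog.ts_eq {k : ℤ} {φ : LC H B e Z Y} (h : IsHomog k φ) : ts φ = k.negOnePow • φ := by
  rw [ts_apply, h.sg_eq, units_smul_map, tw_tw, Int.negOnePow_succ, Units.neg_smul, neg_neg]

lemma IsHomog.ts {k : ℤ} {φ : LC H B e Z Y} (h : IsHomog k φ) : IsHomog k (ts φ) := by
  rw [h.ts_eq]; exact h.units_smul _

lemma ts_lact (c : B.Hom Y Y') (φ : LC H B e Z Y) : ts (lact c φ) = lact (B.sgn c) (ts φ) := by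
  rw [ts_apply, ts_apply, sg_lact, tw_lact, map_neg]

lemma ts_ract (a : Tot (H.Hom U Z)) (φ : LC H B e Z Y) :
    ts (ract a φ) = ract (totSign _ a) (ts φ) := by
  rw [ts_apply, ts_apply, ← ract_sg, tw_ract, map_neg]

lemma sh_ts (a : Tot (H.Hom U Z)) (φ : LC H B e Z Y) :
    sh a (ts φ) = -ts (sh (totSign _ a) φ) := by
  rw [ts_apply, ts_apply, map_neg, sh_tw, sh_sg]

/-- The differential on cochains twisted by `f`. It squares to zero when `f` is a twisting
cochain. -/
def cov (f : AA H B e) : LC H B e Z Y →ₗ[R] LC H B e Z Y :=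
  dd + pb.comp ts - (cup.flip f).comp sg

lemma cov_apply (f : AA H B e) (φ : LC H B e Z Y) :
    cov f φ = dd φ + pb (ts φ) - cup (sg φ) f := rfl

variable {f : AA H B e}

lemma cov_self (hf : ∀ X, IsHomog 0 (f X)) (X : H.Obj) : cov f (f X) = curv f X := by
  rw [cov_apply, (hf X).ts_eq, Int.negOnePow_zero, one_smul, curv]

lemma ts_cov (hf : ∀ X, IsHomog 0 (f X)) (φ : LC H B e Z Y) : ts (cov f φ) = -cov f (ts φ) := by
  have h1 : (fun X => tw (sg (f X))) = -f := funext fun X => by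
    rw [(hf X).odd, map_neg, tw_tw]; rfl
  simp only [cov_apply, ts_apply, map_add, map_sub, map_neg, sg_dd, dd_tw, sg_pb, tw_pb, sg_cup,
    sg_sg, tw_cup, h1, sg_tw, tw_tw]
  abel

lemma cov_cov (hf : ∀ X, IsHomog 0 (f X)) (hc : ∀ X, curv f X = 0) (φ : LC H B e Z Y) :
    cov f (cov f φ) = 0 := by
  have h1 : cup φ (curv f) = 0 := by
    have : curv f = 0 := funext hc
    rw [this, map_zero]
  have h2 : (curv f : AA H B e) = (fun X => dd (f X)) + (fun X => pb (f X)) -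
    (fun X => cup (sg (f X)) f) := rfl
  rw [h2, map_sub, map_add] at h1
  rw [cov_apply, ts_cov hf, cov_apply, cov_apply]
  simp only [map_add, map_sub, map_neg, LinearMap.add_apply, LinearMap.sub_apply, dd_dd, dd_pb,
    dd_cup, pb_pb, pb_cup, sg_dd, sg_pb, sg_cup, sg_sg, cup_assoc, ts_apply, dd_tw, sg_tw,
    tw_tw, LinearMap.neg_apply]
  rw [← neg_eq_zero, ← h1]
  abel

lemma cov_lact (c : B.Hom Y Y') (φ : LC H B e Z Y) :
    cov f (lact c φ) = lact (B.d c) φ + lact (B.sgn c) (cov f φ) := by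
  simp only [cov_apply, dd_lact, ts_lact, pb_lact, sg_lact, ← lact_cup, map_add, map_sub]
  abel

lemma cov_ract (a : Tot (H.Hom U Z)) (φ : LC H B e Z Y) :
    cov f (ract a φ) = ract a (cov f φ) := by
  simp only [cov_apply, ← ract_dd, ts_ract, pb_ract, ← ract_sg, ← ract_cup, map_add, map_sub,
    totSign_totSign]

lemma IsHomog.cov {k : ℤ} {φ : LC H B e Z Y} (h : IsHomog k φ) (hf : ∀ X, IsHomog 0 (f X)) :
    IsHomog (k + 1) (LC.cov f φ) :=
  (h.dd.add h.ts.pb).sub ((h.sg.cup hf).of_eq (by omega))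

lemma _root_.DGCat.totSign_idTot (X : H.Obj) : totSign _ (H.idTot X) = H.idTot X :=
  H.toS.sgn_one X

/-- Evaluation of a cochain at the identity. -/
def ev : LC H B e Z Y →ₗ[R] B.Hom (e Z) Y where
  toFun φ := φ 0 Z (H.single Z Z (H.idTot Z))
  map_add' _ _ := rfl
  map_smul' _ _ := rfl

lemma ev_apply (φ : LC H B e Z Y) : ev φ = φ 0 Z (H.single Z Z (H.idTot Z)) := rfl

lemma ev_cov (φ : LC H B e Z Y) : ev (cov f φ) = B.d (ev φ) := by
  rw [ev_apply, cov_apply]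
  change B.d (ev φ) + 0 - 0 = _
  rw [add_zero, sub_zero]

lemma ev_lact (c : B.Hom Y Y') (φ : LC H B e Z Y) : ev (lact c φ) = B.mul c (ev φ) := rfl

lemma ev_ract (a : Tot (H.Hom U Z)) (φ : LC H B e Z Y) :
    ev (ract a φ) = φ 0 U (H.single U Z a) := by
  rw [ev_apply, ract_apply, H.mulFirst_single, H.comp_idTot]

lemma sh_one_cov (φ : LC H B e Z Y) :
    sh (H.idTot Z) (cov f φ) =
      cov f (sh (H.idTot Z) φ) + ts φ - lact (B.sgn (ev φ)) (f Z) := by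
  rw [cov_apply, map_sub, map_add, sh_pb, sh_cup, H.totSign_idTot, ract_one, sh_ts,
    H.totSign_idTot, map_neg, sub_neg_eq_add, cov_apply, sh_dd, sh_sg]
  change _ - (lact (B.sgn (ev φ)) (f Z) + _) = _
  abel

/-- Prefixing the identity is a homotopy that contracts the twisted complex of cochains on words
starting at `Z` onto the multiples of `f Z`. -/
lemma eq_lact_add_cov (hf : ∀ X, IsHomog 0 (f X)) {φ : LC H B e Z Y} (hφ : cov f φ = 0) :
    φ = lact (ev φ) (f Z) + cov f (ts (sh (H.idTot Z) φ)) := by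
  have h1 := congrArg ts (sh_one_cov (f := f) φ)
  rw [hφ, map_zero, map_zero, map_sub, map_add, ts_cov hf, ts_ts, ts_lact, B.sgn_sgn,
    (hf Z).ts_eq, Int.negOnePow_zero, one_smul] at h1
  rw [eq_comm, sub_eq_zero] at h1
  rw [← h1]; abel

end LC

/-! ### The dg category of a signed category -/

namespace SCat

variable {R : Type u} [CommRing R] (B : SCat.{u} R)

open scoped Classical in
/-- The differential on homogeneous morphisms. -/
def degD {X Y : B.Obj} (i j : ℤ) :
    B.deg (X := X) (Y := Y) i →ₗ[R] B.deg (X := X) (Y := Y) j :=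
  if h : i + 1 = j then B.d.restrict fun x hx => h ▸ B.deg_d i x hx else 0

lemma degD_coe {X Y : B.Obj} (i j : ℤ) (h : i + 1 = j) (x : B.deg (X := X) (Y := Y) i) :
    (B.degD i j x).1 = B.d x.1 := by
  rw [degD, dif_pos h]
  rfl

/-- The complex of homogeneous morphisms in a signed category. -/
def homComplex (X Y : B.Obj) : CochainComplex (ModuleCat.{u} R) ℤ where
  X i := ModuleCat.of R (B.deg (X := X) (Y := Y) i)
  d i j := ModuleCat.ofHom (B.degD i j)
  shape i j h := by
    rw [degD, dif_neg (show ¬ i + 1 = j from h)]; rfl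
  d_comp_d' i j k h h' := by
    refine ModuleCat.hom_ext (LinearMap.ext fun x => Subtype.ext ?_)
    exact (B.degD_coe j k h' _).trans ((congrArg _ (B.degD_coe i j h x)).trans (B.d_d x.1))

lemma homComplex_d {X Y : B.Obj} (i j : ℤ) (h : i + 1 = j) (x : B.deg (X := X) (Y := Y) i) :
    ((B.homComplex X Y).d i j x : B.deg (X := X) (Y := Y) j).1 = B.d x.1 :=
  B.degD_coe i j h x

/-- Composition of homogeneous morphisms. -/
def homComp {X Y Z : B.Obj} (i j k : ℤ) (h : i + j = k) :
    B.deg (X := Y) (Y := Z) i →ₗ[R] B.deg (X := X) (Y := Y) j →ₗ[R] B.deg (X := X) (Y := Z) k :=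
  LinearMap.mk₂ R (fun g f => ⟨B.mul g.1 f.1, h ▸ B.deg_mul i j g.1 f.1 g.2 f.2⟩)
    (fun _ _ _ => Subtype.ext (LinearMap.map_add₂ _ _ _ _))
    (fun _ _ _ => Subtype.ext (LinearMap.map_smul₂ _ _ _ _))
    (fun _ _ _ => Subtype.ext (map_add _ _ _))
    (fun _ _ _ => Subtype.ext (map_smul _ _ _))

/-- The dg category of homogeneous morphisms in a signed category. -/
def toDG : DGCat.{u} R where
  Obj := B.Obj
  Hom X Y := B.homComplex X Y
  comp {X Y Z} i j k h := B.homComp (X := X) (Y := Y) (Z := Z) i j k h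
  id X := (⟨B.one X, B.deg_one X⟩ : B.deg (X := X) (Y := X) 0)
  id_comp i f := Subtype.ext (B.one_mul _)
  comp_id i f := Subtype.ext (B.mul_one _)
  assoc i j k ij jk ijk hij hjk h₁ h₂ h g f := Subtype.ext (B.mul_assoc _ _ _)
  d_id X := Subtype.ext ((B.homComplex_d 0 1 rfl _).trans (B.d_one X))
  leibniz {X Y Z} i j i' j' k k' hk hi hj h₁ h₂ g f := by
    change B.deg (X := Y) (Y := Z) i at g
    change B.deg (X := X) (Y := Y) j at f
    refine Subtype.ext ((B.homComplex_d k k' (by omega) _).trans ?_)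
    have h3 : B.mul g.1 ((B.homComplex X Y).d j j' f : B.deg (X := X) (Y := Y) j').1 =
      B.mul g.1 (B.d f.1) := by rw [B.homComplex_d j j' h₂]
    have h4 : B.mul ((B.homComplex Y Z).d i i' g : B.deg (X := Y) (Y := Z) i').1 f.1 =
      B.mul (B.d g.1) f.1 := by rw [B.homComplex_d i i' h₁]
    change B.d (B.mul g.1 f.1) =
      B.mul ((B.homComplex Y Z).d i i' g : B.deg (X := Y) (Y := Z) i').1 f.1 +
      i.negOnePow • B.mul g.1 ((B.homComplex X Y).d j j' f : B.deg (X := X) (Y := Y) j').1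
    rw [h3, h4, B.d_mul, B.sgn_deg i g.1 g.2, units_smul_map₂]

variable {B} {D : DGCat.{u} R}

lemma tof_tcomp_of_mem {A : CochainComplex (ModuleCat.{u} R) ℤ} {i : ℤ} {x : Tot A}
    (h : x ∈ totDeg A i) : tof A i (tcomp A i x) = x :=
  totProj_of_mem h

lemma Fun.tof_tcomp_map (G : Fun B D.toS) {X Y : B.Obj} (i : ℤ) (x : B.deg (X := X) (Y := Y) i) :
    tof (D.Hom (G.obj X) (G.obj Y)) i (tcomp (D.Hom (G.obj X) (G.obj Y)) i (G.map x.1)) =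
      G.map x.1 :=
  tof_tcomp_of_mem (A := D.Hom (G.obj X) (G.obj Y)) (G.map_deg i x.1 x.2)

lemma tof_injective {A : CochainComplex (ModuleCat.{u} R) ℤ} {i : ℤ} {x y : A.X i}
    (h : tof A i x = tof A i y) : x = y := by
  rw [← tcomp_tof i x, h, tcomp_tof]

/-- The dg functor on homogeneous morphisms defined by a functor of signed categories. -/
def Fun.toDG (G : Fun B D.toS) (hone : ∀ X, G.map (B.one X) = D.toS.one (G.obj X)) :
    DGCat.Functor B.toDG D where
  obj := G.obj
  map X Y :=
    { f := fun i => ModuleCat.ofHom ((tcomp (D.Hom (G.obj X) (G.obj Y)) i).comp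
        (G.map.comp (B.deg (X := X) (Y := Y) i).subtype))
      comm' := fun i j h => by
        change i + 1 = j at h
        ext (x : B.deg (X := X) (Y := Y) i)
        refine (DGCat.tcomp_totD' h _).symm.trans
          (congrArg (tcomp (D.Hom (G.obj X) (G.obj Y)) j) ?_)
        exact (G.map_d x.1).symm.trans (congrArg G.map (B.homComplex_d i j h x).symm) }
  map_id X := (congrArg (tcomp (D.Hom (G.obj X) (G.obj X)) 0) (hone X)).trans (tcomp_tof 0 _)
  map_comp {X Y Z} i j k h g f := by
    change B.deg (X := Y) (Y := Z) i at g
    change B.deg (X := X) (Y := Y) j at f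
    refine tof_injective ((G.tof_tcomp_map k (B.homComp i j k h g f)).trans ?_)
    refine Eq.trans (G.map_mul g.1 f.1) ?_
    refine (congrArg₂ (fun a b => D.toS.mul a b) (G.tof_tcomp_map i g).symm
      (G.tof_tcomp_map j f).symm).trans ?_
    exact D.compTot_tof i j k h _ _

/-- A functor that is bijective on objects and induces an isomorphism on the cohomology of the
homogeneous morphisms defines a quasi-isomorphism of dg categories. -/
lemma Fun.isQuasiIso_toDG (G : Fun B D.toS) (hone : ∀ X, G.map (B.one X) = D.toS.one (G.obj X))
    (hobj : Function.Bijective G.obj)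
    (hinj : ∀ (X Y : B.Obj) (i : ℤ) (x : B.Hom X Y), x ∈ B.deg (X := X) i → B.d x = 0 →
      (∃ y, G.map x = D.toS.d y) → ∃ z ∈ B.deg (X := X) (i - 1), x = B.d z)
    (hsurj : ∀ (X Y : B.Obj) (i : ℤ) (y : D.toS.Hom (G.obj X) (G.obj Y)),
      y ∈ D.toS.deg (X := G.obj X) i → D.toS.d y = 0 → ∃ x ∈ B.deg (X := X) i, B.d x = 0 ∧
        ∃ z, y = G.map x + D.toS.d z) :
    (G.toDG hone).IsQuasiIso where
  bijective_obj := hobj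
  quasiIso_map X Y := by
    refine (quasiIso_iff_elements _).2 fun i => ⟨fun x hx => ?_, fun y hy => ?_⟩
    · rintro ⟨y, hy⟩
      change B.deg (X := X) (Y := Y) i at x
      have h1 : B.d x.1 = 0 := (B.homComplex_d i (i + 1) rfl x).symm.trans (congrArg Subtype.val hx)
      obtain ⟨z, hz, hxz⟩ := hinj X Y i x.1 x.2 h1 ⟨tof (D.Hom (G.obj X) (G.obj Y)) (i - 1) y, by
        refine (G.tof_tcomp_map i x).symm.trans ?_
        refine Eq.trans (congrArg _ hy) (DGCat.totD_tof' (sub_add_cancel i 1) y).symm⟩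
      exact ⟨(⟨z, hz⟩ : B.deg (X := X) (Y := Y) (i - 1)),
        Subtype.ext (hxz.trans (B.homComplex_d (X := X) (Y := Y) (i - 1) i (by omega) ⟨z, hz⟩).symm)⟩
    · change (D.Hom (G.obj X) (G.obj Y)).X i at y
      obtain ⟨x, hx, hdx, z, hz⟩ := hsurj X Y i (tof (D.Hom (G.obj X) (G.obj Y)) i y) (tof_mem i y)
        ((DGCat.totD_eq_zero_iff y).2 hy)
      refine ⟨(⟨x, hx⟩ : B.deg (X := X) (Y := Y) i),
        Subtype.ext ((B.homComplex_d i (i + 1) rfl _).trans hdx),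
        tcomp (D.Hom (G.obj X) (G.obj Y)) (i - 1) z, ?_⟩
      have h1 := congrArg (tcomp (D.Hom (G.obj X) (G.obj Y)) i) hz
      rw [tcomp_tof] at h1
      refine h1.trans ((map_add _ _ _).trans (congrArg _ ?_))
      exact DGCat.tcomp_totD' (sub_add_cancel i 1) z

end SCat

/-! ### Gluing along a twisting cochain -/

namespace LC

variable {R : Type u} [CommRing R] {H : DGCat.{u} R} {B : SCat.{u} R} {e : H.Obj → B.Obj}
  {W X Y Z : H.Obj} {f : AA H B e}

variable (H B e) in
/-- The morphisms in the category glued from `H` and `B` along a twisting cochain: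
a morphism of `H`, a morphism of `B`, and a cochain as homotopy between them. -/
abbrev Glue (X Y : H.Obj) : Type u :=
  Tot (H.Hom X Y) × B.Hom (e X) (e Y) × LC H B e X (e Y)

/-- Composition in the glued category. -/
def glueMul : Glue H B e Y Z →ₗ[R] Glue H B e X Y →ₗ[R] Glue H B e X Z :=
  LinearMap.mk₂ R (fun x y => (H.compTot X Y Z x.1 y.1, B.mul x.2.1 y.2.1,
      lact (B.sgn x.2.1) y.2.2 + ract y.1 x.2.2))
    (fun x x' y => by
      refine Prod.ext ?_ (Prod.ext ?_ ?_)
      · exact LinearMap.map_add₂ _ _ _ _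
      · exact LinearMap.map_add₂ _ _ _ _
      · change lact (B.sgn (x.2.1 + x'.2.1)) y.2.2 + ract y.1 (x.2.2 + x'.2.2) = _ + _ + (_ + _)
        rw [map_add, map_add, map_add, LinearMap.add_apply]; abel)
    (fun r x y => by
      refine Prod.ext ?_ (Prod.ext ?_ ?_)
      · exact LinearMap.map_smul₂ _ _ _ _
      · exact LinearMap.map_smul₂ _ _ _ _
      · change lact (B.sgn (r • x.2.1)) y.2.2 + ract y.1 (r • x.2.2) = r • (_ + _)
        rw [map_smul, map_smul, map_smul, LinearMap.smul_apply, smul_add])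
    (fun x y y' => by
      refine Prod.ext ?_ (Prod.ext ?_ ?_)
      · exact map_add _ _ _
      · exact map_add _ _ _
      · change lact (B.sgn x.2.1) (y.2.2 + y'.2.2) + ract (y.1 + y'.1) x.2.2 = _ + _ + (_ + _)
        rw [map_add, map_add, LinearMap.add_apply]; abel)
    (fun r x y => by
      refine Prod.ext ?_ (Prod.ext ?_ ?_)
      · exact map_smul _ _ _
      · exact map_smul _ _ _
      · change lact (B.sgn x.2.1) (r • y.2.2) + ract (r • y.1) x.2.2 = r • (_ + _)
        rw [map_smul, map_smul, LinearMap.smul_apply, smul_add])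

lemma glueMul_apply (x : Glue H B e Y Z) (y : Glue H B e X Y) :
    glueMul x y = (H.compTot X Y Z x.1 y.1, B.mul x.2.1 y.2.1,
      lact (B.sgn x.2.1) y.2.2 + ract y.1 x.2.2) := rfl

/-- The sign involution in the glued category. -/
def glueSgn : Glue H B e X Y →ₗ[R] Glue H B e X Y :=
  (totSign _).prodMap (B.sgn.prodMap (-ts))

lemma glueSgn_apply (x : Glue H B e X Y) :
    glueSgn x = (totSign _ x.1, B.sgn x.2.1, -ts x.2.2) := rfl

variable (f) in
/-- The differential in the glued category. -/
def glueD : Glue H B e X Y →ₗ[R] Glue H B e X Y where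
  toFun x := (0, B.d x.2.1, lact x.2.1 (f X) - ract x.1 (f Y) - cov f x.2.2)
  map_add' x y := by
    refine Prod.ext (add_zero _).symm (Prod.ext (map_add _ _ _) ?_)
    change lact (x.2.1 + y.2.1) (f X) - ract (x.1 + y.1) (f Y) - cov f (x.2.2 + y.2.2) =
      _ - _ - _ + (_ - _ - _)
    rw [map_add, map_add, map_add, LinearMap.add_apply, LinearMap.add_apply]; abel
  map_smul' r x := by
    refine Prod.ext (smul_zero _).symm (Prod.ext (map_smul _ _ _) ?_)
    change lact (r • x.2.1) (f X) - ract (r • x.1) (f Y) - cov f (r • x.2.2) = r • (_ - _ - _)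
    rw [map_smul, map_smul, map_smul, LinearMap.smul_apply, LinearMap.smul_apply, smul_sub,
      smul_sub]

lemma glueD_apply (x : Glue H B e X Y) :
    glueD f x = (0, B.d x.2.1, lact x.2.1 (f X) - ract x.1 (f Y) - cov f x.2.2) := rfl

/-- The homogeneous morphisms in the glued category. -/
def glueDeg (k : ℤ) : Submodule R (Glue H B e X Y) where
  carrier := {x | x.1 ∈ totDeg _ k ∧ x.2.1 ∈ B.deg (X := e X) k ∧ IsHomog (k - 1) x.2.2}
  add_mem' hx hy := ⟨add_mem hx.1 hy.1, add_mem hx.2.1 hy.2.1, hx.2.2.add hy.2.2⟩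
  zero_mem' := ⟨zero_mem _, zero_mem _, IsHomog.zero _⟩
  smul_mem' r _ hx := ⟨Submodule.smul_mem _ r hx.1, Submodule.smul_mem _ r hx.2.1, hx.2.2.smul r⟩

lemma IsHomog.ract_mem {k j : ℤ} {Y : B.Obj} {φ : LC H B e X Y} (h : IsHomog k φ)
    {a : Tot (H.Hom W X)} (ha : a ∈ totDeg _ j) : IsHomog (k + j) (LC.ract a φ) := by
  obtain ⟨a, rfl⟩ := ha
  exact h.ract j a

lemma _root_.SCat.sgn_mem {X Y : B.Obj} {k : ℤ} {c : B.Hom X Y} (hc : c ∈ B.deg (X := X) k) :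
    B.sgn c ∈ B.deg (X := X) k := by
  rw [B.sgn_deg k c hc]
  exact (B.deg k).toAddSubgroup.zsmul_mem hc _

variable (hf : ∀ X, IsHomog 0 (f X)) (hc : ∀ X, curv f X = 0)

lemma glueMul_assoc (x : Glue H B e Y Z) (y : Glue H B e X Y) (z : Glue H B e W X) :
    glueMul (glueMul x y) z = glueMul x (glueMul y z) := by
  simp only [glueMul_apply]
  refine Prod.ext (H.compTot_assoc _ _ _) (Prod.ext (B.mul_assoc _ _ _) ?_)
  dsimp only
  rw [B.sgn_mul, map_add, map_add, ← lact_lact, ract_lact, ract_ract, add_assoc]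

lemma glueSgn_mul (x : Glue H B e Y Z) (y : Glue H B e X Y) :
    glueSgn (glueMul x y) = glueMul (glueSgn x) (glueSgn y) := by
  simp only [glueMul_apply, glueSgn_apply]
  refine Prod.ext (H.totSign_compTot _ _) (Prod.ext (B.sgn_mul _ _) ?_)
  dsimp only
  rw [map_add, ts_lact, ts_ract, map_neg, map_neg, B.sgn_sgn, neg_add]

include hf in
lemma glueSgn_glueD (x : Glue H B e X Y) : glueSgn (glueD f x) = -glueD f (glueSgn x) := by
  simp only [glueD_apply, glueSgn_apply]
  refine Prod.ext ((map_zero _).trans neg_zero.symm) (Prod.ext (B.sgn_d _) ?_)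
  change -ts _ = -(_ - _ - _)
  rw [map_sub, map_sub, ts_lact, ts_ract, ts_cov hf, (hf X).ts_eq, (hf Y).ts_eq,
    Int.negOnePow_zero, one_smul, one_smul, map_neg]

include hf hc in
lemma glueD_glueD (x : Glue H B e X Y) : glueD f (glueD f x) = 0 := by
  simp only [glueD_apply]
  refine Prod.ext rfl (Prod.ext (B.d_d _) ?_)
  dsimp only
  rw [map_sub, map_sub, cov_lact, cov_ract, cov_self hf, cov_self hf, hc, hc, cov_cov hf hc]
  simp

lemma glueD_mul (x : Glue H B e Y Z) (y : Glue H B e X Y) :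
    glueD f (glueMul x y) = glueMul (glueD f x) y + glueMul (glueSgn x) (glueD f y) := by
  simp only [glueMul_apply, glueSgn_apply, glueD_apply]
  refine Prod.ext ?_ (Prod.ext (B.d_mul _ _) ?_)
  · change 0 = H.compTot X Y Z 0 y.1 + H.compTot X Y Z _ 0
    rw [map_zero, map_zero, LinearMap.zero_apply, add_zero]
  · change lact (B.mul x.2.1 y.2.1) (f X) - ract (H.compTot X Y Z x.1 y.1) (f Z) -
        cov f (lact (B.sgn x.2.1) y.2.2 + ract y.1 x.2.2) =
      lact (B.sgn (B.d x.2.1)) y.2.2 +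
        ract y.1 (lact x.2.1 (f Y) - ract x.1 (f Z) - cov f x.2.2) +
      (lact (B.sgn (B.sgn x.2.1)) (lact y.2.1 (f X) - ract y.1 (f Y) - cov f y.2.2) +
        ract 0 (-ts x.2.2))
    simp only [map_add, map_sub, cov_lact, cov_ract, B.sgn_sgn, B.sgn_d, map_neg, map_zero,
      LinearMap.zero_apply, LinearMap.neg_apply, lact_lact, ract_lact, ract_ract]
    abel

lemma glueSgn_of_mem {k : ℤ} {x : Glue H B e X Y} (hx : x ∈ glueDeg k) :
    glueSgn x = k.negOnePow • x := by
  refine Prod.ext (totSign_of_mem hx.1) (Prod.ext (B.sgn_deg k _ hx.2.1) ?_)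
  change -ts x.2.2 = _
  rw [hx.2.2.ts_eq, Int.negOnePow_sub, Int.negOnePow_one, mul_neg_one, Units.neg_smul, neg_neg]
  rfl

include hf in
lemma glueD_mem {k : ℤ} {x : Glue H B e X Y} (hx : x ∈ glueDeg k) :
    glueD f x ∈ glueDeg (k + 1) := by
  refine ⟨zero_mem _, B.deg_d k _ hx.2.1, ?_⟩
  exact ((((hf X).lact hx.2.1).of_eq (by omega)).sub
    (((hf Y).ract_mem hx.1).of_eq (by omega))).sub ((hx.2.2.cov hf).of_eq (by omega))

lemma glueMul_mem {i j : ℤ} {x : Glue H B e Y Z} {y : Glue H B e X Y} (hx : x ∈ glueDeg i)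
    (hy : y ∈ glueDeg j) : glueMul x y ∈ glueDeg (i + j) :=
  ⟨H.toS.deg_mul i j _ _ hx.1 hy.1, B.deg_mul i j _ _ hx.2.1 hy.2.1,
    ((hy.2.2.lact (SCat.sgn_mem hx.2.1)).of_eq (by omega)).add
      ((hx.2.2.ract_mem hy.1).of_eq (by omega))⟩

/-- The category glued from `H` and `B` along a twisting cochain. Its morphisms are triples
`(h, c, η)` with `d(h, c, η) = (0, dc, c f - f h - ∇η)`; a closed one is a pair of morphisms of `H`
and `B` together with a homotopy that identifies them along `f`. -/
def glue : SCat.{u} R where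
  Obj := H.Obj
  Hom X Y := ModuleCat.of R (Glue H B e X Y)
  mul := glueMul
  one X := (H.idTot X, B.one (e X), 0)
  sgn := glueSgn
  d := glueD f
  deg := glueDeg
  mul_assoc := glueMul_assoc
  one_mul x := by
    refine Prod.ext (H.idTot_comp _) (Prod.ext (B.one_mul _) ?_)
    change lact (B.sgn (B.one _)) x.2.2 + ract x.1 0 = x.2.2
    rw [B.sgn_one, lact_one, map_zero, add_zero]
  mul_one x := by
    refine Prod.ext (H.comp_idTot _) (Prod.ext (B.mul_one _) ?_)
    change lact _ 0 + ract (H.idTot _) x.2.2 = x.2.2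
    rw [ract_one, map_zero, zero_add]
  sgn_mul := glueSgn_mul
  sgn_sgn x := by
    refine Prod.ext (totSign_totSign _) (Prod.ext (B.sgn_sgn _) ?_)
    change -ts (-ts x.2.2) = x.2.2
    rw [map_neg, neg_neg, ts_ts]
  sgn_d := glueSgn_glueD hf
  d_d := glueD_glueD hf hc
  d_mul := glueD_mul
  d_one X := by
    refine Prod.ext rfl (Prod.ext (B.d_one _) ?_)
    change lact (B.one _) (f X) - ract (H.idTot X) (f X) - cov f 0 = 0
    rw [lact_one, ract_one, map_zero, sub_self, sub_zero]
  deg_mul i j _ _ := glueMul_mem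
  deg_one X := ⟨H.toS.deg_one X, B.deg_one _, IsHomog.zero _⟩
  deg_d i _ := glueD_mem hf
  sgn_deg k _ := glueSgn_of_mem

/-- The projection of the glued category to `B`. -/
def glueSnd : SCat.Fun (glue hf hc) B where
  obj X := e X
  map {X Y} := (LinearMap.fst R _ _).comp (LinearMap.snd R _ _ : Glue H B e X Y →ₗ[R] _)
  map_mul _ _ := rfl
  map_sgn _ := rfl
  map_d _ := rfl
  map_deg _ _ h := h.2.1

/-- The projection of the glued category to `H`. -/
def glueFst (hd : ∀ X Y (a : Tot (H.Hom X Y)), totD _ a = 0) : SCat.Fun (glue hf hc) H.toS where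
  obj X := X
  map {X Y} := (LinearMap.fst R _ _ : Glue H B e X Y →ₗ[R] _)
  map_mul _ _ := rfl
  map_sgn _ := rfl
  map_d {X Y} _ := (hd X Y _).symm
  map_deg _ _ h := h.1

end LC

namespace LC

variable {R : Type u} [CommRing R] {H : DGCat.{u} R} {B : SCat.{u} R} {e : H.Obj → B.Obj} {f : AA H B e}
  {X Y Z : H.Obj} (P : B.Proj) (hf : ∀ X, IsHomog 0 (f X)) (hc : ∀ X, curv f X = 0)

lemma _root_.SCat.Proj.exists_d_eq {R : Type u} [CommRing R] {B : SCat.{u} R} (P : B.Proj)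
    {X Y : B.Obj} {k : ℤ} {x : B.Hom X Y} (hx : x ∈ B.deg (X := X) k) (h : ∃ y, x = B.d y) :
    ∃ y ∈ B.deg (X := X) (k - 1), x = B.d y := by
  obtain ⟨y, hy⟩ := h
  refine ⟨P.ρ (k - 1) y, P.mem _ _, ?_⟩
  rw [P.comm_d, ← hy, sub_add_cancel, P.eq_self k x hx]

include hc in
lemma exists_apply_mul (a : Tot (H.Hom Y Z)) (b : Tot (H.Hom X Y)) (hf : ∀ X, IsHomog 0 (f X)) :
    ∃ y, f Z 0 X (H.single X Z (H.compTot X Y Z a b)) =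
      B.mul (f Z 0 Y (H.single Y Z a)) (f Y 0 X (H.single X Y b)) + B.d y := by
  have h1 : curv f Z 1 X (H.cons 0 X Y Z (totSign _ a) (H.single X Y b)) = 0 := by rw [hc]; rfl
  have h0 : curv f Z = dd (f Z) + pb (f Z) + cup (tw (f Z)) f := by
    rw [curv, (hf Z).odd, map_neg, LinearMap.neg_apply, sub_neg_eq_add]
  rw [h0, Pi.add_apply, Pi.add_apply, Pi.add_apply, Pi.add_apply, LinearMap.add_apply,
    LinearMap.add_apply, pb_succ, H.bS_zero, totSign_totSign, H.mulFirst_single,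
    cup_cons, cup_zero, LinearMap.zero_apply, add_zero, tw_apply, H.wSgn_single, totSign_totSign,
    map_neg, map_neg, LinearMap.neg_apply, dd_apply] at h1
  refine ⟨-f Z 1 X (H.cons 0 X Y Z (totSign _ a) (H.single X Y b)), ?_⟩
  rw [map_neg, ← sub_eq_zero, ← h1]
  abel

include hf in
lemma apply_idTot_mem (X : H.Obj) :
    ev (f X) ∈ B.deg (X := e X) (Y := e X) 0 := by
  have := (hf X).apply (V := X) 0 (H.id X)
  rwa [zero_add] at this

include hf hc in
/-- A twisting cochain that induces an isomorphism on cohomology is unital up to homotopy. -/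
lemma QI.exists_ev_eq (hq : QI f) (X : H.Obj) : ∃ y, ev (f X) = B.one (e X) + B.d y := by
  obtain ⟨a, y, hy⟩ := hq.surj X X (B.one (e X)) (B.d_one _)
  obtain ⟨z, hz⟩ := exists_apply_mul hc (H.idTot X) a hf
  rw [H.idTot_comp] at hz
  have h1 : B.mul (ev (f X)) (B.d y) = B.d (B.mul (ev (f X)) y) := by
    have h2 : B.d (ev (f X)) = 0 := hq.closed X X _
    rw [B.d_mul, h2, map_zero, LinearMap.zero_apply, zero_add,
      B.sgn_deg 0 _ (apply_idTot_mem hf X), Int.negOnePow_zero, one_smul]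
  refine ⟨B.mul (ev (f X)) y - z - y, ?_⟩
  have h3 : B.mul (ev (f X)) (f X 0 X (H.single X X a) + B.d y) = ev (f X) := by
    rw [← hy, B.mul_one]
  rw [map_add, h1, ← eq_sub_iff_add_eq] at h3
  rw [hy, hz, ← ev_apply, h3, map_sub, map_sub]
  abel

variable (hq : QI f)

include hf hc hq in
lemma QI.exists_mul_ev_eq (c : B.Hom (e X) (e Y)) (hdc : B.d c = 0) :
    ∃ y, B.mul c (ev (f X)) = c + B.d y := by
  obtain ⟨y, hy⟩ := QI.exists_ev_eq hf hc hq X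
  refine ⟨B.mul (B.sgn c) y, ?_⟩
  have h : B.d (B.sgn c) = 0 := by rw [← neg_eq_zero, ← B.sgn_d, hdc, map_zero]
  rw [hy, map_add, B.mul_one, B.d_mul, h, map_zero, LinearMap.zero_apply, zero_add,
    B.sgn_sgn]

lemma cov_lact_self (hf : ∀ X, IsHomog 0 (f X)) (hc : ∀ X, curv f X = 0)
    (c : B.Hom (e X) (e Y)) : cov f (lact c (f X)) = lact (B.d c) (f X) := by
  rw [cov_lact, cov_self hf, hc, map_zero, add_zero]

include P hf hc in
/-- A cocycle of the twisted complex is exact if its value at the identity is. -/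
lemma exists_eq_cov {k : ℤ} {φ : LC H B e X (e Y)} (hφ : IsHomog k φ) (h : cov f φ = 0)
    (hev : ∃ y, ev φ = B.d y) : ∃ η, IsHomog (k - 1) η ∧ φ = cov f η := by
  have h1 : ev φ ∈ B.deg (X := e X) (Y := e Y) k := by
    have := hφ.apply (V := X) 0 (H.id X)
    rwa [add_zero] at this
  obtain ⟨y, hy, hyd⟩ := P.exists_d_eq h1 hev
  refine ⟨lact y (f X) + ts (sh (H.idTot X) φ), ?_, ?_⟩
  · exact (((hf X).lact hy).of_eq (by omega)).add ((hφ.sh 0 (H.id X)).ts.of_eq (by omega))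
  · rw [map_add, cov_lact_self hf hc, ← hyd]
    exact eq_lact_add_cov hf h

include hf in
lemma apply_single_mem {k : ℤ} {a : Tot (H.Hom X Y)} (ha : a ∈ totDeg _ k) :
    f Y 0 X (H.single X Y a) ∈ B.deg (X := e X) (Y := e Y) k := by
  obtain ⟨a, rfl⟩ := ha
  have := (hf Y).apply (V := X) k a
  rwa [zero_add] at this

include P hf hc hq in
/-- Every morphism of `H` lifts to a cocycle of the glued category over its image under `f`. -/
lemma QI.exists_glueD_eq_zero {k : ℤ} {a : Tot (H.Hom X Y)} (ha : a ∈ totDeg _ k) :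
    ∃ η, (a, f Y 0 X (H.single X Y a), η) ∈ glueDeg (B := B) (e := e) k ∧
      glueD f (a, f Y 0 X (H.single X Y a), η) = 0 := by
  have hcl := hq.closed X Y a
  have hm := apply_single_mem hf ha
  obtain ⟨y, hy⟩ := hq.exists_mul_ev_eq hf hc _ hcl
  obtain ⟨η, hη, h⟩ := exists_eq_cov P (k := k)
    (φ := lact (f Y 0 X (H.single X Y a)) (f X) - ract a (f Y)) hf hc
    ((((hf X).lact hm).of_eq (add_zero k)).sub (((hf Y).ract_mem ha).of_eq (zero_add k)))
    (by rw [map_sub, cov_lact_self hf hc, hcl, cov_ract, cov_self hf, hc, map_zero, map_zero,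
      LinearMap.zero_apply, sub_zero])
    ⟨y, by rw [map_sub, ev_lact, ev_ract, hy, add_sub_cancel_left]⟩
  refine ⟨η, ⟨ha, hm, hη⟩, ?_⟩
  rw [glueD_apply]
  refine Prod.ext rfl (Prod.ext hcl ?_)
  change _ - _ - _ = 0
  rw [h, sub_self]

include P hf hc hq in
/-- A cocycle of the glued category that lies over zero in `H` is a coboundary. -/
lemma QI.exists_eq_glueD {k : ℤ} {x : Glue H B e X Y} (hx : x ∈ glueDeg k)
    (hdx : glueD f x = 0) (h0 : x.1 = 0) : ∃ z ∈ glueDeg (k - 1), x = glueD f z := by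
  obtain ⟨h, c, η⟩ := x
  obtain ⟨-, hcm, hη⟩ := hx
  obtain rfl : h = 0 := h0
  rw [glueD_apply] at hdx
  have h1 : B.d c = 0 := congrArg (fun x => x.2.1) hdx
  have h2 : lact c (f X) - ract 0 (f Y) - cov f η = 0 := congrArg (fun x => x.2.2) hdx
  rw [map_zero, LinearMap.zero_apply, sub_zero, sub_eq_zero] at h2
  obtain ⟨y, hy⟩ := hq.exists_mul_ev_eq hf hc c h1
  obtain ⟨c', hc', hcd⟩ := P.exists_d_eq hcm ⟨ev η - y, by
    rw [map_sub, ← ev_cov, ← h2, ev_lact, hy, add_sub_cancel_right]⟩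
  -- correcting `c'` by the value at the identity makes the remaining cocycle exact
  set v := ev (lact c' (f X) - η) with hv
  have hφ : IsHomog (k - 1) (lact c' (f X) - η) :=
    (((hf X).lact hc').of_eq (add_zero _)).sub hη
  have hφd : cov f (lact c' (f X) - η) = 0 := by
    rw [map_sub, cov_lact_self hf hc, ← hcd, h2, sub_self]
  have hvm : v ∈ B.deg (X := e X) (Y := e Y) (k - 1) := by
    have := hφ.apply (V := X) 0 (H.id X)
    rwa [add_zero] at this
  have hvd : B.d v = 0 := by rw [hv, ← ev_cov, hφd, map_zero]
  obtain ⟨y', hy'⟩ := hq.exists_mul_ev_eq hf hc v hvd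
  obtain ⟨η', hη', h3⟩ := exists_eq_cov P (k := k - 1)
    (φ := lact c' (f X) - η - lact v (f X)) hf hc (hφ.sub (((hf X).lact hvm).of_eq (add_zero _)))
    (by rw [map_sub, hφd, cov_lact_self hf hc, hvd, map_zero, LinearMap.zero_apply, sub_zero])
    ⟨-y', by rw [map_sub, ← hv, ev_lact, hy', map_neg]; abel⟩
  refine ⟨(0, c' - v, η'), ⟨zero_mem _, sub_mem hc' hvm, hη'⟩, ?_⟩
  rw [glueD_apply]
  refine Prod.ext rfl (Prod.ext ?_ ?_)
  · change c = B.d (c' - v)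
    rw [map_sub, hvd, sub_zero]; exact hcd
  · change η = lact (c' - v) (f X) - ract 0 (f Y) - cov f η'
    rw [map_zero, LinearMap.zero_apply, sub_zero, ← h3, map_sub, LinearMap.sub_apply]
    abel

include hq in
/-- A cocycle of the glued category that lies over a coboundary in `B` lies over zero in `H`. -/
lemma QI.fst_eq_zero {x : Glue H B e X Y} (hdx : glueD f x = 0) (h : ∃ y, x.2.1 = B.d y) :
    x.1 = 0 := by
  obtain ⟨y, hy⟩ := h
  refine hq.inj X Y x.1 ⟨B.mul y (ev (f X)) - ev x.2.2, ?_⟩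
  have h1 : lact x.2.1 (f X) - ract x.1 (f Y) - cov f x.2.2 = 0 := congrArg (fun x => x.2.2) hdx
  have h2 := congrArg ev h1
  have h3 : B.d (ev (f X)) = 0 := hq.closed X X _
  have h4 : B.d (B.mul y (ev (f X))) = B.mul x.2.1 (ev (f X)) := by
    rw [B.d_mul, h3, map_zero, add_zero, ← hy]
  rw [map_sub, map_sub, ev_lact, ev_ract, ev_cov, map_zero, sub_right_comm, sub_eq_zero, ← h4,
    ← map_sub] at h2
  exact h2.symm

include P hf hq in
lemma QI.exists_homog {k : ℤ} {c : B.Hom (e X) (e Y)} (hcm : c ∈ B.deg (X := e X) k)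
    (hdc : B.d c = 0) :
    ∃ a ∈ totDeg (H.Hom X Y) k, ∃ z, c = f Y 0 X (H.single X Y a) + B.d z := by
  obtain ⟨a, y, hy⟩ := hq.surj X Y c hdc
  refine ⟨totProj _ k a, totProj_mem k a, P.ρ (k - 1) y, ?_⟩
  have h1 : P.ρ k (f Y 0 X (H.single X Y a)) = f Y 0 X (H.single X Y (totProj _ k a)) := by
    clear hy
    induction a using tot_induction with
    | h0 => simp only [map_zero]
    | h2 x y hx hy => simp only [map_add, hx, hy]
    | h1 i a =>
      have h2 := apply_single_mem hf (tof_mem i a)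
      by_cases h : i = k
      · subst h; rw [P.eq_self _ _ h2, totProj_of_mem (tof_mem i a)]
      · rw [P.eq_zero _ _ _ h2 h, totProj_of_mem_ne (tof_mem i a) h, map_zero, map_zero]
  rw [P.comm_d, sub_add_cancel, ← h1, ← map_add, ← hy, P.eq_self k c hcm]

end LC

namespace LC

variable {R : Type u} [CommRing R] {H D : DGCat.{u} R} {e : H.Obj → D.Obj} {f : AA H D.toS e}

/-- A twisting cochain that induces an isomorphism on cohomology identifies `H` with `D` up to
quasi-isomorphism: both receive a quasi-isomorphism from the glued category. -/
theorem QI.quasiIsomorphic (hq : QI f) (hf : ∀ X, IsHomog 0 (f X)) (hc : ∀ X, curv f X = 0)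
    (hd : ∀ X Y (a : Tot (H.Hom X Y)), totD _ a = 0)
    (he : Function.Bijective e) :
    DGCat.QuasiIsomorphic D H := by
  refine (Relation.EqvGen.rel _ _ ⟨(glueSnd hf hc).toDG fun X => rfl, ?snd⟩).symm.trans _ _ _
    (.rel _ _ ⟨(glueFst hf hc hd).toDG fun X => rfl, ?fst⟩)
  case snd =>
    refine SCat.Fun.isQuasiIso_toDG _ _ he (fun X Y k x hx hdx => ?_) fun X Y k c hcm hdc => ?_
    · rintro ⟨y, hy⟩
      change Glue H D.toS e X Y at x
      change x.2.1 = _ at hy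
      exact hq.exists_eq_glueD D.toSProj hf hc hx hdx (hq.fst_eq_zero hdx ⟨y, hy⟩)
    · obtain ⟨a, ha, z, hz⟩ := hq.exists_homog D.toSProj hf hcm hdc
      obtain ⟨η, hη, hd⟩ := hq.exists_glueD_eq_zero D.toSProj hf hc ha
      exact ⟨_, hη, hd, z, hz⟩
  case fst =>
    refine SCat.Fun.isQuasiIso_toDG _ _ Function.bijective_id (fun X Y k x hx hdx => ?_)
      fun X Y k a ha _ => ?_
    · rintro ⟨y, hy⟩
      exact hq.exists_eq_glueD D.toSProj hf hc hx hdx (hy.trans (hd X Y y))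
    · obtain ⟨η, hη, hd'⟩ := hq.exists_glueD_eq_zero D.toSProj hf hc ha
      exact ⟨_, hη, hd', 0, by rw [map_zero, add_zero]; rfl⟩

end LC

/-! ### Multiplicative sections of the cohomology up to homotopy -/

section Section

variable {R : Type u} [CommRing R] {A B : CochainComplex (ModuleCat.{u} R) ℤ}

/-- The cohomology of a perfect complex is bounded. -/
lemma IsPerfectComplex.exists_finset (h : IsPerfectComplex A) :
    ∃ S : Finset ℤ, ∀ i ∉ S, Subsingleton (Coh A i) := by
  obtain ⟨P, f, hf, -, -, a, b, hP⟩ := h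
  refine ⟨Finset.Icc a b, fun i hi => subsingleton_of_forall_eq 0 fun y => ?_⟩
  obtain ⟨⟨y, hy⟩, rfl⟩ := Submodule.Quotient.mk_surjective _ y
  obtain ⟨x, -, z, hz⟩ := ((quasiIso_iff_elements f).1 hf i).2 y hy
  have := hP i (by rw [Finset.mem_Icc] at hi; omega)
  rw [Subsingleton.elim x 0, map_zero, zero_add] at hz
  exact (Submodule.Quotient.mk_eq_zero _).2 ⟨z, hz.symm⟩

lemma hom_d_comm (g : B ⟶ A) (i j : ℤ) (x : B.X i) : A.d i j (g.f i x) = g.f j (B.d i j x) :=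
  ConcreteCategory.congr_hom (g.comm i j) x

/-- The map from cocycles of the source of a morphism of complexes to the cohomology of the
target. -/
def cocycleMap (g : B ⟶ A) (i : ℤ) : LinearMap.ker (B.d i (i + 1)).hom →ₗ[R] Coh A i :=
  (Submodule.mkQ _).comp (((g.f i).hom.comp (LinearMap.ker (B.d i (i + 1)).hom).subtype).codRestrict
    (LinearMap.ker (A.d i (i + 1)).hom) fun x =>
      (hom_d_comm g i (i + 1) x.1).trans ((congrArg (g.f (i + 1)) x.2).trans (map_zero _)))

lemma cocycleMap_eq_iff (g : B ⟶ A) (i : ℤ) (x : LinearMap.ker (B.d i (i + 1)).hom)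
    (y : LinearMap.ker (A.d i (i + 1)).hom) :
    cocycleMap g i x = Submodule.Quotient.mk y ↔ ∃ z, g.f i x.1 - y.1 = A.d (i - 1) i z :=
  (Submodule.Quotient.eq _).trans ⟨fun ⟨z, hz⟩ => ⟨z, hz.symm⟩, fun ⟨z, hz⟩ => ⟨z, hz.symm⟩⟩

lemma cocycleMap_surjective (g : B ⟶ A) (hg : QuasiIso g) (i : ℤ) :
    Function.Surjective (cocycleMap g i) := fun y => by
  obtain ⟨y, rfl⟩ := Submodule.Quotient.mk_surjective _ y
  obtain ⟨x, hx, z, hz⟩ := ((quasiIso_iff_elements g).1 hg i).2 y.1 y.2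
  refine ⟨⟨x, hx⟩, (cocycleMap_eq_iff g i _ _).2 ⟨-z, ?_⟩⟩
  rw [hz, map_neg]; abel

variable [∀ i, Module.Projective R (Coh A i)]

/-- If the cohomology of `A` is projective, every quasi-isomorphism to `A` has a section on
cohomology, given by a morphism of complexes. -/
lemma exists_cohomology_section (g : B ⟶ A) (hg : QuasiIso g) : ∃ σ : cohComplex A ⟶ B,
    ∀ i (x : Coh A i), ∃ h : B.d i (i + 1) (σ.f i x) = 0, cocycleMap g i ⟨σ.f i x, h⟩ = x := by
  choose s hs using fun i => Module.projective_lifting_property (cocycleMap g i) LinearMap.id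
    (cocycleMap_surjective g hg i)
  have hd : ∀ i j (x : Coh A i), B.d i j (s i x).1 = 0 := fun i j x => by
    by_cases h : i + 1 = j
    · subst h; exact (s i x).2
    · rw [B.shape i j h]; rfl
  refine ⟨⟨fun i => ModuleCat.ofHom ((Submodule.subtype _).comp (s i)), fun i j _ => ?_⟩,
    fun i x => ⟨(s i x).2, LinearMap.congr_fun (hs i) x⟩⟩
  ext x
  refine (hd i j x).trans ?_
  change (0 : B.X j) = (s j 0).1
  rw [map_zero]; rfl

variable {g : B ⟶ A} {σ : cohComplex A ⟶ B} 
  (hσ : ∀ i (x : Coh A i), ∃ h : B.d i (i + 1) (σ.f i x) = 0, cocycleMap g i ⟨σ.f i x, h⟩ = x)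

include hσ in
omit [∀ i, Module.Projective R (Coh A i)] in
lemma quasiIso_cohomology_section (hg : QuasiIso g) : QuasiIso σ := by
  refine (quasiIso_iff_elements σ).2 fun i => ⟨fun (x : Coh A i) _ => ?_, fun y hy => ?_⟩
  · rintro ⟨y, hy⟩
    obtain ⟨h, hx⟩ := hσ i x
    refine ⟨0, Eq.trans (hx.symm.trans ?_) (map_zero _).symm⟩
    refine (cocycleMap_eq_iff g i _ 0).2 ⟨g.f (i - 1) y, ?_⟩
    rw [hom_d_comm, ← hy]; exact sub_zero _
  · set x := cocycleMap g i ⟨y, hy⟩ with hx'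
    obtain ⟨h, hx⟩ := hσ i x
    have h1 : cocycleMap g i (⟨y, hy⟩ - ⟨σ.f i x, h⟩) = Submodule.Quotient.mk 0 := by
      rw [map_sub, hx, hx', sub_self]; rfl
    obtain ⟨z, hz⟩ := (cocycleMap_eq_iff g i _ _).1 h1
    obtain ⟨w, hw⟩ := ((quasiIso_iff_elements g).1 hg i).1 (y - σ.f i x)
      (by rw [map_sub, hy, h, sub_zero]) ⟨z, (sub_zero _).symm.trans hz⟩
    exact ⟨x, rfl, w, by rw [← hw]; abel⟩

end Section

namespace DGCat

variable {R : Type u} [CommRing R] {C D : DGCat.{u} R} (F : Functor D C)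

/-- The action of a functor on morphism complexes between objects with prescribed images. -/
def Functor.cmp {X Y : C.Obj} {X' Y' : D.Obj} (hX : F.obj X' = X) (hY : F.obj Y' = Y) :
    D.Hom X' Y' ⟶ C.Hom X Y :=
  F.map X' Y' ≫ eqToHom (by rw [hX, hY])

lemma Functor.cmp_rfl (X' Y' : D.Obj) : F.cmp (X' := X') (Y' := Y') rfl rfl = F.map X' Y' :=
  Category.comp_id _

lemma Functor.IsQuasiIso.cmp {F : Functor D C} (hF : F.IsQuasiIso) {X Y : C.Obj} {X' Y' : D.Obj}
    (hX : F.obj X' = X) (hY : F.obj Y' = Y) : QuasiIso (F.cmp hX hY) := by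
  subst hX hY
  rw [F.cmp_rfl]
  exact hF.quasiIso_map X' Y'

lemma Functor.cmp_comp {X Y Z : C.Obj} {X' Y' Z' : D.Obj} (hX : F.obj X' = X) (hY : F.obj Y' = Y)
    (hZ : F.obj Z' = Z) (i j k : ℤ) (h : i + j = k) (a : (D.Hom Y' Z').X i)
    (b : (D.Hom X' Y').X j) : (F.cmp hX hZ).f k (D.comp i j k h a b) =
      C.comp i j k h ((F.cmp hY hZ).f i a) ((F.cmp hX hY).f j b) := by
  subst hX hY hZ
  rw [F.cmp_rfl, F.cmp_rfl, F.cmp_rfl, F.map_comp]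

variable {F}

/-- Sections on cohomology are multiplicative up to boundaries. -/
lemma exists_section_comp_sub_eq (hF : F.IsQuasiIso) {X Y Z : C.Obj} {X' Y' Z' : D.Obj}
    (hX : F.obj X' = X) (hY : F.obj Y' = Y) (hZ : F.obj Z' = Z) (i j k : ℤ) (h : i + j = k)
    {a : (D.Hom Y' Z').X i} {b : (D.Hom X' Y').X j} {c : (D.Hom X' Z').X k}
    (ha : (D.Hom Y' Z').d i (i + 1) a = 0) (hb : (D.Hom X' Y').d j (j + 1) b = 0)
    (hc : (D.Hom X' Z').d k (k + 1) c = 0)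
    (habc : cocycleMap (F.cmp hX hZ) k ⟨c, hc⟩ = C.cohComp i j k h
      (cocycleMap (F.cmp hY hZ) i ⟨a, ha⟩) (cocycleMap (F.cmp hX hY) j ⟨b, hb⟩)) :
    ∃ y, c - D.comp i j k h a b = (D.Hom X' Z').d (k - 1) k y := by
  obtain ⟨z, hz⟩ := (cocycleMap_eq_iff (F.cmp hX hZ) k _ _).1
    (habc.trans (C.cohComp_mk i j k h _ _))
  refine ((quasiIso_iff_elements _).1 (hF.cmp hX hZ) k).1 _ ?_ ⟨z, Eq.trans ?_ hz⟩
  · rw [map_sub, hc, D.comp_cocycle h a b ha hb, sub_zero]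
  · rw [map_sub, F.cmp_comp hX hY hZ i j k h]; rfl

end DGCat

/-! ### Twisting cochains on the cohomology category -/

namespace LC

variable {R : Type u} [CommRing R] {H : DGCat.{u} R}

lemma QI.of_van {B : SCat.{u} R} {e : H.Obj → B.Obj} {f f' : AA H B e} (hf : QI f)
    (h : ∀ X, Van 1 (f' X - f X)) : QI f' := by
  have h1 : ∀ X V w, f' X 0 V w = f X 0 V w := fun X V w =>
    sub_eq_zero.1 (LinearMap.congr_fun (h X 0 one_pos V) w)
  refine ⟨fun X Y a => ?_, fun X Y a => ?_, fun X Y b hb => ?_⟩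
  · rw [h1]; exact hf.closed X Y a
  · rw [h1]; exact hf.inj X Y a
  · obtain ⟨a, y, hy⟩ := hf.surj X Y b hb
    exact ⟨a, y, by rw [h1]; exact hy⟩

section Linear

variable {B : SCat.{u} R} {e : H.Obj → B.Obj}
  (τ : ∀ X Y : H.Obj, Tot (H.Hom X Y) →ₗ[R] B.Hom (e X) (e Y))

/-- The cochain with a prescribed component on single letters and no others. -/
def linear : AA H B e := fun Y => supp 0 fun X => τ X Y

lemma linear_apply (X Y : H.Obj) (a : Tot (H.Hom X Y)) :
    linear τ Y 0 X (H.single X Y a) = τ X Y a :=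
  LinearMap.congr_fun (supp_self (N := 0) (ψ := fun X => τ X Y)) a

lemma linear_succ (X Y : H.Obj) (n : ℕ) : linear τ Y (n + 1) X = 0 := supp_ne n.succ_ne_zero

lemma curv_linear_zero (hτ : ∀ X Y a, B.d (τ X Y a) = 0) (X : H.Obj) :
    Van 1 (curv (linear τ) X) := fun n hn V => by
  obtain rfl : n = 0 := by omega
  refine H.word_zero_ext fun a => ?_
  change B.d (linear τ X 0 V (H.single V X a)) + 0 - 0 = 0
  rw [linear_apply, hτ, add_zero, sub_zero]

lemma curv_linear_cons {X Y Z : H.Obj} (a : Tot (H.Hom Y Z)) (b : Tot (H.Hom X Y)) :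
    curv (linear τ) Z 1 X (H.cons 0 X Y Z a (H.single X Y b)) =
      τ X Z (H.compTot X Y Z (totSign _ a) b) - B.mul (B.sgn (τ Y Z a)) (τ X Y b) := by
  change dd (linear τ Z) 1 X _ + pb (linear τ Z) 1 X _ - cup (sg (linear τ Z)) (linear τ) 1 X _ = _
  rw [dd_apply, linear_succ, LinearMap.zero_apply, map_zero, zero_add, pb_succ, H.bS_zero,
    H.mulFirst_single, linear_apply, cup_cons, cup_zero, LinearMap.zero_apply, add_zero, sg_apply,
    linear_apply, linear_apply]

end Linear

section TotMap

variable {D : DGCat.{u} R} {e : H.Obj → D.Obj}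
  (σ : ∀ X Y : H.Obj, H.Hom X Y ⟶ D.Hom (e X) (e Y))

/-- The cochain given by a family of morphisms of complexes. -/
def linearTot : AA H D.toS e := linear (B := D.toS) fun X Y => totMap (σ X Y)

lemma linearTot_apply (X Y : H.Obj) (a : Tot (H.Hom X Y)) :
    linearTot σ Y 0 X (H.single X Y a) = totMap (σ X Y) a :=
  linear_apply (B := D.toS) _ X Y a

lemma isHomog_linearTot (Y : H.Obj) : IsHomog 0 (linearTot σ Y) := by
  refine isHomog_supp fun X i a => ?_
  change totMap (σ X Y) (tof _ i a) ∈ totDeg _ _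
  rw [totMap_tof, show (0 : ℤ) - (0 : ℕ) + i = i by simp]
  exact tof_mem _ _

variable {σ} in
lemma totD_totMap_eq_zero (hd : ∀ X Y (a : Tot (H.Hom X Y)), totD _ a = 0) (X Y : H.Obj)
    (a : Tot (H.Hom X Y)) : totD _ (totMap (σ X Y) a) = 0 := by
  rw [← totMap_totD, hd, map_zero]

lemma qi_linearTot (hd : ∀ X Y (a : Tot (H.Hom X Y)), totD _ a = 0)
    (hσ : ∀ X Y, QuasiIso (σ X Y)) : QI (linearTot σ) := by
  refine ⟨fun X Y a => ?_, fun X Y a h => ?_, fun X Y b hb => ?_⟩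
  · exact (congrArg _ (linearTot_apply σ X Y a)).trans (totD_totMap_eq_zero hd X Y a)
  · obtain ⟨y, hy⟩ := h
    obtain ⟨z, rfl⟩ := totMap_inj (σ X Y) (hσ X Y) a (hd X Y a)
      ⟨y, (linearTot_apply σ X Y a).symm.trans hy⟩
    exact hd X Y z
  · obtain ⟨a, -, z, hz⟩ := totMap_surj (σ X Y) (hσ X Y) b hb
    exact ⟨a, z, hz.trans (congrArg (· + totD _ z) (linearTot_apply σ X Y a).symm)⟩

lemma curv_linearTot_cons {X Y Z : H.Obj} (a : Tot (H.Hom Y Z)) (b : Tot (H.Hom X Y)) :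
    curv (linearTot σ) Z 1 X (H.cons 0 X Y Z a (H.single X Y b)) =
      totMap (σ X Z) (H.compTot X Y Z (totSign _ a) b) -
        D.compTot _ _ _ (totMap (σ Y Z) (totSign _ a)) (totMap (σ X Y) b) := by
  rw [totMap_totSign]
  exact curv_linear_cons (B := D.toS) _ a b

variable {σ}

section

variable (hσ : ∀ X Y Z i j (a : (H.Hom Y Z).X i) (b : (H.Hom X Y).X j),
  ∃ y, (σ X Z).f (i + j) (H.comp i j _ rfl a b) - D.comp i j _ rfl ((σ Y Z).f i a)
    ((σ X Y).f j b) = (D.Hom (e X) (e Z)).d (i + j - 1) (i + j) y)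

include hσ

lemma totMap_compTot_sub_mem {X Y Z : H.Obj} (a : Tot (H.Hom Y Z)) (b : Tot (H.Hom X Y)) :
    totMap (σ X Z) (H.compTot X Y Z a b) - D.compTot _ _ _ (totMap (σ Y Z) a) (totMap (σ X Y) b) ∈
      LinearMap.range (totD (D.Hom (e X) (e Z))) := by
  induction a using tot_induction with
  | h0 => simp only [map_zero, LinearMap.zero_apply, sub_self, zero_mem]
  | h2 x y hx hy =>
    simp only [map_add, LinearMap.add_apply]
    rw [add_sub_add_comm]
    exact add_mem hx hy
  | h1 i a =>
  induction b using tot_induction with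
  | h0 => simp only [map_zero, sub_self, Submodule.zero_mem]
  | h2 x y hx hy =>
    rw [map_add, map_add, map_add, map_add, add_sub_add_comm]
    exact add_mem hx hy
  | h1 j b =>
    obtain ⟨y, hy⟩ := hσ X Y Z i j a b
    refine ⟨tof _ (i + j - 1) y, ?_⟩
    rw [H.compTot_tof i j _ rfl, totMap_tof, totMap_tof, totMap_tof, D.compTot_tof i j _ rfl,
      ← map_sub, hy, DGCat.totD_tof' (sub_add_cancel (i + j) 1)]

/-- A family of morphisms of complexes that is multiplicative up to boundaries is the first
component of a truncated twisting cochain. -/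
lemma exists_curv_linearTot_eq (Z X : H.Obj) (w : H.Word 1 X Z) :
    ∃ y, curv (linearTot σ) Z 1 X w = D.toS.d y := by
  suffices h : curv (linearTot σ) Z 1 X w ∈ LinearMap.range (totD (D.Hom (e X) (e Z))) from
    h.imp fun _ => Eq.symm
  induction w using H.word_induction with
  | h0 => rw [map_zero]; exact Submodule.zero_mem _
  | h2 x y hx hy => rw [map_add]; exact Submodule.add_mem _ hx hy
  | h1 Y a w =>
    obtain ⟨b, rfl⟩ := H.single_surjective w
    exact (curv_linearTot_cons σ a b).symm ▸ totMap_compTot_sub_mem hσ (totSign _ a) b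

end

end TotMap

section Limit

variable {B : SCat.{u} R} {e : H.Obj → B.Obj}

/-- If every truncated twisting cochain that satisfies `Q` extends by one letter, up to a change
in the top word length and within `Q`, then there is a twisting cochain that agrees with a given
truncated one on single letters. -/
lemma exists_curv_eq_zero (Q : AA H B e → Prop)
    (step : ∀ p, 2 ≤ p → ∀ f : AA H B e, (∀ X, IsHomog 0 (f X)) → (∀ X, Van p (curv f X)) → Q f →
      ∃ f' : AA H B e, (∀ X, IsHomog 0 (f' X)) ∧ (∀ X, Van (p - 1) (f' X - f X)) ∧
        (∀ X, Van (p + 1) (curv f' X)) ∧ Q f')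
    {f : AA H B e} (hf : ∀ X, IsHomog 0 (f X)) (hκ : ∀ X, Van 2 (curv f X)) (hQ : Q f) :
    ∃ g : AA H B e, (∀ X, IsHomog 0 (g X)) ∧ (∀ X, Van 1 (g X - f X)) ∧ ∀ X, curv g X = 0 := by
  choose s hs using step
  let S (k : ℕ) : Type u := {f : AA H B e // (∀ X, IsHomog 0 (f X)) ∧
    (∀ X, Van (k + 2) (curv f X)) ∧ Q f}
  let F : ∀ k, S k := Nat.rec ⟨f, hf, hκ, hQ⟩ fun k f =>
    ⟨s (k + 2) (by omega) f.1 f.2.1 f.2.2.1 f.2.2.2, (hs _ _ _ _ _ _).1, (hs _ _ _ _ _ _).2.2.1,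
      (hs _ _ _ _ _ _).2.2.2⟩
  have hF : ∀ k X, Van (k + 1) ((F (k + 1)).1 X - (F k).1 X) := fun k =>
    (hs (k + 2) (by omega) _ (F k).2.1 (F k).2.2.1 (F k).2.2.2).2.1
  have hF' : ∀ k l X n V, n ≤ k → (F (k + l)).1 X n V = (F k).1 X n V := fun k l X n V hn => by
    induction l with
    | zero => rfl
    | succ l ih =>
      rw [← ih]
      exact sub_eq_zero.1 (hF (k + l) X n (by omega) V)
  let g : AA H B e := fun X n V => (F n).1 X n V
  have hg : ∀ k X, Van (k + 1) (g X - (F k).1 X) := fun k X n hn V => by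
    refine sub_eq_zero.2 ?_
    obtain ⟨l, rfl⟩ := Nat.exists_eq_add_of_le (Nat.lt_succ_iff.1 hn)
    exact (hF' n l X n V le_rfl).symm
  refine ⟨g, fun X n V => (F n).2.1 X n V, hg 0, fun X => ?_⟩
  funext n V
  have h1 := van_curv_sub (hg n) X n (by omega) V
  have h2 : dd (g X - (F n).1 X) n V = 0 := (hg n X).dd n n.lt_succ_self V
  rw [Pi.sub_apply, Pi.sub_apply, Pi.sub_apply, Pi.sub_apply, h2, (F n).2.2.1 X n (by omega) V,
    sub_zero, sub_zero] at h1
  exact h1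

end Limit

end LC

/-! ### Descent of formality -/

lemma LC.van_curv_push {R : Type u} [CommRing R] {H : DGCat.{u} R} {B B' : SCat.{u} R}
    {e : H.Obj → B.Obj} (G : SCat.Fun B B') {f : AA H B e} {p : ℕ}
    (h : ∀ X, LC.Van p (LC.curv f X)) (X : H.Obj) :
    LC.Van p (LC.curv (e := fun X => G.obj (e X)) (fun X => LC.push G (f X)) X) := by
  rw [← LC.push_curv]; exact LC.Van.push G (h X)

namespace DGCat

variable {R : Type u} [CommRing R]

section

variable {C D : DGCat.{u} R} {F : Functor D C}

lemma cohomology_totD_eq_zero (C : DGCat.{u} R) (X Y : C.cohomology.Obj)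
    (a : Tot (C.cohomology.Hom X Y)) : totD _ a = 0 := by
  induction a using tot_induction with
  | h0 => exact map_zero _
  | h2 x y hx hy => rw [map_add, hx, hy, add_zero]
  | h1 j a => rw [totD_tof]; exact map_zero _

/-- If the cohomology of `C` is projective, it receives a truncated twisting cochain to any
quasi-isomorphic dg category that induces an isomorphism on cohomology. -/
lemma exists_qi_curv (hF : F.IsQuasiIso) (hflat : C.IsFlat) (e : C.cohomology.Obj → D.Obj)
    (he : ∀ X : C.Obj, F.obj (e X) = X) : ∃ f : AA C.cohomology D.toS e,
      (∀ X, LC.IsHomog 0 (f X)) ∧ LC.QI f ∧ ∀ X, LC.Van 2 (LC.curv f X) := by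
  have (X Y : C.Obj) (i : ℤ) : Module.Projective R (Coh (C.Hom X Y) i) := hflat X Y i
  have (X Y : C.cohomology.Obj) (i : ℤ) : Module.Projective R ((C.cohomology.Hom X Y).X i) :=
    hflat X Y i
  choose σ h hσ using fun X Y : C.Obj =>
    exists_cohomology_section (F.cmp (he X) (he Y)) (hF.cmp (he X) (he Y))
  have hq : LC.QI (H := C.cohomology) (LC.linearTot σ) :=
    LC.qi_linearTot (H := C.cohomology) σ C.cohomology_totD_eq_zero fun X Y =>
      quasiIso_cohomology_section (fun i x => ⟨h X Y i x, hσ X Y i x⟩) (hF.cmp (he X) (he Y))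
  obtain ⟨f, hf, hv, hκ⟩ := LC.exists_extend (H := C.cohomology) (p := 1) D.toSProj
    (fun X => LC.isHomog_linearTot (H := C.cohomology) σ X)
    (LC.curv_linear_zero (H := C.cohomology) (B := D.toS) _
      (LC.totD_totMap_eq_zero C.cohomology_totD_eq_zero))
    (LC.exists_curv_linearTot_eq (H := C.cohomology) (σ := σ) fun X Y Z i j a b =>
      exists_section_comp_sub_eq hF (he X) (he Y) (he Z) i j _ rfl (h Y Z i a) (h X Y j b)
        (h X Z _ _) ((hσ X Z _ _).trans (congrArg₂ (fun a b => C.cohComp i j _ rfl a b)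
          (hσ Y Z i a).symm (hσ X Y j b).symm)))
  exact ⟨f, hf, hq.of_van hv, hκ⟩

end

variable [IsDomain R] [CharZero R] (K : Type u) [Field K] [Algebra R K] [IsFractionRing R K]
  {C : DGCat.{u} R} {n : ℤ}

/-- Formality descends from the generic fibre. -/
theorem IsFormal.of_baseChange (hflat : C.IsFlat) (hCY : C.IsWeaklyProperCalabiYau n)
    (hHH : Module.Projective R C.cohomology.HochschildHomology)
    (hK : (C.baseChange K).IsFormal) : C.IsFormal := by
  obtain ⟨hprop, D, F, hF, hKp, c, hc⟩ := hCY
  have (X Y : C.cohomology.Obj) (i : ℤ) : Module.Projective R ((C.cohomology.Hom X Y).X i) :=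
    hflat X Y i
  let e : C.cohomology.Obj → D.Obj := Function.surjInv hF.bijective_obj.2
  have he : ∀ X : C.Obj, F.obj (e X) = X := Function.surjInv_eq hF.bijective_obj.2
  have hE : LC.HasExtensions C.cohomology ((D.baseChange K).toS.restr R) :=
    (QuasiIsomorphic.hasExtensions_iff (.rel _ _ ⟨F.baseChange K, hF.baseChange K⟩)).2
      (IsFormal.hasExtensions hK)
  obtain ⟨f, hf, hq, hκ⟩ := exists_qi_curv hF hflat e he
  obtain ⟨g, hg, hv, hcg⟩ := LC.exists_curv_eq_zero LC.QI (fun p hp f hf hκ hq => by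
    obtain ⟨m, rfl⟩ : ∃ m, p = m + 1 := ⟨p - 1, by omega⟩
    obtain ⟨f', hf', hv, hκ'⟩ := (isPerfectPairing hf hq (fun _ _ _ _ => rfl) c hc hKp
      fun X Y => (hprop X Y).exists_finset).extends_of_push (fun _ _ _ _ => rfl) hf (by omega) hκ
        (D.toGenericFibre K) (c.toTrace.baseChange K) (Algebra.linearMap R K)
        (IsFractionRing.injective R K) (fun X x => totFunctional_totOne K _ x)
        (hE e (m + 1) _ hp (fun X => (hf X).push _)
          (LC.van_curv_push (D.toGenericFibre K) hκ) (hq.locQI_push K))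
    exact ⟨f', hf', hv, hκ', hq.of_van fun X => (hv X).mono (by omega)⟩) hf hκ hq
  have he' : Function.Bijective e :=
    ⟨Function.injective_surjInv _, fun Y => ⟨F.obj Y, hF.bijective_obj.1 (he _)⟩⟩
  exact (Relation.EqvGen.rel _ _ ⟨F, hF⟩).symm.trans _ _ _ ((hq.of_van hv).quasiIsomorphic hg hcg
    C.cohomology_totD_eq_zero he')

end DGCat

end

theorem mainTheorem8 {R : Type u} [CommRing R] [IsDomain R] [CharZero R]
    (K : Type u) [Field K] [Algebra R K] [IsFractionRing R K]
    (C : DGCat.{u} R) (n : ℤ) (hflat : C.IsFlat) (hCY : C.IsWeaklyProperCalabiYau n)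
    (hHH : Module.Projective R C.cohomology.HochschildHomology) :
    C.IsFormal ↔ (C.baseChange K).IsFormal :=
  ⟨DGCat.IsFormal.baseChange K, DGCat.IsFormal.of_baseChange K hflat hCY hHH⟩
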